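/- Let $G$ be a compact Lie group, let $\rho\colon G\to O(2)$ be a continuous orthogonal representation, let $S(\rho)$ be the unit circle of the corresponding $G$-module, which we identify with the unit circle in $\mathbb{C}$, and put $H=\ker\rho$. For $n\ge 1$ let $D_n\subset O(2)$ be the dihedral group of order $2n$ generated by the rotation through the angle $2\pi/n$ and the reflection about the real axis. Coordinates are chosen so that $\rho(G)\subset SO(2)$, or $\rho(G)=O(2)$, or $\rho(G)=D_n$ for some $n\ge 1$; in the last case put $\mu=e^{\pi i/n}$. For $z\in S(\rho)$ let $G_z$ be the isotropy subgroup at $z$. Let $\chi$ be the character of an irreducible real $H$-module, and suppose that $\chi$ is $G$-invariant, that is, $\chi(g^{-1}hg)=\chi(h)$ for all $g\in G$, $h\in H$. For a subgroup $K\supseteq H$ of $G$, a $K$-extension of $\chi$ is a character of a real $K$-module whose restriction to $H$ is $\chi$. (Modules are finite-dimensional and continuous.) Let $e_1$ be the number of $G_1$-extensions of $\chi$; let $e_\mu$ be the number of $G_\mu$-extensions of $\chi$ if $\rho(G)=D_n$, and $e_\mu=1$ otherwise. The character $\chi$ is of real type if the $H$-endomorphism algebra of the irreducible real $H$-module with character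 $\chi$ is isomorphic to $\mathbb{R}$. Let $\mathrm{Vect}_G(S(\rho),\chi)$ be the commutative semigroup (with the zero bundle as zero element) under Whitney sum of isomorphism classes of real $G$-vector bundles over $S(\rho)$ whose fiber $H$-modules have a multiple of $\chi$ as character. Below, "presented by generators with relations" means that the semigroup with zero is the quotient of the free commutative semigroup with zero on these generators by the congruence generated by these relations. Case A: $\rho(G)\subsetneq SO(2)$ and $\chi$ is of real type. Case B: $\rho(G)=D_n$, and $\chi$ is of real type and neither $G_1$- nor $G_\mu$-extendible. **Theorem.** Except for Cases A and B, $\mathrm{Vect}_G(S(\rho),\chi)$ is presented by 1. one generator $L_\chi$ with no relation, if $(e_1,e_\mu)=(0,0),(1,0),(0,1)$ or $(1,1)$; 2. two generators $L_\chi^{+},L_\chi^{-}$ with no relation, if $(e_1,e_\mu)=(2,1)$ or $(1,2)$; 3. three generators $\widetilde L_\chi^0,\widetilde L_\chi^{+},\widetilde L_\chi^{-}$ with the relation $2\widetilde L_\chi^0=\widetilde L_\chi^{+}+\widetilde L_\chi^{-}$, if $(e_1,e_\mu)=(2,0)$ or $(0,2)$; 4. four generators $L_\chi^{++},L_\chi^{+-},L_\chi^{-+},L_\chi^{--}$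 with the relation $L_\chi^{++}+L_\chi^{--}=L_\chi^{+-}+L_\chi^{-+}$, if $(e_1,e_\mu)=(2,2)$. In Case A or B it is presented by 5. two generators $\widetilde{\widetilde L}{}_\chi^{+},\widetilde{\widetilde L}{}_\chi^{-}$ with the relation $2\widetilde{\widetilde L}{}_\chi^{+}=2\widetilde{\widetilde L}{}_\chi^{-}$. Moreover, in each case the generators can be chosen so that any two of them, except for $\widetilde L_\chi^0$ in case 3, are related through tensor product with a real $G$-line bundle over $S(\rho)$ on whose fibers $H$ acts trivially. -/

import Mathlib

open Bundle
open scoped Manifold ContDiff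

noncomputable section

/-! ## Equivariant real vector bundles over a `G`-space -/

/-- A real `G`-vector bundle over the `G`-space `B`: a topological real vector bundle of finite rank
with a continuous `G`-action on its total space covering the action on `B` and linear on fibers.
The map `E z → E w` given by `g` is `act g h`, where `h : g • z = w`. -/
structure GVectorBundle (G : Type*) [Group G] [TopologicalSpace G]
    (B : Type*) [TopologicalSpace B] [MulAction G B] where
  /-- the model fiber -/
  F : Type
  [normedF : NormedAddCommGroup F]
  [normedSpaceF : NormedSpace ℝ F]
  [finiteDimF : FiniteDimensional ℝ F]
  /-- the fibers -/
  E : B → Type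
  [addE : ∀ z, AddCommGroup (E z)]
  [moduleE : ∀ z, Module ℝ (E z)]
  [topE : ∀ z, TopologicalSpace (E z)]
  [topTotal : TopologicalSpace (TotalSpace F E)]
  [fiberBundle : FiberBundle F E]
  [vectorBundle : VectorBundle ℝ F E]
  act : ∀ (g : G) {z w : B}, g • z = w → (E z →ₗ[ℝ] E w)
  act_one : ∀ {z : B} (h : (1 : G) • z = z) (v : E z), act 1 h v = v
  act_mul : ∀ (g g' : G) {z w x : B} (h' : g' • z = w) (h : g • w = x) (hh : (g * g') • z = x)
    (v : E z), act (g * g') hh v = act g h (act g' h' v)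
  continuous_act : Continuous fun p : G × TotalSpace F E =>
    (⟨p.1 • p.2.proj, act p.1 rfl p.2.snd⟩ : TotalSpace F E)

namespace GVectorBundle

attribute [instance] normedF normedSpaceF finiteDimF addE moduleE topE topTotal fiberBundle
  vectorBundle

variable {G : Type*} [Group G] [TopologicalSpace G]
  {B : Type*} [TopologicalSpace B] [MulAction G B]

/-- The total space. -/
abbrev Total (A : GVectorBundle G B) : Type _ := TotalSpace A.F A.E

/-- An isomorphism of real `G`-vector bundles over `B`: a `G`-equivariant homeomorphism of total
spaces over the identity of `B` that is linear on fibers. -/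
structure Iso (A A' : GVectorBundle G B) where
  map : ∀ z, A.E z ≃ₗ[ℝ] A'.E z
  map_act : ∀ (g : G) {z w : B} (h : g • z = w) (v : A.E z),
    map w (A.act g h v) = A'.act g h (map z v)
  continuous_map : Continuous fun p : A.Total => (⟨p.proj, map p.proj p.snd⟩ : A'.Total)
  continuous_symm : Continuous fun p : A'.Total => (⟨p.proj, (map p.proj).symm p.snd⟩ : A.Total)

namespace Iso

variable {A A' A'' : GVectorBundle G B}

def refl (A : GVectorBundle G B) : Iso A A where
  map z := LinearEquiv.refl ℝ (A.E z)
  map_act _ _ _ _ _ := rfl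
  continuous_map := continuous_id
  continuous_symm := continuous_id

def symm (f : Iso A A') : Iso A' A where
  map z := (f.map z).symm
  map_act g z w h v := by
    apply (f.map w).injective
    rw [f.map_act]
    simp
  continuous_map := f.continuous_symm
  continuous_symm := by simpa using f.continuous_map

def trans (f : Iso A A') (f' : Iso A' A'') : Iso A A'' where
  map z := (f.map z).trans (f'.map z)
  map_act g z w h v := by simp [f.map_act, f'.map_act]
  continuous_map := f'.continuous_map.comp f.continuous_map
  continuous_symm := f.continuous_symm.comp f'.continuous_symm

end Iso

/-- The Whitney sum. -/
def sum (A A' : GVectorBundle G B) : GVectorBundle G B where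
  F := A.F × A'.F
  E := A.E ×ᵇ A'.E
  addE z := inferInstanceAs (AddCommGroup (A.E z × A'.E z))
  moduleE z := inferInstanceAs (Module ℝ (A.E z × A'.E z))
  topE z := inferInstanceAs (TopologicalSpace (A.E z × A'.E z))
  topTotal := FiberBundle.Prod.topologicalSpace A.F A.E A'.F A'.E
  fiberBundle := FiberBundle.prod A.F A.E A'.F A'.E
  vectorBundle := VectorBundle.prod ℝ A.F A.E A'.F A'.E
  act g _ _ h := LinearMap.prodMap (A.act g h) (A'.act g h)
  act_one h v := Prod.ext (A.act_one h v.1) (A'.act_one h v.2)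
  act_mul g g' _ _ _ h' h hh v := Prod.ext (A.act_mul g g' h' h hh v.1) (A'.act_mul g g' h' h hh v.2)
  continuous_act := by
    rw [(FiberBundle.Prod.isInducing_diag A.F A.E A'.F A'.E).continuous_iff]
    have hd := (FiberBundle.Prod.isInducing_diag A.F A.E A'.F A'.E).continuous
    exact (A.continuous_act.comp (continuous_fst.prodMk ((continuous_fst.comp hd).comp
      continuous_snd))).prodMk (A'.continuous_act.comp (continuous_fst.prodMk
        ((continuous_snd.comp hd).comp continuous_snd)))

/-- The zero bundle. -/
def zero [ContinuousSMul G B] : GVectorBundle G B where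
  F := PUnit
  E := Bundle.Trivial B PUnit
  addE _ := inferInstanceAs (AddCommGroup PUnit)
  moduleE _ := inferInstanceAs (Module ℝ PUnit)
  topE _ := inferInstanceAs (TopologicalSpace PUnit)
  act _ _ _ _ := 0
  act_one _ _ := rfl
  act_mul _ _ _ _ _ _ _ _ _ := rfl
  continuous_act := by
    rw [(Bundle.Trivial.isInducing_toProd B PUnit).continuous_iff]
    have hp : Continuous fun p : G × TotalSpace PUnit (Bundle.Trivial B PUnit) => p.2.proj :=
      (FiberBundle.continuous_proj PUnit (Bundle.Trivial B PUnit)).comp continuous_snd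
    exact (continuous_fst.smul hp).prodMk continuous_const

section Sum

variable (A A' : GVectorBundle G B)

lemma continuous_sum_fst : Continuous fun p : (A.sum A').Total =>
    (⟨p.proj, (show A.E p.proj × A'.E p.proj from p.snd).1⟩ : A.Total) :=
  continuous_fst.comp (FiberBundle.Prod.isInducing_diag A.F A.E A'.F A'.E).continuous

lemma continuous_sum_snd : Continuous fun p : (A.sum A').Total =>
    (⟨p.proj, (show A.E p.proj × A'.E p.proj from p.snd).2⟩ : A'.Total) :=
  continuous_snd.comp (FiberBundle.Prod.isInducing_diag A.F A.E A'.F A'.E).continuous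

variable {A A'}

lemma continuous_sum_iff {X : Type*} [TopologicalSpace X] {f : X → (A.sum A').Total} :
    Continuous f ↔
      Continuous (fun x => (⟨(f x).proj,
        (show A.E (f x).proj × A'.E (f x).proj from (f x).snd).1⟩ : A.Total)) ∧
      Continuous (fun x => (⟨(f x).proj,
        (show A.E (f x).proj × A'.E (f x).proj from (f x).snd).2⟩ : A'.Total)) :=
  (FiberBundle.Prod.isInducing_diag A.F A.E A'.F A'.E).continuous_iff.trans
    continuous_prodMk

end Sum

namespace Iso

variable {A A' C C' : GVectorBundle G B}

def sumCongr (f : Iso A C) (f' : Iso A' C') : Iso (A.sum A') (C.sum C') where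
  map z := LinearEquiv.prodCongr (f.map z) (f'.map z)
  map_act g _ _ h v := Prod.ext (f.map_act g h v.1) (f'.map_act g h v.2)
  continuous_map := continuous_sum_iff.2
    ⟨f.continuous_map.comp (continuous_sum_fst A A'),
      f'.continuous_map.comp (continuous_sum_snd A A')⟩
  continuous_symm := continuous_sum_iff.2
    ⟨f.continuous_symm.comp (continuous_sum_fst C C'),
      f'.continuous_symm.comp (continuous_sum_snd C C')⟩

def sumComm (A A' : GVectorBundle G B) : Iso (A.sum A') (A'.sum A) where
  map z := LinearEquiv.prodComm ℝ (A.E z) (A'.E z)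
  map_act _ _ _ _ _ := rfl
  continuous_map := continuous_sum_iff.2 ⟨continuous_sum_snd A A', continuous_sum_fst A A'⟩
  continuous_symm := continuous_sum_iff.2 ⟨continuous_sum_snd A' A, continuous_sum_fst A' A⟩

def sumAssoc (A A' C : GVectorBundle G B) : Iso ((A.sum A').sum C) (A.sum (A'.sum C)) where
  map z := LinearEquiv.prodAssoc ℝ (A.E z) (A'.E z) (C.E z)
  map_act _ _ _ _ _ := rfl
  continuous_map := continuous_sum_iff.2
    ⟨(continuous_sum_fst A A').comp (continuous_sum_fst (A.sum A') C),
      continuous_sum_iff.2 ⟨(continuous_sum_snd A A').comp (continuous_sum_fst (A.sum A') C),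
        continuous_sum_snd (A.sum A') C⟩⟩
  continuous_symm := continuous_sum_iff.2
    ⟨continuous_sum_iff.2 ⟨continuous_sum_fst A (A'.sum C),
        (continuous_sum_fst A' C).comp (continuous_sum_snd A (A'.sum C))⟩,
      (continuous_sum_snd A' C).comp (continuous_sum_snd A (A'.sum C))⟩

def sumZero [ContinuousSMul G B] (A : GVectorBundle G B) : Iso (A.sum zero) A where
  map z := LinearEquiv.prodUnique (R := ℝ) (M := A.E z) (M₂ := PUnit)
  map_act _ _ _ _ _ := rfl
  continuous_map := continuous_sum_fst A zero
  continuous_symm := continuous_sum_iff.2 ⟨continuous_id,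
    (Bundle.Trivial.isInducing_toProd B PUnit).continuous_iff.2
      ((FiberBundle.continuous_proj A.F A.E).prodMk continuous_const)⟩

end Iso

/-- Isomorphism of real `G`-vector bundles as an equivalence relation. -/
instance setoid (G : Type*) [Group G] [TopologicalSpace G]
    (B : Type*) [TopologicalSpace B] [MulAction G B] : Setoid (GVectorBundle G B) where
  r A A' := Nonempty (Iso A A')
  iseqv := ⟨fun A => ⟨Iso.refl A⟩, fun ⟨f⟩ => ⟨f.symm⟩, fun ⟨f⟩ ⟨f'⟩ => ⟨f.trans f'⟩⟩

/-- `L` is a line bundle. -/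
def IsLineBundle (L : GVectorBundle G B) : Prop := ∀ z, Module.finrank ℝ (L.E z) = 1

/-- `C` is the tensor product of the `G`-vector bundles `A` and `A'`: there are bilinear maps
`A z × A' z → C z` which exhibit each `C z` as the tensor product of `A z` and `A' z`, are
`G`-equivariant, and are continuous on the fiber product of total spaces. -/
def IsTensor (A A' C : GVectorBundle G B) : Prop :=
  ∃ β : ∀ z, A.E z →ₗ[ℝ] A'.E z →ₗ[ℝ] C.E z,
    (∀ z, IsTensorProduct (β z)) ∧
    (∀ (g : G) {z w : B} (h : g • z = w) (v : A.E z) (v' : A'.E z),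
      C.act g h (β z v v') = β w (A.act g h v) (A'.act g h v')) ∧
    Continuous fun p : TotalSpace (A.F × A'.F) (A.E ×ᵇ A'.E) =>
      (⟨p.proj, β p.proj p.snd.1 p.snd.2⟩ : C.Total)

end GVectorBundle

/-- The semigroup (with zero) of isomorphism classes of real `G`-vector bundles over `B`. -/
def VectG (G : Type*) [Group G] [TopologicalSpace G]
    (B : Type*) [TopologicalSpace B] [MulAction G B] : Type _ :=
  Quotient (GVectorBundle.setoid G B)

namespace VectG

variable {G : Type*} [Group G] [TopologicalSpace G]
  {B : Type*} [TopologicalSpace B] [MulAction G B]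

/-- The isomorphism class of a real `G`-vector bundle. -/
def mk (A : GVectorBundle G B) : VectG G B := Quotient.mk _ A

/-- Addition is the Whitney sum. -/
instance : Add (VectG G B) where
  add := Quotient.map₂ GVectorBundle.sum fun _ _ ⟨f⟩ _ _ ⟨f'⟩ => ⟨f.sumCongr f'⟩

instance [ContinuousSMul G B] : Zero (VectG G B) where
  zero := mk GVectorBundle.zero

instance [ContinuousSMul G B] : AddCommMonoid (VectG G B) where
  nsmul := nsmulRec
  add_assoc := by
    rintro ⟨A⟩ ⟨A'⟩ ⟨C⟩
    exact Quotient.sound ⟨GVectorBundle.Iso.sumAssoc A A' C⟩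
  add_comm := by
    rintro ⟨A⟩ ⟨A'⟩
    exact Quotient.sound ⟨GVectorBundle.Iso.sumComm A A'⟩
  add_zero := by
    rintro ⟨A⟩
    exact Quotient.sound ⟨GVectorBundle.Iso.sumZero A⟩
  zero_add := by
    rintro ⟨A⟩
    exact Quotient.sound ⟨(GVectorBundle.Iso.sumComm _ A).trans (GVectorBundle.Iso.sumZero A)⟩

end VectG

/-! ## Orthogonal representations in the plane and their unit circles -/

/-- A continuous orthogonal representation `ρ : G → O(2)`, where `O(2)` is the group of linear
isometries of the Euclidean plane `ℂ`. -/
structure OrthRep (G : Type*) [Group G] [TopologicalSpace G] where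
  hom : G →* (ℂ ≃ₗᵢ[ℝ] ℂ)
  continuous_hom : ∀ z : ℂ, Continuous fun g => hom g z

/-- The rotation group `SO(2)`. -/
def SO2 : Subgroup (ℂ ≃ₗᵢ[ℝ] ℂ) := rotation.range

/-- The dihedral group `D_n` of order `2 * n` (for `1 ≤ n`), generated by the rotation through
`2π/n` and the reflection about the real axis. -/
def dihedral (n : ℕ) : Subgroup (ℂ ≃ₗᵢ[ℝ] ℂ) :=
  Subgroup.closure {rotation (Circle.exp (2 * Real.pi / n)), Complex.conjLIE}

namespace OrthRep

variable {G : Type*} [Group G] [TopologicalSpace G]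

/-- The image `ρ(G)`. -/
def image (ρ : OrthRep G) : Subgroup (ℂ ≃ₗᵢ[ℝ] ℂ) := ρ.hom.range

/-- The kernel `H = ρ⁻¹(1)`. -/
abbrev H (ρ : OrthRep G) : Subgroup G := ρ.hom.ker

/-- The unit circle `S(ρ)` in `ℂ` with the action of `G` through `ρ`. -/
def S (_ρ : OrthRep G) : Type := Circle

variable (ρ : OrthRep G)

instance : TopologicalSpace ρ.S := inferInstanceAs (TopologicalSpace Circle)

/-- A point of the unit circle of `ℂ` as a point of `S(ρ)`. -/
def pt (z : Circle) : ρ.S := z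

instance : MulAction G ρ.S where
  smul g z := (⟨ρ.hom g ((show Circle from z) : ℂ), by
    refine mem_sphere_zero_iff_norm.2 ?_
    rw [(ρ.hom g).norm_map]
    exact Circle.norm_coe (show Circle from z)⟩ : Circle)
  one_smul z := by
    apply Circle.ext
    change ρ.hom 1 _ = _
    rw [map_one]
    rfl
  mul_smul g g' z := by
    apply Circle.ext
    change ρ.hom (g * g') _ = ρ.hom g (ρ.hom g' _)
    rw [map_mul]
    rfl

lemma coe_smul (g : G) (z : Circle) : ((show Circle from g • ρ.pt z) : ℂ) = ρ.hom g z := rfl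

instance : ContinuousSMul G ρ.S where
  continuous_smul := by
    have h : Continuous fun p : G × ℂ => ρ.hom p.1 p.2 := by
      have e : (fun p : G × ℂ => ρ.hom p.1 p.2) = fun p =>
          (p.2.re : ℂ) * ρ.hom p.1 1 + (p.2.im : ℂ) * ρ.hom p.1 Complex.I := by
        funext p
        conv_lhs => rw [show p.2 = p.2.re • (1 : ℂ) + p.2.im • Complex.I by simp]
        rw [map_add, map_smul, map_smul, Complex.real_smul, Complex.real_smul]
      rw [e]
      have h₁ := (ρ.continuous_hom 1).comp (continuous_fst : Continuous (Prod.fst : G × ℂ → G))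
      have h₂ := (ρ.continuous_hom Complex.I).comp
        (continuous_fst : Continuous (Prod.fst : G × ℂ → G))
      exact ((Complex.continuous_ofReal.comp (Complex.continuous_re.comp continuous_snd)).mul
        h₁).add ((Complex.continuous_ofReal.comp (Complex.continuous_im.comp continuous_snd)).mul h₂)
    have hc : Continuous fun z : ρ.S => ((show Circle from z) : ℂ) := continuous_subtype_val
    exact Continuous.subtype_mk (h.comp (continuous_fst.prodMk (hc.comp continuous_snd))) _

/-- `ρ(G)` is a dihedral group. -/
def IsDihedral : Prop := ∃ n : ℕ, 1 ≤ n ∧ ρ.image = dihedral n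

open Classical in
/-- The number `n` with `ρ(G) = D_n`, when `ρ(G)` is dihedral. -/
def order : ℕ := if h : ρ.IsDihedral then h.choose else 0

/-- The isotropy subgroup `G_1` at the point `1`. -/
def isotropyOne : Subgroup G := MulAction.stabilizer G (ρ.pt 1)

/-- The isotropy subgroup `G_μ` at the point `μ = exp(π i / n)`, when `ρ(G) = D_n`. -/
def isotropyMu : Subgroup G := MulAction.stabilizer G (ρ.pt (Circle.exp (Real.pi / ρ.order)))

end OrthRep

/-! ## Characters of real modules -/

section Characters

variable {K : Type*} [Group K] [TopologicalSpace K]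

/-- `ψ` is the character of a finite-dimensional continuous real `K`-module. -/
def IsRealCharacter (ψ : K → ℝ) : Prop :=
  ∃ (d : ℕ) (σ : Representation ℝ K (Fin d → ℝ)), (∀ v, Continuous fun k => σ k v) ∧
    σ.character = ψ

/-- `χ` is the character of an irreducible finite-dimensional continuous real `K`-module. -/
def IsIrreducibleRealCharacter (χ : K → ℝ) : Prop :=
  ∃ (d : ℕ) (σ : Representation ℝ K (Fin d → ℝ)), (∀ v, Continuous fun k => σ k v) ∧
    σ.IsIrreducible ∧ σ.character = χ

/-- `χ` is the character of an irreducible real `K`-module with endomorphism algebra `ℝ`. -/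
def IsOfRealType (χ : K → ℝ) : Prop :=
  ∃ (d : ℕ) (σ : Representation ℝ K (Fin d → ℝ)), (∀ v, Continuous fun k => σ k v) ∧
    σ.IsIrreducible ∧ σ.character = χ ∧ Nonempty (σ.IntertwiningMap σ ≃ₐ[ℝ] ℝ)

end Characters

namespace OrthRep

variable {G : Type*} [Group G] [TopologicalSpace G] (ρ : OrthRep G) (χ : ρ.H → ℝ)

/-- The character `χ` of `H` is `G`-invariant: `χ(g⁻¹ h g) = χ(h)`. -/
def IsInvariant : Prop := ∀ (g : G) (h : ρ.H), χ (MulAut.conjNormal g⁻¹ h) = χ h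

/-- The characters of real `K`-modules that extend `χ`. -/
def extensions (K : Subgroup G) : Set (K → ℝ) :=
  {ψ | IsRealCharacter ψ ∧ ∀ (h : G) (hH : h ∈ ρ.H) (hK : h ∈ K), ψ ⟨h, hK⟩ = χ ⟨h, hH⟩}

/-- The number `e_1` of `G_1`-extensions of `χ`. -/
def e₁ : ℕ∞ := (ρ.extensions χ ρ.isotropyOne).encard

open Classical in
/-- The number `e_μ` of `G_μ`-extensions of `χ` if `ρ(G)` is dihedral, and `1` otherwise. -/
def eμ : ℕ∞ := if ρ.IsDihedral then (ρ.extensions χ ρ.isotropyMu).encard else 1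

/-- `ρ(G)` is properly contained in `SO(2)` and `χ` is of real type. -/
def CaseA : Prop := ρ.image < SO2 ∧ IsOfRealType χ

/-- `ρ(G)` is dihedral, and `χ` is of real type and neither `G_1`- nor `G_μ`-extendible. -/
def CaseB : Prop := ρ.IsDihedral ∧ IsOfRealType χ ∧
  ¬ (ρ.extensions χ ρ.isotropyOne).Nonempty ∧ ¬ (ρ.extensions χ ρ.isotropyMu).Nonempty

/-- The character of the fiber `H`-modules of `A` is a multiple of `χ`. -/
def HasFiberMultiple (A : GVectorBundle G ρ.S) : Prop :=
  ∃ m : ℕ, ∀ (z : ρ.S) (h : ρ.H) (hz : (h : G) • z = z),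
    LinearMap.trace ℝ (A.E z) (A.act h hz) = m * χ h

/-- The semigroup `Vect_G(S(ρ), χ)` of isomorphism classes of real `G`-vector bundles over `S(ρ)`
whose fiber `H`-modules have a multiple of `χ` as character. -/
def Vect : AddSubmonoid (VectG G ρ.S) where
  carrier := {x | ∃ A, ρ.HasFiberMultiple χ A ∧ VectG.mk A = x}
  zero_mem' := ⟨GVectorBundle.zero, ⟨0, fun z h hz => by
    rw [Nat.cast_zero, zero_mul]
    exact map_zero (LinearMap.trace ℝ PUnit)⟩, rfl⟩
  add_mem' := by
    rintro _ _ ⟨A, ⟨m, hm⟩, rfl⟩ ⟨A', ⟨m', hm'⟩, rfl⟩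
    refine ⟨A.sum A', ⟨m + m', fun z h hz => ?_⟩, rfl⟩
    have i₁ : Module.Finite ℝ (A.E z) := Module.Finite.equiv
      ((trivializationAt A.F A.E z).continuousLinearEquivAt ℝ z
        (FiberBundle.mem_baseSet_trivializationAt A.F A.E z)).symm.toLinearEquiv
    have i₂ : Module.Finite ℝ (A'.E z) := Module.Finite.equiv
      ((trivializationAt A'.F A'.E z).continuousLinearEquivAt ℝ z
        (FiberBundle.mem_baseSet_trivializationAt A'.F A'.E z)).symm.toLinearEquiv
    push_cast
    rw [add_mul, ← hm z h hz, ← hm' z h hz]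
    exact LinearMap.trace_prodMap' (A.act h hz) (A'.act h hz)

/-- `H` acts trivially on the fibers of `L`. -/
def HasTrivialFiber (L : GVectorBundle G ρ.S) : Prop :=
  ∀ (z : ρ.S) (h : ρ.H) (hz : (h : G) • z = z) (v : L.E z), L.act h hz v = v

/-- `y` is obtained from `x` by tensoring with a real `G`-line bundle over `S(ρ)` with trivial
fiber `H`-module. -/
def RelatedByLine (x y : VectG G ρ.S) : Prop :=
  ∃ A L C : GVectorBundle G ρ.S, L.IsLineBundle ∧ ρ.HasTrivialFiber L ∧ A.IsTensor L C ∧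
    VectG.mk A = x ∧ VectG.mk C = y

end OrthRep

/-- The commutative semigroup (with zero) `M` is presented by the generators `L i` subject to the
relations `r`: every element is a sum of generators, and two such sums agree in `M` exactly when
they are identified by the congruence on the free commutative monoid generated by `r`. -/
def IsPresentedBy {ι M : Type*} [AddCommMonoid M] (L : ι → M)
    (r : (ι →₀ ℕ) → (ι →₀ ℕ) → Prop) : Prop :=
  (∀ x : M, ∃ a : ι →₀ ℕ, a.sum (fun i k => k • L i) = x) ∧
  ∀ a b : ι →₀ ℕ, a.sum (fun i k => k • L i) = b.sum (fun i k => k • L i) ↔ addConGen r a b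

end

/-! ## Representations of compact groups -/

/-! The orbit space of `S(ρ)` is an interval if `ρ(G)` is dihedral, a circle if `ρ(G)` is a finite
group of rotations, and a point if `ρ(G)` contains `SO(2)`. In the first two situations an arc `c`
starting at `1` is a fundamental domain, whose points have isotropy group `H` except at the ends of
the dihedral arc. Over the arc a bundle has a frame in which `H` acts by a constant representation
(`exists_equivariant_frame`), so the bundle is encoded by its transition maps: the actions of `G_1`
and `G_μ` on the end fibers, or the monodromy of a generator `g₀` of the rotation group. All
compatible data are realized by bundles (`LocalFrames.exists_frame`), and two sets of data related
by a path of `H`-isomorphisms give isomorphic bundles (`nonempty_iso_of_gauge`). In the transitive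
situation the isotropy representation on one fiber determines everything.

The question is thus about path components of the automorphism group of the `H`-module `mχ`, a
general linear group over the real, complex or quaternionic numbers. Unless `χ` is of real type, an
equivariant complex structure connects all isomorphisms (`joined_of_isotypic`). In real type there
are two components, told apart by the sign of a determinant. If moreover `χ` extends to an end
group, a reflection in one summand is an automorphism over that end group lying in the negative
component (`exists_joined_automorphism`). Hence outside Cases A and B a bundle is determined by the
characters of its end fibers, and all pairs of characters over the same multiple of `χ` occur; this
is recorded in `EndCharacters`.

Where `H` has index two in an end group, Clifford theory describes the characters over multiples of
`χ` (`endType_of_indexTwo`): they are multiples of an induced character over `2χ`, or multiples of a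
single extension, or free combinations of an extension and its sign twist. The semigroup of bundles
is the fiber product of two such semigroups over the multiplicity, and its presentation is a count
with natural numbers (`EndCharacters.presentations`). If there is no second end, `H` itself takes
its place; it has exactly one extension, in agreement with the convention `e_μ = 1`.

In Cases A and B one sign survives. In Case A it is the sign of the determinant of the monodromy
matrix. In Case B an element of an end group outside `H` acts by `M ⊗ γ` with `M * M = -1`, so each
end gives a complex structure and thereby an orientation of an even-dimensional space; the two
orientations can be compared. The sign is well defined because a matrix commuting with a complex
structure has positive determinant. Rank and sign classify the bundles, ranks add and signs
multiply, and `isPresentedBy_of_sign` yields `2 L⁺ = 2 L⁻`. The line bundles relating the generators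
come from multiplying transition maps by one-dimensional characters trivial on `H` (the
`exists_tensor` theorems), or by the monodromy `-1`. -/

section CompactReps

set_option linter.unusedSectionVars false

open Module Representation

/-- A compact group carries a left-invariant mean on its continuous functions. -/
theorem exists_invariant_mean (K : Type*) [Group K] [TopologicalSpace K] [IsTopologicalGroup K]
    [CompactSpace K] : ∃ I : C(K, ℝ) →L[ℝ] ℝ, I 1 = 1 ∧
      ∀ (g : K) (f : C(K, ℝ)), I (f.comp ⟨fun k => g * k, by fun_prop⟩) = I f := by
  borelize K
  let μ : MeasureTheory.Measure K :=
    MeasureTheory.Measure.haarMeasure ⊤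
  have : MeasureTheory.IsProbabilityMeasure μ :=
    ⟨MeasureTheory.Measure.haarMeasure_self⟩
  have hint : ∀ f : C(K, ℝ), MeasureTheory.Integrable (fun k => f k) μ := fun f =>
    f.continuous.integrable_of_hasCompactSupport (HasCompactSupport.of_compactSpace f)
  let I : C(K, ℝ) →ₗ[ℝ] ℝ :=
    { toFun := fun f => ∫ k, f k ∂μ
      map_add' := fun f f' => MeasureTheory.integral_add (hint f) (hint f')
      map_smul' := fun a f => MeasureTheory.integral_const_mul a _ }
  refine ⟨I.mkContinuous 1 fun f => ?_, ?_, fun g f => ?_⟩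
  · rw [one_mul]
    refine (MeasureTheory.norm_integral_le_of_norm_le_const
      (Filter.Eventually.of_forall fun k => f.norm_coe_le_norm k)).trans ?_
    simp
  · change ∫ k, (1 : ℝ) ∂μ = 1
    simp
  · exact MeasureTheory.integral_mul_left_eq_self (fun k => f k) g

section WeakContinuity

variable {K : Type*} [TopologicalSpace K] {V W : Type*} [AddCommGroup V] [Module ℝ V]
  [AddCommGroup W] [Module ℝ W] [FiniteDimensional ℝ V] [FiniteDimensional ℝ W]

/-- Continuity of a map into a finite-dimensional space, tested on linear forms. -/
def WeaklyContinuous (F : K → W) : Prop := ∀ l : Dual ℝ W, Continuous fun k => l (F k)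

lemma WeaklyContinuous.map {F : K → V} (hF : WeaklyContinuous F) (f : V →ₗ[ℝ] W) :
    WeaklyContinuous fun k => f (F k) := fun l => hF (l.comp f)

/-- Submodules, spaces of linear maps and induced modules carry no preferred norm, so continuity is
tested on linear forms. Expanding `v k` in a basis of `V` leaves finite sums of products of
continuous real functions. -/
lemma WeaklyContinuous.apply {F : K → V →ₗ[ℝ] W} (hF : ∀ v, WeaklyContinuous fun k => F k v)
    {v : K → V} (hv : WeaklyContinuous v) : WeaklyContinuous fun k => F k (v k) := by
  intro l
  let b := finBasis ℝ V
  have e : (fun k => l (F k (v k))) = fun k => ∑ j, b.coord j (v k) * l (F k (b j)) := by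
    funext k
    conv_lhs => rw [← b.sum_repr (v k)]
    simp only [map_sum, map_smul, smul_eq_mul, Basis.coord_apply]
  rw [e]
  exact continuous_finsetSum _ fun j _ => (hv (b.coord j)).mul (hF (b j) l)

lemma weaklyContinuous_linearMap {F : K → V →ₗ[ℝ] W} (hF : ∀ v, WeaklyContinuous fun k => F k v) :
    WeaklyContinuous F := by
  intro l
  let b := finBasis ℝ V
  let c := finBasis ℝ W
  have e : (fun k => l (F k)) = fun k =>
      ∑ j, ∑ i, c.coord i (F k (b j)) * l ((b.coord j).smulRight (c i)) := by
    funext k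
    have : F k = ∑ j, ∑ i, c.coord i (F k (b j)) • (b.coord j).smulRight (c i) := by
      refine b.ext fun j' => ?_
      simp only [LinearMap.sum_apply, LinearMap.smul_apply, LinearMap.smulRight_apply,
        Basis.coord_apply, Basis.repr_self]
      conv_lhs => rw [← c.sum_repr (F k (b j'))]
      rw [Finset.sum_eq_single j']
      · simp
      · intro j _ hj
        simp [hj.symm]
      · simp
    conv_lhs => rw [this]
    simp
  rw [e]
  exact continuous_finsetSum _ fun j _ => continuous_finsetSum _ fun i _ =>
    (hF (b j) (c.coord i)).mul continuous_const

lemma WeaklyContinuous.continuous {X : Type*} [NormedAddCommGroup X] [NormedSpace ℝ X]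
    [FiniteDimensional ℝ X] {F : K → X} (hF : WeaklyContinuous F) : Continuous F := by
  let b := finBasis ℝ X
  have e : F = fun k => ∑ j, b.coord j (F k) • b j := by
    funext k
    exact (b.sum_repr (F k)).symm
  rw [e]
  exact continuous_finsetSum _ fun j _ => (hF (b.coord j)).smul continuous_const

lemma Continuous.weaklyContinuous {X : Type*} [NormedAddCommGroup X] [NormedSpace ℝ X]
    [FiniteDimensional ℝ X] {F : K → X} (hF : Continuous F) : WeaklyContinuous F :=
  fun l => l.continuous_of_finiteDimensional.comp hF

/-- The mean of a vector-valued function is assembled from the means of its coordinates; linearity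
of `I` makes it compatible with every linear form. -/
lemma WeaklyContinuous.exists_mean {F : K → W} (hF : WeaklyContinuous F)
    (I : C(K, ℝ) →ₗ[ℝ] ℝ) : ∃ w : W, ∀ l : Dual ℝ W, l w = I ⟨fun k => l (F k), hF l⟩ := by
  let b := finBasis ℝ W
  refine ⟨∑ i, I ⟨fun k => b.coord i (F k), hF _⟩ • b i, fun l => ?_⟩
  have e : (⟨fun k => l (F k), hF l⟩ : C(K, ℝ)) =
      ∑ i, l (b i) • (⟨fun k => b.coord i (F k), hF _⟩ : C(K, ℝ)) := by
    ext k
    simp only [ContinuousMap.coe_mk, ContinuousMap.coe_sum, Finset.sum_apply,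
      ContinuousMap.coe_smul, Pi.smul_apply, smul_eq_mul]
    conv_lhs => rw [← b.sum_repr (F k)]
    simp only [map_sum, map_smul, smul_eq_mul, Basis.coord_apply, mul_comm]
  rw [e]
  simp only [map_sum, map_smul, smul_eq_mul, mul_comm]

lemma eq_of_forall_dual_eq {w w' : W} (h : ∀ l : Dual ℝ W, l w = l w') : w = w' :=
  sub_eq_zero.1 ((forall_dual_apply_eq_zero_iff ℝ _).1 fun l => by rw [map_sub, h, sub_self])

end WeakContinuity

variable {K : Type*} [Group K] [TopologicalSpace K]
  {V W W' : Type*} [AddCommGroup V] [Module ℝ V] [AddCommGroup W] [Module ℝ W]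
  [AddCommGroup W'] [Module ℝ W']
  [FiniteDimensional ℝ V] [FiniteDimensional ℝ W] [FiniteDimensional ℝ W']

/-- A continuous representation on a finite-dimensional real space. -/
def Representation.IsCont (σ : Representation ℝ K W) : Prop :=
  ∀ w, WeaklyContinuous fun k => σ k w

lemma Representation.IsCont.character {σ : Representation ℝ K W} (hσ : σ.IsCont) :
    Continuous fun k => σ.character k :=
  weaklyContinuous_linearMap hσ (LinearMap.trace ℝ W)

lemma Representation.IsCont.sub {σ : Representation ℝ K W} (hσ : σ.IsCont)
    (N : Subrepresentation σ) : N.toRepresentation.IsCont := by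
  intro w l
  -- A linear retraction onto the submodule turns forms on it into forms on `W`.
  obtain ⟨p, hp⟩ := N.toSubmodule.subtype.exists_leftInverse_of_injective
    (LinearMap.ker_eq_bot.2 N.toSubmodule.injective_subtype)
  have : (fun k => l (N.toRepresentation k w)) = fun k => (l.comp p) (σ k w) := by
    funext k
    have h := LinearMap.congr_fun hp (N.toRepresentation k w)
    simp only [LinearMap.comp_apply] at h ⊢
    rw [LinearMap.id_apply] at h
    conv_lhs => rw [← h]
    rfl
  rw [this]
  exact hσ _ _

variable [IsTopologicalGroup K]

lemma Representation.IsCont.linHom {σ : Representation ℝ K V} {τ : Representation ℝ K W}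
    (hσ : σ.IsCont) (hτ : τ.IsCont) : (σ.linHom τ).IsCont := by
  intro f
  refine weaklyContinuous_linearMap fun v => ?_
  refine WeaklyContinuous.apply (F := fun k => τ k) hτ (v := fun k => f (σ k⁻¹ v)) ?_
  refine WeaklyContinuous.map (F := fun k => σ k⁻¹ v) ?_ f
  exact fun l => (hσ v l).comp continuous_inv

variable [CompactSpace K]

/-- Averaging over a compact group projects onto the invariants. -/
theorem Representation.IsCont.exists_projection {σ : Representation ℝ K W} (hσ : σ.IsCont)
    {I : C(K, ℝ) →L[ℝ] ℝ} (h1 : I 1 = 1)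
    (hI : ∀ (g : K) (f : C(K, ℝ)), I (f.comp ⟨fun k => g * k, by fun_prop⟩) = I f) :
    ∃ P : W →ₗ[ℝ] W, LinearMap.IsProj σ.invariants P ∧
      ∀ (l : Dual ℝ W) (w : W), l (P w) = I ⟨fun k => l (σ k w), hσ w l⟩ := by
  choose P hP using fun w => (hσ w).exists_mean (I : C(K, ℝ) →ₗ[ℝ] ℝ)
  have hP' : ∀ w l, l (P w) = I ⟨fun k => l (σ k w), hσ w l⟩ := hP
  let P' : W →ₗ[ℝ] W :=
    { toFun := P
      map_add' := fun v w => eq_of_forall_dual_eq fun l => by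
        rw [map_add, hP', hP', hP', ← map_add]
        congr 1
        ext k
        simp
      map_smul' := fun a w => eq_of_forall_dual_eq fun l => by
        rw [map_smul, hP', hP', RingHom.id_apply, ← map_smul]
        congr 1
        ext k
        simp }
  refine ⟨P', ⟨fun w g => eq_of_forall_dual_eq fun l => ?_, fun w hw =>
    eq_of_forall_dual_eq fun l => ?_⟩, fun l w => hP' w l⟩
  -- Moving `σ g` inside the mean replaces `k` by `g * k`, which left invariance absorbs.
  · change (l.comp (σ g)) (P w) = l (P w)
    rw [hP', hP', ← hI g ⟨fun k => l (σ k w), hσ w l⟩]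
    congr 1
    ext k
    simp
  · change l (P w) = l w
    rw [hP']
    have : (⟨fun k => l (σ k w), hσ w l⟩ : C(K, ℝ)) = l w • 1 := by
      ext k
      simp [hw k]
    rw [this, map_smul, h1, smul_eq_mul, mul_one]

/-- A projection has trace equal to its rank, and the trace of the averaging projection is the mean
of the traces of `σ k`. -/
theorem Representation.IsCont.finrank_invariants {σ : Representation ℝ K W} (hσ : σ.IsCont)
    {I : C(K, ℝ) →L[ℝ] ℝ} (h1 : I 1 = 1)
    (hI : ∀ (g : K) (f : C(K, ℝ)), I (f.comp ⟨fun k => g * k, by fun_prop⟩) = I f) :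
    (finrank ℝ σ.invariants : ℝ) = I ⟨fun k => σ.character k, hσ.character⟩ := by
  obtain ⟨P, hP, hPI⟩ := hσ.exists_projection h1 hI
  rw [← hP.trace]
  let b := finBasis ℝ W
  rw [LinearMap.trace_eq_matrix_trace ℝ b, Matrix.trace]
  simp only [Matrix.diag_apply, LinearMap.toMatrix_apply]
  simp only [← Basis.coord_apply, hPI]
  rw [← map_sum]
  congr 1
  ext k
  simp [Representation.character, LinearMap.trace_eq_matrix_trace ℝ b, Matrix.trace,
    LinearMap.toMatrix_apply]

/-- The dimension of the space of intertwining maps depends linearly on the characters. -/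
theorem finrank_intertwiningMap_eq_mul {σ : Representation ℝ K V} {τ : Representation ℝ K W}
    {V₁ W₁ : Type*} [AddCommGroup V₁] [Module ℝ V₁] [FiniteDimensional ℝ V₁] [AddCommGroup W₁]
    [Module ℝ W₁] [FiniteDimensional ℝ W₁]
    {σ₁ : Representation ℝ K V₁} {τ₁ : Representation ℝ K W₁} (hσ : σ.IsCont) (hτ : τ.IsCont)
    (hσ₁ : σ₁.IsCont) (hτ₁ : τ₁.IsCont) {m n : ℕ} (h : ∀ k, σ.character k = m * σ₁.character k)
    (h' : ∀ k, τ.character k = n * τ₁.character k) :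
    finrank ℝ (IntertwiningMap σ τ) = m * n * finrank ℝ (IntertwiningMap σ₁ τ₁) := by
  obtain ⟨I, h1, hI⟩ := exists_invariant_mean K
  -- Intertwining maps are the invariants of `linHom`, whose character is a product of values of the
  -- two characters, so the factors `m` and `n` come out of the mean.
  rw [← (invariantsEquivIntertwiningMap σ τ).finrank_eq,
    ← (invariantsEquivIntertwiningMap σ₁ τ₁).finrank_eq]
  rify
  rw [(hσ.linHom hτ).finrank_invariants h1 hI, (hσ₁.linHom hτ₁).finrank_invariants h1 hI,
    ← smul_eq_mul, ← map_smul]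
  congr 1
  ext k
  simp only [char_linHom, ContinuousMap.coe_mk, ContinuousMap.coe_smul, Pi.smul_apply,
    smul_eq_mul, h, h']
  ring

/-- Complete reducibility. -/
theorem Representation.IsCont.exists_isCompl {σ : Representation ℝ K W} (hσ : σ.IsCont)
    (N : Subrepresentation σ) :
    ∃ N' : Subrepresentation σ, IsCompl N.toSubmodule N'.toSubmodule := by
  obtain ⟨I, h1, hI⟩ := exists_invariant_mean K
  obtain ⟨p, hp⟩ := N.toSubmodule.subtype.exists_leftInverse_of_injective
    (LinearMap.ker_eq_bot.2 N.toSubmodule.injective_subtype)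
  -- Maschke's argument: the averaged retraction is equivariant and still the identity on `N`, so
  -- its kernel is an invariant complement.
  obtain ⟨P, hP, hPI⟩ := (hσ.linHom (hσ.sub N)).exists_projection h1 hI
  have hinv := hP.map_mem p
  have hid : ∀ n : N.toSubmodule, P p n = n := by
    intro n
    refine eq_of_forall_dual_eq fun l => ?_
    have h := hPI (l.comp (LinearMap.applyₗ (n : W))) p
    refine h.trans ?_
    have : (⟨fun k => (l.comp (LinearMap.applyₗ (n : W))) (σ.linHom N.toRepresentation k p),
        (hσ.linHom (hσ.sub N)) p _⟩ : C(K, ℝ)) = l n • 1 := by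
      ext k
      have hk : p (σ k⁻¹ n) = N.toRepresentation k⁻¹ n :=
        LinearMap.congr_fun hp (N.toRepresentation k⁻¹ n)
      simp [hk]
    rw [this, map_smul, h1, smul_eq_mul, mul_one]
  refine ⟨⟨LinearMap.ker (P p), fun g v hv => ?_⟩, LinearMap.isCompl_of_proj hid⟩
  rw [LinearMap.mem_ker] at hv ⊢
  have h := LinearMap.congr_fun (hinv g) (σ g v)
  simp only [linHom_apply, LinearMap.comp_apply, inv_self_apply] at h
  rw [← h, hv, map_zero]

/-- A representation is the direct sum of complementary subrepresentations. -/
noncomputable def Subrepresentation.prodEquiv {σ : Representation ℝ K W} (N N' : Subrepresentation σ)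
    (h : IsCompl N.toSubmodule N'.toSubmodule) :
    (N.toRepresentation.prod N'.toRepresentation).Equiv σ :=
  Representation.Equiv.mk (Submodule.prodEquivOfIsCompl _ _ h) fun g => by
    ext ⟨x, hx⟩ <;> simp [Subrepresentation.toRepresentation]

lemma Representation.character_prod (σ : Representation ℝ K V) (τ : Representation ℝ K W) (k : K) :
    (σ.prod τ).character k = σ.character k + τ.character k :=
  LinearMap.trace_prodMap' (σ k) (τ k)

lemma Subrepresentation.character_add {σ : Representation ℝ K W} (N N' : Subrepresentation σ)
    (h : IsCompl N.toSubmodule N'.toSubmodule) (k : K) :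
    σ.character k = N.toRepresentation.character k + N'.toRepresentation.character k := by
  rw [← char_iso (N.prodEquiv N' h), Representation.character_prod]

/-- A nonzero finite-dimensional representation contains an irreducible one. -/
theorem exists_irreducible_subrepresentation (σ : Representation ℝ K W) [Nontrivial W] :
    ∃ N : Subrepresentation σ, N.toRepresentation.IsIrreducible := by
  classical
  -- A nonzero subrepresentation of least dimension is irreducible.
  have hex : ∃ n, ∃ N : Subrepresentation σ, N.toSubmodule ≠ ⊥ ∧ finrank ℝ N.toSubmodule = n :=
    ⟨_, ⊤, top_ne_bot, rfl⟩
  obtain ⟨N, hN, hn⟩ := Nat.find_spec hex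
  refine ⟨N, ?_⟩
  have hnt : Nontrivial N.toSubmodule := Submodule.nontrivial_iff_ne_bot.2 hN
  refine @IsSimpleOrder.mk _ _ _ ⟨⊥, ⊤, fun h => ?_⟩ fun M => ?_
  · have := congrArg (·.toSubmodule) h
    exact bot_ne_top this
  · by_cases hM : M.toSubmodule = ⊥
    · exact Or.inl (Subrepresentation.toSubmodule_injective hM)
    · right
      refine Subrepresentation.toSubmodule_injective ?_
      change M.toSubmodule = ⊤
      refine Submodule.eq_top_of_finrank_eq (le_antisymm (Submodule.finrank_le _) ?_)
      rw [hn]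
      refine Nat.find_min' hex ⟨⟨M.toSubmodule.map N.toSubmodule.subtype, ?_⟩, ?_, ?_⟩
      · rintro g _ ⟨v, hv, rfl⟩
        exact ⟨_, M.apply_mem_toSubmodule g hv, rfl⟩
      · exact fun h0 => hM (Submodule.map_injective_of_injective N.toSubmodule.injective_subtype
          (h0.trans (Submodule.map_bot _).symm))
      · exact N.toSubmodule.finrank_map_subtype_eq _

lemma finrank_intertwiningMap_pos_iff {σ : Representation ℝ K V} {τ : Representation ℝ K W} :
    0 < finrank ℝ (IntertwiningMap σ τ) ↔ ∃ f : IntertwiningMap σ τ, f ≠ 0 := by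
  have : FiniteDimensional ℝ (IntertwiningMap σ τ) :=
    Module.Finite.equiv (invariantsEquivIntertwiningMap σ τ)
  rw [finrank_pos_iff]
  exact ⟨fun _ => exists_ne 0, fun ⟨f, hf⟩ => ⟨f, 0, hf⟩⟩

/-- An injective intertwining map identifies its source with its range. -/
noncomputable def Representation.IntertwiningMap.equivRange {σ : Representation ℝ K V}
    {τ : Representation ℝ K W} (f : IntertwiningMap σ τ) (hf : Function.Injective f) :
    σ.Equiv f.range.toRepresentation :=
  Representation.Equiv.mk (LinearEquiv.ofInjective f.toLinearMap hf) fun g => by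
    refine LinearMap.ext fun v => Subtype.ext ?_
    exact IntertwiningMap.isIntertwining σ τ f g v

/-- The direct sum of two equivalences. -/
noncomputable def Representation.Equiv.prodCongr {V' : Type*} [AddCommGroup V'] [Module ℝ V']
    {σ : Representation ℝ K V} {τ : Representation ℝ K W} {σ' : Representation ℝ K V'}
    {τ' : Representation ℝ K W'} (e : σ.Equiv τ) (e' : σ'.Equiv τ') :
    (σ.prod σ').Equiv (τ.prod τ') :=
  Representation.Equiv.mk (LinearEquiv.prodCongr e.toLinearEquiv e'.toLinearEquiv) fun g =>
    LinearMap.ext fun x => Prod.ext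
      (IntertwiningMap.isIntertwining σ τ e.toIntertwiningMap g x.1)
      (IntertwiningMap.isIntertwining σ' τ' e'.toIntertwiningMap g x.2)

/-- Continuous real representations of a compact group are determined by their characters. -/
theorem exists_equiv_of_character_eq {V W : Type*} [AddCommGroup V] [Module ℝ V] [AddCommGroup W]
    [Module ℝ W] [FiniteDimensional ℝ V] [FiniteDimensional ℝ W]
    {σ : Representation ℝ K V} {τ : Representation ℝ K W}
    (hσ : σ.IsCont) (hτ : τ.IsCont) (h : ∀ k, σ.character k = τ.character k) :
    Nonempty (σ.Equiv τ) := by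
  induction hn : finrank ℝ V using Nat.strong_induction_on generalizing V W with
  | _ n ih =>
  have hdim : finrank ℝ V = finrank ℝ W := by
    have := h 1
    simpa using this
  rcases subsingleton_or_nontrivial V with hV | hV
  · have : Subsingleton W := by
      rw [← finrank_zero_iff (R := ℝ), ← hdim]
      exact finrank_zero_of_subsingleton
    exact ⟨Representation.Equiv.mk (LinearEquiv.ofFinrankEq V W hdim)
      fun g => by ext v; exact Subsingleton.elim _ _⟩
  · obtain ⟨S, hS⟩ := exists_irreducible_subrepresentation σ
    have hSc := hσ.sub S
    -- The dimension of a space of intertwining maps sees only characters, so the inclusion of `S`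
    -- into `σ` forces a nonzero map from `S` to `τ`. Cancelling `S` on both sides leaves smaller
    -- modules with equal characters.
    have hpos : 0 < finrank ℝ (IntertwiningMap S.toRepresentation τ) := by
      rw [finrank_intertwiningMap_eq_mul hSc hτ hSc hσ (m := 1) (n := 1) (by simp)
        (by simpa using fun k => (h k).symm), one_mul, one_mul, finrank_intertwiningMap_pos_iff]
      have hS' : Nontrivial S.toSubmodule := by
        by_contra hc
        rw [not_nontrivial_iff_subsingleton] at hc
        exact (hS.toNontrivial.exists_pair_ne.elim fun a ⟨b, hab⟩ => hab
          (Subrepresentation.toSubmodule_injective (Subsingleton.elim _ _)))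
      obtain ⟨x, hx⟩ := exists_ne (0 : S.toSubmodule)
      exact ⟨⟨S.toSubmodule.subtype, fun g => rfl⟩, fun h0 => hx
        (Subtype.ext (congrArg (fun f : IntertwiningMap S.toRepresentation σ => f x) h0))⟩
    obtain ⟨f, hf⟩ := finrank_intertwiningMap_pos_iff.1 hpos
    have hinj := (IsIrreducible.injective_or_eq_zero f).resolve_right hf
    let e := f.equivRange hinj
    obtain ⟨S', hS'⟩ := hσ.exists_isCompl S
    obtain ⟨R', hR'⟩ := hτ.exists_isCompl f.range
    have hlt : finrank ℝ S'.toSubmodule < n := by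
      have h1 := Submodule.finrank_add_eq_of_isCompl hS'
      have h2 : 0 < finrank ℝ S.toSubmodule := by
        rw [finrank_pos_iff]
        by_contra hc
        rw [not_nontrivial_iff_subsingleton] at hc
        exact hf (by ext x; rw [Subsingleton.elim x 0]; simp)
      omega
    obtain ⟨e'⟩ := ih _ hlt (hσ.sub S') (hτ.sub R') (fun k => by
      have h1 := h k
      rw [S.character_add S' hS', f.range.character_add R' hR', char_iso e] at h1
      linarith) rfl
    exact ⟨(S.prodEquiv S' hS').symm.trans ((e.prodCongr e').trans (f.range.prodEquiv R' hR'))⟩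

end CompactReps

/-! ### Clifford theory for a subgroup of index two -/

section IndexTwo

set_option linter.unusedSectionVars false

open Module Representation

/-- The inclusion `ι` of a compact group `N` onto a normal subgroup of index two of `K`, with an
element `c` of the other coset. -/
structure IndexTwo (N K : Type*) [Group N] [Group K] [TopologicalSpace N] [TopologicalSpace K]
    where
  ι : N →* K
  injective : Function.Injective ι
  continuous : Continuous ι
  c : K
  notMem : ∀ n, ι n ≠ c
  cover : ∀ k, (∃ n, k = ι n) ∨ ∃ n, k = c * ι n
  conj : N → N
  conj_spec : ∀ n, c * ι n * c⁻¹ = ι (conj n)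
  conjInv : N → N
  conjInv_spec : ∀ n, c⁻¹ * ι n * c = ι (conjInv n)

namespace IndexTwo

variable {N K : Type*} [Group N] [Group K] [TopologicalSpace N] [TopologicalSpace K]
  (E : IndexTwo N K)

lemma sq_mem : ∃ n, E.c * E.c = E.ι n := by
  rcases E.cover (E.c * E.c) with h | ⟨n, h⟩
  · exact h
  · exact (E.notMem n (mul_left_cancel h).symm).elim

lemma not_both {k : K} {n : N} (h : k = E.c * E.ι n) : ¬ ∃ n, k = E.ι n := by
  rintro ⟨n', rfl⟩
  exact E.notMem (n' * n⁻¹) (by rw [map_mul, h, map_inv, mul_inv_cancel_right])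

open Classical in
/-- The sign character with kernel the subgroup of index two. -/
noncomputable def sign (k : K) : ℝ := if ∃ n, k = E.ι n then 1 else -1

lemma sign_ι (n : N) : E.sign (E.ι n) = 1 := if_pos ⟨n, rfl⟩

lemma sign_c_mul (n : N) : E.sign (E.c * E.ι n) = -1 := if_neg (E.not_both rfl)

lemma sign_mul (k l : K) : E.sign (k * l) = E.sign k * E.sign l := by
  have h : ∀ n n', E.ι n * (E.c * E.ι n') = E.c * E.ι (E.conjInv n * n') := fun n n' => by
    rw [map_mul, ← E.conjInv_spec]
    group
  obtain ⟨s, hs⟩ := E.sq_mem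
  rcases E.cover k with ⟨n, rfl⟩ | ⟨n, rfl⟩ <;> rcases E.cover l with ⟨n', rfl⟩ | ⟨n', rfl⟩
  · rw [← map_mul, sign_ι, sign_ι, sign_ι, one_mul]
  · rw [h, sign_c_mul, sign_c_mul, sign_ι, one_mul]
  · rw [mul_assoc, ← map_mul, sign_c_mul, sign_c_mul, sign_ι, mul_one]
  · rw [mul_assoc, h, ← mul_assoc, hs, ← map_mul, sign_ι, sign_c_mul, sign_c_mul]
    norm_num

lemma sign_sq (k : K) : E.sign k * E.sign k = 1 := by
  unfold sign
  split_ifs <;> norm_num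

lemma sign_c : E.sign E.c = -1 := by
  simpa using E.sign_c_mul 1

/-- The compact space `N ⊕ N` maps onto `K` by a closed continuous map, which is therefore a
quotient map: continuity may be checked on each coset. -/
lemma continuous_of {X : Type*} [TopologicalSpace X] [IsTopologicalGroup K] [CompactSpace N]
    [T2Space K] {φ : K → X} (h₁ : Continuous fun n => φ (E.ι n))
    (h₂ : Continuous fun n => φ (E.c * E.ι n)) : Continuous φ := by
  let q : N ⊕ N → K := Sum.elim E.ι fun n => E.c * E.ι n
  have hq : Continuous q :=
    E.continuous.sumElim (continuous_const.mul E.continuous)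
  have hs : Function.Surjective q := fun k => by
    rcases E.cover k with ⟨n, rfl⟩ | ⟨n, rfl⟩
    exacts [⟨.inl n, rfl⟩, ⟨.inr n, rfl⟩]
  refine (hq.isClosedMap.isQuotientMap hq hs).continuous_iff.2 (continuous_sum_dom.2 ⟨h₁, h₂⟩)

lemma continuous_sign [IsTopologicalGroup K] [CompactSpace N] [T2Space K] :
    Continuous E.sign := by
  refine E.continuous_of ?_ ?_
  · simpa only [sign_ι] using continuous_const
  · simpa only [sign_c_mul] using continuous_const

variable {W : Type*} [AddCommGroup W] [Module ℝ W] [FiniteDimensional ℝ W]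

/-- The tensor product of a representation with the sign character. -/
noncomputable def twist (σ : Representation ℝ K W) : Representation ℝ K W where
  toFun k := E.sign k • σ k
  map_one' := by
    rw [map_one, ← map_one E.ι, sign_ι, one_smul]
  map_mul' k l := by
    ext w
    simp [sign_mul, mul_smul, smul_comm (E.sign k)]

lemma twist_apply (σ : Representation ℝ K W) (k : K) (w : W) :
    E.twist σ k w = E.sign k • σ k w := rfl

lemma character_twist (σ : Representation ℝ K W) (k : K) :
    (E.twist σ).character k = E.sign k * σ.character k :=
  map_smul (LinearMap.trace ℝ W) _ _

/-- Restriction to the subgroup of index two. -/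
def res (σ : Representation ℝ K W) : Representation ℝ N W := σ.comp E.ι

lemma res_apply (σ : Representation ℝ K W) (n : N) : E.res σ n = σ (E.ι n) := rfl

lemma character_res (σ : Representation ℝ K W) (n : N) :
    (E.res σ).character n = σ.character (E.ι n) := rfl

lemma isCont_res {σ : Representation ℝ K W} (hσ : σ.IsCont) : (E.res σ).IsCont :=
  fun w l => (hσ w l).comp E.continuous

lemma isCont_twist [IsTopologicalGroup K] [CompactSpace N] [T2Space K]
    {σ : Representation ℝ K W} (hσ : σ.IsCont) : (E.twist σ).IsCont := by
  intro w l
  simp only [twist_apply, map_smul]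
  exact E.continuous_sign.smul (hσ w l)

end IndexTwo

lemma Representation.IsCont.isRealCharacter {K W : Type*} [Group K] [TopologicalSpace K]
    [AddCommGroup W] [Module ℝ W] [FiniteDimensional ℝ W] {σ : Representation ℝ K W}
    (hσ : σ.IsCont) : IsRealCharacter σ.character := by
  let e := (finBasis ℝ W).equivFun
  let τ : Representation ℝ K (Fin (finrank ℝ W) → ℝ) :=
    { toFun := fun k => e.conj (σ k)
      map_one' := by ext; simp
      map_mul' := fun k l => by ext; simp [LinearEquiv.conj_apply] }
  refine ⟨_, τ, fun v => WeaklyContinuous.continuous ?_, ?_⟩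
  · exact (hσ (e.symm v)).map e.toLinearMap
  · funext k
    exact LinearMap.trace_conj' (σ k) e

lemma IsRealCharacter.exists_isCont {K : Type*} [Group K] [TopologicalSpace K] {ψ : K → ℝ}
    (h : IsRealCharacter ψ) : ∃ (d : ℕ) (σ : Representation ℝ K (Fin d → ℝ)), σ.IsCont ∧
      σ.character = ψ :=
  let ⟨d, σ, hσ, h⟩ := h
  ⟨d, σ, fun v => (hσ v).weaklyContinuous, h⟩

section

variable {K : Type*} [Group K] [TopologicalSpace K] [IsTopologicalGroup K] [CompactSpace K]
  {V W : Type*} [AddCommGroup V] [Module ℝ V] [AddCommGroup W] [Module ℝ W]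
  [FiniteDimensional ℝ V] [FiniteDimensional ℝ W]

/-- Splitting off the image of an injective intertwining map. -/
lemma exists_character_sub {σ : Representation ℝ K W} {τ : Representation ℝ K V}
    (hσ : σ.IsCont) (f : IntertwiningMap τ σ) (hf : Function.Injective f) :
    ∃ N' : Subrepresentation σ, ∀ k,
      σ.character k = τ.character k + N'.toRepresentation.character k := by
  obtain ⟨N', hN'⟩ := hσ.exists_isCompl f.range
  refine ⟨N', fun k => ?_⟩
  rw [f.range.character_add N' hN', char_iso (f.equivRange hf)]

/-- Splitting off a surjective intertwining map. -/
lemma exists_character_sub_of_surjective {σ : Representation ℝ K W} {τ : Representation ℝ K V}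
    (hσ : σ.IsCont) (f : IntertwiningMap σ τ) (hf : Function.Surjective f) :
    ∃ N' : Subrepresentation σ, ∀ k,
      σ.character k = τ.character k + N'.toRepresentation.character k := by
  obtain ⟨N', hN'⟩ := hσ.exists_isCompl f.ker
  refine ⟨f.ker, fun k => ?_⟩
  let g : IntertwiningMap N'.toRepresentation τ :=
    ⟨f.toLinearMap.comp N'.toSubmodule.subtype, fun k => by
      ext v
      exact IntertwiningMap.isIntertwining σ τ f k v⟩
  have hg : Function.Bijective g := by
    refine ⟨(injective_iff_map_eq_zero g.toLinearMap).2 fun v hv => ?_, fun w => ?_⟩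
    · have : (v : W) ∈ f.ker.toSubmodule ⊓ N'.toSubmodule := ⟨hv, v.2⟩
      rw [hN'.inf_eq_bot] at this
      exact Subtype.ext this
    · obtain ⟨v, rfl⟩ := hf w
      obtain ⟨x, hx, y, hy, rfl⟩ := Submodule.mem_sup.1
        (hN'.sup_eq_top ▸ Submodule.mem_top : v ∈ f.ker.toSubmodule ⊔ N'.toSubmodule)
      refine ⟨⟨y, hy⟩, ?_⟩
      change f.toLinearMap y = f.toLinearMap (x + y)
      rw [map_add, show f.toLinearMap x = 0 from hx, zero_add]
  rw [f.ker.character_add N' hN', char_iso (g.ofBijective hg), add_comm]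

/-- Multiplicities of an irreducible constituent. -/
lemma exists_intertwiningMap_ne_zero {σ : Representation ℝ K W} {τ : Representation ℝ K V}
    (hσ : σ.IsCont) (hτ : τ.IsCont) [Nontrivial V] {m : ℕ} (hm : m ≠ 0)
    (h : ∀ k, σ.character k = m * τ.character k) : ∃ f : IntertwiningMap τ σ, f ≠ 0 := by
  rw [← finrank_intertwiningMap_pos_iff, finrank_intertwiningMap_eq_mul hτ hσ hτ hτ (m := 1)
    (n := m) (by simp) h, one_mul]
  refine Nat.mul_pos (Nat.pos_of_ne_zero hm) (finrank_intertwiningMap_pos_iff.2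
    ⟨IntertwiningMap.id τ, fun h => ?_⟩)
  obtain ⟨x, hx⟩ := exists_ne (0 : V)
  exact hx (congrArg (fun f : IntertwiningMap τ τ => f x) h)

lemma Representation.IsIrreducible.nontrivial {τ : Representation ℝ K V} (h : τ.IsIrreducible) :
    Nontrivial V := by
  by_contra hc
  rw [not_nontrivial_iff_subsingleton] at hc
  exact (h.toNontrivial.exists_pair_ne.elim fun a ⟨b, hab⟩ => hab
    (Subrepresentation.toSubmodule_injective (Subsingleton.elim _ _)))

lemma Representation.IsIrreducible.of_equiv {τ : Representation ℝ K V} (h : τ.IsIrreducible)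
    {σ : Representation ℝ K W} (e : τ.Equiv σ) : σ.IsIrreducible := by
  have hV := h.nontrivial
  have hW : Nontrivial W := e.toLinearEquiv.symm.toEquiv.nontrivial
  refine @IsSimpleOrder.mk _ _ _ ⟨⊥, ⊤, fun h => ?_⟩ fun M => ?_
  · exact bot_ne_top (congrArg (·.toSubmodule) h)
  · let M' : Subrepresentation τ := ⟨M.toSubmodule.comap e.toLinearMap, fun g v hv => by
      have := M.apply_mem_toSubmodule g hv
      rw [Submodule.mem_comap]
      exact (IntertwiningMap.isIntertwining τ σ e.toIntertwiningMap g v).symm ▸ this⟩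
    have key : M.toSubmodule = M'.toSubmodule.map e.toLinearMap :=
      (Submodule.map_comap_eq_of_surjective e.toLinearEquiv.surjective _).symm
    rcases h.eq_bot_or_eq_top M' with h0 | h0
    · left
      apply Subrepresentation.toSubmodule_injective
      rw [key, h0]
      exact Submodule.map_bot _
    · right
      apply Subrepresentation.toSubmodule_injective
      rw [key, h0]
      exact (Submodule.map_top _).trans (LinearMap.range_eq_top.2 e.toLinearEquiv.surjective)

end

namespace IndexTwo

variable {N K : Type*} [Group N] [Group K] [TopologicalSpace N] [TopologicalSpace K]
  [IsTopologicalGroup N] [IsTopologicalGroup K] [CompactSpace N] [CompactSpace K] [T2Space K]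
  (E : IndexTwo N K) {U : Type*} [AddCommGroup U] [Module ℝ U] [FiniteDimensional ℝ U]
  (τ : Representation ℝ N U)

/-- The induced representation, on functions `f : K → U` with `f (k n) = n⁻¹ f k`. -/
def indSpace : Submodule ℝ (K → U) where
  carrier := {f | ∀ k n, f (k * E.ι n) = τ n⁻¹ (f k)}
  add_mem' hf hg k n := by simp [hf k n, hg k n]
  zero_mem' k n := by simp
  smul_mem' a f hf k n := by simp [hf k n]

/-- The induced representation. -/
def ind : Representation ℝ K (E.indSpace τ) where
  toFun k :=
    { toFun := fun f => ⟨fun l => f.1 (k⁻¹ * l), fun l n => by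
        have := f.2 (k⁻¹ * l) n
        rwa [mul_assoc] at this⟩
      map_add' := fun f g => rfl
      map_smul' := fun a f => rfl }
  map_one' := by
    ext f
    simp
  map_mul' k l := by
    ext f
    simp [mul_assoc]

lemma ind_apply (k l : K) (f : E.indSpace τ) : (E.ind τ k f).1 l = f.1 (k⁻¹ * l) := rfl

/-- Evaluation at representatives of the two cosets. -/
noncomputable def indEquiv : E.indSpace τ ≃ₗ[ℝ] U × U :=
  LinearEquiv.ofBijective
    { toFun := fun f => (f.1 1, f.1 E.c)
      map_add' := fun f g => rfl
      map_smul' := fun a f => rfl } <| by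
    constructor
    · intro f g h
      have h1 : f.1 1 = g.1 1 := congrArg Prod.fst h
      have h2 : f.1 E.c = g.1 E.c := congrArg Prod.snd h
      ext k
      rcases E.cover k with ⟨n, rfl⟩ | ⟨n, rfl⟩
      · rw [← one_mul (E.ι n), f.2, g.2, h1]
      · rw [f.2, g.2, h2]
    · classical
      rintro ⟨u, v⟩
      let F : K → U := fun k => if h : ∃ n, k = E.ι n then τ h.choose⁻¹ u else
        if h : ∃ n, k = E.c * E.ι n then τ h.choose⁻¹ v else 0
      have hF1 : ∀ n, F (E.ι n) = τ n⁻¹ u := fun n => by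
        have h : ∃ n', E.ι n = E.ι n' := ⟨n, rfl⟩
        have hn : h.choose = n := (E.injective h.choose_spec).symm
        simp only [F]
        rw [dif_pos h, hn]
      have hF2 : ∀ n, F (E.c * E.ι n) = τ n⁻¹ v := fun n => by
        have h : ∃ n', E.c * E.ι n = E.c * E.ι n' := ⟨n, rfl⟩
        have hn : h.choose = n := (E.injective (mul_left_cancel h.choose_spec)).symm
        simp only [F]
        rw [dif_neg (E.not_both rfl), dif_pos h, hn]
      refine ⟨⟨F, fun k n => ?_⟩, ?_⟩
      · rcases E.cover k with ⟨n', rfl⟩ | ⟨n', rfl⟩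
        · rw [← map_mul, hF1, hF1, mul_inv_rev, map_mul, Module.End.mul_apply]
        · rw [mul_assoc, ← map_mul, hF2, hF2, mul_inv_rev, map_mul, Module.End.mul_apply]
      · have h1 := hF1 1
        have h2 := hF2 1
        simp only [map_one, mul_one, inv_one, Module.End.one_apply] at h1 h2
        exact Prod.ext h1 h2

instance : FiniteDimensional ℝ (E.indSpace τ) := Module.Finite.equiv (E.indEquiv τ).symm

/-- In the coordinates of `indEquiv` the subgroup acts block-diagonally, through `τ` and a conjugate
of `τ`; by hypothesis both blocks have the same trace. -/
lemma character_ind_ι (hτ : ∀ n, τ.character (E.conjInv n) = τ.character n) (n : N) :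
    (E.ind τ).character (E.ι n) = 2 * τ.character n := by
  have h : (E.indEquiv τ).conj (E.ind τ (E.ι n)) = LinearMap.prodMap (τ n) (τ (E.conjInv n)) := by
    refine LinearMap.ext fun p => ?_
    obtain ⟨f, rfl⟩ := (E.indEquiv τ).surjective p
    rw [LinearEquiv.conj_apply_apply, LinearEquiv.symm_apply_apply]
    refine Prod.ext ?_ ?_
    · change f.1 ((E.ι n)⁻¹ * 1) = τ n (f.1 1)
      rw [mul_one, ← map_inv, ← one_mul (E.ι n⁻¹), f.2, inv_inv]
    · change f.1 ((E.ι n)⁻¹ * E.c) = τ (E.conjInv n) (f.1 E.c)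
      have : (E.ι n)⁻¹ * E.c = E.c * E.ι (E.conjInv n)⁻¹ := by
        rw [map_inv, ← E.conjInv_spec]
        group
      rw [this, f.2, inv_inv]
  rw [Representation.character, ← LinearMap.trace_conj' _ (E.indEquiv τ), h,
    LinearMap.trace_prodMap']
  change τ.character n + τ.character (E.conjInv n) = _
  rw [hτ]
  ring

/-- Multiplying functions by the sign is an involution `θ` that anticommutes with the action of
every element of the other coset, so the trace of such an element equals its own negative. -/
lemma character_ind_of_notMem {k : K} (hk : ¬ ∃ n, k = E.ι n) : (E.ind τ).character k = 0 := by
  have hs : ∀ l, E.sign (k⁻¹ * l) = - E.sign l := fun l => by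
    have h1 : E.sign k = -1 := if_neg hk
    have h2 : E.sign (k * (k⁻¹ * l)) = E.sign l := by rw [mul_inv_cancel_left]
    rw [E.sign_mul, h1] at h2
    linarith
  let θ : E.indSpace τ →ₗ[ℝ] E.indSpace τ :=
    { toFun := fun f => ⟨fun k => E.sign k • f.1 k, fun k n => by
        change E.sign (k * E.ι n) • f.1 (k * E.ι n) = τ n⁻¹ (E.sign k • f.1 k)
        rw [E.sign_mul, E.sign_ι, mul_one, f.2, map_smul]⟩
      map_add' := fun f g => Subtype.ext (funext fun k => smul_add _ _ _)
      map_smul' := fun a f => Subtype.ext (funext fun k => smul_comm _ _ _) }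
  have hθ : θ * θ = 1 := by
    ext f k
    change E.sign k • E.sign k • f.1 k = f.1 k
    rw [smul_smul, E.sign_sq, one_smul]
  have h : θ * (E.ind τ k * θ) = (-1 : ℝ) • E.ind τ k := by
    ext f l
    change E.sign l • E.sign (k⁻¹ * l) • f.1 (k⁻¹ * l) = (-1 : ℝ) • f.1 (k⁻¹ * l)
    rw [hs, smul_smul, mul_neg, E.sign_sq]
  have h2 := LinearMap.trace_mul_comm ℝ θ (E.ind τ k * θ)
  rw [mul_assoc, hθ, mul_one, h, map_smul, smul_eq_mul] at h2
  change LinearMap.trace ℝ _ (E.ind τ k) = 0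
  linarith

lemma isCont_ind (hτ : τ.IsCont) : (E.ind τ).IsCont := by
  have hc : ∀ (f : E.indSpace τ), WeaklyContinuous f.1 := by
    intro f l
    refine E.continuous_of ?_ ?_
    · have : (fun n => l (f.1 (E.ι n))) = fun n => l (τ n⁻¹ (f.1 1)) := by
        funext n
        rw [← f.2, one_mul]
      rw [this]
      exact (hτ _ l).comp continuous_inv
    · simp only [f.2 E.c]
      exact (hτ _ l).comp continuous_inv
  intro f l
  have e : (fun k => l (E.ind τ k f)) = fun k =>
      ((l.comp (E.indEquiv τ).symm.toLinearMap).comp (LinearMap.inl ℝ U U)) (f.1 (k⁻¹ * 1)) +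
      ((l.comp (E.indEquiv τ).symm.toLinearMap).comp (LinearMap.inr ℝ U U)) (f.1 (k⁻¹ * E.c)) := by
    funext k
    conv_lhs => rw [← (E.indEquiv τ).symm_apply_apply (E.ind τ k f)]
    simp only [LinearMap.comp_apply, LinearEquiv.coe_coe]
    rw [← map_add, ← map_add]
    congr 2
    exact Prod.ext (add_zero _).symm (zero_add _).symm
  rw [e]
  exact ((hc f _).comp (by fun_prop)).add ((hc f _).comp (by fun_prop))

variable {χ : N → ℝ}

/-- The characters of `K`-modules extending `χ`. -/
def Ext (χ : N → ℝ) : Set (K → ℝ) := {ψ | IsRealCharacter ψ ∧ ∀ n, ψ (E.ι n) = χ n}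

variable {W : Type*} [AddCommGroup W] [Module ℝ W] [FiniteDimensional ℝ W] {τ}

lemma isIrreducible_of_res {σ : Representation ℝ K W} (h : (E.res σ).IsIrreducible) :
    σ.IsIrreducible := by
  have := h.nontrivial
  refine @IsSimpleOrder.mk _ _ _ ⟨⊥, ⊤, fun h => ?_⟩ fun M => ?_
  · exact bot_ne_top (congrArg (·.toSubmodule) h)
  · let M' : Subrepresentation (E.res σ) :=
      ⟨M.toSubmodule, fun g _ hv => M.apply_mem_toSubmodule (E.ι g) hv⟩
    rcases h.eq_bot_or_eq_top M' with h0 | h0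
    · exact Or.inl (Subrepresentation.toSubmodule_injective (congrArg (·.toSubmodule) h0))
    · exact Or.inr (Subrepresentation.toSubmodule_injective (congrArg (·.toSubmodule) h0))

/-- If `χ` has no extension, the induced representation has no submodule of half its dimension. -/
lemma finrank_lt_of_injective_ind (hirr : τ.IsIrreducible)
    (hX : E.Ext τ.character = ∅) {σ : Representation ℝ K W} (hσ : σ.IsCont) [Nontrivial W]
    (f : IntertwiningMap σ (E.ind τ)) (hf : Function.Injective f) :
    finrank ℝ U < finrank ℝ W := by
  -- Evaluation at `1`, the map of Frobenius reciprocity. It is onto by irreducibility of `τ`; if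
  -- the dimensions agreed it would be bijective and `σ` would be an extension.
  let p : IntertwiningMap (E.res σ) τ :=
    ⟨{ toFun := fun w => (f w).1 1
       map_add' := fun _ _ => by simp
       map_smul' := fun _ _ => by simp }, fun n => by
      refine LinearMap.ext fun w => ?_
      change (f (σ (E.ι n) w)).1 1 = τ n ((f w).1 1)
      rw [IntertwiningMap.isIntertwining σ (E.ind τ) f, ind_apply, mul_one, ← map_inv,
        ← one_mul (E.ι n⁻¹), (f w).2, inv_inv]⟩
  have hp : p ≠ 0 := by
    intro h0
    obtain ⟨w, hw⟩ := exists_ne (0 : W)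
    refine hw (hf ?_)
    rw [map_zero]
    ext k
    have h1 : (f (σ k⁻¹ w)).1 1 = 0 :=
      congrArg (fun q : IntertwiningMap (E.res σ) τ => q (σ k⁻¹ w)) h0
    rw [IntertwiningMap.isIntertwining σ (E.ind τ) f, ind_apply, inv_inv, mul_one] at h1
    exact h1
  have hsurj : Function.Surjective p.toLinearMap :=
    (IsIrreducible.surjective_or_eq_zero p).resolve_right hp
  refine lt_of_le_of_ne (LinearMap.finrank_le_finrank_of_surjective hsurj) fun heq => ?_
  have hinj : Function.Injective p.toLinearMap :=
    (LinearMap.injective_iff_surjective_of_finrank_eq_finrank heq.symm).2 hsurj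
  have : σ.character ∈ E.Ext τ.character :=
    ⟨hσ.isRealCharacter, fun n => congrFun (char_iso (p.ofBijective ⟨hinj, hsurj⟩)) n⟩
  rw [hX] at this
  exact this

/-- If `χ` has no extension, the characters over multiples of `χ` vanish off the subgroup and the
multiples are even. -/
theorem character_of_ext_empty (hτ : τ.IsCont) (hirr : τ.IsIrreducible)
    (hconj : ∀ n, τ.character (E.conjInv n) = τ.character n) (hX : E.Ext τ.character = ∅)
    {σ : Representation ℝ K W} (hσ : σ.IsCont) {m : ℕ}
    (h : ∀ n, σ.character (E.ι n) = m * τ.character n) :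
    ∃ k, m = 2 * k ∧ ∀ x, (¬ ∃ n, x = E.ι n) → σ.character x = 0 := by
  have hU := hirr.nontrivial
  have hd : 0 < finrank ℝ U := finrank_pos
  induction m using Nat.strong_induction_on generalizing W with
  | _ m ih =>
  rcases Nat.eq_zero_or_pos m with rfl | hm
  · refine ⟨0, rfl, fun x _ => ?_⟩
    have h1 := h 1
    simp only [map_one, char_one, Nat.cast_zero, zero_mul, Nat.cast_eq_zero] at h1
    have : Subsingleton W := finrank_zero_iff.1 h1
    rw [Representation.character, Subsingleton.elim (σ x) 0, map_zero]
  · obtain ⟨p, hp⟩ : ∃ p : IntertwiningMap (E.res σ) τ, p ≠ 0 := by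
      rw [← finrank_intertwiningMap_pos_iff, finrank_intertwiningMap_eq_mul (E.isCont_res hσ) hτ hτ
        hτ (m := m) (n := 1) h (by simp), mul_one]
      exact Nat.mul_pos hm (finrank_intertwiningMap_pos_iff.2 ⟨IntertwiningMap.id τ, fun h => by
        obtain ⟨x, hx⟩ := exists_ne (0 : U)
        exact hx (congrArg (fun f : IntertwiningMap τ τ => f x) h)⟩)
    -- The map to the induced module that corresponds to `p` under Frobenius reciprocity.
    let F : IntertwiningMap σ (E.ind τ) :=
      ⟨{ toFun := fun w => ⟨fun k => p (σ k⁻¹ w), fun k n => by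
          have := IntertwiningMap.isIntertwining _ _ p n⁻¹ (σ k⁻¹ w)
          rw [E.res_apply] at this
          rw [← this, ← Module.End.mul_apply, ← map_mul, map_inv, ← mul_inv_rev]⟩
         map_add' := fun v w => Subtype.ext (funext fun k => by simp)
         map_smul' := fun a w => Subtype.ext (funext fun k => by simp) }, fun k => by
        ext w l
        change p (σ l⁻¹ (σ k w)) = p (σ (k⁻¹ * l)⁻¹ w)
        rw [mul_inv_rev, inv_inv, map_mul, Module.End.mul_apply]⟩
    have hF : F.range.toSubmodule ≠ ⊥ := by
      intro h0
      apply hp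
      ext w
      have h1 : F.toLinearMap w ∈ F.range.toSubmodule := ⟨w, rfl⟩
      rw [h0, Submodule.mem_bot] at h1
      have h2 : p (σ 1⁻¹ w) = 0 := congrFun (congrArg Subtype.val h1) 1
      simpa using h2
    obtain ⟨R', hR'⟩ := (E.isCont_ind τ hτ).exists_isCompl F.range
    -- Otherwise the range and its complement would both have dimension larger than that of `U`,
    -- while the induced module has only twice this dimension. Hence `F` is onto, and splitting off
    -- the induced module lowers `m` by two.
    have hR0 : R'.toSubmodule = ⊥ := by
      by_contra hne
      have hn1 : Nontrivial F.range.toSubmodule := Submodule.nontrivial_iff_ne_bot.2 hF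
      have hn2 : Nontrivial R'.toSubmodule := Submodule.nontrivial_iff_ne_bot.2 hne
      have h1 := E.finrank_lt_of_injective_ind hirr hX ((E.isCont_ind τ hτ).sub F.range)
        ⟨F.range.toSubmodule.subtype, fun _ => rfl⟩ Subtype.val_injective
      have h2 := E.finrank_lt_of_injective_ind hirr hX ((E.isCont_ind τ hτ).sub R')
        ⟨R'.toSubmodule.subtype, fun _ => rfl⟩ Subtype.val_injective
      have h3 := Submodule.finrank_add_eq_of_isCompl hR'
      rw [(E.indEquiv τ).finrank_eq, finrank_prod] at h3
      omega
    have hsurj : Function.Surjective F := by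
      have := hR'.sup_eq_top
      rw [hR0, sup_bot_eq] at this
      exact LinearMap.range_eq_top.1 this
    obtain ⟨N', hN'⟩ := exists_character_sub_of_surjective hσ F hsurj
    have hdim := hN' 1
    have hm2 : 2 ≤ m := by
      have h1 := h 1
      rw [map_one, char_one, char_one] at h1
      rw [char_one, char_one, char_one, (E.indEquiv τ).finrank_eq, finrank_prod] at hdim
      have h2 : finrank ℝ W = m * finrank ℝ U := by exact_mod_cast h1
      have h3 : finrank ℝ W = finrank ℝ U + finrank ℝ U + finrank ℝ N'.toSubmodule := by
        exact_mod_cast hdim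
      by_contra hlt
      have : m = 1 := by omega
      rw [this] at h2
      omega
    obtain ⟨k, hk, hk'⟩ := ih (m - 2) (by omega) (hσ.sub N') fun n => by
      have h1 := hN' (E.ι n)
      rw [h, E.character_ind_ι τ hconj] at h1
      push_cast [hm2]
      linarith
    refine ⟨k + 1, by omega, fun x hx => ?_⟩
    rw [hN', hk' x hx, E.character_ind_of_notMem τ hx, add_zero]

/-- If `χ` has an extension `ψ`, the characters over multiples of `χ` are combinations of `ψ` and
its twist. -/
theorem character_of_mem_ext (hτ : τ.IsCont) (hirr : τ.IsIrreducible)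
    {ψ : K → ℝ} (hψ : ψ ∈ E.Ext τ.character)
    {σ : Representation ℝ K W} (hσ : σ.IsCont) {m : ℕ}
    (h : ∀ n, σ.character (E.ι n) = m * τ.character n) :
    ∃ a b, a + b = m ∧ ∀ x, σ.character x = a * ψ x + b * (E.sign x * ψ x) := by
  obtain ⟨d, X, hX, rfl⟩ := hψ.1.exists_isCont
  obtain ⟨e⟩ := exists_equiv_of_character_eq hτ (E.isCont_res hX) (fun n => (hψ.2 n).symm)
  have hXirr : (E.res X).IsIrreducible := hirr.of_equiv e
  have hnt := hXirr.nontrivial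
  have hXt : (E.res (E.twist X)).IsIrreducible := by
    have : E.res (E.twist X) = E.res X := by
      ext n : 1
      change E.sign (E.ι n) • X (E.ι n) = _
      rw [E.sign_ι, one_smul]
      rfl
    rwa [this]
  induction m generalizing W with
  | zero =>
    refine ⟨0, 0, rfl, fun x => ?_⟩
    have h1 := h 1
    simp only [map_one, char_one, Nat.cast_zero, zero_mul, Nat.cast_eq_zero] at h1
    have : Subsingleton W := finrank_zero_iff.1 h1
    rw [Representation.character, Subsingleton.elim (σ x) 0, map_zero]
    simp
  | succ m ih =>
    obtain ⟨f, hf⟩ := exists_intertwiningMap_ne_zero (E.isCont_res hσ) (E.isCont_res hX)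
      (Nat.succ_ne_zero m) (fun n => by rw [character_res, h, character_res, hψ.2])
    have hfn : ∀ n v, f (X (E.ι n) v) = σ (E.ι n) (f v) :=
      fun n v => IntertwiningMap.isIntertwining (E.res X) (E.res σ) f n v
    obtain ⟨s, hs⟩ := E.sq_mem
    -- The combinations `f + ε c f c⁻¹` of the `N`-map `f` are `K`-maps into `σ`, from `X` for `ε =
    -- 1` and from the twist of `X` for `ε = -1`. Their sum is `2 f`, so one of them is nonzero and
    -- splits off a copy of its irreducible source.
    have key : ∀ ε : ℝ, ε * ε = 1 → ∀ n v,
        f (X (E.ι n) v) + ε • σ E.c (f (X E.c⁻¹ (X (E.ι n) v))) =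
          σ (E.ι n) (f v + ε • σ E.c (f (X E.c⁻¹ v))) := by
      intro ε _ n v
      rw [map_add, map_smul, hfn]
      congr 2
      have h1 : E.c⁻¹ * E.ι n = E.ι (E.conjInv n) * E.c⁻¹ := by
        rw [← E.conjInv_spec]; group
      have h2 : E.c * E.ι (E.conjInv n) = E.ι n * E.c := by
        rw [← E.conjInv_spec]; group
      rw [← Module.End.mul_apply, ← map_mul, h1, map_mul, Module.End.mul_apply, hfn,
        ← Module.End.mul_apply, ← map_mul, h2, map_mul, Module.End.mul_apply]
    have keyc : ∀ ε : ℝ, ε * ε = 1 → ∀ v,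
        f (X E.c v) + ε • σ E.c (f (X E.c⁻¹ (X E.c v))) =
          ε • σ E.c (f v + ε • σ E.c (f (X E.c⁻¹ v))) := by
      intro ε hε v
      rw [map_add, smul_add, add_comm, map_smul, smul_smul, hε, one_smul,
        ← Module.End.mul_apply (X E.c⁻¹), ← map_mul, inv_mul_cancel, map_one,
        Module.End.one_apply, ← Module.End.mul_apply (σ E.c), ← map_mul, hs, ← hfn, ← hs,
        ← Module.End.mul_apply (X _), ← map_mul, mul_inv_cancel_right]
    let g : ℝ → (Fin d → ℝ) →ₗ[ℝ] W := fun ε =>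
      f.toLinearMap + ε • ((σ E.c).comp (f.toLinearMap.comp (X E.c⁻¹)))
    have hg : ∀ ε v, g ε v = f v + ε • σ E.c (f (X E.c⁻¹ v)) := fun ε v => rfl
    have hcase : g 1 ≠ 0 ∨ g (-1) ≠ 0 := by
      by_contra! hc
      apply hf
      refine IntertwiningMap.ext (LinearMap.ext fun v => ?_)
      have h1 := LinearMap.congr_fun hc.1 v
      have h2 := LinearMap.congr_fun hc.2 v
      rw [hg] at h1 h2
      simp only [one_smul, LinearMap.zero_apply, neg_smul] at h1 h2
      have h3 : (2 : ℝ) • f v = 0 := by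
        rw [two_smul]
        calc f v + f v = (f v + σ E.c (f (X E.c⁻¹ v))) + (f v + -σ E.c (f (X E.c⁻¹ v))) := by abel
          _ = 0 := by rw [h1, h2, add_zero]
      exact (smul_eq_zero.1 h3).resolve_left two_ne_zero
    have hXi := E.isIrreducible_of_res hXirr
    have hXti := E.isIrreducible_of_res hXt
    rcases hcase with hne | hne
    · let g' : IntertwiningMap X σ := ⟨g 1, fun k => by
        refine LinearMap.ext fun v => ?_
        change g 1 (X k v) = σ k (g 1 v)
        rcases E.cover k with ⟨n, rfl⟩ | ⟨n, rfl⟩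
        · exact key 1 (by norm_num) n v
        · rw [map_mul, map_mul, Module.End.mul_apply, Module.End.mul_apply]
          have h1 := keyc 1 (by norm_num) (X (E.ι n) v)
          have h2 := key 1 (by norm_num) n v
          rw [hg, h1, h2, one_smul, hg]⟩
      obtain ⟨N', hN'⟩ := exists_character_sub hσ g'
        ((IsIrreducible.injective_or_eq_zero g').resolve_right
          fun h0 => hne (congrArg (·.toLinearMap) h0))
      obtain ⟨a, b, hab, h'⟩ := ih (hσ.sub N') fun n => by
        have h1 := hN' (E.ι n)
        rw [h, hψ.2] at h1
        push_cast at h1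
        linarith
      refine ⟨a + 1, b, by omega, fun x => ?_⟩
      rw [hN', h']
      push_cast
      ring
    · let g' : IntertwiningMap (E.twist X) σ := ⟨g (-1), fun k => by
        refine LinearMap.ext fun v => ?_
        change g (-1) (E.sign k • X k v) = σ k (g (-1) v)
        rw [map_smul]
        rcases E.cover k with ⟨n, rfl⟩ | ⟨n, rfl⟩
        · rw [E.sign_ι, one_smul]
          exact key (-1) (by norm_num) n v
        · rw [map_mul, map_mul, Module.End.mul_apply, Module.End.mul_apply, E.sign_c_mul]
          have h1 := keyc (-1) (by norm_num) (X (E.ι n) v)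
          have h2 := key (-1) (by norm_num) n v
          rw [hg, h1, h2, smul_smul, hg]
          norm_num⟩
      obtain ⟨N', hN'⟩ := exists_character_sub hσ g'
        ((IsIrreducible.injective_or_eq_zero g').resolve_right
          fun h0 => hne (congrArg (·.toLinearMap) h0))
      obtain ⟨a, b, hab, h'⟩ := ih (hσ.sub N') fun n => by
        have h1 := hN' (E.ι n)
        rw [h, character_twist, E.sign_ι, hψ.2] at h1
        push_cast at h1
        linarith
      refine ⟨a, b + 1, by omega, fun x => ?_⟩
      rw [hN', h', character_twist]
      push_cast
      ring

lemma twist_mem_ext {ψ : K → ℝ} (hψ : ψ ∈ E.Ext χ) : (fun k => E.sign k * ψ k) ∈ E.Ext χ := by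
  obtain ⟨d, X, hX, rfl⟩ := hψ.1.exists_isCont
  refine ⟨?_, fun n => by
    change E.sign (E.ι n) * _ = _
    rw [E.sign_ι, one_mul]
    exact hψ.2 n⟩
  have := (E.isCont_twist hX).isRealCharacter
  convert! this using 1
  funext k
  exact (E.character_twist X k).symm

/-- For multiplicity one the two coefficients in `character_of_mem_ext` add up to one, so only `ψ`
and its twist remain, possibly coinciding. -/
lemma ext_eq_pair (hτ : τ.IsCont) (hirr : τ.IsIrreducible) {ψ : K → ℝ}
    (hψ : ψ ∈ E.Ext τ.character) : E.Ext τ.character = {ψ, fun k => E.sign k * ψ k} := by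
  ext φ
  constructor
  · intro hφ
    obtain ⟨d, X, hX, rfl⟩ := hφ.1.exists_isCont
    obtain ⟨a, b, hab, h⟩ := E.character_of_mem_ext hτ hirr hψ hX (m := 1)
      (fun n => by rw [hφ.2]; simp)
    have : (a = 1 ∧ b = 0) ∨ (a = 0 ∧ b = 1) := by omega
    rcases this with ⟨rfl, rfl⟩ | ⟨rfl, rfl⟩
    · left
      funext x
      simp [h x]
    · right
      refine Set.mem_singleton_iff.2 (funext fun x => ?_)
      simp [h x]
  · rintro (rfl | h)
    · exact hψ
    · rw [Set.mem_singleton_iff.1 h]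
      exact E.twist_mem_ext hψ

end IndexTwo

end IndexTwo

/-! ### Paths of invertible linear maps -/

section Paths

set_option linter.unusedSectionVars false

open Module Representation Polynomial

variable {W : Type*} [AddCommGroup W] [Module ℝ W] [FiniteDimensional ℝ W]

/-- Applied to a minimal polynomial, this splits off the part with negative eigenvalues. The linear
factors with negative root form `a`; the other linear factors and the factor without real roots form
`b`. Coprimality holds because no root of `a` is a root of `b`. -/
lemma exists_factorization_by_sign {p : ℝ[X]} (hp : p ≠ 0) : ∃ a b : ℝ[X], p = a * b ∧
    IsCoprime a b ∧ (∀ x, a.IsRoot x → x < 0) ∧ ∀ x, b.IsRoot x → 0 ≤ x := by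
  classical
  obtain ⟨q, hpq, -, hq⟩ := p.exists_prod_multiset_X_sub_C_mul
  have hq0 : q ≠ 0 := by
    rintro rfl
    exact hp (by rw [← hpq, mul_zero])
  let A := p.roots.filter (· < 0)
  let B := p.roots.filter (¬ · < 0)
  let b := (B.map fun a => X - C a).prod * q
  have hroot : ∀ (M : Multiset ℝ) (x : ℝ), (M.map fun a => X - C a).prod.IsRoot x → x ∈ M := by
    intro M x h
    rw [IsRoot.def, eval_multiset_prod, Multiset.prod_eq_zero_iff] at h
    simp only [Multiset.map_map, Multiset.mem_map, Function.comp_apply, eval_sub, eval_X,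
      eval_C] at h
    obtain ⟨a, ha, h⟩ := h
    rwa [sub_eq_zero.1 h]
  have hb : ∀ x, b.IsRoot x → 0 ≤ x := by
    intro x hx
    rcases root_mul.1 hx with h | h
    · exact not_lt.1 (Multiset.mem_filter.1 (hroot _ _ h)).2
    · have := (mem_roots hq0).2 h
      rw [hq] at this
      exact (Multiset.notMem_zero _ this).elim
  have hA : ∀ M : Multiset ℝ, (∀ x ∈ M, x < 0) → IsCoprime (M.map fun a => X - C a).prod b := by
    intro M
    induction M using Multiset.induction with
    | empty => intro _; simpa using isCoprime_one_left
    | cons x M ih =>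
      intro h
      rw [Multiset.map_cons, Multiset.prod_cons]
      refine IsCoprime.mul_left ?_ (ih fun y hy => h y (Multiset.mem_cons_of_mem hy))
      refine (irreducible_X_sub_C x).coprime_iff_not_dvd.2 fun hd => ?_
      exact absurd (hb x (dvd_iff_isRoot.1 hd)) (not_le.2 (h x (Multiset.mem_cons_self _ _)))
  refine ⟨(A.map fun a => X - C a).prod, b, ?_, hA A fun x hx => (Multiset.mem_filter.1 hx).2,
    fun x hx => (Multiset.mem_filter.1 (hroot _ _ hx)).2, hb⟩
  rw [← mul_assoc, ← Multiset.prod_add, ← Multiset.map_add, Multiset.filter_add_not, hpq]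

/-- An invertible endomorphism is joined by a segment of invertible endomorphisms to an involution
which is a polynomial in it. -/
theorem exists_involution {f : Module.End ℝ W} (hf : Function.Injective f) :
    ∃ s ∈ Algebra.adjoin ℝ {f}, s * s = 1 ∧
      ∀ t : ℝ, 0 ≤ t → t ≤ 1 → Function.Injective ((1 - t) • f + t • s : Module.End ℝ W) := by
  obtain ⟨a, b, hab, ⟨u, v, huv⟩, ha, hb⟩ :=
    exists_factorization_by_sign (minpoly.ne_zero (Algebra.IsIntegral.isIntegral (R := ℝ) f))
  have hmin : aeval f (a * b) = 0 := by
    rw [← hab]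
    exact minpoly.aeval ℝ f
  -- The Bézout identity gives complementary projections: `e` has its image in the kernel of `a(f)`,
  -- `e'` in that of `b(f)`. The involution is `-1` on the first and `1` on the second. A kernel
  -- vector on the segment would be an eigenvector of `f` with nonnegative eigenvalue in the first
  -- part or nonpositive eigenvalue in the second, against the signs of the roots and the
  -- injectivity of `f`.
  let e' := aeval f (u * a)
  let e := aeval f (v * b)
  have hsum : e' + e = 1 := by
    rw [← map_add, huv, map_one]
  have hzero : e' * e = 0 := by
    rw [← map_mul, show u * a * (v * b) = u * v * (a * b) by ring, map_mul, hmin, mul_zero]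
  have hzero' : e * e' = 0 := by
    rw [← map_mul, show v * b * (u * a) = u * v * (a * b) by ring, map_mul, hmin, mul_zero]
  have hae : aeval f a * e = 0 := by
    rw [← map_mul, show a * (v * b) = v * (a * b) by ring, map_mul, hmin, mul_zero]
  have hbe : aeval f b * e' = 0 := by
    rw [← map_mul, show b * (u * a) = u * (a * b) by ring, map_mul, hmin, mul_zero]
  have hee : e * e = e := by
    calc e * e = (e' + e) * e := by rw [add_mul, hzero, zero_add]
      _ = e := by rw [hsum, one_mul]
  have hee' : e' * e' = e' := by
    calc e' * e' = (e' + e) * e' := by rw [add_mul, hzero', add_zero]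
      _ = e' := by rw [hsum, one_mul]
  have hcomm : ∀ q : ℝ[X], aeval f q * f = f * aeval f q := fun q => by
    have : aeval f q * aeval f (X : ℝ[X]) = aeval f (X : ℝ[X]) * aeval f q := by
      rw [← map_mul, mul_comm, map_mul]
    rwa [aeval_X] at this
  have heig : ∀ (q : ℝ[X]) (c : ℝ) (y : W), f y = c • y → aeval f q y = 0 → y ≠ 0 →
      q.IsRoot c := by
    intro q c y hy hq hy0
    have := Module.End.aeval_apply_of_hasEigenvector (p := q) (μ := c) (f := f) (x := y)
      ⟨Module.End.mem_eigenspace_iff.2 hy, hy0⟩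
    rw [hq] at this
    exact (smul_eq_zero.1 this.symm).resolve_right hy0
  refine ⟨e' - e, Subalgebra.sub_mem _ (aeval_mem_adjoin_singleton ℝ f)
    (aeval_mem_adjoin_singleton ℝ f), ?_, fun t ht0 ht1 => ?_⟩
  · rw [mul_sub, sub_mul, sub_mul, hee, hee', hzero, hzero', sub_zero, zero_sub, sub_neg_eq_add,
      hsum]
  refine (injective_iff_map_eq_zero _).2 fun x hx => ?_
  have hx' : (1 - t) • f x + t • (e' x - e x) = 0 := hx
  have h1 : (1 - t) • f (e x) - t • e x = 0 := by
    have := congrArg e hx'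
    rw [map_add, map_smul, map_smul, map_sub, map_zero] at this
    rw [show e (f x) = f (e x) from LinearMap.congr_fun (hcomm (v * b)) x,
      show e (e' x) = 0 from LinearMap.congr_fun hzero' x,
      show e (e x) = e x from LinearMap.congr_fun hee x, zero_sub, smul_neg] at this
    rwa [sub_eq_add_neg]
  have h2 : (1 - t) • f (e' x) + t • e' x = 0 := by
    have := congrArg e' hx'
    rw [map_add, map_smul, map_smul, map_sub, map_zero] at this
    rwa [show e' (f x) = f (e' x) from LinearMap.congr_fun (hcomm (u * a)) x,
      show e' (e x) = 0 from LinearMap.congr_fun hzero x,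
      show e' (e' x) = e' x from LinearMap.congr_fun hee' x, sub_zero] at this
  have hxs : e' x + e x = x := LinearMap.congr_fun hsum x
  have hz : e x = 0 := by
    by_contra hne
    rcases ht1.lt_or_eq with hlt | rfl
    · have hpos : 0 < 1 - t := by linarith
      have hfy : f (e x) = (t / (1 - t)) • e x := by
        rw [sub_eq_zero] at h1
        rw [div_eq_inv_mul, mul_smul, ← h1, smul_smul, inv_mul_cancel₀ hpos.ne', one_smul]
      have := ha _ (heig a _ _ hfy (LinearMap.congr_fun hae x) hne)
      exact absurd (div_nonneg ht0 hpos.le) (not_le.2 this)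
    · simp at h1
      exact hne h1
  have hz' : e' x = 0 := by
    by_contra hne
    rcases ht1.lt_or_eq with hlt | rfl
    · have hpos : 0 < 1 - t := by linarith
      have hfy : f (e' x) = (-(t / (1 - t))) • e' x := by
        rw [add_eq_zero_iff_eq_neg] at h2
        rw [neg_smul, div_eq_inv_mul, mul_smul, ← smul_neg, ← h2, smul_smul,
          inv_mul_cancel₀ hpos.ne', one_smul]
      have h3 := hb _ (heig b _ _ hfy (LinearMap.congr_fun hbe x) hne)
      have h4 : t / (1 - t) = 0 := le_antisymm (by linarith) (div_nonneg ht0 hpos.le)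
      rw [h4, neg_zero, zero_smul] at hfy
      exact hne (hf (by rw [hfy, map_zero]))
    · simp at h2
      exact hne h2
  rw [← hxs, hz, hz', add_zero]

/-- Rotating the negative eigenspace of an involution to the identity. -/
theorem exists_rotation {s J : Module.End ℝ W} (hs : s * s = 1) (hJ : s * J = -J)
    (hJ' : J * s = -J) (hJJ : J * J = -((1 / 2 : ℝ) • (1 - s))) :
    ∃ φ : ℝ → Module.End ℝ W, (∀ t, ∃ a b : ℝ, φ t = 1 + a • (1 - s) + b • J) ∧ φ 0 = s ∧
      φ 1 = 1 ∧ (∀ t, Function.Injective (φ t)) ∧ ∀ v, WeaklyContinuous fun t => φ t v := by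
  -- The hypotheses say that `J` is a complex structure on the `-1`-eigenspace of `s` and zero on
  -- the other one. So `φ t` is the rotation by the angle `π (1 - t)` on the former and the identity
  -- on the latter; its inverse rotates by the opposite angle.
  let φ : ℝ → Module.End ℝ W := fun t => 1 + ((Real.cos (Real.pi * (1 - t)) - 1) / 2) • (1 - s) +
    Real.sin (Real.pi * (1 - t)) • J
  refine ⟨φ, fun t => ⟨_, _, rfl⟩, ?_, ?_, fun t => ?_, fun v l => ?_⟩
  · simp only [φ, sub_zero, mul_one, Real.cos_pi, Real.sin_pi, zero_smul, add_zero]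
    norm_num
  · simp [φ]
  · have hinv : (1 + ((Real.cos (Real.pi * (1 - t)) - 1) / 2) • (1 - s) -
        Real.sin (Real.pi * (1 - t)) • J) * φ t = 1 := by
      simp only [φ]
      generalize hc : Real.cos (Real.pi * (1 - t)) = c
      generalize hd : Real.sin (Real.pi * (1 - t)) = d
      have hcd : d * d = 1 - c * c := by
        rw [← hc, ← hd]
        have := Real.sin_sq_add_cos_sq (Real.pi * (1 - t))
        linarith
      simp only [mul_add, add_mul, sub_mul, mul_sub, smul_mul_assoc, mul_smul_comm, one_mul,
        mul_one, hs, hJ, hJ', hJJ, smul_smul, smul_sub, smul_neg, smul_add]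
      match_scalars <;> first | ring1 | linear_combination (1 / 2 : ℝ) * hcd |
        linear_combination (-1 / 2 : ℝ) * hcd
    exact Function.LeftInverse.injective (g := (1 + ((Real.cos (Real.pi * (1 - t)) - 1) / 2) •
      (1 - s) - Real.sin (Real.pi * (1 - t)) • J : Module.End ℝ W))
      fun v => LinearMap.congr_fun hinv v
  · have : (fun t => l (φ t v)) = fun t => l v +
        ((Real.cos (Real.pi * (1 - t)) - 1) / 2) * l ((1 - s) v) +
        Real.sin (Real.pi * (1 - t)) * l (J v) := by
      funext t
      simp [φ]
    rw [this]
    fun_prop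

lemma continuous_det {X : Type*} [TopologicalSpace X] {φ : X → Module.End ℝ W}
    (h : ∀ v, WeaklyContinuous fun t => φ t v) : Continuous fun t => LinearMap.det (φ t) := by
  let b := finBasis ℝ W
  simp only [← LinearMap.det_toMatrix b]
  refine Continuous.matrix_det (continuous_matrix fun i j => ?_)
  simp only [LinearMap.toMatrix_apply]
  exact h (b j) (b.coord i)

lemma det_ne_zero_of_injective {f : Module.End ℝ W} (hf : Function.Injective f) :
    LinearMap.det f ≠ 0 := by
  have := (LinearEquiv.ofInjectiveEndo f hf).isUnit_det'
  exact this.ne_zero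

/-- Along a path of invertible endomorphisms the sign of the determinant is constant. -/
lemma det_pos_of_path {φ : ℝ → Module.End ℝ W} (h : ∀ v, WeaklyContinuous fun t => φ t v)
    (hinj : ∀ t, 0 ≤ t → t ≤ 1 → Function.Injective (φ t)) (h1 : 0 < LinearMap.det (φ 1)) :
    0 < LinearMap.det (φ 0) := by
  by_contra hc
  have h0 : LinearMap.det (φ 0) ≤ 0 := not_lt.1 hc
  obtain ⟨t, ht, h⟩ := intermediate_value_Icc (zero_le_one' ℝ)
    (continuous_det h).continuousOn ⟨h0, h1.le⟩
  exact det_ne_zero_of_injective (hinj t ht.1 ht.2) h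

lemma mul_comm_of_mem_adjoin {f s J : Module.End ℝ W} (hs : s ∈ Algebra.adjoin ℝ {f})
    (hJ : J * f = f * J) : J * s = s * J := by
  induction hs using Algebra.adjoin_induction with
  | mem x hx => rw [Set.mem_singleton_iff.1 hx, hJ]
  | algebraMap r => exact (Algebra.commutes r J).symm
  | add x y _ _ hx hy => rw [mul_add, add_mul, hx, hy]
  | mul x y _ _ hx hy => rw [← mul_assoc, hx, mul_assoc, hy, mul_assoc]

lemma weaklyContinuous_segment (f s : Module.End ℝ W) (v : W) :
    WeaklyContinuous fun t : ℝ => ((1 - t) • f + t • s : Module.End ℝ W) v := by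
  intro l
  have : (fun t : ℝ => l (((1 - t) • f + t • s : Module.End ℝ W) v)) = fun t =>
      (1 - t) * l (f v) + t * l (s v) := by
    funext t
    simp
  rw [this]
  fun_prop

/-- An invertible endomorphism commuting with a complex structure has positive determinant. -/
theorem det_pos_of_commute {f J : Module.End ℝ W} (hf : Function.Injective f) (hJ : J * J = -1)
    (hc : J * f = f * J) : 0 < LinearMap.det f := by
  obtain ⟨s, hsf, hs, hinj⟩ := exists_involution hf
  have hJs := mul_comm_of_mem_adjoin hsf hc
  -- As `s` is a polynomial in `f`, it commutes with `J`, and `J` restricts to its negative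
  -- eigenspace; `J'` is this restriction extended by zero.
  let J' : Module.End ℝ W := (1 / 2 : ℝ) • (J * (1 - s))
  obtain ⟨φ, -, h0, h1, hφ, hcont⟩ := exists_rotation (s := s) (J := J') hs
    (by simp only [J', mul_smul_comm, mul_sub, mul_one, ← hJs, ← mul_assoc]
        rw [mul_assoc J s s, hs, mul_one]
        module)
    (by simp only [J', smul_mul_assoc, mul_sub, sub_mul, mul_one, mul_assoc, hs, smul_sub, neg_sub])
    (by
      have : (1 - s) * (J * (1 - s)) = J * ((2 : ℝ) • (1 - s)) := by
        simp only [sub_mul, mul_sub, one_mul, mul_one, ← mul_assoc, ← hJs]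
        rw [mul_assoc J s s, hs]
        simp only [mul_smul_comm, mul_one, mul_sub]
        module
      simp only [J', smul_mul_assoc, mul_smul_comm, smul_smul]
      rw [mul_assoc, this, ← mul_assoc, hJ, mul_smul_comm, neg_one_mul, smul_smul]
      module)
  have hdet : 0 < LinearMap.det (φ 0) := det_pos_of_path hcont (fun t _ _ => hφ t)
    (by rw [h1]; simp)
  have := det_pos_of_path (φ := fun t => (1 - t) • f + t • s) (weaklyContinuous_segment f s)
    (fun t => hinj t) (by simpa [h0] using hdet)
  simpa using this

end Paths

/-! ### Path components of equivariant isomorphisms -/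

section JoinedEquivs

set_option linter.unusedSectionVars false

open Module Representation

variable {K : Type*} [Group K] [TopologicalSpace K]
  {V W W' : Type*} [AddCommGroup V] [Module ℝ V] [AddCommGroup W] [Module ℝ W]
  [AddCommGroup W'] [Module ℝ W']
  [FiniteDimensional ℝ V] [FiniteDimensional ℝ W] [FiniteDimensional ℝ W']
  {σ : Representation ℝ K V} {τ : Representation ℝ K W} {τ' : Representation ℝ K W'}

/-- The topology of pointwise convergence on equivalences of representations. -/
instance Representation.Equiv.topology : TopologicalSpace (σ.Equiv τ) :=
  TopologicalSpace.induced (fun e (p : V × Dual ℝ W) => p.2 (e p.1)) inferInstance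

lemma continuous_equiv_iff {X : Type*} [TopologicalSpace X] {φ : X → σ.Equiv τ} :
    Continuous φ ↔ ∀ v, WeaklyContinuous fun t => φ t v :=
  continuous_induced_rng.trans (continuous_pi_iff.trans
    ⟨fun h v l => h (v, l), fun h p => h p.1 p.2⟩)

lemma continuous_trans_left (e : σ.Equiv τ) :
    Continuous fun f : τ.Equiv τ' => e.trans f :=
  continuous_equiv_iff.2 fun v l =>
    continuous_equiv_iff.1 (continuous_id : Continuous fun f : τ.Equiv τ' => f) (e v) l

lemma continuous_trans_right (e : τ.Equiv τ') :
    Continuous fun f : σ.Equiv τ => f.trans e :=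
  continuous_equiv_iff.2 fun v l =>
    continuous_equiv_iff.1 (continuous_id : Continuous fun f : σ.Equiv τ => f) v
      (l.comp e.toLinearMap)

/-- An injective endomorphism commuting with a representation as a self-equivalence. -/
noncomputable def Representation.Equiv.ofEnd (f : Module.End ℝ V) (hf : Function.Injective f)
    (hc : ∀ k, f * σ k = σ k * f) : σ.Equiv σ :=
  Representation.Equiv.mk (LinearEquiv.ofInjectiveEndo f hf) fun k => hc k

lemma Representation.Equiv.ofEnd_apply (f : Module.End ℝ V) (hf : Function.Injective f)
    (hc : ∀ k, f * σ k = σ k * f) (v : V) : Representation.Equiv.ofEnd f hf hc v = f v := rfl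

lemma joined_of_path {f g : σ.Equiv σ} {φ : ℝ → Module.End ℝ V}
    (hφ : ∀ v, WeaklyContinuous fun t => φ t v)
    (hinj : ∀ t, 0 ≤ t → t ≤ 1 → Function.Injective (φ t))
    (hc : ∀ t k, φ t * σ k = σ k * φ t) (h0 : ∀ v, φ 0 v = f v) (h1 : ∀ v, φ 1 v = g v) :
    Joined f g := by
  refine ⟨⟨⟨fun t => Representation.Equiv.ofEnd (φ t) (hinj t t.2.1 t.2.2) (hc t),
    continuous_equiv_iff.2 fun v l => ?_⟩, ?_, ?_⟩⟩
  · exact (hφ v l).comp continuous_subtype_val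
  · exact Representation.Equiv.ext (funext h0)
  · exact Representation.Equiv.ext (funext h1)

/-- The involution supplied by `exists_involution` is a polynomial in `f`, so it commutes with the
representation and so does the whole segment leading to it. -/
lemma exists_joined_involution (f : σ.Equiv σ) :
    ∃ s : σ.Equiv σ, Joined f s ∧ ∀ v, s (s v) = v := by
  obtain ⟨s, hsf, hs, hinj⟩ := exists_involution (f := f.toLinearMap) f.toLinearEquiv.injective
  have hfc : ∀ k, σ k * f.toLinearMap = f.toLinearMap * σ k := fun k =>
    LinearMap.ext fun v => (IntertwiningMap.isIntertwining σ σ f.toIntertwiningMap k v).symm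
  have hc : ∀ k, s * σ k = σ k * s := fun k => (mul_comm_of_mem_adjoin hsf (hfc k)).symm
  have hsi : Function.Injective s := Function.LeftInverse.injective (g := s)
    fun v => LinearMap.congr_fun hs v
  refine ⟨Representation.Equiv.ofEnd s hsi hc, joined_of_path
    (φ := fun t => (1 - t) • f.toLinearMap + t • s)
    (weaklyContinuous_segment f.toLinearMap s) hinj (fun t k => ?_) (fun v => ?_) (fun v => ?_),
    fun v => LinearMap.congr_fun hs v⟩
  · rw [add_mul, mul_add, smul_mul_assoc, smul_mul_assoc, mul_smul_comm, mul_smul_comm, hc,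
      hfc]
  · simp
  · simp [Representation.Equiv.ofEnd_apply]

/-- An involution is joined to the identity when its negative eigenspace has a complex structure. -/
lemma joined_refl_of_complexStructure (s : σ.Equiv σ) (hs : ∀ v, s (s v) = v)
    (N : Subrepresentation σ) (hN : ∀ v, v ∈ N.toSubmodule ↔ s v = -v)
    (J : IntertwiningMap N.toRepresentation N.toRepresentation) (hJ : ∀ v, J (J v) = -v) :
    Joined s (Representation.Equiv.refl σ) := by
  have hsl : ∀ v, s.toLinearMap v = s v := fun v => rfl
  -- The equivariant projection onto the negative eigenspace; it extends `J` by zero to an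
  -- endomorphism of `V`.
  let P : V →ₗ[ℝ] N.toSubmodule :=
    { toFun := fun v => ⟨(1 / 2 : ℝ) • (v - s v), by
        rw [hN, map_smul, map_sub, hs, ← smul_neg, neg_sub]⟩
      map_add' := fun v w => Subtype.ext (by simp [map_add]; module)
      map_smul' := fun a w => Subtype.ext (by simp; module) }
  have hP : ∀ v, (P v : V) = (1 / 2 : ℝ) • (v - s v) := fun v => rfl
  have hPs : ∀ v, P (s v) = - P v := fun v => Subtype.ext (by
    rw [Submodule.coe_neg, hP, hP, hs, ← smul_neg, neg_sub])
  have hPN : ∀ n : N.toSubmodule, P n = n := fun n => Subtype.ext (by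
    rw [hP, (hN n).1 n.2, sub_neg_eq_add, ← two_smul ℝ, smul_smul]; norm_num)
  have hsc : ∀ k v, s (σ k v) = σ k (s v) :=
    fun k v => IntertwiningMap.isIntertwining σ σ s.toIntertwiningMap k v
  have hPc : ∀ k v, P (σ k v) = N.toRepresentation k (P v) := fun k v => Subtype.ext (by
    change (P (σ k v) : V) = σ k (P v)
    rw [hP, hP, hsc, map_smul, map_sub])
  let J' : Module.End ℝ V := N.toSubmodule.subtype.comp (J.toLinearMap.comp P)
  have hJ' : ∀ v, J' v = (J (P v) : N.toSubmodule) := fun v => rfl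
  obtain ⟨φ, hab, h0, h1, hφ, hcont⟩ := exists_rotation (s := s.toLinearMap) (J := J')
    (LinearMap.ext hs)
    (LinearMap.ext fun v => by
      change s (J (P v) : N.toSubmodule) = - J' v
      rw [(hN _).1 (J (P v)).2, hJ'])
    (LinearMap.ext fun v => by
      change J' (s v) = - J' v
      rw [hJ', hJ', hPs, map_neg, Submodule.coe_neg])
    (LinearMap.ext fun v => by
      change J' (J' v) = -((1 / 2 : ℝ) • (v - s v))
      rw [hJ', hJ', hPN, hJ, Submodule.coe_neg, hP])
  refine joined_of_path hcont (fun t _ _ => hφ t) (fun t k => ?_) (fun v => ?_) (fun v => ?_)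
  · obtain ⟨a, b, h⟩ := hab t
    have hJc : J' * σ k = σ k * J' := LinearMap.ext fun v => by
      change J' (σ k v) = σ k (J' v)
      rw [hJ', hPc, IntertwiningMap.isIntertwining _ _ J]
      rfl
    have hsk : s.toLinearMap * σ k = σ k * s.toLinearMap := LinearMap.ext (hsc k)
    rw [h]
    simp only [add_mul, mul_add, smul_mul_assoc, mul_smul_comm, sub_mul, mul_sub, one_mul,
      mul_one, hJc, hsk]
  · rw [h0]
    rfl
  · rw [h1]
    rfl

/-- The negative eigenspace of an involution. -/
def negEigenspace (s : σ.Equiv σ) : Subrepresentation σ where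
  toSubmodule := LinearMap.ker (s.toLinearMap + LinearMap.id)
  apply_mem_toSubmodule g v hv := by
    rw [LinearMap.mem_ker] at hv ⊢
    have hv' : s v + v = 0 := hv
    change s (σ g v) + σ g v = 0
    rw [show s (σ g v) = σ g (s v) from
      IntertwiningMap.isIntertwining σ σ s.toIntertwiningMap g v, ← map_add, hv', map_zero]

lemma mem_negEigenspace (s : σ.Equiv σ) (v : V) :
    v ∈ (negEigenspace s).toSubmodule ↔ s v = -v := by
  rw [← add_eq_zero_iff_eq_neg]
  rfl

/-- The direct sum of copies of a representation. -/
def Representation.power (τ : Representation ℝ K W) (ι : Type*) : Representation ℝ K (ι → W) where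
  toFun k := LinearMap.pi fun i => (τ k).comp (LinearMap.proj i)
  map_one' := by ext; simp
  map_mul' k l := by ext; simp

lemma Representation.power_apply (τ : Representation ℝ K W) (ι : Type*) (k : K) (v : ι → W)
    (i : ι) : τ.power ι k v i = τ k (v i) := rfl

lemma Representation.character_power (τ : Representation ℝ K W) (ι : Type*) [Fintype ι] (k : K) :
    (τ.power ι).character k = Fintype.card ι * τ.character k := by
  classical
  have : τ.power ι k = ∑ i, (LinearMap.single ℝ (fun _ : ι => W) i).comp
      ((τ k).comp (LinearMap.proj i)) := by
    refine LinearMap.ext fun v => funext fun j => ?_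
    rw [Representation.power_apply, LinearMap.sum_apply, Finset.sum_apply,
      Finset.sum_eq_single j]
    · simp
    · intro i _ hij
      simp [Pi.single_eq_of_ne hij.symm]
    · simp
  rw [Representation.character, this, map_sum]
  have h2 : ∀ i, ((τ k).comp (LinearMap.proj i)).comp (LinearMap.single ℝ (fun _ : ι => W) i) =
      τ k := fun i => LinearMap.ext fun v => by
    change τ k (Pi.single (M := fun _ : ι => W) i v i) = τ k v
    rw [Pi.single_eq_same]
  have h3 : ∀ i, LinearMap.trace ℝ (ι → W) ((LinearMap.single ℝ (fun _ : ι => W) i).comp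
      ((τ k).comp (LinearMap.proj i))) = τ.character k := fun i => by
    rw [LinearMap.trace_comp_comm', h2]
    rfl
  rw [Finset.sum_congr rfl fun i _ => h3 i, Finset.sum_const, Finset.card_univ, nsmul_eq_mul]

lemma Representation.IsCont.power (hτ : τ.IsCont) (ι : Type*) [Fintype ι] :
    (τ.power ι).IsCont := by
  classical
  intro v l
  have : (fun k => l (τ.power ι k v)) = fun k =>
      ∑ i, (l.comp (LinearMap.single ℝ (fun _ : ι => W) i)) (τ k (v i)) := by
    funext k
    conv_lhs => rw [← LinearMap.sum_single_apply (fun _ : ι => W) (τ.power ι k v)]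
    rw [map_sum]
    rfl
  rw [this]
  exact continuous_finsetSum _ fun i _ => hτ _ _

variable [IsTopologicalGroup K] [CompactSpace K]

/-- Submodules of an isotypic module are isotypic. -/
lemma exists_multiplicity_of_injective {V W W' : Type*} [AddCommGroup V] [Module ℝ V]
    [AddCommGroup W] [Module ℝ W] [AddCommGroup W'] [Module ℝ W'] [FiniteDimensional ℝ V]
    [FiniteDimensional ℝ W] [FiniteDimensional ℝ W'] {σ : Representation ℝ K V}
    {τ : Representation ℝ K W} {τ' : Representation ℝ K W'} (hσ : σ.IsCont)
    (hτ : τ.IsCont) (hτ' : τ'.IsCont) (hirr : τ.IsIrreducible) {m : ℕ}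
    (h : ∀ k, τ'.character k = m * τ.character k) (f : IntertwiningMap σ τ')
    (hf : Function.Injective f) : ∃ n : ℕ, ∀ k, σ.character k = n * τ.character k := by
  induction hn : finrank ℝ V using Nat.strong_induction_on generalizing V with
  | _ n ih =>
  rcases subsingleton_or_nontrivial V with hV | hV
  · refine ⟨0, fun k => ?_⟩
    rw [Representation.character, Subsingleton.elim (σ k) 0, map_zero, Nat.cast_zero, zero_mul]
  · obtain ⟨S, hS⟩ := exists_irreducible_subrepresentation σ
    have hSc := hσ.sub S
    have hSn := hS.nontrivial
    let i : IntertwiningMap S.toRepresentation σ := ⟨S.toSubmodule.subtype, fun _ => rfl⟩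
    have hpos : 0 < finrank ℝ (IntertwiningMap S.toRepresentation τ') := by
      refine finrank_intertwiningMap_pos_iff.2 ⟨f.comp i, fun h0 => ?_⟩
      obtain ⟨x, hx⟩ := exists_ne (0 : S.toSubmodule)
      have h1 : f (i x) = 0 := congrArg (fun g : IntertwiningMap S.toRepresentation τ' => g x) h0
      exact hx (Subtype.ext (hf (h1.trans (map_zero f).symm)))
    -- Maps from `S` to the isotypic module can be nonzero only if maps from `S` to `τ` can, and by
    -- Schur's lemma such a map is an isomorphism.
    rw [finrank_intertwiningMap_eq_mul hSc hτ' hSc hτ (m := 1) (n := m) (by simp) h] at hpos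
    obtain ⟨g, hg⟩ := finrank_intertwiningMap_pos_iff.1 (Nat.pos_of_mul_pos_left hpos)
    have hbij := (IsIrreducible.bijective_or_eq_zero g).resolve_right hg
    have hSτ : ∀ k, S.toRepresentation.character k = τ.character k :=
      fun k => congrFun (char_iso (g.ofBijective hbij)) k
    obtain ⟨S', hS'⟩ := hσ.exists_isCompl S
    have hlt : finrank ℝ S'.toSubmodule < n := by
      have h1 := Submodule.finrank_add_eq_of_isCompl hS'
      have h2 : 0 < finrank ℝ S.toSubmodule := finrank_pos
      omega
    obtain ⟨n', hn'⟩ := ih _ hlt (hσ.sub S')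
      (f.comp ⟨S'.toSubmodule.subtype, fun _ => rfl⟩) (hf.comp Subtype.val_injective) rfl
    refine ⟨1 + n', fun k => ?_⟩
    rw [S.character_add S' hS', hSτ, hn']
    push_cast
    ring

/-- If `τ` has an equivariant complex structure, automorphisms of `τ`-isotypic modules are joined
to the identity. -/
theorem joined_refl_of_isotypic (hσ : σ.IsCont) (hτ : τ.IsCont) (hirr : τ.IsIrreducible)
    (J : IntertwiningMap τ τ) (hJ : ∀ w, J (J w) = -w) {m : ℕ}
    (h : ∀ k, σ.character k = m * τ.character k) (f : σ.Equiv σ) :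
    Joined f (Representation.Equiv.refl σ) := by
  obtain ⟨s, hfs, hs⟩ := exists_joined_involution f
  -- The negative eigenspace is again a multiple of `τ`, so `J` acts on it copy by copy.
  have hNc := hσ.sub (negEigenspace s)
  obtain ⟨n, hn⟩ := exists_multiplicity_of_injective hNc hτ hσ hirr h
    ⟨(negEigenspace s).toSubmodule.subtype, fun _ => rfl⟩ Subtype.val_injective
  obtain ⟨e⟩ := exists_equiv_of_character_eq hNc (hτ.power (Fin n))
    fun k => by rw [hn, Representation.character_power, Fintype.card_fin]
  let Jn : IntertwiningMap (τ.power (Fin n)) (τ.power (Fin n)) :=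
    ⟨LinearMap.pi fun i => J.toLinearMap.comp (LinearMap.proj i), fun k =>
      LinearMap.ext fun v => funext fun i => IntertwiningMap.isIntertwining τ τ J k (v i)⟩
  refine hfs.trans (joined_refl_of_complexStructure s hs (negEigenspace s) (mem_negEigenspace s)
    (e.symm.toIntertwiningMap.comp (Jn.comp e.toIntertwiningMap)) fun v => ?_)
  have h1 : ∀ u, Jn (Jn u) = -u := fun u => funext fun i => hJ (u i)
  change e.symm (Jn (e (e.symm (Jn (e v))))) = -v
  rw [e.apply_symm_apply, h1, map_neg, e.symm_apply_apply]

/-- If `τ` has an equivariant complex structure, any two equivalences of `τ`-isotypic modules are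
joined. -/
theorem joined_of_isotypic {σ' : Representation ℝ K W'} (hσ : σ.IsCont) (hτ : τ.IsCont)
    (hirr : τ.IsIrreducible) (J : IntertwiningMap τ τ) (hJ : ∀ w, J (J w) = -w) {m : ℕ}
    (h : ∀ k, σ.character k = m * τ.character k) (f g : σ.Equiv σ') : Joined f g := by
  have h1 := (joined_refl_of_isotypic hσ hτ hirr J hJ h (f.trans g.symm)).map
    (continuous_trans_right g)
  have e1 : (f.trans g.symm).trans g = f :=
    Representation.Equiv.ext (funext fun v => g.apply_symm_apply (f v))
  have e2 : (Representation.Equiv.refl σ).trans g = g := rfl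
  rwa [e1, e2] at h1

end JoinedEquivs

/-! ### Real type: matrices and signs of determinants -/

section RealType

set_option linter.unusedSectionVars false

open Module Representation

lemma mul_pos_of_nonvanishing {φ : unitInterval → ℝ} (hφ : Continuous φ) (h : ∀ t, φ t ≠ 0) :
    0 < φ 0 * φ 1 := by
  by_contra hc
  have hc' : φ 0 * φ 1 ≤ 0 := not_lt.1 hc
  have h0 : (0 : ℝ) ∈ Set.range φ := by
    rcases mul_nonpos_iff.1 hc' with ⟨h1, h2⟩ | ⟨h1, h2⟩
    · exact intermediate_value_univ 1 0 hφ ⟨h2, h1⟩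
    · exact intermediate_value_univ 0 1 hφ ⟨h1, h2⟩
  obtain ⟨t, ht⟩ := h0
  exact h t ht

section Det

variable {K : Type*} [Group K] [TopologicalSpace K] {V : Type*} [AddCommGroup V] [Module ℝ V]
  [FiniteDimensional ℝ V] {σ : Representation ℝ K V}

lemma det_mul_det_pos_of_joined {f g : σ.Equiv σ} (h : Joined f g) :
    0 < LinearMap.det f.toLinearMap * LinearMap.det g.toLinearMap := by
  obtain ⟨p⟩ := h
  have hp := continuous_equiv_iff.1 p.continuous
  have := mul_pos_of_nonvanishing (φ := fun t => LinearMap.det (p t).toLinearMap)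
    (continuous_det hp) fun t => det_ne_zero_of_injective (p t).toLinearEquiv.injective
  simpa using this

/-- An even-dimensional space has a complex structure. -/
lemma exists_complexStructure_of_even {N : Type*} [AddCommGroup N] [Module ℝ N]
    [FiniteDimensional ℝ N] (h : Even (finrank ℝ N)) :
    ∃ J : N →ₗ[ℝ] N, ∀ v, J (J v) = -v := by
  obtain ⟨k, hk⟩ := h
  let e : N ≃ₗ[ℝ] (Fin k → ℝ) × (Fin k → ℝ) := LinearEquiv.ofFinrankEq _ _ (by simp [hk])
  let J : (Fin k → ℝ) × (Fin k → ℝ) →ₗ[ℝ] (Fin k → ℝ) × (Fin k → ℝ) :=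
    LinearMap.prod (-LinearMap.snd ℝ _ _) (LinearMap.fst ℝ _ _)
  refine ⟨e.symm.toLinearMap.comp (J.comp e.toLinearMap), fun v => ?_⟩
  have hJ : ∀ p, J (J p) = -p := fun p => rfl
  simp only [LinearMap.comp_apply, LinearEquiv.coe_coe, LinearEquiv.apply_symm_apply, hJ, map_neg,
    LinearEquiv.symm_apply_apply]

lemma det_involution (s : Module.End ℝ V) (hs : ∀ v, s (s v) = v) :
    LinearMap.det s = (-1) ^ finrank ℝ (LinearMap.ker (s + LinearMap.id)) := by
  have hc : IsCompl (LinearMap.ker (s + LinearMap.id)) (LinearMap.ker (s - LinearMap.id)) := by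
    rw [isCompl_iff, Submodule.disjoint_def, Submodule.codisjoint_iff_exists_add_eq]
    refine ⟨fun x h1 h2 => ?_, fun z => ⟨(1 / 2 : ℝ) • (z - s z), (1 / 2 : ℝ) • (z + s z), ?_, ?_,
      by module⟩⟩
    · rw [LinearMap.mem_ker, LinearMap.add_apply, LinearMap.id_apply] at h1
      rw [LinearMap.mem_ker, LinearMap.sub_apply, LinearMap.id_apply] at h2
      have : (2 : ℝ) • x = 0 := by
        rw [two_smul]
        calc x + x = (s x + x) - (s x - x) := by abel
          _ = 0 := by rw [h1, h2, sub_zero]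
      exact (smul_eq_zero.1 this).resolve_left two_ne_zero
    · simp [hs]
    · simp [hs, add_comm]
  let e := Submodule.prodEquivOfIsCompl _ _ hc
  have h : s = e.conj (LinearMap.prodMap (-LinearMap.id) LinearMap.id) := by
    refine LinearMap.ext fun v => ?_
    obtain ⟨⟨⟨x, hx⟩, ⟨y, hy⟩⟩, rfl⟩ := e.surjective v
    rw [LinearEquiv.conj_apply_apply, LinearEquiv.symm_apply_apply]
    rw [LinearMap.mem_ker, LinearMap.add_apply, LinearMap.id_apply] at hx
    rw [LinearMap.mem_ker, LinearMap.sub_apply, LinearMap.id_apply, sub_eq_zero] at hy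
    simp only [e, Submodule.coe_prodEquivOfIsCompl', LinearMap.prodMap_apply, LinearMap.neg_apply,
      LinearMap.id_apply, Submodule.coe_neg, map_add]
    rw [hy, add_eq_zero_iff_eq_neg.1 hx]
  conv_lhs => rw [h]
  rw [LinearEquiv.conj_apply]
  have := LinearMap.det_conj
    (LinearMap.prodMap (-LinearMap.id : _ →ₗ[ℝ] LinearMap.ker (s + LinearMap.id))
      (LinearMap.id : _ →ₗ[ℝ] LinearMap.ker (s - LinearMap.id))) e
  rw [LinearMap.comp_assoc, this, LinearMap.det_prodMap, LinearMap.det_id, mul_one,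
    show (-LinearMap.id : _ →ₗ[ℝ] LinearMap.ker (s + LinearMap.id)) =
      (-1 : ℝ) • LinearMap.id from (neg_one_smul ℝ _).symm, LinearMap.det_smul, LinearMap.det_id, mul_one]

/-- The automorphisms of positive determinant of a real vector space are joined to the identity. -/
theorem joined_refl_of_det_pos (hσ : ∀ k, σ k = 1) (f : σ.Equiv σ)
    (hf : 0 < LinearMap.det f.toLinearMap) : Joined f (Representation.Equiv.refl σ) := by
  obtain ⟨s, hfs, hs⟩ := exists_joined_involution f
  have hds : 0 < LinearMap.det s.toLinearMap :=
    (mul_pos_iff_of_pos_left hf).1 (det_mul_det_pos_of_joined hfs)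
  rw [det_involution s.toLinearMap hs] at hds
  -- The determinant of an involution is the parity of its negative eigenspace, so that space is
  -- even-dimensional and carries a complex structure.
  have heven : Even (finrank ℝ (negEigenspace s).toSubmodule) := by
    by_contra hodd
    rw [Nat.not_even_iff_odd] at hodd
    have : (-1 : ℝ) ^ finrank ℝ (negEigenspace s).toSubmodule = -1 := hodd.neg_one_pow
    have h2 : (0 : ℝ) < (-1) ^ finrank ℝ (negEigenspace s).toSubmodule := hds
    linarith
  obtain ⟨J, hJ⟩ := exists_complexStructure_of_even heven
  refine hfs.trans (joined_refl_of_complexStructure s hs (negEigenspace s) (mem_negEigenspace s)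
    ⟨J, fun k => LinearMap.ext fun v => ?_⟩ hJ)
  have h1 : ∀ v, (negEigenspace s).toRepresentation k v = v := fun v => Subtype.ext (by
    change σ k v = v
    rw [hσ]
    rfl)
  rw [LinearMap.comp_apply, LinearMap.comp_apply, h1, h1]

end Det

section MatAct

variable {U : Type*} [AddCommGroup U] [Module ℝ U] {ι κ μ : Type*} [Fintype ι]

/-- The tensor product of a matrix and an endomorphism. -/
def matAct (M : Matrix κ ι ℝ) (γ : U →ₗ[ℝ] U) : (ι → U) →ₗ[ℝ] (κ → U) :=
  LinearMap.pi fun i => ∑ j, M i j • γ.comp (LinearMap.proj j)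

lemma matAct_apply (M : Matrix κ ι ℝ) (γ : U →ₗ[ℝ] U) (u : ι → U) (i : κ) :
    matAct M γ u i = ∑ j, M i j • γ (u j) := by
  rw [matAct, LinearMap.pi_apply, LinearMap.sum_apply]
  rfl

lemma matAct_matAct [Fintype κ] (M : Matrix μ κ ℝ) (N : Matrix κ ι ℝ) (γ δ : U →ₗ[ℝ] U) (u : ι → U) :
    matAct M γ (matAct N δ u) = matAct (M * N) (γ.comp δ) u := by
  funext i
  simp only [matAct_apply, map_sum, map_smul, Finset.smul_sum, smul_smul, Matrix.mul_apply,
    Finset.sum_smul, LinearMap.comp_apply]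
  exact Finset.sum_comm

lemma matAct_one [DecidableEq ι] (γ : U →ₗ[ℝ] U) (u : ι → U) (i : ι) :
    matAct (1 : Matrix ι ι ℝ) γ u i = γ (u i) := by
  rw [matAct_apply, Finset.sum_eq_single i]
  · simp
  · intro j _ hj
    rw [Matrix.one_apply_ne hj.symm, zero_smul]
  · simp

lemma matAct_one_id [DecidableEq ι] (u : ι → U) :
    matAct (1 : Matrix ι ι ℝ) LinearMap.id u = u :=
  funext fun i => matAct_one _ u i

lemma matAct_injective [Nontrivial U] [DecidableEq ι] {M N : Matrix κ ι ℝ} {γ : U →ₗ[ℝ] U}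
    (hγ : Function.Injective γ) (h : ∀ u, matAct M γ u = matAct N γ u) : M = N := by
  obtain ⟨u, hu⟩ := exists_ne (0 : U)
  ext i j
  have h1 := congrFun (h (Pi.single j u)) i
  have h2 : ∀ M : Matrix κ ι ℝ, matAct M γ (Pi.single j u) i = M i j • γ u := by
    intro M
    rw [matAct_apply, Finset.sum_eq_single j]
    · simp
    · intro k _ hk
      simp [Pi.single_eq_of_ne hk]
    · simp
  rw [h2, h2, ← sub_eq_zero, ← sub_smul] at h1
  have h3 : γ u ≠ 0 := fun h0 => hu (hγ (h0.trans (map_zero γ).symm))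
  exact sub_eq_zero.1 ((smul_eq_zero.1 h1).resolve_right h3)

end MatAct

variable {K : Type*} [Group K] [TopologicalSpace K] {U : Type*} [AddCommGroup U] [Module ℝ U]
  [FiniteDimensional ℝ U] {τ : Representation ℝ K U} {ι κ : Type*} [Fintype ι] [Fintype κ]
  [DecidableEq ι] [DecidableEq κ]

lemma matAct_power (M : Matrix κ ι ℝ) {γ : U →ₗ[ℝ] U} {k l : K}
    (h : ∀ u, γ (τ k u) = τ l (γ u)) (u : ι → U) :
    matAct M γ (τ.power ι k u) = τ.power κ l (matAct M γ u) := by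
  funext i
  simp only [matAct_apply, Representation.power_apply, h, map_sum, map_smul]

/-- Twisted-equivariant maps between multiples of a module of real type are given by matrices. -/
lemma exists_matrix (hR : ∀ f : IntertwiningMap τ τ, ∃ r : ℝ, ∀ u, f u = r • u) (γ : U ≃ₗ[ℝ] U)
    {α : K → K} (hγ : ∀ k u, γ (τ k u) = τ (α k) (γ u)) (g : (ι → U) →ₗ[ℝ] (κ → U))
    (hg : ∀ k u, g (τ.power ι k u) = τ.power κ (α k) (g u)) :
    ∃ M : Matrix κ ι ℝ, ∀ u, g u = matAct M γ.toLinearMap u := by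
  have hsymm : ∀ k u, γ.symm (τ (α k) u) = τ k (γ.symm u) := fun k u => by
    rw [LinearEquiv.symm_apply_eq, hγ, LinearEquiv.apply_symm_apply]
  -- Undoing `γ` in the block `(i, j)` of `g` leaves an honest endomorphism of `τ`, which is a
  -- scalar: the entry of the matrix.
  let F : κ → ι → IntertwiningMap τ τ := fun i j =>
    ⟨γ.symm.toLinearMap.comp ((LinearMap.proj i).comp
      (g.comp (LinearMap.single ℝ (fun _ : ι => U) j))), fun k => LinearMap.ext fun u => by
      have h1 : (Pi.single j (τ k u) : ι → U) = τ.power ι k (Pi.single j u) := by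
        funext i
        rw [Representation.power_apply]
        by_cases h : i = j
        · subst h
          simp
        · simp [h]
      change γ.symm (g (Pi.single j (τ k u)) i) = τ k (γ.symm (g (Pi.single j u) i))
      rw [h1, hg, Representation.power_apply, hsymm]⟩
  choose r hr using fun i j => hR (F i j)
  refine ⟨Matrix.of r, fun u => funext fun i => ?_⟩
  rw [matAct_apply]
  conv_lhs => rw [← LinearMap.sum_single_apply (fun _ : ι => U) u]
  rw [map_sum, Finset.sum_apply]
  refine Finset.sum_congr rfl fun j _ => ?_
  have h2 : γ.symm (g (Pi.single j (u j)) i) = r i j • u j := hr i j (u j)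
  rw [LinearEquiv.symm_apply_eq] at h2
  change g (Pi.single j (u j)) i = r i j • γ (u j)
  rw [h2, map_smul]

/-- The automorphism of a multiple of a module given by an invertible matrix. -/
noncomputable def matEquiv (τ : Representation ℝ K U) (M : Matrix ι ι ℝ) (hM : IsUnit M.det) :
    (τ.power ι).Equiv (τ.power ι) :=
  Representation.Equiv.mk
    (LinearEquiv.ofLinearMap (matAct M LinearMap.id) (matAct M⁻¹ LinearMap.id)
      (LinearMap.ext fun u => by
        rw [LinearMap.comp_apply, matAct_matAct, Matrix.mul_nonsing_inv _ hM]
        exact matAct_one_id u)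
      (LinearMap.ext fun u => by
        rw [LinearMap.comp_apply, matAct_matAct, Matrix.nonsing_inv_mul _ hM]
        exact matAct_one_id u))
    fun k => LinearMap.ext fun u =>
      matAct_power M (k := k) (l := k) (γ := LinearMap.id) (fun _ => rfl) u

/-- A path to the identity among real matrices of positive determinant is carried to the module by
tensoring with the identity of `U`. -/
lemma joined_matEquiv (M : Matrix ι ι ℝ) (hM : 0 < M.det) (f : (τ.power ι).Equiv (τ.power ι))
    (hf : ∀ u, f u = matAct M LinearMap.id u) :
    Joined f (Representation.Equiv.refl (τ.power ι)) := by
  -- For the trivial group every linear automorphism is an equivalence, so paths of matrices become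
  -- paths in `σ.Equiv σ`.
  let σ : Representation ℝ Unit (ι → ℝ) := 1
  let F : σ.Equiv σ → (τ.power ι).Equiv (τ.power ι) := fun e =>
    matEquiv τ (LinearMap.toMatrix' e.toLinearMap) (by
      rw [LinearMap.det_toMatrix', isUnit_iff_ne_zero]
      exact det_ne_zero_of_injective e.toLinearEquiv.injective)
  have hF : Continuous F := by
    refine continuous_equiv_iff.2 fun u l => ?_
    have : (fun e => l (F e u)) = fun e : σ.Equiv σ =>
        ∑ i, ∑ j, e (Pi.single j 1) i * l (Pi.single i (u j)) := by
      funext e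
      conv_lhs => rw [← LinearMap.sum_single_apply (fun _ : ι => U) (F e u)]
      rw [map_sum]
      refine Finset.sum_congr rfl fun i _ => ?_
      have h1 : F e u i = ∑ j : ι, e (Pi.single j 1) i • u j := by
        change matAct _ LinearMap.id u i = _
        rw [matAct_apply]
        refine Finset.sum_congr rfl fun j _ => ?_
        rw [LinearMap.toMatrix'_apply]
        rfl
      rw [h1, ← LinearMap.single_apply (R := ℝ), map_sum, map_sum]
      refine Finset.sum_congr rfl fun j _ => ?_
      rw [map_smul, map_smul, smul_eq_mul]
      rfl
    rw [this]
    refine continuous_finsetSum _ fun i _ => continuous_finsetSum _ fun j _ => ?_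
    exact (continuous_equiv_iff.1 (continuous_id : Continuous fun e : σ.Equiv σ => e)
      (Pi.single j 1) (LinearMap.proj i)).mul continuous_const
  let e : σ.Equiv σ := Representation.Equiv.ofEnd (Matrix.toLin' M)
    (Function.LeftInverse.injective (g := Matrix.toLin' M⁻¹) fun v => by
      rw [← Matrix.toLin'_mul_apply, Matrix.nonsing_inv_mul _ (isUnit_iff_ne_zero.2 hM.ne'),
        Matrix.toLin'_one, LinearMap.id_apply])
    fun k => by rw [MonoidHom.one_apply, mul_one, one_mul]
  have he : e.toLinearMap = Matrix.toLin' M := rfl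
  have hj := (joined_refl_of_det_pos (σ := σ) (fun _ => rfl) e
    (by rw [he, LinearMap.det_toLin']; exact hM)).map hF
  have e1 : F e = f := Representation.Equiv.ext (funext fun u => by
    rw [hf]
    change matAct (LinearMap.toMatrix' e.toLinearMap) LinearMap.id u = _
    rw [he, LinearMap.toMatrix'_toLin'])
  have e2 : F (Representation.Equiv.refl σ) = Representation.Equiv.refl _ :=
    Representation.Equiv.ext (funext fun u => by
      change matAct (LinearMap.toMatrix' LinearMap.id) LinearMap.id u = u
      rw [LinearMap.toMatrix'_id, matAct_one_id])
  rwa [e1, e2] at hj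

/-- The sign of the determinant is constant along paths. -/
lemma det_mul_det_pos_of_joined_matAct [Nontrivial U]
    (hR : ∀ f : IntertwiningMap τ τ, ∃ r : ℝ, ∀ u, f u = r • u)
    {f g : (τ.power ι).Equiv (τ.power ι)} {M N : Matrix ι ι ℝ}
    (hf : ∀ u, f u = matAct M LinearMap.id u) (hg : ∀ u, g u = matAct N LinearMap.id u)
    (h : Joined f g) : 0 < M.det * N.det := by
  obtain ⟨p⟩ := h
  have hp := continuous_equiv_iff.1 p.continuous
  have hmat : ∀ e : (τ.power ι).Equiv (τ.power ι), ∃ M : Matrix ι ι ℝ, ∀ u,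
      e u = matAct M LinearMap.id u := fun e =>
    exists_matrix hR (LinearEquiv.refl ℝ U) (α := fun k => k) (fun _ _ => rfl) e.toLinearMap
      fun k u => IntertwiningMap.isIntertwining _ _ e.toIntertwiningMap k u
  choose m hm using fun t => hmat (p t)
  obtain ⟨u, hu⟩ := exists_ne (0 : U)
  obtain ⟨l, hl⟩ : ∃ l : Dual ℝ U, l u ≠ 0 := by
    by_contra! hc
    exact hu ((forall_dual_apply_eq_zero_iff ℝ u).1 hc)
  -- Matrix entries are recovered from one vector `u` and a form not vanishing on it; this makes the
  -- chosen matrices continuous in `t`.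
  have hent : ∀ t i j, m t i j = l (p t (Pi.single j u) i) * (l u)⁻¹ := by
    intro t i j
    rw [hm, matAct_apply, Finset.sum_eq_single j]
    · simp [hl]
    · intro k _ hk
      simp [Pi.single_eq_of_ne hk]
    · simp
  have hcont : Continuous fun t => (m t).det := by
    refine Continuous.matrix_det (continuous_matrix fun i j => ?_)
    simp only [hent]
    exact (hp (Pi.single j u) (l.comp (LinearMap.proj i))).mul continuous_const
  have hunit : ∀ t, (m t).det ≠ 0 := by
    intro t
    obtain ⟨m', hm'⟩ := hmat (p t).symm
    have : m' * m t = 1 := by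
      refine matAct_injective (U := U) (γ := LinearMap.id) Function.injective_id fun w => ?_
      have := matAct_matAct m' (m t) (LinearMap.id : U →ₗ[ℝ] U) LinearMap.id w
      rw [LinearMap.comp_id] at this
      rw [← this, ← hm, ← hm', (p t).symm_apply_apply, matAct_one_id]
    intro h0
    have := congrArg Matrix.det this
    rw [Matrix.det_mul, h0, mul_zero, Matrix.det_one] at this
    exact zero_ne_one this
  have := mul_pos_of_nonvanishing hcont hunit
  have h0 : m 0 = M := matAct_injective (U := U) (γ := LinearMap.id) Function.injective_id
    fun w => by rw [← hm, ← hf, p.source]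
  have h1 : m 1 = N := matAct_injective (U := U) (γ := LinearMap.id) Function.injective_id
    fun w => by rw [← hm, ← hg, p.target]
  simpa only [h0, h1] using this

end RealType

/-! ### Frames, transition maps and isomorphisms of bundles -/

section Frames

set_option linter.unusedSectionVars false

open Module Topology

/-- Projection along a compact factor is closed. This replaces continuous choices of presentations
`z = g • c t`, which need not exist: continuity can be tested on all presentations at once. -/
theorem isQuotientMap_snd_of_isClosed {X E : Type*} [TopologicalSpace X] [TopologicalSpace E]
    [CompactSpace X] {r : Set (X × E)} (hr : IsClosed r) (hs : ∀ e, ∃ x, (x, e) ∈ r) :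
    IsQuotientMap (fun y : r => y.1.2) := by
  refine IsClosedMap.isQuotientMap ?_ (by fun_prop) fun e => ?_
  · exact isClosedMap_snd_of_compactSpace.comp hr.isClosedEmbedding_subtypeVal.isClosedMap
  · obtain ⟨x, hx⟩ := hs e
    exact ⟨⟨(x, e), hx⟩, rfl⟩

/-- Inversion is continuous on invertible operators, and in finite dimension pointwise continuity of
a family is continuity in the operator norm. -/
theorem LinearEquiv.continuous_family_symm {X W W' : Type*} [TopologicalSpace X]
    [NormedAddCommGroup W] [NormedSpace ℝ W] [FiniteDimensional ℝ W]
    [NormedAddCommGroup W'] [NormedSpace ℝ W']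
    {m : X → (W ≃ₗ[ℝ] W')} (hm : ∀ w, Continuous fun x => m x w) {v : X → W'}
    (hv : Continuous v) : Continuous fun x => (m x).symm (v x) := by
  rw [continuous_iff_continuousAt]
  intro x₀
  have : FiniteDimensional ℝ W' := (m x₀).finiteDimensional
  have : CompleteSpace W := FiniteDimensional.complete ℝ W
  let M : X → (W →L[ℝ] W') := fun x => (m x).toContinuousLinearEquiv
  have hM : Continuous M := continuous_clm_apply.2 hm
  have h₁ : ContinuousAt ContinuousLinearMap.inverse (M x₀) :=
    (contDiffAt_map_inverse (𝕜 := ℝ) (n := 0) (m x₀).toContinuousLinearEquiv).continuousAt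
  have h₂ : ContinuousAt (fun x => ContinuousLinearMap.inverse (M x)) x₀ :=
    ContinuousAt.comp (f := M) h₁ hM.continuousAt
  have h₃ := h₂.clm_apply hv.continuousAt
  refine h₃.congr (Filter.Eventually.of_forall fun x => ?_)
  change ContinuousLinearMap.inverse ((m x).toContinuousLinearEquiv : W →L[ℝ] W') (v x) = _
  rw [ContinuousLinearMap.inverse_equiv]
  rfl

theorem LinearEquiv.continuous_family_apply {X W W' : Type*} [TopologicalSpace X]
    [NormedAddCommGroup W] [NormedSpace ℝ W] [FiniteDimensional ℝ W]
    [NormedAddCommGroup W'] [NormedSpace ℝ W']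
    {m : X → (W →ₗ[ℝ] W')} (hm : ∀ w, Continuous fun x => m x w) {v : X → W}
    (hv : Continuous v) : Continuous fun x => m x (v x) := by
  let M : X → (W →L[ℝ] W') := fun x => (m x).toContinuousLinearMap
  have hM : Continuous M := continuous_clm_apply.2 hm
  exact hM.clm_apply hv

namespace GVectorBundle

variable {G : Type*} [Group G] [TopologicalSpace G]
  {B : Type*} [TopologicalSpace B] [MulAction G B]

instance (A : GVectorBundle G B) (z : B) : FiniteDimensional ℝ (A.E z) :=
  Module.Finite.equiv ((trivializationAt A.F A.E z).continuousLinearEquivAt ℝ z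
    (FiberBundle.mem_baseSet_trivializationAt A.F A.E z)).symm.toLinearEquiv

variable (A : GVectorBundle G B)

theorem mk_act {g : G} {z w : B} (h : g • z = w) (v : A.E z) :
    (⟨w, A.act g h v⟩ : A.Total) = ⟨g • z, A.act g rfl v⟩ := by
  subst h
  rfl

theorem act_inv_act {g : G} {z w : B} (h : g • z = w) (h' : g⁻¹ • w = z) (v : A.E z) :
    A.act g⁻¹ h' (A.act g h v) = v := by
  rw [← A.act_mul g⁻¹ g h h' (by rw [inv_mul_cancel, one_smul])]
  have := A.act_one (one_smul G z) v
  convert this using 3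
  exact inv_mul_cancel g

theorem act_act_inv {g : G} {z w : B} (h : g • z = w) (h' : g⁻¹ • w = z) (v : A.E w) :
    A.act g h (A.act g⁻¹ h' v) = v := by
  rw [← A.act_mul g g⁻¹ h' h (by rw [mul_inv_cancel, one_smul])]
  have := A.act_one (one_smul G w) v
  convert this using 3
  exact mul_inv_cancel g

/-- The action of `g` as a linear equivalence of fibers. -/
def actEquiv (g : G) {z w : B} (h : g • z = w) : A.E z ≃ₗ[ℝ] A.E w :=
  LinearEquiv.ofLinearMap (A.act g h) (A.act g⁻¹ (by rw [← h, inv_smul_smul]))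
    (LinearMap.ext fun v => A.act_act_inv h _ v) (LinearMap.ext fun v => A.act_inv_act h _ v)

@[simp] theorem actEquiv_apply (g : G) {z w : B} (h : g • z = w) (v : A.E z) :
    A.actEquiv g h v = A.act g h v := rfl

theorem continuous_act_comp {Y : Type*} [TopologicalSpace Y] {g : Y → G} (hg : Continuous g)
    {z w : Y → B} {v : ∀ y, A.E (z y)} (hv : Continuous fun y => (⟨z y, v y⟩ : A.Total))
    (h : ∀ y, g y • z y = w y) :
    Continuous fun y => (⟨w y, A.act (g y) (h y) (v y)⟩ : A.Total) := by
  have := A.continuous_act.comp (hg.prodMk hv)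
  refine this.congr fun y => ?_
  exact (A.mk_act (h y) (v y)).symm

/-- A frame of `A` along `c`: a continuous trivialization of the pullback of `A` along `c`. -/
structure Frame {T : Type*} [TopologicalSpace T] (c : T → B) (W : Type*)
    [NormedAddCommGroup W] [NormedSpace ℝ W] where
  map : ∀ t, W ≃ₗ[ℝ] A.E (c t)
  continuous_map : Continuous fun p : T × W => (⟨c p.1, map p.1 p.2⟩ : A.Total)

namespace Frame

variable {A} {T : Type*} [TopologicalSpace T] {c : T → B}
  {W : Type*} [NormedAddCommGroup W] [NormedSpace ℝ W]
  (φ : A.Frame c W)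

/-- The transition map of a frame along `k : c t → c s`. -/
def trans (k : G) {s t : T} (h : k • c t = c s) : W ≃ₗ[ℝ] W :=
  ((φ.map t).trans (A.actEquiv k h)).trans (φ.map s).symm

theorem map_trans (k : G) {s t : T} (h : k • c t = c s) (w : W) :
    φ.map s (φ.trans k h w) = A.act k h (φ.map t w) := by
  simp [trans]

theorem trans_apply (k : G) {s t : T} (h : k • c t = c s) (w : W) :
    φ.trans k h w = (φ.map s).symm (A.act k h (φ.map t w)) := rfl

theorem trans_one {t : T} (h : (1 : G) • c t = c t) (w : W) : φ.trans 1 h w = w := by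
  rw [trans_apply, A.act_one, LinearEquiv.symm_apply_apply]

theorem trans_mul {k l : G} {r s t : T} (hl : l • c t = c s) (hk : k • c s = c r)
    (h : (k * l) • c t = c r) (w : W) :
    φ.trans (k * l) h w = φ.trans k hk (φ.trans l hl w) := by
  rw [trans_apply, trans_apply, map_trans, A.act_mul k l hl hk h]

variable [FiniteDimensional ℝ W]

/-- In a local trivialization the frame becomes a continuous family of isomorphisms between fixed
spaces, whose inverses depend continuously on the parameter. -/
theorem continuous_symm {Y : Type*} [TopologicalSpace Y] {f : Y → T} (hf : Continuous f)
    {v : ∀ y, A.E (c (f y))} (hv : Continuous fun y => (⟨c (f y), v y⟩ : A.Total)) :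
    Continuous fun y => (φ.map (f y)).symm (v y) := by
  rw [continuous_iff_continuousAt]
  intro y₀
  let e := trivializationAt A.F A.E (c (f y₀))
  have hc : Continuous fun y => c (f y) :=
    (FiberBundle.continuous_proj A.F A.E).comp hv
  have hO : IsOpen {y | c (f y) ∈ e.baseSet} := e.open_baseSet.preimage hc
  have hy₀ : y₀ ∈ {y | c (f y) ∈ e.baseSet} :=
    FiberBundle.mem_baseSet_trivializationAt A.F A.E _
  suffices h : ContinuousOn (fun y => (φ.map (f y)).symm (v y)) {y | c (f y) ∈ e.baseSet} from
    h.continuousAt (hO.mem_nhds hy₀)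
  rw [continuousOn_iff_continuous_domRestrict]
  have key : ∀ {u : ∀ y, A.E (c (f y))}, Continuous (fun y => (⟨c (f y), u y⟩ : A.Total)) →
      Continuous fun y : {y | c (f y) ∈ e.baseSet} =>
        e.linearEquivAt ℝ (c (f y)) y.2 (u y) := by
    intro u hu
    have h₁ : Continuous fun y : {y | c (f y) ∈ e.baseSet} =>
        e (⟨c (f y), u y⟩ : A.Total) := by
      refine e.continuousOn.comp_continuous (hu.comp continuous_subtype_val) fun y => ?_
      exact e.mem_source.2 y.2
    exact continuous_snd.comp h₁
  have h₂ := LinearEquiv.continuous_family_symm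
    (m := fun y : {y | c (f y) ∈ e.baseSet} =>
      (φ.map (f y)).trans (e.linearEquivAt ℝ (c (f y)) y.2))
    (fun w => key (φ.continuous_map.comp (hf.prodMk continuous_const)))
    (key hv)
  refine h₂.congr fun y => ?_
  change ((φ.map (f y)).trans (e.linearEquivAt ℝ (c (f y)) y.2)).symm
    (e.linearEquivAt ℝ (c (f y)) y.2 (v y)) = (φ.map (f y)).symm (v y)
  rw [LinearEquiv.symm_apply_eq, LinearEquiv.trans_apply, LinearEquiv.apply_symm_apply]

/-- Translates of frame vectors. -/
def point (x : G × T × W) : A.Total := ⟨x.1 • c x.2.1, A.act x.1 rfl (φ.map x.2.1 x.2.2)⟩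

theorem continuous_point : Continuous φ.point :=
  A.continuous_act.comp (continuous_fst.prodMk (φ.continuous_map.comp continuous_snd))

/-- Translates of frame vectors fill the total space, and its topology is the quotient topology they
define. Hence a map out of a bundle is continuous as soon as it is so on translates of frame
vectors. -/
theorem isQuotientMap_point [IsTopologicalGroup G] [CompactSpace G] [CompactSpace T] [T2Space B]
    [ContinuousSMul G B] (hc : Continuous c) (hcov : ∀ z, ∃ (g : G) (t : T), g • c t = z) :
    IsQuotientMap φ.point := by
  let r : Set ((G × T) × A.Total) := {y | y.2.proj = y.1.1 • c y.1.2}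
  have hr : IsClosed r := isClosed_eq ((FiberBundle.continuous_proj A.F A.E).comp continuous_snd)
    (by fun_prop)
  have hq := isQuotientMap_snd_of_isClosed hr fun e => by
    obtain ⟨g, t, h⟩ := hcov e.proj
    exact ⟨(g, t), h.symm⟩
  let p : r → G × T × W := fun y => (y.1.1.1, y.1.1.2, (φ.map y.1.1.2).symm
    (A.act y.1.1.1⁻¹ (by rw [y.2, inv_smul_smul]) y.1.2.snd))
  have hp : Continuous p := by
    refine Continuous.prodMk (by fun_prop) (Continuous.prodMk (by fun_prop) ?_)
    refine φ.continuous_symm (by fun_prop) ?_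
    exact A.continuous_act_comp (by fun_prop) (z := fun y : r => y.1.2.proj)
      (v := fun y : r => y.1.2.snd) (continuous_snd.comp continuous_subtype_val) _
  refine IsQuotientMap.of_comp hp φ.continuous_point ?_
  convert hq using 1
  funext y
  obtain ⟨⟨⟨g, t⟩, ⟨z, v⟩⟩, hy⟩ := y
  change z = g • c t at hy
  subst hy
  simp only [Function.comp, point, p]
  congr 1
  rw [LinearEquiv.apply_symm_apply]
  exact A.act_act_inv _ _ _

end Frame

section Iso

variable {A} {A' : GVectorBundle G B} {T : Type*} [TopologicalSpace T] {c : T → B}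
  {W : Type*} [NormedAddCommGroup W] [NormedSpace ℝ W] [FiniteDimensional ℝ W]

theorem continuous_of_map_act [IsTopologicalGroup G] [CompactSpace G] [CompactSpace T]
    [T2Space B] [ContinuousSMul G B] (hc : Continuous c)
    (hcov : ∀ z, ∃ (g : G) (t : T), g • c t = z) (φ : A.Frame c W) (φ' : A'.Frame c W)
    (f : ∀ z, A.E z ≃ₗ[ℝ] A'.E z) (hf : ∀ (k : G) (s : T) {z} (e : k • c s = z) (w : W),
      f z (A.act k e (φ.map s w)) = A'.act k e (φ'.map s w)) :
    Continuous fun p : A.Total => (⟨p.proj, f p.proj p.snd⟩ : A'.Total) := by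
  rw [(φ.isQuotientMap_point hc hcov).continuous_iff]
  refine φ'.continuous_point.congr fun x => ?_
  exact congrArg (fun v => (⟨_, v⟩ : A'.Total)) (hf x.1 x.2.1 rfl x.2.2).symm

/-- Over `g • c t` the map is forced to send translated frame vectors to translated frame vectors.
Another presentation of the same point differs by a transition map, and equality of transition maps
makes the result independent of it. -/
theorem exists_map_act_of_trans_eq (hcov : ∀ z, ∃ (g : G) (t : T), g • c t = z)
    (φ : A.Frame c W) (φ' : A'.Frame c W)
    (h : ∀ (k : G) (s t : T) (h : k • c t = c s) (w : W), φ.trans k h w = φ'.trans k h w) :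
    ∃ f : ∀ z, A.E z ≃ₗ[ℝ] A'.E z, ∀ (k : G) (s : T) {z} (e : k • c s = z) (w : W),
      f z (A.act k e (φ.map s w)) = A'.act k e (φ'.map s w) := by
  choose g t hgt using hcov
  let m : ∀ z, A.E z ≃ₗ[ℝ] A'.E z := fun z =>
    (((A.actEquiv (g z) (hgt z)).symm.trans (φ.map (t z)).symm).trans (φ'.map (t z))).trans
      (A'.actEquiv (g z) (hgt z))
  refine ⟨m, fun k s z e w => ?_⟩
  have e' : ((g z)⁻¹ * k) • c s = c (t z) := by
    rw [mul_smul, e, inv_smul_eq_iff, hgt]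
  have h₁ := h _ _ _ e' w
  have h₂ := φ'.map_trans _ e' w
  have aux : ∀ (C : GVectorBundle G B) (v : C.E (c s)),
      (C.actEquiv (g z) (hgt z)).symm (C.act k e v) = C.act ((g z)⁻¹ * k) e' v := by
    intro C v
    rw [LinearEquiv.symm_apply_eq, actEquiv_apply, ← C.act_mul _ _ e' (hgt z)
      (by rw [mul_inv_cancel_left, e])]
    congr 2
    rw [mul_inv_cancel_left]
  have h₃ : m z (A.act k e (φ.map s w)) =
      A'.actEquiv (g z) (hgt z) (φ'.map (t z) ((φ.map (t z)).symm
        ((A.actEquiv (g z) (hgt z)).symm (A.act k e (φ.map s w))))) := rfl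
  rw [h₃, aux, ← φ.trans_apply, h₁, h₂, ← aux, LinearEquiv.apply_symm_apply]

theorem exists_eq_act_map (hcov : ∀ z, ∃ (g : G) (t : T), g • c t = z) (φ : A.Frame c W) {z : B}
    (v : A.E z) : ∃ (g : G) (t : T) (h : g • c t = z) (w : W), v = A.act g h (φ.map t w) := by
  obtain ⟨g, t, h⟩ := hcov z
  refine ⟨g, t, h, (φ.map t).symm ((A.actEquiv g h).symm v), ?_⟩
  rw [LinearEquiv.apply_symm_apply, ← actEquiv_apply, LinearEquiv.apply_symm_apply]

/-- Two bundles with frames that have the same transition maps are isomorphic. -/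
theorem nonempty_iso_of_trans_eq [IsTopologicalGroup G] [CompactSpace G] [CompactSpace T]
    [T2Space B] [ContinuousSMul G B] (hc : Continuous c)
    (hcov : ∀ z, ∃ (g : G) (t : T), g • c t = z) (φ : A.Frame c W) (φ' : A'.Frame c W)
    (h : ∀ (k : G) (s t : T) (h : k • c t = c s) (w : W), φ.trans k h w = φ'.trans k h w) :
    Nonempty (Iso A A') := by
  obtain ⟨f, hf⟩ := exists_map_act_of_trans_eq hcov φ φ' h
  refine ⟨⟨f, fun g z w e v => ?_, continuous_of_map_act hc hcov φ φ' f hf,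
    continuous_of_map_act hc hcov φ' φ (fun z => (f z).symm) fun k s z e w => ?_⟩⟩
  · obtain ⟨k, t, rfl, u, rfl⟩ := exists_eq_act_map hcov φ v
    rw [← A.act_mul g k rfl e (by rw [mul_smul, e]), hf, hf,
      A'.act_mul g k rfl e (by rw [mul_smul, e])]
  · rw [LinearEquiv.symm_apply_eq, hf]

end Iso

namespace Frame

variable {A} {A' C : GVectorBundle G B} {T : Type*} [TopologicalSpace T] {c : T → B}
  {W W' : Type*} [NormedAddCommGroup W] [NormedSpace ℝ W]
  [NormedAddCommGroup W'] [NormedSpace ℝ W']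

/-- Transport of a frame along an isomorphism. -/
def ofIso (φ : A.Frame c W) (f : Iso A A') : A'.Frame c W where
  map t := (φ.map t).trans (f.map (c t))
  continuous_map := f.continuous_map.comp φ.continuous_map

/-- The frame of a Whitney sum. -/
def sum (φ : A.Frame c W) (φ' : A'.Frame c W') : (A.sum A').Frame c (W × W') where
  map t := LinearEquiv.prodCongr (φ.map t) (φ'.map t)
  continuous_map := continuous_sum_iff.2
    ⟨φ.continuous_map.comp (continuous_fst.prodMk (continuous_fst.comp continuous_snd)),
      φ'.continuous_map.comp (continuous_fst.prodMk (continuous_snd.comp continuous_snd))⟩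

/-- Change of a frame by a continuous family of automorphisms of the model. -/
def change (φ : A.Frame c W) (a : T → (W' ≃ₗ[ℝ] W))
    (ha : Continuous fun p : T × W' => a p.1 p.2) : A.Frame c W' where
  map t := (a t).trans (φ.map t)
  continuous_map := φ.continuous_map.comp (continuous_fst.prodMk ha)

theorem change_trans (φ : A.Frame c W) (a : T → (W' ≃ₗ[ℝ] W))
    (ha : Continuous fun p : T × W' => a p.1 p.2) (k : G) {s t : T} (h : k • c t = c s) (w : W') :
    (φ.change a ha).trans k h w = (a s).symm (φ.trans k h (a t w)) := rfl

theorem symm_act_map (φ : A.Frame c W) {g : G} (k : G) {s t : T} (e : k • c s = g • c t)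
    (e' : (g⁻¹ * k) • c s = c t) (w : W) :
    (φ.map t).symm ((A.actEquiv g rfl).symm (A.act k e (φ.map s w))) = φ.trans (g⁻¹ * k) e' w := by
  rw [trans_apply, LinearEquiv.symm_apply_eq, LinearEquiv.apply_symm_apply,
    LinearEquiv.symm_apply_eq, actEquiv_apply, ← A.act_mul _ _ e' rfl
    (by rw [mul_inv_cancel_left, e])]
  congr 2
  rw [mul_inv_cancel_left]

/-- A linear family that multiplies transition maps by those of a line bundle frame exhibits a
tensor product. -/
theorem isTensor [FiniteDimensional ℝ W] [IsTopologicalGroup G] [CompactSpace G] [CompactSpace T]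
    [T2Space B] [ContinuousSMul G B] (hc : Continuous c)
    (hcov : ∀ z, ∃ (g : G) (t : T), g • c t = z)
    (φ : A.Frame c W) (l : A'.Frame c ℝ) (ψ : C.Frame c W)
    (h : ∀ (k : G) (s t : T) (h : k • c t = c s) (w : W),
      ψ.trans k h w = l.trans k h 1 • φ.trans k h w) : A.IsTensor A' C := by
  have hl : ∀ (k : G) (s t : T) (h : k • c t = c s) (x : ℝ), l.trans k h x = x * l.trans k h 1 := by
    intro k s t h x
    conv_lhs => rw [show x = x • (1 : ℝ) by simp, map_smul, smul_eq_mul]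
  have hb : ∀ z, ∃ b : A.E z →ₗ[ℝ] A'.E z →ₗ[ℝ] C.E z,
      (∀ (k : G) (s : T) (e : k • c s = z) (w : W) (x : ℝ),
        b (A.act k e (φ.map s w)) (A'.act k e (l.map s x)) = C.act k e (ψ.map s (x • w))) ∧
      IsTensorProduct b := by
    intro z
    -- The product is written in the coordinates of one presentation of the point; the hypothesis on
    -- transition maps makes its formula the same for all presentations.
    obtain ⟨g, t, rfl⟩ := hcov z
    let a : A.E (g • c t) ≃ₗ[ℝ] W := (A.actEquiv g rfl).symm.trans (φ.map t).symm
    let a' : A'.E (g • c t) ≃ₗ[ℝ] ℝ := (A'.actEquiv g rfl).symm.trans (l.map t).symm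
    let a'' : C.E (g • c t) ≃ₗ[ℝ] W := (C.actEquiv g rfl).symm.trans (ψ.map t).symm
    let b : A.E (g • c t) →ₗ[ℝ] A'.E (g • c t) →ₗ[ℝ] C.E (g • c t) :=
      LinearMap.mk₂ ℝ (fun v y => a''.symm (a' y • a v))
        (fun v v' y => by simp) (fun r v y => by
          rw [← map_smul a''.symm, map_smul a, smul_comm])
        (fun v y y' => by simp [add_smul]) (fun r v y => by
          rw [← map_smul a''.symm, map_smul a', smul_assoc])
    refine ⟨b, fun k s e w x => ?_, ?_⟩
    · have e' : (g⁻¹ * k) • c s = c t := by rw [mul_smul, e, inv_smul_smul]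
      change a''.symm (((l.map t).symm ((A'.actEquiv g rfl).symm (A'.act k e (l.map s x)))) •
        ((φ.map t).symm ((A.actEquiv g rfl).symm (A.act k e (φ.map s w))))) = _
      rw [φ.symm_act_map k e e', l.symm_act_map k e e', LinearEquiv.symm_apply_eq]
      change _ = (ψ.map t).symm ((C.actEquiv g rfl).symm (C.act k e (ψ.map s (x • w))))
      rw [ψ.symm_act_map k e e', h, hl, map_smul, smul_smul, mul_comm]
    · have : (TensorProduct.lift b : _ → _) = ((TensorProduct.congr a a').trans
          (TensorProduct.rid ℝ W)).trans a''.symm := by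
        rw [← LinearEquiv.coe_toLinearMap]
        congr 1
        refine TensorProduct.ext' fun v y => ?_
        simp [b]
      rw [IsTensorProduct, this]
      exact LinearEquiv.bijective _
  choose b hb hb' using hb
  have hbt : ∀ {z : B} (k : G) (s : T) (e : k • c s = z) (v : A.E (c s)) (v' : A'.E (c s)),
      b z (A.act k e v) (A'.act k e v') =
        C.act k e (ψ.map s ((l.map s).symm v' • (φ.map s).symm v)) := by
    intro z k s e v v'
    rw [← hb, LinearEquiv.apply_symm_apply, LinearEquiv.apply_symm_apply]
  refine ⟨b, hb', fun g z w e v v' => ?_, ?_⟩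
  · obtain ⟨k, t, rfl⟩ := hcov z
    obtain ⟨v, rfl⟩ := (A.actEquiv k (z := c t) rfl).surjective v
    obtain ⟨v', rfl⟩ := (A'.actEquiv k (z := c t) rfl).surjective v'
    simp only [actEquiv_apply]
    have e' : (g * k) • c t = w := by rw [mul_smul, e]
    rw [← A.act_mul g k rfl e e', ← A'.act_mul g k rfl e e', hbt, hbt, C.act_mul g k rfl e e']
  -- Continuity is tested on translates of frame vectors of the Whitney sum, where the pairing is
  -- scalar multiplication.
  · have hq := (φ.sum l).isQuotientMap_point hc hcov
    refine hq.continuous_iff.2 ?_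
    have hψ : Continuous fun x : G × T × (W × ℝ) => ψ.point (x.1, x.2.1, x.2.2.2 • x.2.2.1) :=
      ψ.continuous_point.comp (by fun_prop)
    refine hψ.congr fun x => ?_
    exact congrArg (fun v => (⟨_, v⟩ : C.Total)) (hb _ x.1 x.2.1 rfl x.2.2.1 x.2.2.2).symm

end Frame

end GVectorBundle

end Frames

/-! ### Construction of bundles from transition maps -/

section Realization

set_option linter.unusedSectionVars false

open Module Topology

/-- A cocycle of coordinate changes, covering the action of `G` on `B`. -/
structure EquivariantCocycle (G : Type*) [Group G] [TopologicalSpace G]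
    (B : Type*) [TopologicalSpace B] [MulAction G B]
    (W : Type) [NormedAddCommGroup W] [NormedSpace ℝ W] (J : Type*) where
  U : J → Set B
  isOpen_U : ∀ j, IsOpen (U j)
  idx : B → J
  mem_idx : ∀ z, z ∈ U (idx z)
  -- `tr i j g z` is the action of `g` from the fiber at `z`, read in chart `i`, to the fiber at `g
  -- • z`, read in chart `j`; for `g = 1` these are the usual coordinate changes.
  tr : J → J → G → B → (W →L[ℝ] W)
  tr_one : ∀ {i z}, z ∈ U i → ∀ v, tr i i 1 z v = v
  tr_mul : ∀ {i j k x y z}, z ∈ U i → x • z ∈ U j → (y * x) • z ∈ U k → ∀ v,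
    tr j k y (x • z) (tr i j x z v) = tr i k (y * x) z v
  continuousOn_tr : ∀ i j, ContinuousOn (fun p : G × B => tr i j p.1 p.2)
    {p | p.2 ∈ U i ∧ p.1 • p.2 ∈ U j}

namespace EquivariantCocycle

variable {G : Type*} [Group G] [TopologicalSpace G]
  {B : Type*} [TopologicalSpace B] [MulAction G B] [ContinuousSMul G B]
  {W : Type} [NormedAddCommGroup W] [NormedSpace ℝ W] [FiniteDimensional ℝ W] {J : Type*}
  (Z : EquivariantCocycle G B W J)

/-- The underlying vector bundle core. -/
def core : VectorBundleCore ℝ B W J where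
  baseSet := Z.U
  isOpen_baseSet := Z.isOpen_U
  indexAt := Z.idx
  mem_baseSet_at := Z.mem_idx
  coordChange i j z := Z.tr i j 1 z
  coordChange_self _ _ hz v := Z.tr_one hz v
  continuousOn_coordChange i j :=
    (Z.continuousOn_tr i j).comp (f := fun z => ((1 : G), z)) (by fun_prop)
      fun z hz => ⟨hz.1, by simpa using hz.2⟩
  coordChange_comp i j k z hz v := by
    have := Z.tr_mul (x := 1) (y := 1) hz.1.1 (by simpa using hz.1.2) (by simpa using hz.2) v
    simpa using this

theorem act_aux {i j k : J} {x : G} {z : B} (hi : z ∈ Z.U i) (hj : z ∈ Z.U j)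
    (hk : x • z ∈ Z.U k) (v : W) : Z.tr j k x z (Z.tr i j 1 z v) = Z.tr i k x z v := by
  have := Z.tr_mul (x := 1) (y := x) hi (by simpa using hj) (by simpa using hk) v
  simpa using this

theorem act_aux' {i j k : J} {x : G} {z : B} (hi : z ∈ Z.U i) (hj : x • z ∈ Z.U j)
    (hk : x • z ∈ Z.U k) (v : W) :
    Z.tr j k 1 (x • z) (Z.tr i j x z v) = Z.tr i k x z v := by
  have := Z.tr_mul (x := x) (y := 1) hi (by simpa using hj) (by simpa using hk) v
  simpa using this

/-- The `G`-vector bundle of a cocycle. -/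
noncomputable def bundle : GVectorBundle G B where
  F := W
  E := Z.core.Fiber
  act g z w _ := (Z.tr (Z.idx z) (Z.idx w) g z : W →ₗ[ℝ] W)
  act_one _ v := Z.tr_one (Z.mem_idx _) v
  act_mul g g' z w x h' h hh v := by
    subst h'
    subst h
    exact (Z.tr_mul (Z.mem_idx _) (Z.mem_idx _) (by rw [mul_smul]; exact Z.mem_idx _) v).symm
  continuous_act := by
    rw [continuous_iff_continuousAt]
    rintro ⟨g₀, p₀⟩
    have hproj : Continuous (TotalSpace.proj : Z.core.TotalSpace → B) := Z.core.continuous_proj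
    rw [FiberBundle.continuousAt_totalSpace]
    refine ⟨(continuous_fst.smul (hproj.comp continuous_snd)).continuousAt, ?_⟩
    set i := Z.idx p₀.proj
    set j := Z.idx (g₀ • p₀.proj)
    have hO : IsOpen {q : G × Z.core.TotalSpace | q.2.proj ∈ Z.U i ∧ q.1 • q.2.proj ∈ Z.U j} :=
      ((Z.isOpen_U i).preimage (hproj.comp continuous_snd)).inter
        ((Z.isOpen_U j).preimage (continuous_fst.smul (hproj.comp continuous_snd)))
    have hmem : (g₀, p₀) ∈
        {q : G × Z.core.TotalSpace | q.2.proj ∈ Z.U i ∧ q.1 • q.2.proj ∈ Z.U j} :=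
      ⟨Z.mem_idx _, Z.mem_idx _⟩
    have h₁ : ContinuousOn (fun q : G × Z.core.TotalSpace => Z.tr i j q.1 q.2.proj)
        {q : G × Z.core.TotalSpace | q.2.proj ∈ Z.U i ∧ q.1 • q.2.proj ∈ Z.U j} :=
      (Z.continuousOn_tr i j).comp (f := fun q : G × Z.core.TotalSpace => (q.1, q.2.proj))
        (continuous_fst.prodMk (hproj.comp continuous_snd)).continuousOn fun q hq => hq
    have h₂ : ContinuousAt (fun p : Z.core.TotalSpace => ((Z.core.localTriv i) p).2) p₀ :=
      continuous_snd.continuousAt.comp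
        ((Z.core.localTriv i).continuousAt ((Z.core.mem_localTriv_source i p₀).2 (Z.mem_idx _)))
    have h₃ := (h₁.continuousAt (hO.mem_nhds hmem)).clm_apply
      (h₂.comp (x := (g₀, p₀)) (f := Prod.snd) continuous_snd.continuousAt)
    refine h₃.congr ?_
    filter_upwards [hO.mem_nhds hmem] with q hq
    change Z.tr i j q.1 q.2.proj (Z.tr (Z.idx q.2.proj) i 1 q.2.proj q.2.snd) =
      Z.tr (Z.idx (q.1 • q.2.proj)) j 1 (q.1 • q.2.proj)
        (Z.tr (Z.idx q.2.proj) (Z.idx (q.1 • q.2.proj)) q.1 q.2.proj q.2.snd)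
    exact (Z.act_aux (Z.mem_idx _) hq.1 hq.2 _).trans
      (Z.act_aux' (Z.mem_idx _) (Z.mem_idx _) hq.2 _).symm

theorem continuous_bundle_mk {X : Type*} [TopologicalSpace X] {z : X → B} (hz : Continuous z)
    {v : X → W} (hv : ∀ j, ContinuousOn (fun x => Z.tr (Z.idx (z x)) j 1 (z x) (v x))
      (z ⁻¹' Z.U j)) : Continuous fun x => (⟨z x, v x⟩ : Z.bundle.Total) := by
  rw [continuous_iff_continuousAt]
  intro x₀
  change ContinuousAt (fun x => (⟨z x, v x⟩ : Z.core.TotalSpace)) x₀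
  rw [FiberBundle.continuousAt_totalSpace]
  exact ⟨hz.continuousAt, (hv _).continuousAt
    (((Z.isOpen_U _).preimage hz).mem_nhds (Z.mem_idx _))⟩

end EquivariantCocycle

section LocalFrames

variable {G : Type*} [Group G] [TopologicalSpace G]
  {B : Type*} [TopologicalSpace B] [MulAction G B]
  {T : Type*} [TopologicalSpace T]

/-- Local frames for transition maps `κ` along `c`. -/
structure LocalFrames (c : T → B) {W : Type} [NormedAddCommGroup W] [NormedSpace ℝ W]
    (κ : ∀ (k : G) {s t : T}, k • c t = c s → (W ≃ₗ[ℝ] W)) (J : Type*) where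
  U : J → Set B
  isOpen_U : ∀ j, IsOpen (U j)
  cover : ∀ t, ∃ j, c t ∈ U j
  -- `frame j g t` expresses in chart `j` the frame at `c t` translated by `g`. The next condition
  -- says that two presentations of the same point are compared by the prescribed transition map.
  frame : J → G → T → (W ≃ₗ[ℝ] W)
  frame_mul : ∀ {j g k s t} (h : k • c t = c s), g • c s ∈ U j → ∀ w,
    frame j (g * k) t w = frame j g s (κ k h w)
  continuousOn_frame : ∀ j w, ContinuousOn (fun p : G × T => frame j p.1 p.2 w)
    {p | p.1 • c p.2 ∈ U j}

namespace LocalFrames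

variable {c : T → B} {W : Type} [NormedAddCommGroup W] [NormedSpace ℝ W]
  {κ : ∀ (k : G) {s t : T}, k • c t = c s → (W ≃ₗ[ℝ] W)} {J : Type*}
  (Φ : LocalFrames c κ J)

/-- The translated domains. -/
def dom (i : G × J) : Set B := {z | i.1⁻¹ • z ∈ Φ.U i.2}

/-- The translated frames. -/
def coord (i : G × J) (g : G) (t : T) : W ≃ₗ[ℝ] W := Φ.frame i.2 (i.1⁻¹ * g) t

theorem coord_mul {i : G × J} {g k : G} {s t : T} (h : k • c t = c s) (hg : g • c s ∈ Φ.dom i)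
    (w : W) : Φ.coord i (g * k) t w = Φ.coord i g s (κ k h w) := by
  unfold coord
  rw [← mul_assoc]
  exact Φ.frame_mul h (by rwa [mul_smul]) w

theorem exists_mem_dom (hcov : ∀ z, ∃ (g : G) (t : T), g • c t = z) (z : B) :
    ∃ i, z ∈ Φ.dom i := by
  obtain ⟨g, t, rfl⟩ := hcov z
  obtain ⟨j, hj⟩ := Φ.cover t
  exact ⟨(g, j), by simpa [dom] using hj⟩

variable [IsTopologicalGroup G] [CompactSpace G] [CompactSpace T] [T2Space B]
  [ContinuousSMul G B] [FiniteDimensional ℝ W]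

theorem continuousOn_coord (i : G × J) (w : W) :
    ContinuousOn (fun p : G × T => Φ.coord i p.1 p.2 w) {p | p.1 • c p.2 ∈ Φ.dom i} :=
  (Φ.continuousOn_frame i.2 w).comp (f := fun p : G × T => (i.1⁻¹ * p.1, p.2)) (by fun_prop)
    fun p hp => by
      change (i.1⁻¹ * p.1) • c p.2 ∈ Φ.U i.2
      rw [mul_smul]
      exact hp

theorem continuousOn_coord_symm (i j : G × J) (v : W) :
    ContinuousOn (fun p : G × (G × T) =>
        Φ.coord j (p.1 * p.2.1) p.2.2 ((Φ.coord i p.2.1 p.2.2).symm v))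
      {p | p.2.1 • c p.2.2 ∈ Φ.dom i ∧ p.1 • p.2.1 • c p.2.2 ∈ Φ.dom j} := by
  set S := {p : G × (G × T) | p.2.1 • c p.2.2 ∈ Φ.dom i ∧ p.1 • p.2.1 • c p.2.2 ∈ Φ.dom j}
  rw [continuousOn_iff_continuous_domRestrict]
  refine LinearEquiv.continuous_family_apply
    (m := fun p : S => (Φ.coord j (p.1.1 * p.1.2.1) p.1.2.2).toLinearMap) (fun w => ?_)
    (LinearEquiv.continuous_family_symm (m := fun p : S => Φ.coord i p.1.2.1 p.1.2.2)
      (fun w => ?_) continuous_const)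
  · exact (Φ.continuousOn_coord j w).comp_continuous
      (f := fun p : S => (p.1.1 * p.1.2.1, p.1.2.2)) (by fun_prop)
      fun p => by simpa [mul_smul] using p.2.2
  · exact (Φ.continuousOn_coord i w).comp_continuous
      (f := fun p : S => (p.1.2.1, p.1.2.2)) (by fun_prop) fun p => p.2.1

/-- Independence of coordinate changes from the presentation `z = g • c t` of a point. -/
theorem coord_indep {i j : G × J} {g g' x : G} {t t' : T} (h : g • c t = g' • c t')
    (hi : g • c t ∈ Φ.dom i) (hj : x • g • c t ∈ Φ.dom j) (v : W) :
    Φ.coord j (x * g) t ((Φ.coord i g t).symm v) =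
      Φ.coord j (x * g') t' ((Φ.coord i g' t').symm v) := by
  have hk : (g'⁻¹ * g) • c t = c t' := by rw [mul_smul, h, inv_smul_smul]
  obtain ⟨w, rfl⟩ := (Φ.coord i g t).surjective v
  rw [LinearEquiv.symm_apply_apply]
  have h₁ := Φ.coord_mul hk (g := g') (i := i) (by rwa [← h]) w
  have h₂ := Φ.coord_mul hk (g := x * g') (i := j) (by rwa [mul_smul, ← h]) w
  rw [mul_inv_cancel_left] at h₁
  rw [show x * g' * (g'⁻¹ * g) = x * g by group] at h₂
  rw [h₁, h₂, LinearEquiv.symm_apply_apply]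

/-- The cocycle of a family of local frames. -/
noncomputable def cocycle (hc : Continuous c) (hcov : ∀ z, ∃ (g : G) (t : T), g • c t = z) :
    EquivariantCocycle G B W (G × J) where
  U := Φ.dom
  isOpen_U i := (Φ.isOpen_U i.2).preimage (continuous_const_smul _)
  idx z := (Φ.exists_mem_dom hcov z).choose
  mem_idx z := (Φ.exists_mem_dom hcov z).choose_spec
  tr i j x z := LinearMap.toContinuousLinearMap
    (((Φ.coord i (hcov z).choose (hcov z).choose_spec.choose).symm.trans
      (Φ.coord j (x * (hcov z).choose) (hcov z).choose_spec.choose)).toLinearMap)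
  tr_one {i z} hz v := by
    change Φ.coord i (1 * _) _ ((Φ.coord i _ _).symm v) = v
    rw [one_mul, LinearEquiv.apply_symm_apply]
  tr_mul {i j k x y z} hi hj hk v := by
    have e := (hcov z).choose_spec.choose_spec
    have e' := (hcov (x • z)).choose_spec.choose_spec
    change Φ.coord k (y * (hcov (x • z)).choose) (hcov (x • z)).choose_spec.choose
      ((Φ.coord j (hcov (x • z)).choose (hcov (x • z)).choose_spec.choose).symm
        (Φ.coord j (x * (hcov z).choose) (hcov z).choose_spec.choose
          ((Φ.coord i (hcov z).choose (hcov z).choose_spec.choose).symm v))) =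
      Φ.coord k (y * x * (hcov z).choose) (hcov z).choose_spec.choose
        ((Φ.coord i (hcov z).choose (hcov z).choose_spec.choose).symm v)
    rw [Φ.coord_indep (g' := x * (hcov z).choose) (t' := (hcov z).choose_spec.choose)
      (by rw [e', mul_smul, e]) (by rwa [e']) (by rwa [e', ← mul_smul]),
      LinearEquiv.symm_apply_apply, mul_assoc]
  continuousOn_tr i j := by
    have hO : IsOpen {p : G × B | p.2 ∈ Φ.dom i ∧ p.1 • p.2 ∈ Φ.dom j} :=
      (((Φ.isOpen_U i.2).preimage (continuous_const_smul _)).preimage continuous_snd).inter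
        (((Φ.isOpen_U j.2).preimage (continuous_const_smul _)).preimage continuous_smul)
    -- The coordinate changes are defined through an arbitrary choice of presentation, but they do
    -- not depend on it, so continuity can be checked on the space of all presentations.
    have hq : IsQuotientMap (fun p : G × (G × T) => (p.1, p.2.1 • c p.2.2)) := by
      let r : Set ((G × T) × (G × B)) := {y | y.2.2 = y.1.1 • c y.1.2}
      have hr : IsClosed r := isClosed_eq (by fun_prop) (by fun_prop)
      have hq := isQuotientMap_snd_of_isClosed hr fun e => by
        obtain ⟨g, t, h⟩ := hcov e.2
        exact ⟨(g, t), h.symm⟩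
      refine IsQuotientMap.of_comp (f := fun y : r => (y.1.2.1, y.1.1)) (by fun_prop)
        (by fun_prop) ?_
      convert hq using 1
      funext y
      exact Prod.ext rfl y.2.symm
    rw [continuousOn_clm_apply]
    intro v
    rw [hq.continuousOn_isOpen_iff hO]
    refine (Φ.continuousOn_coord_symm i j v).congr fun p hp => ?_
    have e := (hcov (p.2.1 • c p.2.2)).choose_spec.choose_spec
    exact (Φ.coord_indep e.symm hp.1 hp.2 v).symm

/-- Local frames for given transition maps come from a bundle with a frame. -/
theorem exists_frame (Φ : LocalFrames c κ J) (hc : Continuous c) (hcov : ∀ z, ∃ (g : G) (t : T), g • c t = z) :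
    ∃ (A : GVectorBundle G B) (φ : A.Frame c W),
      ∀ (k : G) (s t : T) (h : k • c t = c s) (w : W), φ.trans k h w = κ k h w := by
  let Z := Φ.cocycle hc hcov
  have htr : ∀ {i j : G × J} {x : G} {z : B} (g : G) (t : T), g • c t = z → z ∈ Φ.dom i →
      x • z ∈ Φ.dom j → ∀ v, Z.tr i j x z (Φ.coord i g t v) = Φ.coord j (x * g) t v := by
    intro i j x z g t h hi hj v
    have e := (hcov z).choose_spec.choose_spec
    conv_rhs => rw [← (Φ.coord i g t).symm_apply_apply v]
    exact Φ.coord_indep (e.trans h.symm) (by rwa [e]) (by rwa [e]) _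
  let φ : Z.bundle.Frame c W :=
    { map := fun t => (Φ.coord (Z.idx (c t)) 1 t : W ≃ₗ[ℝ] W)
      continuous_map := by
        refine Z.continuous_bundle_mk (z := fun p : T × W => c p.1) (by fun_prop) fun j => ?_
        have : ContinuousOn (fun p : T × W => Φ.coord j 1 p.1 p.2)
            ((fun p : T × W => c p.1) ⁻¹' Z.U j) := by
          rw [continuousOn_iff_continuous_domRestrict]
          refine LinearEquiv.continuous_family_apply
            (m := fun p : ((fun p : T × W => c p.1) ⁻¹' Z.U j) =>
              (Φ.coord j 1 p.1.1).toLinearMap) (fun w => ?_) (by fun_prop)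
          exact (Φ.continuousOn_coord j w).comp_continuous
            (f := fun p : ((fun p : T × W => c p.1) ⁻¹' Z.U j) => ((1 : G), p.1.1)) (by fun_prop)
            fun p => by
              have := p.2
              simp only [Set.mem_ofPred_eq, one_smul]
              exact this
        refine this.congr fun p hp => ?_
        refine (htr 1 p.1 (one_smul _ _) (Z.mem_idx _) (by rw [one_smul]; exact hp) p.2).trans ?_
        rw [mul_one] }
  refine ⟨Z.bundle, φ, fun k s t h w => ?_⟩
  rw [GVectorBundle.Frame.trans_apply, LinearEquiv.symm_apply_eq]
  have h₁ := htr (x := k) 1 t (one_smul _ _) (Z.mem_idx (c t))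
    (j := Z.idx (c s)) (by rw [h]; exact Z.mem_idx _) w
  refine h₁.trans ?_
  rw [mul_one]
  have h₂ := Φ.coord_mul h (g := 1) (i := Z.idx (c s)) (by rw [one_smul]; exact Z.mem_idx _) w
  rw [one_mul] at h₂
  exact h₂

end LocalFrames

end LocalFrames

end Realization

/-! ### Rigidity of continuous families of representations -/

section EquivariantFrames

set_option linter.unusedSectionVars false

open Module Representation

section Mean

variable {X K : Type*} [TopologicalSpace X] [TopologicalSpace K] [CompactSpace K]
  {W W' : Type*} [NormedAddCommGroup W] [NormedSpace ℝ W] [FiniteDimensional ℝ W]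
  [NormedAddCommGroup W'] [NormedSpace ℝ W'] [FiniteDimensional ℝ W']

/-- A jointly continuous function is a continuous map into functions on the compact `K` with the
uniform norm, and `I` is bounded; so means depend continuously on parameters. -/
theorem exists_continuous_mean (I : C(K, ℝ) →L[ℝ] ℝ) {F : X → K → W →ₗ[ℝ] W'}
    (hF : ∀ w, Continuous fun p : X × K => F p.1 p.2 w) :
    ∃ M : X → W →ₗ[ℝ] W', (∀ w, Continuous fun x => M x w) ∧
      ∀ (x : X) (w : W) (l : Dual ℝ W'), ∃ h : Continuous fun k => l (F x k w),
        l (M x w) = I ⟨fun k => l (F x k w), h⟩ := by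
  have hFx : ∀ (x : X) (w : W), Continuous fun k => F x k w := fun x w =>
    (hF w).comp (by fun_prop : Continuous fun k : K => (x, k))
  have hw : ∀ x, WeaklyContinuous (F x) := fun x =>
    weaklyContinuous_linearMap fun w => (hFx x w).weaklyContinuous
  choose M hM using fun x => (hw x).exists_mean (I : C(K, ℝ) →ₗ[ℝ] ℝ)
  have key : ∀ (x : X) (w : W) (l : Dual ℝ W'), ∃ h : Continuous fun k => l (F x k w),
        l (M x w) = I ⟨fun k => l (F x k w), h⟩ := fun x w l =>
    ⟨l.continuous_of_finiteDimensional.comp (hFx x w),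
      hM x (l.comp (LinearMap.applyₗ w))⟩
  refine ⟨M, fun w => WeaklyContinuous.continuous fun l => ?_, key⟩
  have hc : Continuous fun p : X × K => l (F p.1 p.2 w) :=
    l.continuous_of_finiteDimensional.comp (hF w)
  refine (I.continuous.comp (ContinuousMap.curry ⟨_, hc⟩).continuous).congr fun x => ?_
  obtain ⟨h, e⟩ := key x w l
  rw [e]
  rfl

end Mean

section Gauge

variable {K : Type*} [Group K] [TopologicalSpace K] [IsTopologicalGroup K] [CompactSpace K]
  {W : Type*} [NormedAddCommGroup W] [NormedSpace ℝ W] [FiniteDimensional ℝ W]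

theorem LinearMap.continuous_det_of_apply {X : Type*} [TopologicalSpace X]
    {M : X → W →ₗ[ℝ] W} (hM : ∀ w, Continuous fun x => M x w) :
    Continuous fun x => LinearMap.det (M x) :=
  continuous_det fun w => (hM w).weaklyContinuous

/-- The mean of `σ x k * σ y k⁻¹` over `k` intertwines the two representations. It is the identity
for `x = y`, hence invertible near the diagonal: nearby representations of a compact group are
conjugate. -/
theorem exists_intertwining_family {X : Type*} [TopologicalSpace X]
    (σ : X → Representation ℝ K W) (hσ : ∀ w, Continuous fun p : X × K => σ p.1 p.2 w) :
    ∃ M : X × X → W →ₗ[ℝ] W, (∀ w, Continuous fun x => M x w) ∧ (∀ x, M (x, x) = 1) ∧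
      ∀ x y k w, M (x, y) (σ y k w) = σ x k (M (x, y) w) := by
  obtain ⟨I, hI₁, hI⟩ := exists_invariant_mean K
  let F : X × X → K → W →ₗ[ℝ] W := fun p k => σ p.1 k * σ p.2 k⁻¹
  have hF : ∀ w, Continuous fun p : (X × X) × K => F p.1 p.2 w := fun w =>
    LinearEquiv.continuous_family_apply (m := fun p : (X × X) × K => σ p.1.1 p.2)
      (fun w => (hσ w).comp (by fun_prop : Continuous fun p : (X × X) × K => (p.1.1, p.2)))
      ((hσ w).comp (by fun_prop : Continuous fun p : (X × X) × K => (p.1.2, p.2⁻¹)))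
  obtain ⟨M, hM, hM'⟩ := exists_continuous_mean I hF
  refine ⟨M, hM, fun x => LinearMap.ext fun w => eq_of_forall_dual_eq fun l => ?_,
    fun x y k w => eq_of_forall_dual_eq fun l => ?_⟩
  · obtain ⟨h, e⟩ := hM' (x, x) w l
    rw [e]
    have : (⟨fun k => l (F (x, x) k w), h⟩ : C(K, ℝ)) = l w • 1 := by
      ext k
      simp [F, ← map_mul]
    rw [this, map_smul, hI₁]
    simp
  · obtain ⟨h, e⟩ := hM' (x, y) (σ y k w) l
    obtain ⟨h', e'⟩ := hM' (x, y) w (l.comp (σ x k))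
    rw [e]
    refine Eq.trans ?_ e'.symm
    rw [← hI k]
    congr 1
    ext k'
    have e₁ : σ x (k * k') = σ x k * σ x k' := map_mul _ _ _
    have e₂ : σ y (k * k')⁻¹ * σ y k = σ y k'⁻¹ := by rw [← map_mul]; congr 1; group
    have : F (x, y) (k * k') (σ y k w) = σ x k (F (x, y) k' w) := by
      simp only [F, e₁, Module.End.mul_apply, ← e₂]
    exact congrArg l this

/-- Along a fine enough subdivision of the interval the intertwining maps of
`exists_intertwining_family` are invertible, and composing them conjugates the whole family to its
initial member. -/
theorem exists_gauge (σ : unitInterval → Representation ℝ K W)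
    (hσ : ∀ w, Continuous fun p : unitInterval × K => σ p.1 p.2 w) :
    ∃ a : unitInterval → (W ≃ₗ[ℝ] W), (∀ w, Continuous fun t => a t w) ∧
      ∀ t k w, a t (σ 0 k w) = σ t k (a t w) := by
  obtain ⟨M, hM, hM₁, hM'⟩ := exists_intertwining_family σ hσ
  have hd : Continuous fun p => LinearMap.det (M p) := LinearMap.continuous_det_of_apply hM
  have hc : ∀ s : unitInterval, ∃ O : Set unitInterval, IsOpen O ∧ s ∈ O ∧ ∀ t ∈ O, ∀ t' ∈ O,
      LinearMap.det (M (t, t')) ≠ 0 := by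
    intro s
    have h₁ : {p | LinearMap.det (M p) ≠ 0} ∈ nhds (s, s) :=
      (isOpen_ne.preimage hd).mem_nhds (by simp [hM₁])
    rw [nhds_prod_eq, Filter.mem_prod_self_iff] at h₁
    obtain ⟨u, hu, hu'⟩ := h₁
    obtain ⟨O, hO, hO', hs⟩ := mem_nhds_iff.1 hu
    exact ⟨O, hO', hs, fun t ht t' ht' => hu' (Set.mk_mem_prod (hO ht) (hO ht'))⟩
  choose O hO hs hO' using hc
  obtain ⟨t, ht0, htm, ⟨m, htm'⟩, ht⟩ := exists_monotone_Icc_subset_open_cover_unitInterval hO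
    (fun s _ => Set.mem_iUnion.2 ⟨s, hs s⟩)
  -- After `n` steps the family is straightened up to `t n` and frozen afterwards; the minimum with
  -- `t n` avoids gluing.
  have key : ∀ n, ∃ b : unitInterval → (W →ₗ[ℝ] W), (∀ w, Continuous fun t => b t w) ∧
      (∀ s, LinearMap.det (b s) ≠ 0) ∧ ∀ s k w, b s (σ 0 k w) = σ (min s (t n)) k (b s w) := by
    intro n
    induction n with
    | zero => exact ⟨fun _ => 1, fun w => continuous_const, by simp, fun s k w => by simp [ht0]⟩
    | succ n ih =>
      obtain ⟨b, hb, hb', hb''⟩ := ih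
      refine ⟨fun s => M (min s (t (n + 1)), min s (t n)) * b s, fun w => ?_, fun s => ?_,
        fun s k w => ?_⟩
      · exact LinearEquiv.continuous_family_apply
          (m := fun s => M (min s (t (n + 1)), min s (t n)))
          (fun w => (hM w).comp (by fun_prop)) (hb w)
      · rw [map_mul]
        refine mul_ne_zero ?_ (hb' s)
        rcases le_total s (t n) with h | h
        · rw [min_eq_left h, min_eq_left (h.trans (htm n.le_succ)), hM₁]
          simp
        · obtain ⟨i, hi⟩ := ht n
          refine hO' i _ (hi ?_) _ (hi ?_)
          · exact ⟨le_min h (htm n.le_succ), min_le_right _ _⟩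
          · rw [min_eq_right h]
            exact ⟨le_rfl, htm n.le_succ⟩
      · rw [Module.End.mul_apply, hb'', hM', Module.End.mul_apply]
  obtain ⟨b, hb, hb', hb''⟩ := key m
  refine ⟨fun s => LinearEquiv.ofIsUnitDet (f := b s) (v := finBasis ℝ W) (v' := finBasis ℝ W)
    (by rw [LinearMap.det_toMatrix]; exact (hb' s).isUnit), hb, fun s k w => ?_⟩
  have := hb'' s k w
  rw [htm' m le_rfl, min_eq_left unitInterval.le_one'] at this
  exact this

end Gauge

end EquivariantFrames

/-! ### Frames over an interval -/

section FramesOverInterval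

open Module

namespace GVectorBundle

variable {G : Type*} [Group G] [TopologicalSpace G]
  {B : Type*} [TopologicalSpace B] [MulAction G B]

/-- The interval is subdivided so that each piece lies in one local trivialization, and the frame is
continued from piece to piece. -/
theorem exists_frame_unitInterval (A : GVectorBundle G B) {c : unitInterval → B} (hc : Continuous c) :
    Nonempty (A.Frame c A.F) := by
  let O : unitInterval → Set unitInterval := fun s => c ⁻¹' (trivializationAt A.F A.E (c s)).baseSet
  obtain ⟨t, ht0, htm, ⟨m, htm'⟩, ht⟩ := exists_monotone_Icc_subset_open_cover_unitInterval
    (c := O) (fun s => (trivializationAt A.F A.E (c s)).open_baseSet.preimage hc)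
    (fun s _ => Set.mem_iUnion.2 ⟨s, FiberBundle.mem_baseSet_trivializationAt A.F A.E (c s)⟩)
  choose i hi using ht
  have hsymm : ∀ n, ContinuousOn (fun p : unitInterval × A.F => (⟨c p.1,
      (trivializationAt A.F A.E (c (i n))).symmₗ ℝ (c p.1) p.2⟩ : A.Total))
      {p | p.1 ∈ O (i n)} := by
    intro n
    refine ((trivializationAt A.F A.E (c (i n))).continuousOn_symm.comp
      (f := fun p : unitInterval × A.F => (c p.1, p.2)) (by fun_prop) fun p hp => ?_).congr fun p hp => ?_
    · exact ⟨hp, Set.mem_univ _⟩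
    · change _ = (⟨c p.1, (trivializationAt A.F A.E (c (i n))).symm (c p.1) p.2⟩ : A.Total)
      rw [Trivialization.coe_symmₗ _ hp]
  have hbij : ∀ n s, s ∈ O (i n) → Function.Bijective
      ((trivializationAt A.F A.E (c (i n))).symmₗ ℝ (c s)) := fun n s hs =>
    ⟨fun v v' h => by
      have := congrArg ((trivializationAt A.F A.E (c (i n))).linearMapAt ℝ (c s)) h
      rwa [Trivialization.linearMapAt_symmₗ _ hs, Trivialization.linearMapAt_symmₗ _ hs] at this,
      fun v => ⟨_, Trivialization.symmₗ_linearMapAt _ hs v⟩⟩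
  have key : ∀ n, ∃ φ : ∀ s, A.F →ₗ[ℝ] A.E (c s), (∀ s ≤ t n, Function.Bijective (φ s)) ∧
      ContinuousOn (fun p : unitInterval × A.F => (⟨c p.1, φ p.1 p.2⟩ : A.Total)) {p | p.1 ≤ t n} := by
    intro n
    induction n with
    | zero =>
      have h0 : ∀ s ≤ t 0, s ∈ O (i 0) := fun s hs =>
        hi 0 (by rw [ht0] at hs ⊢; exact ⟨unitInterval.nonneg', hs.trans unitInterval.nonneg'⟩)
      refine ⟨fun s => (trivializationAt A.F A.E (c (i 0))).symmₗ ℝ (c s), fun s hs =>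
        hbij 0 s (h0 s hs), (hsymm 0).mono fun p hp => h0 _ hp⟩
    | succ n ih =>
      obtain ⟨φ, hφ, hφ'⟩ := ih
      let e := trivializationAt A.F A.E (c (i n))
      have hn : ∀ s, t n ≤ s → s ≤ t (n + 1) → c s ∈ e.baseSet := fun s h h' => hi n ⟨h, h'⟩
      have hn₀ : c (t n) ∈ e.baseSet := hn _ le_rfl (htm n.le_succ)
      -- Past `t n` the frame is kept constant in the next trivialization, with the value reached at
      -- `t n`; so both formulas agree there.
      let ψ : ∀ s, A.F →ₗ[ℝ] A.E (c s) := fun s =>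
        (e.symmₗ ℝ (c s)).comp ((e.linearMapAt ℝ (c (t n))).comp (φ (t n)))
      have hψ : ContinuousOn (fun p : unitInterval × A.F => (⟨c p.1, ψ p.1 p.2⟩ : A.Total))
          {p | t n ≤ p.1 ∧ p.1 ≤ t (n + 1)} := by
        refine (hsymm n).comp (f := fun p : unitInterval × A.F => (p.1,
          ((e.linearMapAt ℝ (c (t n))).comp (φ (t n))) p.2)) (Continuous.continuousOn ?_)
          fun p hp => hn _ hp.1 hp.2
        exact continuous_fst.prodMk
          ((LinearMap.continuous_of_finiteDimensional _).comp continuous_snd)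
      refine ⟨fun s => if s ≤ t n then φ s else ψ s, fun s hs => ?_, ?_⟩
      · dsimp only
        split_ifs with h
        · exact hφ s h
        · have h₁ : Function.Bijective (e.linearMapAt ℝ (c (t n))) := by
            rw [e.linearMapAt_def_of_mem hn₀]
            exact (e.linearEquivAt ℝ _ hn₀).bijective
          exact (hbij n s (hn s (le_of_not_ge h) hs)).comp (h₁.comp (hφ _ le_rfl))
      · have hcl₁ : IsClosed {p : unitInterval × A.F | p.1 ≤ t n} := isClosed_le (by fun_prop) (by fun_prop)
        have hcl₂ : IsClosed {p : unitInterval × A.F | t n ≤ p.1 ∧ p.1 ≤ t (n + 1)} :=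
          (isClosed_le (by fun_prop) (by fun_prop)).inter (isClosed_le (by fun_prop) (by fun_prop))
        have hcov : {p : unitInterval × A.F | p.1 ≤ t (n + 1)} ⊆
            {p : unitInterval × A.F | p.1 ≤ t n} ∪ {p : unitInterval × A.F | t n ≤ p.1 ∧ p.1 ≤ t (n + 1)} := by
          intro p hp
          rcases le_total p.1 (t n) with h | h
          · exact Or.inl h
          · exact Or.inr ⟨h, hp⟩
        refine (ContinuousOn.union_of_isClosed ?_ ?_ hcl₁ hcl₂).mono hcov
        · refine hφ'.congr fun p hp => ?_
          simp only [if_pos (show p.1 ≤ t n from hp)]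
        · refine hψ.congr fun p hp => ?_
          dsimp only
          split_ifs with h
          · have h' : p.1 = t n := le_antisymm h hp.1
            obtain ⟨s, v⟩ := p
            simp only at h'
            subst h'
            simp only [ψ, LinearMap.comp_apply]
            rw [e.symmₗ_linearMapAt hn₀]
          · rfl
  obtain ⟨φ, hφ, hφ'⟩ := key m
  have hm : ∀ s : unitInterval, s ≤ t m := fun s => by rw [htm' m le_rfl]; exact unitInterval.le_one'
  exact ⟨⟨fun s => LinearEquiv.ofBijective (φ s) (hφ s (hm s)),
    continuousOn_univ.1 (hφ'.mono fun p _ => hm p.1)⟩⟩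

theorem Frame.continuous_trans {A : GVectorBundle G B} {T : Type*} [TopologicalSpace T]
    {c : T → B} {W : Type*} [NormedAddCommGroup W] [NormedSpace ℝ W] [FiniteDimensional ℝ W]
    (φ : A.Frame c W) {Y : Type*} [TopologicalSpace Y] {k : Y → G} (hk : Continuous k)
    {s t : Y → T} (hs : Continuous s) (ht : Continuous t) {w : Y → W} (hw : Continuous w)
    (h : ∀ y, k y • c (t y) = c (s y)) :
    Continuous fun y => φ.trans (k y) (h y) (w y) :=
  φ.continuous_symm hs (A.continuous_act_comp hk (φ.continuous_map.comp (ht.prodMk hw)) h)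

variable [IsTopologicalGroup G] [CompactSpace G]

/-- Frames that are equivariant for a subgroup acting trivially on the path. -/
theorem exists_equivariant_frame (A : GVectorBundle G B) {c : unitInterval → B} (hc : Continuous c)
    (N : Subgroup G) (hN : IsClosed (N : Set G)) (hfix : ∀ (h : N) (t : unitInterval), (h : G) • c t = c t) :
    ∃ φ : A.Frame c A.F, ∀ (h : N) (t : unitInterval) (w : A.F),
      φ.trans (h : G) (hfix h t) w = φ.trans (h : G) (hfix h 0) w := by
  obtain ⟨φ⟩ := A.exists_frame_unitInterval hc
  have : CompactSpace N := isCompact_iff_compactSpace.1 hN.isCompact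
  let σ : unitInterval → Representation ℝ N A.F := fun t =>
    { toFun := fun h => (φ.trans (h : G) (hfix h t)).toLinearMap
      map_one' := LinearMap.ext fun w => φ.trans_one _ w
      map_mul' := fun h h' => LinearMap.ext fun w => φ.trans_mul (hfix h' t) (hfix h t) _ w }
  -- In any frame `N` acts through a continuous family of representations, which a change of frame
  -- makes constant.
  obtain ⟨a, ha, ha'⟩ := exists_gauge σ fun w =>
    φ.continuous_trans (continuous_subtype_val.comp continuous_snd) continuous_fst continuous_fst
      continuous_const fun p : unitInterval × N => hfix p.2 p.1
  have ha₂ : Continuous fun p : unitInterval × A.F => a p.1 p.2 :=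
    LinearEquiv.continuous_family_apply (m := fun p : unitInterval × A.F => (a p.1).toLinearMap)
      (fun w => (ha w).comp continuous_fst) continuous_snd
  have h₁ : ∀ (h : N) (t : unitInterval) (w : A.F),
      (φ.change a ha₂).trans (h : G) (hfix h t) w = σ 0 h w := by
    intro h t w
    rw [Frame.change_trans, LinearEquiv.symm_apply_eq]
    exact (ha' t h w).symm
  exact ⟨φ.change a ha₂, fun h t w => (h₁ h t w).trans (h₁ h 0 w).symm⟩

end GVectorBundle

end FramesOverInterval

/-! ### Fundamental domains and clutching -/

section Domains

set_option linter.unusedSectionVars false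

open Module Topology

/-- The action of a group element as a linear equivalence. -/
def Representation.linearEquiv {K W : Type*} [Group K] [AddCommGroup W] [Module ℝ W]
    (σ : Representation ℝ K W) (k : K) : W ≃ₗ[ℝ] W :=
  LinearEquiv.ofLinearMap (σ k) (σ k⁻¹)
    (by rw [← Module.End.mul_eq_comp, ← map_mul, mul_inv_cancel, map_one]; rfl)
    (by rw [← Module.End.mul_eq_comp, ← map_mul, inv_mul_cancel, map_one]; rfl)

@[simp] theorem Representation.linearEquiv_apply {K W : Type*} [Group K] [AddCommGroup W]
    [Module ℝ W] (σ : Representation ℝ K W) (k : K) (w : W) : σ.linearEquiv k w = σ k w := rfl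

section Coset

variable {G : Type*} [Group G] [TopologicalSpace G] [IsTopologicalGroup G]
  {W : Type*} [NormedAddCommGroup W] [NormedSpace ℝ W]

open Classical in
/-- The extension by the identity of a representation of a subgroup. -/
noncomputable def Representation.extend {K : Subgroup G} (σ : Representation ℝ K W) (g : G) :
    W ≃ₗ[ℝ] W := if h : g ∈ K then σ.linearEquiv ⟨g, h⟩ else LinearEquiv.refl ℝ W

theorem Representation.extend_apply {K : Subgroup G} (σ : Representation ℝ K W) {g : G}
    (h : g ∈ K) (w : W) : σ.extend g w = σ ⟨g, h⟩ w := by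
  rw [extend, dif_pos h]
  rfl

/-- With a representative `r g` of each coset, `σ ((r g)⁻¹ * g)` has the required covariance. Cosets
of an open subgroup are open, so `r` is locally constant and continuity follows. -/
theorem exists_coset_extension {K : Subgroup G} (hK : IsOpen (K : Set G))
    (σ : Representation ℝ K W) (hσ : ∀ w, Continuous fun k => σ k w) :
    ∃ a : G → (W ≃ₗ[ℝ] W), (∀ g k (h : k ∈ K) w, a (g * k) w = a g (σ ⟨k, h⟩ w)) ∧
      ∀ w, Continuous fun g => a g w := by
  let r : G → G := fun g => (QuotientGroup.mk g : G ⧸ K).out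
  have hr : ∀ g, (r g)⁻¹ * g ∈ K := fun g => QuotientGroup.eq.1 (QuotientGroup.out_eq' _)
  refine ⟨fun g => σ.linearEquiv ⟨(r g)⁻¹ * g, hr g⟩, fun g k h w => ?_, fun w => ?_⟩
  · have hrk : r (g * k) = r g := by
      simp only [r]
      congr 1
      exact (QuotientGroup.eq.2 (by simpa using h)).symm
    simp only [Representation.linearEquiv_apply]
    rw [← Module.End.mul_apply, ← map_mul]
    congr 2
    ext
    simp [hrk, mul_assoc]
  · rw [continuous_iff_continuousAt]
    intro g₀
    have hO : IsOpen {g | (r g₀)⁻¹ * g ∈ K} := hK.preimage (by fun_prop)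
    suffices h : ContinuousOn (fun g => σ.linearEquiv ⟨(r g)⁻¹ * g, hr g⟩ w)
        {g | (r g₀)⁻¹ * g ∈ K} from h.continuousAt (hO.mem_nhds (hr g₀))
    rw [continuousOn_iff_continuous_domRestrict]
    have h₁ : Continuous fun g : {g | (r g₀)⁻¹ * g ∈ K} => (⟨(r g₀)⁻¹ * g, g.2⟩ : K) := by
      fun_prop
    refine ((hσ w).comp h₁).congr fun g => ?_
    have hrg : r g = r g₀ := by
      have : (QuotientGroup.mk (r g₀) : G ⧸ K) = QuotientGroup.mk (g : G) := QuotientGroup.eq.2 g.2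
      have h' : (QuotientGroup.mk (r g₀) : G ⧸ K) = QuotientGroup.mk g₀ :=
        QuotientGroup.out_eq' _
      simp only [r]
      rw [← this, h']
    simp only [Function.comp, Set.domRestrict, Representation.linearEquiv_apply, hrg]

end Coset

namespace GVectorBundle

variable {G : Type*} [Group G] [TopologicalSpace G]
  {B : Type*} [TopologicalSpace B] [MulAction G B]

/-- The character of the fiber at `z` as a representation of a subgroup fixing `z`. -/
noncomputable def charOn (A : GVectorBundle G B) (z : B) (K : Subgroup G)
    (hK : ∀ k : K, (k : G) • z = z) (k : K) : ℝ :=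
  LinearMap.trace ℝ (A.E z) (A.act (k : G) (hK k))

theorem charOn_congr {A A' : GVectorBundle G B} (f : Iso A A') (z : B) (K : Subgroup G)
    (hK : ∀ k : K, (k : G) • z = z) : A.charOn z K hK = A'.charOn z K hK := by
  funext k
  unfold charOn
  rw [← LinearMap.trace_conj' _ (f.map z)]
  congr 1
  ext v
  simp [LinearEquiv.conj_apply, f.map_act]

theorem charOn_sum (A A' : GVectorBundle G B) (z : B) (K : Subgroup G)
    (hK : ∀ k : K, (k : G) • z = z) :
    (A.sum A').charOn z K hK = A.charOn z K hK + A'.charOn z K hK := by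
  funext k
  exact LinearMap.trace_prodMap' (A.act (k : G) (hK k)) (A'.act (k : G) (hK k))

namespace Frame

variable {A A' : GVectorBundle G B} {T : Type*} [TopologicalSpace T] {c : T → B}
  {W W' : Type*} [NormedAddCommGroup W] [NormedSpace ℝ W]
  [NormedAddCommGroup W'] [NormedSpace ℝ W']
  (φ : A.Frame c W)

/-- The representation on the model of a frame of a subgroup fixing a point of the path. -/
def rep (t : T) (K : Subgroup G) (hK : ∀ k : K, (k : G) • c t = c t) : Representation ℝ K W where
  toFun k := (φ.trans (k : G) (hK k)).toLinearMap
  map_one' := LinearMap.ext fun w => φ.trans_one _ w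
  map_mul' k l := LinearMap.ext fun w => φ.trans_mul (hK l) (hK k) _ w

theorem rep_apply (t : T) (K : Subgroup G) (hK : ∀ k : K, (k : G) • c t = c t) (k : K) (w : W) :
    φ.rep t K hK k w = φ.trans (k : G) (hK k) w := rfl

theorem character_rep (t : T) (K : Subgroup G) (hK : ∀ k : K, (k : G) • c t = c t) :
    (φ.rep t K hK).character = A.charOn (c t) K hK := by
  funext k
  unfold charOn Representation.character
  rw [← LinearMap.trace_conj' _ (φ.map t)]
  congr 1
  ext v
  simp [LinearEquiv.conj_apply, rep_apply, map_trans]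

variable [FiniteDimensional ℝ W] [FiniteDimensional ℝ W']

theorem continuous_rep (t : T) (K : Subgroup G) (hK : ∀ k : K, (k : G) • c t = c t) (w : W) :
    Continuous fun k => φ.rep t K hK k w :=
  φ.continuous_trans continuous_subtype_val continuous_const continuous_const continuous_const hK

theorem isCont_rep (t : T) (K : Subgroup G) (hK : ∀ k : K, (k : G) • c t = c t) :
    (φ.rep t K hK).IsCont := fun w => (φ.continuous_rep t K hK w).weaklyContinuous

variable [IsTopologicalGroup G] [CompactSpace G] [CompactSpace T] [T2Space B] [ContinuousSMul G B]

/-- Frames which differ by a gauge transformation belong to isomorphic bundles. -/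
theorem nonempty_iso_of_gauge (hc : Continuous c) (hcov : ∀ z, ∃ (g : G) (t : T), g • c t = z)
    (φ' : A'.Frame c W') (a : T → (W ≃ₗ[ℝ] W')) (ha : ∀ w, Continuous fun t => a t w)
    (h : ∀ (k : G) (s t : T) (h : k • c t = c s) (w : W),
      a s (φ.trans k h w) = φ'.trans k h (a t w)) : Nonempty (Iso A A') := by
  have ha₂ : Continuous fun p : T × W => a p.1 p.2 :=
    LinearEquiv.continuous_family_apply (m := fun p : T × W => (a p.1).toLinearMap)
      (fun w => (ha w).comp continuous_fst) continuous_snd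
  refine nonempty_iso_of_trans_eq hc hcov φ (φ'.change a ha₂) fun k s t e w => ?_
  rw [change_trans, ← h, LinearEquiv.symm_apply_apply]

end Frame

end GVectorBundle

open GVectorBundle

variable {G : Type*} [Group G] [TopologicalSpace G]
  {B : Type*} [TopologicalSpace B] [MulAction G B]

/-- The path `c` is a fundamental domain with trivial stabilizers modulo `N` in its interior. -/
structure IntervalDomain (N : Subgroup G) (c : unitInterval → B) : Prop where
  continuous : Continuous c
  cover : ∀ z, ∃ (g : G) (t : unitInterval), g • c t = z
  eq_of_smul : ∀ {k : G} {s t}, k • c t = c s → t = s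
  mem_of_smul : ∀ {k : G} {t}, t ≠ 0 → t ≠ 1 → k • c t = c t → k ∈ N
  smul_eq : ∀ {k : G}, k ∈ N → ∀ t, k • c t = c t

/-- The path `c` is a fundamental domain with trivial stabilizers modulo `N`, except that `g₀`
moves its beginning to its end. -/
structure CyclicDomain (N : Subgroup G) (c : unitInterval → B) (g₀ : G) : Prop where
  continuous : Continuous c
  cover : ∀ z, ∃ (g : G) (t : unitInterval), g • c t = z
  smul_zero : g₀ • c 0 = c 1
  smul_eq : ∀ {k : G}, k ∈ N → ∀ t, k • c t = c t
  cases : ∀ {k : G} {s t}, k • c t = c s → (t = s ∧ k ∈ N) ∨ (t = 0 ∧ s = 1 ∧ g₀⁻¹ * k ∈ N) ∨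
    (t = 1 ∧ s = 0 ∧ g₀ * k ∈ N)

theorem isOpen_compl_orbit [CompactSpace G] [T2Space B] [ContinuousSMul G B] (z : B) :
    IsOpen (MulAction.orbit G z)ᶜ :=
  (isCompact_range (by fun_prop : Continuous fun g : G => g • z)).isClosed.isOpen_compl

namespace IntervalDomain

variable {N : Subgroup G} {c : unitInterval → B} (D : IntervalDomain N c)

section Trans

variable {A A' : GVectorBundle G B}
  {W W' : Type*} [NormedAddCommGroup W] [NormedSpace ℝ W]
  [NormedAddCommGroup W'] [NormedSpace ℝ W']

/-- Induction over transition maps. -/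
theorem induct (D : IntervalDomain N c) {P : ∀ (k : G) (s t : unitInterval), k • c t = c s → Prop}
    (h0 : ∀ k (h : k • c 0 = c 0), P k 0 0 h) (h1 : ∀ k (h : k • c 1 = c 1), P k 1 1 h)
    (hN : ∀ k, k ∈ N → ∀ t h, P k t t h) (k : G) (s t : unitInterval) (h : k • c t = c s) :
    P k s t h := by
  have := D.eq_of_smul h
  subst this
  by_cases ht0 : t = 0
  · subst ht0
    exact h0 k h
  by_cases ht1 : t = 1
  · subst ht1
    exact h1 k h
  exact hN k (D.mem_of_smul ht0 ht1 h) t h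

theorem nonempty_iso (D : IntervalDomain N c) [FiniteDimensional ℝ W] [FiniteDimensional ℝ W'] [IsTopologicalGroup G]
    [CompactSpace G] [T2Space B] [ContinuousSMul G B] (φ : A.Frame c W) (φ' : A'.Frame c W')
    (a : unitInterval → (W ≃ₗ[ℝ] W')) (ha : ∀ w, Continuous fun t => a t w)
    (h0 : ∀ k (h : k • c 0 = c 0) w, a 0 (φ.trans k h w) = φ'.trans k h (a 0 w))
    (h1 : ∀ k (h : k • c 1 = c 1) w, a 1 (φ.trans k h w) = φ'.trans k h (a 1 w))
    (hN : ∀ k, k ∈ N → ∀ t (h : k • c t = c t) w, a t (φ.trans k h w) = φ'.trans k h (a t w)) :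
    Nonempty (Iso A A') :=
  φ.nonempty_iso_of_gauge D.continuous D.cover φ' a ha
    (D.induct h0 h1 hN)

end Trans

/-- Two representations of the end groups which agree on `N` can be glued: the complements of the
two end orbits are open, and over each of them only one end group intervenes, so a coset extension
of its representation serves as local frame. -/
theorem exists_frame [IsTopologicalGroup G] [CompactSpace G] [T2Space B] [ContinuousSMul G B]
    (hN : IsOpen (N : Set G)) {W : Type} [NormedAddCommGroup W] [NormedSpace ℝ W]
    [FiniteDimensional ℝ W]
    (σ : Representation ℝ (MulAction.stabilizer G (c 0)) W)
    (τ : Representation ℝ (MulAction.stabilizer G (c 1)) W)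
    (hσ : ∀ w, Continuous fun k => σ k w) (hτ : ∀ w, Continuous fun k => τ k w)
    (hστ : ∀ k (hk : k ∈ N) w, σ ⟨k, D.smul_eq hk 0⟩ w = τ ⟨k, D.smul_eq hk 1⟩ w) :
    ∃ (A : GVectorBundle G B) (φ : A.Frame c W),
      (∀ k (h : k • c 0 = c 0) w, φ.trans k h w = σ ⟨k, h⟩ w) ∧
      (∀ k (h : k • c 1 = c 1) w, φ.trans k h w = τ ⟨k, h⟩ w) ∧
      (∀ k (hk : k ∈ N) t (h : k • c t = c t) w, φ.trans k h w = σ ⟨k, D.smul_eq hk 0⟩ w) := by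
  have hO : ∀ t, IsOpen (MulAction.stabilizer G (c t) : Set G) := fun t =>
    Subgroup.isOpen_mono (fun k hk => D.smul_eq hk t) hN
  obtain ⟨a, ha, ha'⟩ := exists_coset_extension (hO 0) σ hσ
  obtain ⟨b, hb, hb'⟩ := exists_coset_extension (hO 1) τ hτ
  let κ : ∀ (k : G) {s t : unitInterval}, k • c t = c s → (W ≃ₗ[ℝ] W) := fun k _ t _ =>
    if t = 1 then τ.extend k else σ.extend k
  have h01 : ¬ (0 : unitInterval) = 1 := zero_ne_one
  let Φ : LocalFrames c κ Bool :=
    { U := fun j => if j then (MulAction.orbit G (c 1))ᶜ else (MulAction.orbit G (c 0))ᶜ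
      isOpen_U := fun j => by cases j <;> exact isOpen_compl_orbit _
      cover := fun t => by
        by_cases ht : t = 1
        · refine ⟨false, ?_⟩
          rintro ⟨k, hk⟩
          exact h01 ((D.eq_of_smul hk).trans ht)
        · refine ⟨true, ?_⟩
          rintro ⟨k, hk⟩
          exact ht (D.eq_of_smul hk).symm
      frame := fun j g _ => if j then a g else b g
      frame_mul := by
        rintro (_ | _) g k s t h hg w
        · have hs : t ≠ 0 := by
            rintro rfl
            have := D.eq_of_smul h
            subst this
            exact hg ⟨g, rfl⟩
          have := D.eq_of_smul h
          subst this
          simp only [κ, Bool.false_eq_true, if_false]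
          split_ifs with h1
          · subst h1
            rw [τ.extend_apply h, hb g k h]
          · have hk := D.mem_of_smul hs h1 h
            rw [σ.extend_apply (D.smul_eq hk 0), hστ k hk, hb g k (D.smul_eq hk 1)]
        · have hs : t ≠ 1 := by
            rintro rfl
            have := D.eq_of_smul h
            subst this
            exact hg ⟨g, rfl⟩
          have := D.eq_of_smul h
          subst this
          have hk : k ∈ MulAction.stabilizer G (c 0) := by
            by_cases h0 : t = 0
            · subst h0
              exact h
            · exact D.smul_eq (D.mem_of_smul h0 hs h) 0
          simp only [κ, if_true, if_neg hs]
          rw [σ.extend_apply hk, ha g k hk]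
      continuousOn_frame := by
        rintro (_ | _) w
        · exact ((hb' w).comp continuous_fst).continuousOn
        · exact ((ha' w).comp continuous_fst).continuousOn }
  obtain ⟨A, φ, hφ⟩ := Φ.exists_frame D.continuous D.cover
  refine ⟨A, φ, fun k h w => ?_, fun k h w => ?_, fun k hk t h w => ?_⟩
  · rw [hφ]
    simp only [κ, if_neg h01]
    exact σ.extend_apply h w
  · rw [hφ]
    simp only [κ, if_true]
    exact τ.extend_apply h w
  · rw [hφ]
    simp only [κ]
    split_ifs with h1
    · rw [hστ k hk]
      exact τ.extend_apply _ w
    · exact σ.extend_apply _ w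

end IntervalDomain

namespace CyclicDomain

variable {N : Subgroup G} {c : unitInterval → B} {g₀ : G} (D : CyclicDomain N c g₀)

section Trans

variable {A A' : GVectorBundle G B}
  {W W' : Type*} [NormedAddCommGroup W] [NormedSpace ℝ W]
  [NormedAddCommGroup W'] [NormedSpace ℝ W']

theorem trans_zero_one (φ : A.Frame c W) {k : G} (h : k • c 0 = c 1) (hk : g₀⁻¹ * k ∈ N) (w : W) :
    φ.trans k h w = φ.trans g₀ D.smul_zero (φ.trans (g₀⁻¹ * k) (D.smul_eq hk 0) w) := by
  have e : g₀ * (g₀⁻¹ * k) = k := mul_inv_cancel_left _ _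
  rw [← φ.trans_mul (D.smul_eq hk 0) D.smul_zero (by rw [e, h])]
  congr 2
  exact e.symm

theorem trans_one_zero (φ : A.Frame c W) {k : G} (h : k • c 1 = c 0) (hk : g₀ * k ∈ N) (w : W) :
    φ.trans k h w =
      (φ.trans g₀ D.smul_zero).symm (φ.trans (g₀ * k) (D.smul_eq hk 1) w) := by
  rw [LinearEquiv.eq_symm_apply, φ.trans_mul h D.smul_zero]

theorem nonempty_iso (D : CyclicDomain N c g₀) [FiniteDimensional ℝ W] [FiniteDimensional ℝ W'] [IsTopologicalGroup G]
    [CompactSpace G] [T2Space B] [ContinuousSMul G B] (φ : A.Frame c W) (φ' : A'.Frame c W')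
    (a : unitInterval → (W ≃ₗ[ℝ] W')) (ha : ∀ w, Continuous fun t => a t w)
    (h01 : ∀ w, a 1 (φ.trans g₀ D.smul_zero w) = φ'.trans g₀ D.smul_zero (a 0 w))
    (hN : ∀ k, k ∈ N → ∀ t (h : k • c t = c t) w, a t (φ.trans k h w) = φ'.trans k h (a t w)) :
    Nonempty (Iso A A') := by
  refine φ.nonempty_iso_of_gauge D.continuous D.cover φ' a ha fun k s t h w => ?_
  rcases D.cases h with ⟨rfl, hk⟩ | ⟨rfl, rfl, hk⟩ | ⟨rfl, rfl, hk⟩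
  · exact hN k hk _ h w
  · rw [D.trans_zero_one φ h hk, D.trans_zero_one φ' h hk, h01, hN _ hk]
  · rw [D.trans_one_zero φ h hk, D.trans_one_zero φ' h hk, LinearEquiv.eq_symm_apply, ← h01,
      LinearEquiv.apply_symm_apply, hN _ hk]

end Trans

/-- The constant representation of `N` on the arc is closed up along `g₀` by the monodromy `γ`; the
only compatibility condition is that `γ` is semilinear for conjugation by `g₀`. -/
theorem exists_frame [IsTopologicalGroup G] [CompactSpace G] [T2Space B] [ContinuousSMul G B]
    [hNn : N.Normal] (hN : IsOpen (N : Set G)) {W : Type} [NormedAddCommGroup W]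
    [NormedSpace ℝ W] [FiniteDimensional ℝ W]
    (σ : Representation ℝ N W) (hσ : ∀ w, Continuous fun k => σ k w) (γ : W ≃ₗ[ℝ] W)
    (hγ : ∀ k w, γ (σ k w) = σ (MulAut.conjNormal g₀ k) (γ w)) :
    ∃ (A : GVectorBundle G B) (φ : A.Frame c W),
      (∀ w, φ.trans g₀ D.smul_zero w = γ w) ∧
      (∀ k (hk : k ∈ N) t (h : k • c t = c t) w, φ.trans k h w = σ ⟨k, hk⟩ w) := by
  obtain ⟨a, ha, ha'⟩ := exists_coset_extension hN σ hσ
  let κ : ∀ (k : G) {s t : unitInterval}, k • c t = c s → (W ≃ₗ[ℝ] W) := fun k s t _ =>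
    if t = s then σ.extend k else if t = 0 then (σ.extend (g₀⁻¹ * k)).trans γ
      else (σ.extend (g₀ * k)).trans γ.symm
  have h01 : ¬ (0 : unitInterval) = 1 := zero_ne_one
  have h10 : ¬ (1 : unitInterval) = 0 := one_ne_zero
  -- Removing the orbit of any interior point leaves a chart around the point where the ends are
  -- glued; the midpoint is used.
  let m : unitInterval := ⟨1 / 2, by norm_num, by norm_num⟩
  have hm0 : (0 : unitInterval) < m := by
    change (0 : ℝ) < 1 / 2
    norm_num
  have hm1 : ¬ (1 : unitInterval) < m := by
    change ¬ (1 : ℝ) < 1 / 2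
    norm_num
  have hm1' : m ≠ 1 := fun h => hm1 (by
    have : m < 1 := by
      change (1 / 2 : ℝ) < 1
      norm_num
    exact absurd h this.ne)
  have hconj : ∀ {k : G} (_ : k ∈ N), g₀⁻¹ * k * g₀ ∈ N := fun {k} hk => by
    simpa using hNn.conj_mem k hk g₀⁻¹
  have hγ' : ∀ (k : G) (hk : k ∈ N) w, σ ⟨g₀⁻¹ * k * g₀, hconj hk⟩ (γ.symm w) =
      γ.symm (σ ⟨k, hk⟩ w) := by
    intro k hk w
    rw [LinearEquiv.eq_symm_apply, hγ, LinearEquiv.apply_symm_apply]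
    congr 2
    ext
    simp [mul_assoc]
  let Φ : LocalFrames c κ Bool :=
    { U := fun j => if j then (MulAction.orbit G (c 0))ᶜ else (MulAction.orbit G (c m))ᶜ
      isOpen_U := fun j => by cases j <;> exact isOpen_compl_orbit _
      cover := fun t => by
        by_cases ht : t = m
        · refine ⟨true, ?_⟩
          rintro ⟨k, hk⟩
          rcases D.cases hk with ⟨h, -⟩ | ⟨-, h, -⟩ | ⟨h, -, -⟩
          · exact hm0.ne (h.trans ht)
          · exact hm1' (ht ▸ h)
          · exact h01 h
        · refine ⟨false, ?_⟩
          rintro ⟨k, hk⟩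
          rcases D.cases hk with ⟨h, -⟩ | ⟨h, -, -⟩ | ⟨h, -, -⟩
          · exact ht h.symm
          · exact hm0.ne h.symm
          · exact hm1' h
      -- The chart around the gluing point continues the beginning of the arc backwards: the second
      -- half of the arc is reached through `g₀`, and `γ⁻¹` corrects its frame.
      frame := fun j g t => if j then a g else if t < m then a g else γ.symm.trans (a (g * g₀))
      frame_mul := by
        rintro (_ | _) g k s t h hg w
        · simp only [Bool.false_eq_true, if_false, κ]
          rcases D.cases h with ⟨rfl, hk⟩ | ⟨rfl, rfl, hk⟩ | ⟨rfl, rfl, hk⟩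
          · rw [if_pos rfl, σ.extend_apply hk]
            split_ifs with ht
            · exact ha g k hk w
            · simp only [LinearEquiv.trans_apply]
              rw [← hγ' k hk, ← ha _ _ (hconj hk)]
              congr 2
              group
          · rw [if_pos hm0, if_neg hm1, if_neg h01, if_pos rfl]
            simp only [LinearEquiv.trans_apply]
            rw [LinearEquiv.symm_apply_apply, σ.extend_apply hk, ← ha _ _ hk]
            congr 2
            group
          · rw [if_pos hm0, if_neg hm1, if_neg h10, if_neg h10]
            simp only [LinearEquiv.trans_apply]
            rw [σ.extend_apply hk, ← hγ' _ hk, ← ha _ _ (hconj hk)]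
            congr 2
            group
        · simp only [if_true, κ]
          have h₁ : ¬ c s ∈ MulAction.orbit G (c 0) := fun ⟨x, hx⟩ => hg ⟨g * x, by
            simp only [mul_smul]
            exact congrArg (g • ·) hx⟩
          rcases D.cases h with ⟨rfl, hk⟩ | ⟨rfl, rfl, hk⟩ | ⟨rfl, rfl, hk⟩
          · rw [if_pos rfl, σ.extend_apply hk, ha g k hk w]
          · exact absurd ⟨g₀, D.smul_zero⟩ h₁
          · exact absurd ⟨1, one_smul _ _⟩ h₁
      continuousOn_frame := by
        rintro (_ | _) w
        · intro p hp
          have hp' : p.2 ≠ m := by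
            intro h
            refine hp ⟨p.1, ?_⟩
            rw [h]
          refine ContinuousAt.continuousWithinAt ?_
          rcases lt_or_gt_of_ne hp' with h | h
          · have hO : IsOpen {p : G × unitInterval | p.2 < m} :=
              isOpen_lt continuous_snd continuous_const
            refine ((ha' w).comp continuous_fst).continuousAt.congr ?_
            filter_upwards [hO.mem_nhds h] with q hq
            simp only [Function.comp, Bool.false_eq_true, if_false, if_pos (show q.2 < m from hq)]
          · have hO : IsOpen {p : G × unitInterval | m < p.2} :=
              isOpen_lt continuous_const continuous_snd
            refine ((ha' (γ.symm w)).comp (by fun_prop :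
              Continuous fun p : G × unitInterval => p.1 * g₀)).continuousAt.congr ?_
            filter_upwards [hO.mem_nhds h] with q hq
            simp only [Function.comp, Bool.false_eq_true, if_false,
              if_neg (not_lt.2 (show m < q.2 from hq).le), LinearEquiv.trans_apply]
        · exact ((ha' w).comp continuous_fst).continuousOn }
  obtain ⟨A, φ, hφ⟩ := Φ.exists_frame D.continuous D.cover
  refine ⟨A, φ, fun w => ?_, fun k hk t h w => ?_⟩
  · rw [hφ]
    simp only [κ, if_neg h01, if_true, LinearEquiv.trans_apply]
    rw [σ.extend_apply (by rw [inv_mul_cancel]; exact N.one_mem)]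
    congr 1
    have : (⟨g₀⁻¹ * g₀, by rw [inv_mul_cancel]; exact N.one_mem⟩ : N) = 1 := by
      ext
      simp
    rw [this, map_one]
    rfl
  · rw [hφ]
    simp only [κ, if_true]
    exact σ.extend_apply hk w

end CyclicDomain

section Transitive

variable [IsTopologicalGroup G] [CompactSpace G] [T2Space B] [ContinuousSMul G B]

/-- Here the subgroup need not be open, so coset representatives cannot be chosen locally constant.
Instead `σ` is extended to `G` by Tietze's theorem and the extension is averaged over `K` to restore
covariance; invertibility is kept only near `K`. -/
theorem exists_induced_extension [T2Space G] (K : Subgroup G) (hK : IsClosed (K : Set G))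
    {W : Type*} [NormedAddCommGroup W] [NormedSpace ℝ W] [FiniteDimensional ℝ W]
    (σ : Representation ℝ K W) (hσ : ∀ w, Continuous fun k => σ k w) :
    ∃ M : G → W →ₗ[ℝ] W, (∀ w, Continuous fun g => M g w) ∧ M 1 = 1 ∧
      ∀ g (k : K) w, M (g * k) w = M g (σ k w) := by
  have : CompactSpace K := isCompact_iff_compactSpace.1 hK.isCompact
  obtain ⟨I, hI₁, hI⟩ := exists_invariant_mean K
  have hσc : Continuous fun k : K => ((σ k).toContinuousLinearMap : W →L[ℝ] W) :=
    continuous_clm_apply.2 hσ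
  have : TietzeExtension (W →L[ℝ] W) := TietzeExtension.of_tvs ℝ
  obtain ⟨F, hF⟩ := ContinuousMap.exists_restrict_eq hK (⟨_, hσc⟩ : C(K, W →L[ℝ] W))
  have hF' : ∀ k : K, ∀ w, F k w = σ k w := fun k w =>
    congrArg (fun f : W →L[ℝ] W => f w) (DFunLike.congr_fun hF k)
  obtain ⟨M, hM, hM'⟩ := exists_continuous_mean (X := G) I
    (F := fun g k => (F (g * k) : W →ₗ[ℝ] W) * σ k⁻¹) fun w => by
      have h₁ : Continuous fun p : G × K => F (p.1 * p.2) := by fun_prop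
      exact h₁.clm_apply ((hσ w).comp (by fun_prop))
  refine ⟨M, hM, LinearMap.ext fun w => eq_of_forall_dual_eq fun l => ?_,
    fun g k w => eq_of_forall_dual_eq fun l => ?_⟩
  · obtain ⟨h, e⟩ := hM' 1 w l
    rw [e]
    have : (⟨_, h⟩ : C(K, ℝ)) = l w • 1 := by
      ext k
      have : F (k : G) (σ k⁻¹ w) = w := by
        rw [hF', ← Module.End.mul_apply, ← map_mul, mul_inv_cancel, map_one]
        rfl
      simp [this]
    rw [this, map_smul, hI₁]
    simp
  · obtain ⟨h, e⟩ := hM' (g * k) w l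
    obtain ⟨h', e'⟩ := hM' g (σ k w) l
    rw [e, e']
    conv_rhs => rw [← hI k]
    congr 1
    ext k'
    have e₂ : σ (k * k')⁻¹ * σ k = σ k'⁻¹ := by rw [← map_mul]; congr 1; group
    have e₃ : g * ((k * k' : K) : G) = g * k * k' := by simp [mul_assoc]
    simp only [ContinuousMap.comp_apply, ContinuousMap.coe_mk, Module.End.mul_apply, ← e₂, e₃]

/-- The homogeneous bundle of `σ`. The set where the covariant extension `M` of `σ` is invertible is
open, contains `1` and is stable under right translation by the isotropy group, so it descends to a
neighbourhood of `z` with a local frame. -/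
theorem exists_frame_of_transitive [T2Space G] {z : B} (hz : ∀ w, ∃ g : G, g • z = w)
    {W : Type} [NormedAddCommGroup W] [NormedSpace ℝ W] [FiniteDimensional ℝ W]
    (σ : Representation ℝ (MulAction.stabilizer G z) W) (hσ : ∀ w, Continuous fun k => σ k w) :
    ∃ (A : GVectorBundle G B) (φ : A.Frame (fun _ : PUnit.{1} => z) W),
      ∀ k (h : k • z = z) w, φ.trans (s := PUnit.unit) (t := PUnit.unit) k h w = σ ⟨k, h⟩ w := by
  have hK : IsClosed (MulAction.stabilizer G z : Set G) := by
    have : (MulAction.stabilizer G z : Set G) = {g | g • z = z} := rfl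
    rw [this]
    exact isClosed_eq (by fun_prop) continuous_const
  obtain ⟨M, hM, hM₁, hM'⟩ := exists_induced_extension _ hK σ hσ
  have hd : Continuous fun g => LinearMap.det (M g) := LinearMap.continuous_det_of_apply hM
  have hq : IsQuotientMap (fun g : G => g • z) :=
    IsClosedMap.isQuotientMap (Continuous.isClosedMap (by fun_prop)) (by fun_prop) hz
  classical
  let κ : ∀ (k : G) {s t : PUnit.{1}}, k • z = z → (W ≃ₗ[ℝ] W) := fun k _ _ _ => σ.extend k
  let E : ∀ g, LinearMap.det (M g) ≠ 0 → (W ≃ₗ[ℝ] W) := fun g h =>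
    LinearEquiv.ofIsUnitDet (f := M g) (v := finBasis ℝ W) (v' := finBasis ℝ W)
      (by rw [LinearMap.det_toMatrix]; exact h.isUnit)
  have hdk : ∀ g (k : G), k • z = z → (LinearMap.det (M (g * k)) ≠ 0 ↔
      LinearMap.det (M g) ≠ 0) := by
    intro g k hk
    have : M (g * k) = M g * (σ.linearEquiv ⟨k, hk⟩).toLinearMap :=
      LinearMap.ext fun w => hM' g ⟨k, hk⟩ w
    rw [this, map_mul]
    have h₂ := (LinearEquiv.isUnit_det' (σ.linearEquiv ⟨k, hk⟩)).ne_zero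
    simp [h₂]
  have hU : ∀ g : G, g • z ∈ (fun g : G => g • z) '' {g | LinearMap.det (M g) ≠ 0} →
      LinearMap.det (M g) ≠ 0 := by
    rintro g ⟨g', hg', e⟩
    have e' : (g'⁻¹ * g) • z = z := by
      rw [mul_smul, inv_smul_eq_iff]
      exact e.symm
    have := (hdk g' _ e').2 hg'
    rwa [mul_inv_cancel_left] at this
  let Φ : LocalFrames (fun _ : PUnit.{1} => z) κ Unit :=
    { U := fun _ => (fun g : G => g • z) '' {g | LinearMap.det (M g) ≠ 0}
      isOpen_U := fun _ => by
        rw [← hq.isOpen_preimage]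
        convert isOpen_ne.preimage hd using 1
        ext g
        exact ⟨hU g, fun h => ⟨g, h, rfl⟩⟩
      cover := fun _ => ⟨(), 1, by simp [hM₁], one_smul _ _⟩
      frame := fun _ g _ => if h : LinearMap.det (M g) ≠ 0 then E g h else LinearEquiv.refl ℝ W
      frame_mul := by
        intro _ g k _ _ h hg w
        have h₁ := hU g hg
        have h₂ := (hdk g k h).2 h₁
        rw [dif_pos h₁, dif_pos h₂]
        have h₃ := hM' g ⟨k, h⟩ w
        simp only [κ]
        rw [σ.extend_apply h]
        exact h₃
      continuousOn_frame := by
        intro _ w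
        refine ((hM w).comp continuous_fst).continuousOn.congr fun p hp => ?_
        rw [dif_pos (hU p.1 hp)]
        rfl }
  obtain ⟨A, φ, hφ⟩ := Φ.exists_frame continuous_const fun w => by
    obtain ⟨g, hg⟩ := hz w
    exact ⟨g, PUnit.unit, hg⟩
  refine ⟨A, φ, fun k h w => ?_⟩
  rw [hφ]
  exact σ.extend_apply h w

theorem nonempty_iso_of_transitive {z : B} (hz : ∀ w, ∃ g : G, g • z = w)
    {A A' : GVectorBundle G B} {W W' : Type*} [NormedAddCommGroup W] [NormedSpace ℝ W]
    [NormedAddCommGroup W'] [NormedSpace ℝ W'] [FiniteDimensional ℝ W] [FiniteDimensional ℝ W']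
    (φ : A.Frame (fun _ : PUnit.{1} => z) W) (φ' : A'.Frame (fun _ : PUnit.{1} => z) W')
    (a : W ≃ₗ[ℝ] W') (h : ∀ k (h : k • z = z) w,
      a (φ.trans (s := PUnit.unit) (t := PUnit.unit) k h w) =
        φ'.trans (s := PUnit.unit) (t := PUnit.unit) k h (a w)) : Nonempty (Iso A A') :=
  φ.nonempty_iso_of_gauge continuous_const (fun w => by
    obtain ⟨g, hg⟩ := hz w
    exact ⟨g, PUnit.unit, hg⟩) φ' (fun _ => a) (fun _ => continuous_const)
    fun k _ _ e w => h k e w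

end Transitive

end Domains

/-! ### Geometry of the action on the circle -/

section CircleGeometry

set_option linter.unusedSectionVars false

open Module Topology

/-- The inclusion of a normal subgroup of index two. -/
def IndexTwo.ofSubgroup {G : Type*} [Group G] [TopologicalSpace G] {H K : Subgroup G}
    [hH : H.Normal] (hHK : H ≤ K) (c : G) (hcK : c ∈ K) (hcH : c ∉ H)
    (hc : ∀ k ∈ K, k ∈ H ∨ c⁻¹ * k ∈ H) : IndexTwo H K where
  ι := Subgroup.inclusion hHK
  injective := Subgroup.inclusion_injective hHK
  continuous := continuous_inclusion hHK
  c := ⟨c, hcK⟩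
  notMem n h := hcH (by
    have := congrArg Subtype.val h
    simp only [Subgroup.coe_inclusion] at this
    exact this ▸ n.2)
  cover k := by
    rcases hc k k.2 with h | h
    · exact Or.inl ⟨⟨k, h⟩, rfl⟩
    · exact Or.inr ⟨⟨_, h⟩, by ext; simp⟩
  conj := MulAut.conjNormal c
  conj_spec n := by ext; simp
  conjInv := MulAut.conjNormal c⁻¹
  conjInv_spec n := by ext; simp

theorem dihedral_cases {n : ℕ} {f : ℂ ≃ₗᵢ[ℝ] ℂ} (hn : 1 ≤ n) (hf : f ∈ dihedral n) :
    ∃ ζ : Circle, ζ ^ n = 1 ∧ ((∀ z : ℂ, f z = ζ * z) ∨ ∀ z : ℂ, f z = ζ * (starRingEnd ℂ) z) := by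
  have hn' : (n : ℝ) ≠ 0 := by
    have : 0 < n := hn
    positivity
  have hconj : ∀ ζ : Circle, (ζ : ℂ) * (starRingEnd ℂ) (ζ : ℂ) = 1 := fun ζ => by
    rw [← Circle.coe_inv_eq_conj, ← Circle.coe_mul, mul_inv_cancel, Circle.coe_one]
  refine Subgroup.closure_induction (p := fun (f : ℂ ≃ₗᵢ[ℝ] ℂ) _ => ∃ ζ : Circle, ζ ^ n = 1 ∧
    ((∀ z : ℂ, f z = ζ * z) ∨ ∀ z : ℂ, f z = ζ * (starRingEnd ℂ) z)) ?_ ?_ ?_ ?_ hf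
  · rintro f (rfl | rfl)
    · refine ⟨Circle.exp (2 * Real.pi / n), ?_, Or.inl fun z => rotation_apply _ _⟩
      rw [← Circle.exp_natCast_mul, mul_div_cancel₀ _ hn', Circle.exp_two_pi]
    · exact ⟨1, one_pow _, Or.inr fun z => by simp⟩
  · exact ⟨1, one_pow _, Or.inl fun z => by simp⟩
  · rintro f g - - ⟨ζ, hζ, h⟩ ⟨ξ, hξ, h'⟩
    rcases h with h | h <;> rcases h' with h' | h'
    · exact ⟨ζ * ξ, by rw [mul_pow, hζ, hξ, one_mul], Or.inl fun z => by
        change f (g z) = _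
        rw [h, h', Circle.coe_mul, mul_assoc]⟩
    · exact ⟨ζ * ξ, by rw [mul_pow, hζ, hξ, one_mul], Or.inr fun z => by
        change f (g z) = _
        rw [h, h', Circle.coe_mul, mul_assoc]⟩
    · refine ⟨ζ * ξ⁻¹, by rw [mul_pow, hζ, inv_pow, hξ, inv_one, one_mul], Or.inr fun z => ?_⟩
      change f (g z) = _
      rw [h, h', Circle.coe_mul, Circle.coe_inv_eq_conj, map_mul, mul_assoc]
    · refine ⟨ζ * ξ⁻¹, by rw [mul_pow, hζ, inv_pow, hξ, inv_one, one_mul], Or.inl fun z => ?_⟩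
      change f (g z) = _
      rw [h, h', Circle.coe_mul, Circle.coe_inv_eq_conj, map_mul, Complex.conj_conj, mul_assoc]
  · rintro f - ⟨ζ, hζ, h | h⟩
    · refine ⟨ζ⁻¹, by rw [inv_pow, hζ, inv_one], Or.inl fun z => ?_⟩
      apply f.injective
      change f (f.symm z) = _
      rw [f.apply_symm_apply, h, Circle.coe_inv_eq_conj, ← mul_assoc, hconj, one_mul]
    · refine ⟨ζ, hζ, Or.inr fun z => ?_⟩
      apply f.injective
      change f (f.symm z) = _
      rw [f.apply_symm_apply, h, map_mul, Complex.conj_conj, ← mul_assoc, hconj, one_mul]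

theorem rotation_mem_dihedral (n : ℕ) (m : ℤ) :
    rotation (Circle.exp (m * (2 * Real.pi / n))) ∈ dihedral n := by
  rw [Circle.exp_intCast_mul, map_zpow]
  exact zpow_mem (K := dihedral n) (Subgroup.subset_closure (Or.inl rfl)) m

theorem conj_mem_dihedral (n : ℕ) : Complex.conjLIE ∈ dihedral n :=
  Subgroup.subset_closure (Or.inr rfl)

theorem finite_isometries (n : ℕ) (hn : 0 < n) : {f : ℂ ≃ₗᵢ[ℝ] ℂ | ∃ ζ : Circle, ζ ^ n = 1 ∧
    ((∀ z : ℂ, f z = ζ * z) ∨ ∀ z : ℂ, f z = ζ * (starRingEnd ℂ) z)}.Finite := by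
  have h₁ : {ζ : Circle | ζ ^ n = 1}.Finite := by
    have h₂ : {z : ℂ | z ^ n = 1}.Finite := by
      refine (Polynomial.nthRootsFinset n (1 : ℂ)).finite_toSet.subset fun z hz => ?_
      exact (Polynomial.mem_nthRootsFinset hn _).2 hz
    refine (h₂.preimage (f := fun ζ : Circle => (ζ : ℂ)) Circle.coe_injective.injOn).subset
      fun ζ hζ => ?_
    change (ζ : ℂ) ^ n = 1
    rw [← Circle.coe_pow, show ζ ^ n = 1 from hζ, Circle.coe_one]
  refine ((h₁.image fun ζ => rotation ζ).union
    (h₁.image fun ζ => Complex.conjLIE.trans (rotation ζ))).subset ?_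
  rintro f ⟨ζ, hζ, h | h⟩
  · exact Or.inl ⟨ζ, hζ, LinearIsometryEquiv.ext fun z => by rw [h, rotation_apply]⟩
  · exact Or.inr ⟨ζ, hζ, LinearIsometryEquiv.ext fun z => by
      rw [h, LinearIsometryEquiv.trans_apply, rotation_apply, Complex.conjLIE_apply]⟩

namespace OrthRep

variable {G : Type*} [Group G] [TopologicalSpace G] (ρ : OrthRep G)

instance : T2Space ρ.S := inferInstanceAs (T2Space Circle)

theorem pt_injective {z w : Circle} (h : ρ.pt z = ρ.pt w) : z = w := h

theorem exists_pt (z : ρ.S) : ∃ x : ℝ, z = ρ.pt (Circle.exp x) := by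
  obtain ⟨x, hx⟩ := Circle.exp_surjective z
  exact ⟨x, hx.symm⟩

variable {ρ}

theorem smul_rot {g : G} {ζ : Circle} (h : ∀ z, ρ.hom g z = ζ * z) (z : Circle) :
    g • ρ.pt z = ρ.pt (ζ * z) := by
  apply Circle.ext
  exact h z

theorem smul_refl {g : G} {ζ : Circle} (h : ∀ z, ρ.hom g z = ζ * (starRingEnd ℂ) z) (z : Circle) :
    g • ρ.pt z = ρ.pt (ζ * z⁻¹) := by
  apply Circle.ext
  refine (h z).trans ?_
  rw [← Circle.coe_inv_eq_conj]
  rfl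

theorem mem_H_of_rot {g : G} {ζ : Circle} (h : ∀ z, ρ.hom g z = ζ * z) (hζ : ζ = 1) :
    g ∈ ρ.H := by
  rw [MonoidHom.mem_ker]
  refine LinearIsometryEquiv.ext fun z => ?_
  rw [h, hζ]
  simp

theorem smul_eq_of_mem_H {g : G} (h : g ∈ ρ.H) (z : ρ.S) : g • z = z := by
  apply Circle.ext
  change ρ.hom g _ = _
  rw [MonoidHom.mem_ker.1 h]
  rfl

theorem H_le_stabilizer (z : ρ.S) : ρ.H ≤ MulAction.stabilizer G z := fun _ h =>
  smul_eq_of_mem_H h z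

theorem inv_mul_mem_H_of_refl {g k : G} {ζ : Circle}
    (h : ∀ z, ρ.hom g z = ζ * (starRingEnd ℂ) z) (h' : ∀ z, ρ.hom k z = ζ * (starRingEnd ℂ) z) :
    g⁻¹ * k ∈ ρ.H := by
  rw [MonoidHom.mem_ker, map_mul, map_inv, inv_mul_eq_one]
  exact LinearIsometryEquiv.ext fun z => by rw [h, h']

theorem notMem_H_of_refl {g : G} {ζ : Circle} (h : ∀ z, ρ.hom g z = ζ * (starRingEnd ℂ) z) :
    g ∉ ρ.H := by
  intro hg
  rw [MonoidHom.mem_ker] at hg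
  have h₁ := h 1
  have h₂ := h Complex.I
  rw [hg] at h₁ h₂
  simp only [map_one, mul_one, LinearIsometryEquiv.coe_one, id_eq, Complex.conj_I] at h₁ h₂
  rw [← h₁, one_mul] at h₂
  have := congrArg Complex.im h₂
  simp at this
  norm_num at this

variable (ρ)

theorem exists_rot_or_refl (g : G) : ∃ ζ : Circle,
    (∀ z, ρ.hom g z = ζ * z) ∨ ∀ z, ρ.hom g z = ζ * (starRingEnd ℂ) z := by
  obtain ⟨a, h | h⟩ := linear_isometry_complex (ρ.hom g)
  · exact ⟨a, Or.inl fun z => by rw [h, rotation_apply]⟩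
  · exact ⟨a, Or.inr fun z => by
      rw [h, LinearIsometryEquiv.trans_apply, rotation_apply, Complex.conjLIE_apply]⟩

theorem isClosed_H : IsClosed (ρ.H : Set G) := by
  have : (ρ.H : Set G) = ⋂ z : ℂ, {g | ρ.hom g z = z} := by
    ext g
    simp only [SetLike.mem_coe, MonoidHom.mem_ker, Set.mem_iInter, Set.mem_ofPred_eq]
    exact ⟨fun h z => by rw [h]; rfl, fun h => LinearIsometryEquiv.ext h⟩
  rw [this]
  exact isClosed_iInter fun z => isClosed_eq (ρ.continuous_hom z) continuous_const

/-- The image is contained in a finite set of isometries, so `H` is closed of finite index and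
therefore open. -/
theorem isOpen_H [IsTopologicalGroup G] {n : ℕ} (hn : 0 < n)
    (h : ∀ f ∈ ρ.image, ∃ ζ : Circle, ζ ^ n = 1 ∧
      ((∀ z : ℂ, f z = ζ * z) ∨ ∀ z : ℂ, f z = ζ * (starRingEnd ℂ) z)) : IsOpen (ρ.H : Set G) := by
  have : Finite ρ.hom.range := ((finite_isometries n hn).subset h).to_subtype
  have := Subgroup.finiteIndex_ker ρ.hom
  exact Subgroup.isOpen_of_isClosed_of_finiteIndex _ ρ.isClosed_H

/-- An arc of the circle that starts at `1`. -/
noncomputable def arc (a : ℝ) (t : unitInterval) : ρ.S := ρ.pt (Circle.exp (a * t))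

theorem continuous_arc (a : ℝ) : Continuous (ρ.arc a) :=
  (Circle.exp.continuous.comp (by fun_prop) : Continuous fun t : unitInterval =>
    Circle.exp (a * t))

theorem arc_zero (a : ℝ) : ρ.arc a 0 = ρ.pt 1 := by simp [arc]

theorem arc_one (a : ℝ) : ρ.arc a 1 = ρ.pt (Circle.exp a) := by simp [arc]

variable {ρ}

section Dihedral

variable (hρ : ρ.IsDihedral)
include hρ

theorem image_eq_dihedral : 1 ≤ ρ.order ∧ ρ.image = dihedral ρ.order := by
  rw [order, dif_pos hρ]
  exact hρ.choose_spec

theorem isOpen_H_of_isDihedral [IsTopologicalGroup G] : IsOpen (ρ.H : Set G) :=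
  ρ.isOpen_H (image_eq_dihedral hρ).1 fun _ hf => dihedral_cases (image_eq_dihedral hρ).1
    ((image_eq_dihedral hρ).2 ▸ hf)

theorem exists_refl_of_isDihedral (m : ℤ) : ∃ g : G, ∀ z,
    ρ.hom g z = Circle.exp (m * (2 * Real.pi / ρ.order)) * (starRingEnd ℂ) z := by
  have h : rotation (Circle.exp (m * (2 * Real.pi / ρ.order))) * Complex.conjLIE ∈ ρ.image := by
    rw [(image_eq_dihedral hρ).2]
    exact mul_mem (rotation_mem_dihedral _ m) (conj_mem_dihedral _)
  obtain ⟨g, hg⟩ := h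
  refine ⟨g, fun z => ?_⟩
  rw [hg]
  change rotation _ (Complex.conjLIE z) = _
  rw [rotation_apply, Complex.conjLIE_apply]

theorem exists_rot_of_isDihedral (m : ℤ) : ∃ g : G, ∀ z,
    ρ.hom g z = Circle.exp (m * (2 * Real.pi / ρ.order)) * z := by
  have h : rotation (Circle.exp (m * (2 * Real.pi / ρ.order))) ∈ ρ.image := by
    rw [(image_eq_dihedral hρ).2]
    exact rotation_mem_dihedral _ m
  obtain ⟨g, hg⟩ := h
  exact ⟨g, fun z => by rw [hg, rotation_apply]⟩

theorem cases_of_isDihedral (g : G) : ∃ ζ : Circle, ζ ^ ρ.order = 1 ∧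
    ((∀ z, ρ.hom g z = ζ * z) ∨ ∀ z, ρ.hom g z = ζ * (starRingEnd ℂ) z) :=
  dihedral_cases (image_eq_dihedral hρ).1 ((image_eq_dihedral hρ).2 ▸ ⟨g, rfl⟩)

/-- Two points of the dihedral arc in one orbit coincide, and only the ends are fixed by an element
outside `H`, namely the reflection in the line through that end. -/
theorem arc_aux {k : G} {s t : unitInterval}
    (h : k • ρ.arc (Real.pi / ρ.order) t = ρ.arc (Real.pi / ρ.order) s) :
    t = s ∧ (k ∈ ρ.H ∨ ((t = 0 ∨ t = 1) ∧ ∀ z, ρ.hom k z =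
      Circle.exp (2 * (Real.pi / ρ.order * t)) * (starRingEnd ℂ) z)) := by
  have hn := (image_eq_dihedral hρ).1
  have hn' : (ρ.order : ℝ) ≠ 0 := by
    have : 0 < ρ.order := hn
    positivity
  have hpi := Real.pi_pos
  -- Raising to the power `ρ.order` removes the root of unity in `k`; what remains is that `t` or
  -- `-t` differs from `s` by an even integer.
  have hpow : ∀ x : ℝ, Circle.exp (Real.pi / ρ.order * x) ^ ρ.order = Circle.exp (Real.pi * x) := by
    intro x
    rw [← Circle.exp_natCast_mul]
    congr 1
    field_simp
  obtain ⟨ζ, hζ, hk | hk⟩ := cases_of_isDihedral hρ k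
  · rw [arc, arc, smul_rot hk] at h
    have h₁ := ρ.pt_injective h
    have h₂ : Circle.exp (Real.pi * t) = Circle.exp (Real.pi * s) := by
      rw [← hpow, ← hpow, ← h₁, mul_pow, hζ, one_mul]
    obtain ⟨m, hm⟩ := Circle.exp_eq_exp.1 h₂
    have h₃ : (t : ℝ) = s + m * 2 := by
      apply mul_left_cancel₀ hpi.ne'
      rw [hm]
      ring
    have hm0 : m = 0 := by
      have h₄ : (m : ℝ) < 1 := by linarith [t.2.2, s.2.1]
      have h₅ : (-1 : ℝ) < m := by linarith [t.2.1, s.2.2]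
      have : m < 1 := by exact_mod_cast h₄
      have : -1 < m := by exact_mod_cast h₅
      omega
    have hts : t = s := by
      ext
      rw [h₃, hm0]
      simp
    subst hts
    exact ⟨rfl, Or.inl (mem_H_of_rot hk (mul_eq_right.1 h₁))⟩
  · rw [arc, arc, smul_refl hk] at h
    have h₁ := ρ.pt_injective h
    have h₂ : Circle.exp (Real.pi * -t) = Circle.exp (Real.pi * s) := by
      rw [← hpow, ← hpow, ← h₁, mul_pow, hζ, one_mul, mul_neg, Circle.exp_neg]
    obtain ⟨m, hm⟩ := Circle.exp_eq_exp.1 h₂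
    have h₃ : -(t : ℝ) = s + m * 2 := by
      apply mul_left_cancel₀ hpi.ne'
      rw [hm]
      ring
    have h₄ : (m : ℝ) < 1 := by linarith [t.2.1, s.2.1]
    have h₅ : (-2 : ℝ) < m := by linarith [t.2.2, s.2.2]
    have h₄' : m < 1 := by exact_mod_cast h₄
    have h₅' : -2 < m := by exact_mod_cast h₅
    have hts : t = s ∧ (t = 0 ∨ t = 1) := by
      obtain rfl | rfl : m = 0 ∨ m = -1 := by omega
      · push_cast at h₃
        have e₁ : (t : ℝ) = 0 := by linarith [t.2.1, s.2.1]
        have e₂ : (s : ℝ) = 0 := by linarith [t.2.1, s.2.1]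
        exact ⟨Subtype.ext (e₁.trans e₂.symm), Or.inl (Subtype.ext e₁)⟩
      · push_cast at h₃
        have e₁ : (t : ℝ) = 1 := by linarith [t.2.2, s.2.2]
        have e₂ : (s : ℝ) = 1 := by linarith [t.2.2, s.2.2]
        exact ⟨Subtype.ext (e₁.trans e₂.symm), Or.inr (Subtype.ext e₁)⟩
    obtain ⟨rfl, ht⟩ := hts
    refine ⟨rfl, Or.inr ⟨ht, ?_⟩⟩
    have : ζ = Circle.exp (2 * (Real.pi / ρ.order * t)) := by
      rw [mul_inv_eq_iff_eq_mul] at h₁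
      rw [h₁, two_mul, Circle.exp_add]
    rwa [← this]

theorem intervalDomain : IntervalDomain ρ.H (ρ.arc (Real.pi / ρ.order)) where
  continuous := ρ.continuous_arc _
  smul_eq h t := smul_eq_of_mem_H h _
  eq_of_smul h := (arc_aux hρ h).1
  mem_of_smul h0 h1 h := by
    rcases (arc_aux hρ h).2 with h | ⟨h | h, -⟩
    · exact h
    · exact absurd h h0
    · exact absurd h h1
  cover z := by
    have hn := (image_eq_dihedral hρ).1
    have hn₀ : (0 : ℝ) < ρ.order := by
      have : 0 < ρ.order := hn
      positivity
    have hn' := hn₀.ne'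
    have hpi := Real.pi_pos
    obtain ⟨x, rfl⟩ := ρ.exists_pt z
    have hp : 0 < 2 * Real.pi / ρ.order := by positivity
    -- A rotation moves the angle into a period of length `2π/n`; if it falls in the second half, a
    -- reflection folds it onto the arc.
    obtain ⟨m, ⟨h₁, h₂⟩, -⟩ := existsUnique_sub_zsmul_mem_Ico hp x 0
    rw [zsmul_eq_mul] at h₁ h₂
    rw [zero_add] at h₂
    set y := x - m * (2 * Real.pi / ρ.order) with hy
    rcases le_total y (Real.pi / ρ.order) with h | h
    · obtain ⟨g, hg⟩ := exists_rot_of_isDihedral hρ m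
      refine ⟨g, ⟨y / (Real.pi / ρ.order), by positivity, (div_le_one (by positivity)).2 h⟩, ?_⟩
      rw [arc, smul_rot hg, ← Circle.exp_add]
      congr 2
      field_simp
      rw [hy]
      field_simp
      ring
    · obtain ⟨g, hg⟩ := exists_refl_of_isDihedral hρ (m + 1)
      refine ⟨g, ⟨(2 * Real.pi / ρ.order - y) / (Real.pi / ρ.order), by
        have : 0 ≤ 2 * Real.pi / ρ.order - y := by linarith
        positivity, (div_le_one (by positivity)).2 (by
        have : 2 * Real.pi / ρ.order = 2 * (Real.pi / ρ.order) := by ring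
        linarith)⟩, ?_⟩
      rw [arc, smul_refl hg, ← Circle.exp_neg, ← Circle.exp_add]
      congr 2
      push_cast
      rw [hy]
      field_simp
      ring

theorem exists_indexTwo_arc {t : unitInterval} (ht : t = 0 ∨ t = 1) : ∃ c : G,
    c ∈ MulAction.stabilizer G (ρ.arc (Real.pi / ρ.order) t) ∧ c ∉ ρ.H ∧
    ∀ k ∈ MulAction.stabilizer G (ρ.arc (Real.pi / ρ.order) t), k ∈ ρ.H ∨ c⁻¹ * k ∈ ρ.H := by
  -- The reflection in the line through the end at angle `α` is `z ↦ exp(2 i α) * conj z`.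
  have h : ∃ c : G, ∀ z, ρ.hom c z =
      Circle.exp (2 * (Real.pi / ρ.order * t)) * (starRingEnd ℂ) z := by
    rcases ht with rfl | rfl
    · obtain ⟨c, hc⟩ := exists_refl_of_isDihedral hρ 0
      exact ⟨c, fun z => by rw [hc]; simp⟩
    · obtain ⟨c, hc⟩ := exists_refl_of_isDihedral hρ 1
      refine ⟨c, fun z => ?_⟩
      have : Circle.exp ((1 : ℤ) * (2 * Real.pi / ρ.order)) =
          Circle.exp (2 * (Real.pi / ρ.order * (1 : unitInterval))) := by
        congr 1
        push_cast
        ring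
      rw [hc, this]
  obtain ⟨c, hc⟩ := h
  refine ⟨c, ?_, notMem_H_of_refl hc, fun k hk => ?_⟩
  · rw [MulAction.mem_stabilizer_iff, arc, smul_refl hc]
    congr 1
    rw [two_mul, Circle.exp_add, mul_inv_cancel_right]
  · rcases (arc_aux hρ hk).2 with h | ⟨-, h⟩
    · exact Or.inl h
    · exact Or.inr (inv_mul_mem_H_of_refl hc h)

end Dihedral

section Rotations

theorem rot_of_le_SO2 (hρ : ρ.image ≤ SO2) (g : G) : ∃ ζ : Circle, ∀ z, ρ.hom g z = ζ * z := by
  obtain ⟨ζ, hζ⟩ := hρ ⟨g, rfl⟩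
  exact ⟨ζ, fun z => by rw [← hζ, rotation_apply]⟩

theorem stabilizer_eq_of_le_SO2 (hρ : ρ.image ≤ SO2) (z : ρ.S) :
    MulAction.stabilizer G z = ρ.H := by
  refine le_antisymm (fun g hg => ?_) (H_le_stabilizer z)
  obtain ⟨x, rfl⟩ := ρ.exists_pt z
  obtain ⟨ζ, hζ⟩ := rot_of_le_SO2 hρ g
  rw [MulAction.mem_stabilizer_iff, smul_rot hζ] at hg
  exact mem_H_of_rot hζ (mul_eq_right.1 (ρ.pt_injective hg))

theorem transitive_of_SO2_le (hρ : SO2 ≤ ρ.image) (w : ρ.S) : ∃ g : G, g • ρ.pt 1 = w := by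
  obtain ⟨x, rfl⟩ := ρ.exists_pt w
  obtain ⟨g, hg⟩ := hρ ⟨Circle.exp x, rfl⟩
  refine ⟨g, ?_⟩
  rw [smul_rot (ζ := Circle.exp x) (fun z => by rw [hg, rotation_apply]), mul_one]

theorem exists_indexTwo_of_top (hρ : ρ.image = ⊤) : ∃ c : G,
    c ∈ MulAction.stabilizer G (ρ.pt 1) ∧ c ∉ ρ.H ∧
    ∀ k ∈ MulAction.stabilizer G (ρ.pt 1), k ∈ ρ.H ∨ c⁻¹ * k ∈ ρ.H := by
  obtain ⟨c, hc⟩ : Complex.conjLIE ∈ ρ.image := by rw [hρ]; trivial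
  have hc' : ∀ z, ρ.hom c z = ((1 : Circle) : ℂ) * (starRingEnd ℂ) z := fun z => by
    rw [hc, Complex.conjLIE_apply, Circle.coe_one, one_mul]
  refine ⟨c, ?_, notMem_H_of_refl hc', fun k hk => ?_⟩
  · rw [MulAction.mem_stabilizer_iff, smul_refl hc']
    simp
  · obtain ⟨ζ, h | h⟩ := ρ.exists_rot_or_refl k
    · rw [MulAction.mem_stabilizer_iff, smul_rot h] at hk
      exact Or.inl (mem_H_of_rot h (mul_eq_right.1 (ρ.pt_injective hk)))
    · rw [MulAction.mem_stabilizer_iff, smul_refl h] at hk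
      have : ζ = 1 := by simpa using ρ.pt_injective hk
      subst this
      exact Or.inr (inv_mul_mem_H_of_refl hc' h)

/-- The angles of the rotations in the image form a subgroup of the reals, closed because `G` is
compact. It is not dense, since the image is proper, so it is cyclic, and it contains `2π`. -/
theorem exists_generator [CompactSpace G] (hρ : ρ.image < SO2) : ∃ (a : ℝ) (n : ℕ), 0 < a ∧
    0 < n ∧ n * a = 2 * Real.pi ∧
    (∀ x : ℝ, rotation (Circle.exp x) ∈ ρ.image ↔ ∃ m : ℤ, x = m * a) := by
  let P : AddSubgroup ℝ :=
    { carrier := {x | rotation (Circle.exp x) ∈ ρ.image}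
      add_mem' := fun {x y} hx hy => by
        change rotation (Circle.exp (x + y)) ∈ ρ.image
        rw [Circle.exp_add, map_mul]
        exact mul_mem hx hy
      zero_mem' := by
        change rotation (Circle.exp 0) ∈ ρ.image
        rw [Circle.exp_zero, map_one]
        exact one_mem _
      neg_mem' := fun {x} hx => by
        change rotation (Circle.exp (-x)) ∈ ρ.image
        rw [Circle.exp_neg, map_inv]
        exact inv_mem hx }
  have hPmem : ∀ x, x ∈ P ↔ rotation (Circle.exp x) ∈ ρ.image := fun x => Iff.rfl
  have hPcl : IsClosed (P : Set ℝ) := by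
    have h₁ : (P : Set ℝ) = (fun x : ℝ => (Circle.exp x : ℂ)) ⁻¹' Set.range fun g => ρ.hom g 1 := by
      ext x
      constructor
      · rintro ⟨g, hg⟩
        exact ⟨g, by
          dsimp only
          rw [hg, rotation_apply, mul_one]⟩
      · rintro ⟨g, hg⟩
        obtain ⟨ζ, hζ⟩ := rot_of_le_SO2 hρ.le g
        refine ⟨g, LinearIsometryEquiv.ext fun z => ?_⟩
        dsimp only at hg
        rw [hζ, mul_one] at hg
        rw [hζ, hg, rotation_apply]
    rw [h₁]
    exact (isCompact_range (ρ.continuous_hom 1)).isClosed.preimage (by fun_prop)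
  have h2pi : 2 * Real.pi ∈ P := by
    rw [hPmem, Circle.exp_two_pi, map_one]
    exact one_mem _
  rcases AddSubgroup.dense_or_cyclic P with h | ⟨a, ha⟩
  · exfalso
    have hP : (P : Set ℝ) = Set.univ := by rw [← hPcl.closure_eq, h.closure_eq]
    refine hρ.not_ge ?_
    rintro _ ⟨ζ, rfl⟩
    obtain ⟨x, rfl⟩ := Circle.exp_surjective ζ
    have : x ∈ (P : Set ℝ) := by rw [hP]; trivial
    exact this
  · rw [← AddSubgroup.zmultiples_eq_closure] at ha
    have hpi := Real.pi_pos
    have key : ∀ a : ℝ, 0 < a → P = AddSubgroup.zmultiples a → ∃ (a : ℝ) (n : ℕ), 0 < a ∧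
        0 < n ∧ n * a = 2 * Real.pi ∧
        (∀ x : ℝ, rotation (Circle.exp x) ∈ ρ.image ↔ ∃ m : ℤ, x = m * a) := by
      intro a ha0 ha
      rw [ha] at h2pi
      obtain ⟨n, hn⟩ := AddSubgroup.mem_zmultiples_iff.1 h2pi
      rw [zsmul_eq_mul] at hn
      have hn0 : 0 < n := by
        by_contra hc
        have : (n : ℝ) ≤ 0 := by exact_mod_cast not_lt.1 hc
        nlinarith
      obtain ⟨n, rfl⟩ := Int.eq_ofNat_of_zero_le hn0.le
      refine ⟨a, n, ha0, by exact_mod_cast hn0, by exact_mod_cast hn, fun x => ?_⟩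
      rw [← hPmem, ha, AddSubgroup.mem_zmultiples_iff]
      exact exists_congr fun m => by rw [zsmul_eq_mul, eq_comm]
    rcases lt_trichotomy a 0 with h | h | h
    · refine key (-a) (neg_pos.2 h) ?_
      rw [ha, AddSubgroup.zmultiples_neg]
    · rw [ha, h] at h2pi
      simp at h2pi
    · exact key a h ha

theorem exists_cyclicDomain [CompactSpace G] [IsTopologicalGroup G] (hρ : ρ.image < SO2) :
    IsOpen (ρ.H : Set G) ∧ ∃ (a : ℝ) (g₀ : G), CyclicDomain ρ.H (ρ.arc a) g₀ := by
  obtain ⟨a, n, ha, hn, hna, h⟩ := exists_generator hρ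
  refine ⟨ρ.isOpen_H hn ?_, ?_⟩
  · rintro f ⟨g, rfl⟩
    obtain ⟨ζ, hζ⟩ := rot_of_le_SO2 hρ.le g
    obtain ⟨x, rfl⟩ := Circle.exp_surjective ζ
    refine ⟨_, ?_, Or.inl hζ⟩
    obtain ⟨m, rfl⟩ := (h x).1 ⟨g, LinearIsometryEquiv.ext fun z => by rw [hζ, rotation_apply]⟩
    rw [← Circle.exp_natCast_mul, Circle.exp_eq_one]
    exact ⟨m, by rw [← hna]; ring⟩
  · obtain ⟨g₀, hg₀⟩ := (h a).2 ⟨1, by simp⟩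
    have hg₀' : ∀ z, ρ.hom g₀ z = Circle.exp a * z := fun z => by rw [hg₀, rotation_apply]
    have hmul : ∀ {k : G} {ζ : Circle}, (∀ z, ρ.hom k z = ζ * z) →
        ∀ z, ρ.hom (g₀ * k) z = (Circle.exp a * ζ : Circle) * z := fun {k ζ} hk z => by
      rw [map_mul]
      change ρ.hom g₀ (ρ.hom k z) = _
      rw [hk, hg₀', Circle.coe_mul, mul_assoc]
    have hinv : ∀ {k : G} {ζ : Circle}, (∀ z, ρ.hom k z = ζ * z) →
        ∀ z, ρ.hom (g₀⁻¹ * k) z = ((Circle.exp a)⁻¹ * ζ : Circle) * z := fun {k ζ} hk z => by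
      apply (ρ.hom g₀).injective
      change (ρ.hom g₀ * ρ.hom (g₀⁻¹ * k)) z = _
      rw [← map_mul, mul_inv_cancel_left, hk, hg₀', ← mul_assoc, ← Circle.coe_mul,
        mul_inv_cancel_left]
    refine ⟨a, g₀, ⟨ρ.continuous_arc a, fun z => ?_, ?_, fun hk t => smul_eq_of_mem_H hk _, ?_⟩⟩
    · obtain ⟨x, rfl⟩ := ρ.exists_pt z
      obtain ⟨m, ⟨h₁, h₂⟩, -⟩ := existsUnique_sub_zsmul_mem_Ico ha x 0
      rw [zsmul_eq_mul] at h₁ h₂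
      rw [zero_add] at h₂
      obtain ⟨g, hg⟩ := (h (m * a)).2 ⟨m, rfl⟩
      refine ⟨g, ⟨(x - m * a) / a, by positivity, (div_le_one ha).2 h₂.le⟩, ?_⟩
      rw [arc, smul_rot (ζ := Circle.exp (m * a)) (fun z => by rw [hg, rotation_apply]),
        ← Circle.exp_add]
      congr 2
      field_simp
      ring
    · rw [arc_zero, arc_one, smul_rot hg₀', mul_one]
    · intro k s t hk
      obtain ⟨ζ, hζ⟩ := rot_of_le_SO2 hρ.le k
      rw [arc, arc, smul_rot hζ] at hk
      have h₁ := ρ.pt_injective hk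
      -- The difference of parameters is an integer between `-1` and `1`: zero gives equal points,
      -- and the values `1` and `-1` are the passages from one end to the other.
      have h₂ : ζ = Circle.exp (a * s - a * t) := by
        rw [Circle.exp_sub, eq_div_iff_mul_eq', h₁]
      obtain ⟨m, hm⟩ := (h (a * s - a * t)).1 ⟨k, LinearIsometryEquiv.ext fun z => by
        rw [hζ, rotation_apply, h₂]⟩
      have hm' : (s : ℝ) - t = m := by
        apply mul_left_cancel₀ ha.ne'
        rw [mul_sub, hm]
        ring
      have h₃ : (m : ℝ) ≤ 1 := by linarith [s.2.2, t.2.1]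
      have h₄ : (-1 : ℝ) ≤ m := by linarith [s.2.1, t.2.2]
      have h₃' : m ≤ 1 := by exact_mod_cast h₃
      have h₄' : -1 ≤ m := by exact_mod_cast h₄
      obtain rfl | rfl | rfl : m = 0 ∨ m = 1 ∨ m = -1 := by omega
      · refine Or.inl ⟨Subtype.ext (by push_cast at hm'; linarith), mem_H_of_rot hζ ?_⟩
        rw [h₂, hm]
        simp
      · push_cast at hm'
        refine Or.inr (Or.inl ⟨Subtype.ext ?_, Subtype.ext ?_, mem_H_of_rot (hinv hζ) ?_⟩)
        · change (t : ℝ) = 0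
          linarith [s.2.2, t.2.1]
        · change (s : ℝ) = 1
          linarith [s.2.2, t.2.1]
        · rw [h₂, hm]
          simp
      · push_cast at hm'
        refine Or.inr (Or.inr ⟨Subtype.ext ?_, Subtype.ext ?_, mem_H_of_rot (hmul hζ) ?_⟩)
        · change (t : ℝ) = 1
          linarith [s.2.1, t.2.2]
        · change (s : ℝ) = 0
          linarith [s.2.1, t.2.2]
        · rw [h₂, hm]
          simp

end Rotations

end OrthRep

end CircleGeometry

/-! ### Automorphisms and characters over the end groups -/

section MultipleCharacters

set_option linter.unusedSectionVars false

open Module Representation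

namespace IndexTwo

variable {N K : Type*} [Group N] [Group K] [TopologicalSpace N] [TopologicalSpace K]
  (E : IndexTwo N K) {U : Type*} [AddCommGroup U] [Module ℝ U] [FiniteDimensional ℝ U]

open Classical in
/-- A sum of copies of a module and of its twist. -/
noncomputable def signedPower (σ : Representation ℝ K U) {ι : Type*} (s : ι → Prop) :
    Representation ℝ K (ι → U) where
  toFun k := LinearMap.pi fun i =>
    (if s i then E.twist σ k else σ k).comp (LinearMap.proj i)
  map_one' := by
    refine LinearMap.ext fun v => funext fun i => ?_
    simp
  map_mul' k l := by
    refine LinearMap.ext fun v => funext fun i => ?_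
    by_cases h : s i <;> simp [h]

open Classical in
theorem signedPower_apply (σ : Representation ℝ K U) {ι : Type*} (s : ι → Prop) (k : K) (v : ι → U)
    (i : ι) : E.signedPower σ s k v i = if s i then E.twist σ k (v i) else σ k (v i) := by
  by_cases h : s i <;> simp [signedPower, h]

theorem signedPower_ι (σ : Representation ℝ K U) {ι : Type*} (s : ι → Prop) (n : N) (v : ι → U) :
    E.signedPower σ s (E.ι n) v = (E.res σ).power ι n v := by
  funext i
  rw [signedPower_apply, Representation.power_apply, twist_apply, sign_ι, one_smul, ite_self]
  rfl

open Classical in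
theorem character_signedPower (σ : Representation ℝ K U) {ι : Type*} [Fintype ι] (s : ι → Prop)
    (k : K) : (E.signedPower σ s).character k =
      ∑ i, if s i then E.sign k * σ.character k else σ.character k := by
  have : E.signedPower σ s k = ∑ i, (LinearMap.single ℝ (fun _ : ι => U) i).comp
      ((if s i then E.twist σ k else σ k).comp (LinearMap.proj i)) := by
    refine LinearMap.ext fun v => ?_
    have h := LinearMap.sum_single_apply (fun _ : ι => U) (E.signedPower σ s k v)
    rw [← h, LinearMap.sum_apply]
    refine Finset.sum_congr rfl fun i _ => ?_
    rw [signedPower_apply]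
    by_cases h : s i <;> simp [h]
  rw [Representation.character, this, map_sum]
  refine Finset.sum_congr rfl fun i _ => ?_
  rw [LinearMap.trace_comp_comm', LinearMap.comp_assoc]
  have h₁ : (LinearMap.proj i : (ι → U) →ₗ[ℝ] U).comp (LinearMap.single ℝ (fun _ : ι => U) i) =
      LinearMap.id := LinearMap.ext fun u => by simp
  rw [h₁, LinearMap.comp_id]
  by_cases h : s i
  · simp only [if_pos h]
    exact E.character_twist σ k
  · simp only [if_neg h]
    rfl

theorem isCont_signedPower [IsTopologicalGroup K] [CompactSpace N] [T2Space K]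
    {σ : Representation ℝ K U} (hσ : σ.IsCont) {ι : Type*} [Fintype ι] (s : ι → Prop) :
    (E.signedPower σ s).IsCont := by
  classical
  intro v l
  have : (fun k => l (E.signedPower σ s k v)) = fun k => ∑ i,
      (l.comp (LinearMap.single ℝ (fun _ : ι => U) i))
        (if s i then E.twist σ k (v i) else σ k (v i)) := by
    funext k
    conv_lhs => rw [← LinearMap.sum_single_apply (fun _ : ι => U) (E.signedPower σ s k v)]
    rw [map_sum]
    refine Finset.sum_congr rfl fun i _ => ?_
    rw [signedPower_apply]
    rfl
  rw [this]
  refine continuous_finsetSum _ fun i _ => ?_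
  by_cases h : s i
  · simp only [if_pos h]
    exact E.isCont_twist hσ (v i) _
  · simp only [if_neg h]
    exact hσ (v i) _

end IndexTwo

theorem IntertwiningMap.scalar_of_equiv {K U U' : Type*} [Group K] [AddCommGroup U] [Module ℝ U]
    [AddCommGroup U'] [Module ℝ U'] {τ : Representation ℝ K U} {τ' : Representation ℝ K U'}
    (e : τ.Equiv τ') (hR : ∀ f : IntertwiningMap τ τ, ∃ r : ℝ, ∀ u, f u = r • u)
    (f : IntertwiningMap τ' τ') : ∃ r : ℝ, ∀ u, f u = r • u := by
  obtain ⟨r, hr⟩ := hR ((e.symm.toIntertwiningMap.comp f).comp e.toIntertwiningMap)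
  refine ⟨r, fun u => ?_⟩
  have := hr (e.symm u)
  change e.symm (f (e (e.symm u))) = r • e.symm u at this
  rw [e.apply_symm_apply] at this
  apply e.symm.toLinearEquiv.injective
  exact this.trans (map_smul e.symm.toLinearMap r u).symm

namespace IndexTwo

variable {N K : Type*} [Group N] [Group K] [TopologicalSpace N] [TopologicalSpace K]
  [IsTopologicalGroup N] [IsTopologicalGroup K] [CompactSpace N] [CompactSpace K] [T2Space K]
  (E : IndexTwo N K) {U V V' : Type*} [AddCommGroup U] [Module ℝ U] [FiniteDimensional ℝ U]
  [AddCommGroup V] [Module ℝ V] [FiniteDimensional ℝ V]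
  [AddCommGroup V'] [Module ℝ V'] [FiniteDimensional ℝ V'] {τ : Representation ℝ N U}

theorem exists_equiv_signedPower (hτ : τ.IsCont) (hirr : τ.IsIrreducible)
    {X : Representation ℝ K U} (hX : X.IsCont) (hX' : ∀ n, X.character (E.ι n) = τ.character n)
    {σ : Representation ℝ K V} (hσ : σ.IsCont) {m : ℕ}
    (h : ∀ n, σ.character (E.ι n) = m * τ.character n) :
    ∃ (ι : Type) (_ : Fintype ι) (_ : DecidableEq ι) (s : ι → Prop),
      Nonempty (σ.Equiv (E.signedPower X s)) := by
  classical
  obtain ⟨a, b, -, hab⟩ := E.character_of_mem_ext hτ hirr ⟨hX.isRealCharacter, hX'⟩ hσ h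
  refine ⟨Fin a ⊕ Fin b, inferInstance, inferInstance, fun i => i.isRight = true,
    exists_equiv_of_character_eq hσ (E.isCont_signedPower hX _) fun k => ?_⟩
  rw [hab, character_signedPower, Fintype.sum_sum_type]
  simp

/-- If `χ` is of real type and extends, every component of the group of automorphisms over the
subgroup contains an automorphism over the whole group. -/
theorem exists_joined_automorphism (hτ : τ.IsCont) (hirr : τ.IsIrreducible)
    (hR : ∀ f : IntertwiningMap τ τ, ∃ r : ℝ, ∀ u, f u = r • u)
    (hX : (E.Ext τ.character).Nonempty) {σ : Representation ℝ K V} (hσ : σ.IsCont) {m : ℕ}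
    (h : ∀ n, σ.character (E.ι n) = m * τ.character n) (f : (E.res σ).Equiv (E.res σ)) :
    ∃ (r : σ.Equiv σ) (r' : (E.res σ).Equiv (E.res σ)), (∀ v, r' v = r v) ∧ Joined r' f := by
  obtain ⟨ψ, hψ, hψ'⟩ := hX
  obtain ⟨d, X, hXc, rfl⟩ := hψ.exists_isCont
  obtain ⟨e₀⟩ := exists_equiv_of_character_eq hτ (E.isCont_res hXc) (fun n => (hψ' n).symm)
  have hX₂ : ∀ n, X.character (E.ι n) = (E.res X).character n := fun n => rfl
  have h' : ∀ n, σ.character (E.ι n) = m * (E.res X).character n := fun n => by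
    rw [h, ← hX₂, hψ']
  obtain ⟨ι, _, _, s, ⟨e⟩⟩ := E.exists_equiv_signedPower (E.isCont_res hXc)
    (hirr.of_equiv e₀) hXc hX₂ hσ h'
  have hR' := IntertwiningMap.scalar_of_equiv e₀ hR
  let i : (E.res σ).Equiv ((E.res X).power ι) := Representation.Equiv.mk e.toLinearEquiv
    fun n => LinearMap.ext fun v =>
      (IntertwiningMap.isIntertwining _ _ e.toIntertwiningMap (E.ι n) v).trans
        (E.signedPower_ι X s n (e v))
  have hi : ∀ v, i v = e v := fun v => rfl
  let f₀ : ((E.res X).power ι).Equiv ((E.res X).power ι) := (i.symm.trans f).trans i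
  have hf₀ : ∀ v, f₀ v = i (f (i.symm v)) := fun v => rfl
  obtain ⟨M, hM⟩ := exists_matrix hR' (LinearEquiv.refl ℝ _) (α := fun k => k) (fun _ _ => rfl)
    f₀.toLinearMap fun k u => IntertwiningMap.isIntertwining _ _ f₀.toIntertwiningMap k u
  obtain ⟨M', hM'⟩ := exists_matrix hR' (LinearEquiv.refl ℝ _) (α := fun k => k) (fun _ _ => rfl)
    f₀.symm.toLinearMap fun k u => IntertwiningMap.isIntertwining _ _ f₀.symm.toIntertwiningMap k u
  have hnt := (hirr.of_equiv e₀).nontrivial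
  have hMM : M' * M = 1 := by
    refine matAct_injective (U := Fin d → ℝ) (γ := LinearMap.id) Function.injective_id fun w => ?_
    have := matAct_matAct M' M (LinearMap.id : (Fin d → ℝ) →ₗ[ℝ] _) LinearMap.id w
    rw [LinearMap.comp_id] at this
    rw [← this, matAct_one_id]
    have h₁ : matAct M LinearMap.id w = f₀ w := (hM w).symm
    have h₂ : matAct M' LinearMap.id (f₀ w) = f₀.symm (f₀ w) := (hM' _).symm
    rw [h₁, h₂, f₀.symm_apply_apply]
  have hdet : M.det ≠ 0 := fun h0 => by
    have := congrArg Matrix.det hMM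
    rw [Matrix.det_mul, h0, mul_zero, Matrix.det_one] at this
    exact zero_ne_one this
  have key : ∀ D : ((E.res X).power ι).Equiv ((E.res X).power ι),
      (∀ k v, D (E.signedPower X s k v) = E.signedPower X s k (D v)) → Joined D f₀ →
      ∃ (r : σ.Equiv σ) (r' : (E.res σ).Equiv (E.res σ)), (∀ v, r' v = r v) ∧ Joined r' f := by
    intro D hD hj
    refine ⟨(e.trans (Representation.Equiv.mk (σ := E.signedPower X s) (ρ := E.signedPower X s)
      D.toLinearEquiv fun k => LinearMap.ext (hD k))).trans e.symm, (i.trans D).trans i.symm,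
      fun v => rfl, ?_⟩
    have hj' := (hj.map (continuous_trans_left i)).map (continuous_trans_right i.symm)
    have : (i.trans f₀).trans i.symm = f := Representation.Equiv.ext (funext fun v => by
      change i.symm (i (f (i.symm (i v)))) = f v
      rw [i.symm_apply_apply, i.symm_apply_apply])
    rwa [this] at hj'
  -- Over `K` the module is a sum of copies of `X` and of its twist, so diagonal matrices commute
  -- with `K`. The identity lies in the component of positive determinant; the reflection `Dm` in a
  -- single copy lies in the other one.
  rcases lt_or_gt_of_ne hdet with hneg | hpos
  · have hne : Nonempty ι := by
      by_contra hc
      rw [not_nonempty_iff] at hc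
      rw [Matrix.det_isEmpty] at hneg
      linarith
    obtain ⟨j⟩ := hne
    let Dm : Matrix ι ι ℝ := Matrix.diagonal fun i => if i = j then -1 else 1
    have hDd : Dm.det = -1 := by
      rw [Matrix.det_diagonal, Finset.prod_ite_eq' Finset.univ j]
      simp
    have hDu : IsUnit Dm.det := by rw [hDd]; simp
    let D := matEquiv (E.res X) Dm hDu
    have hDa : ∀ v i, D v i = (if i = j then (-1 : ℝ) else 1) • v i := by
      intro v i
      change matAct Dm LinearMap.id v i = _
      rw [matAct_apply, Finset.sum_eq_single i]
      · simp [Dm]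
      · intro k _ hk
        simp [Dm, Matrix.diagonal_apply_ne _ hk.symm]
      · simp
    have hDD : ∀ v, D (D v) = v := by
      intro v
      funext i
      rw [hDa, hDa]
      by_cases h : i = j <;> simp [h]
    refine key D (fun k v => funext fun i => ?_) ?_
    · rw [hDa, signedPower_apply, signedPower_apply, hDa]
      by_cases h : s i <;> by_cases h' : i = j <;> simp [h, h']
    · have h₁ : Joined (f₀.trans D) (Representation.Equiv.refl _) := by
        refine joined_matEquiv (Dm * M) ?_ _ fun u => ?_
        · rw [Matrix.det_mul, hDd]
          linarith
        · have := matAct_matAct Dm M (LinearMap.id : (Fin d → ℝ) →ₗ[ℝ] _) LinearMap.id u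
          rw [LinearMap.comp_id] at this
          rw [← this]
          exact congrArg (matAct Dm LinearMap.id) (hM u)
      have h₂ := h₁.map (continuous_trans_right D)
      have e₁ : (f₀.trans D).trans D = f₀ := Representation.Equiv.ext (funext fun v => hDD (f₀ v))
      have e₂ : (Representation.Equiv.refl _).trans D = D := rfl
      rw [e₁, e₂] at h₂
      exact h₂.symm
  · exact key (Representation.Equiv.refl _) (fun _ _ => rfl)
      (joined_matEquiv M hpos f₀ fun u => hM u).symm

end IndexTwo

section Ends

variable {G : Type*} [Group G] [TopologicalSpace G]

/-- The characters of real `K`-modules that restrict to `m` times `χ`. -/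
def multChars {H : Subgroup G} (χ : H → ℝ) (K : Subgroup G) (m : ℕ) : Set (K → ℝ) :=
  {ψ | IsRealCharacter ψ ∧ ∀ (h : G) (hH : h ∈ H) (hK : h ∈ K), ψ ⟨h, hK⟩ = m * χ ⟨h, hH⟩}

/-- A description of the characters over multiples of `χ`, with `e` extensions of `χ`. -/
def EndType {H : Subgroup G} (χ : H → ℝ) (K : Subgroup G) (e : ℕ∞) : Prop :=
  (e = 0 ∧ ∃ ψ : K → ℝ, ψ ≠ 0 ∧ ∀ m φ, φ ∈ multChars χ K m ↔ ∃ k : ℕ, m = 2 * k ∧ φ = k • ψ) ∨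
  (e = 1 ∧ ∃ ψ : K → ℝ, ψ ≠ 0 ∧ ∀ m φ, φ ∈ multChars χ K m ↔ φ = m • ψ) ∨
  (e = 2 ∧ ∃ (ψ : K → ℝ) (η : K →* ℝ), Continuous η ∧ (∀ k : K, (k : G) ∈ H → η k = 1) ∧
    (∀ k, η k * η k = 1) ∧
    (∀ a b a' b' : ℕ, a • ψ + b • (η * ψ) = a' • ψ + b' • (η * ψ) → a = a' ∧ b = b') ∧
    ∀ m φ, φ ∈ multChars χ K m ↔ ∃ a b : ℕ, a + b = m ∧ φ = a • ψ + b • (η * ψ))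

variable [IsTopologicalGroup G] [T2Space G] {H K : Subgroup G} [CompactSpace H] [CompactSpace K]
  {U : Type*} [AddCommGroup U] [Module ℝ U] [FiniteDimensional ℝ U] {τ : Representation ℝ H U}

theorem character_one_ne_zero {K : Type*} [Group K] {σ : Representation ℝ K U} [Nontrivial U] :
    σ.character 1 ≠ 0 := by
  rw [Representation.char_one]
  exact_mod_cast (finrank_pos (R := ℝ) (M := U)).ne'

theorem endType_self (hτ : τ.IsCont) (hirr : τ.IsIrreducible) : EndType τ.character H 1 := by
  have := hirr.nontrivial
  refine Or.inr (Or.inl ⟨rfl, τ.character, fun h => character_one_ne_zero (congrFun h 1),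
    fun m φ => ⟨fun ⟨_, h⟩ => ?_, ?_⟩⟩)
  · funext k
    rw [h k k.2 k.2]
    simp
  · rintro rfl
    refine ⟨?_, fun h hH _ => by simp⟩
    have := (hτ.power (Fin m)).isRealCharacter
    convert! this using 1
    funext k
    rw [Representation.character_power]
    simp

theorem encard_extensions_self {ρ : OrthRep G} {χ : ρ.H → ℝ} (hχ : IsRealCharacter χ) :
    (ρ.extensions χ ρ.H).encard = 1 := by
  rw [Set.encard_eq_one]
  refine ⟨χ, Set.eq_singleton_iff_unique_mem.2 ⟨⟨hχ, fun h hH _ => rfl⟩, fun ψ hψ => ?_⟩⟩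
  funext k
  exact hψ.2 k k.2 k.2

/-- Without an extension everything is a multiple of the induced character. With one, everything is
a combination of it and its twist, and the trichotomy is completed by whether these two coincide. -/
theorem endType_of_indexTwo [H.Normal] (hHK : H ≤ K) {c : G} (hcK : c ∈ K) (hcH : c ∉ H)
    (hc : ∀ k ∈ K, k ∈ H ∨ c⁻¹ * k ∈ H) (hτ : τ.IsCont) (hirr : τ.IsIrreducible)
    (hinv : ∀ (g : G) (h : H), τ.character (MulAut.conjNormal g⁻¹ h) = τ.character h) :
    EndType τ.character K ((IndexTwo.ofSubgroup hHK c hcK hcH hc).Ext τ.character).encard := by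
  set E := IndexTwo.ofSubgroup hHK c hcK hcH hc with hE
  have hnt := hirr.nontrivial
  have hι : ∀ (h : G) (hH : h ∈ H) (hK : h ∈ K), (⟨h, hK⟩ : K) = E.ι ⟨h, hH⟩ := fun _ _ _ => rfl
  have hmem : ∀ {m : ℕ} {φ : K → ℝ}, φ ∈ multChars τ.character K m ↔
      IsRealCharacter φ ∧ ∀ n, φ (E.ι n) = m * τ.character n := fun {m φ} =>
    ⟨fun h => ⟨h.1, fun n => h.2 n n.2 _⟩, fun h => ⟨h.1, fun x hH hK => h.2 ⟨x, hH⟩⟩⟩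
  by_cases hX : E.Ext τ.character = ∅
  · left
    refine ⟨by rw [hX, Set.encard_empty], (E.ind τ).character, fun h => ?_, fun m φ => ?_⟩
    · have h₁ := E.character_ind_ι τ (hinv c) 1
      rw [map_one] at h₁
      have := congrFun h 1
      rw [h₁] at this
      exact character_one_ne_zero (σ := τ) (by
        have h0 : (0 : K → ℝ) 1 = 0 := rfl
        rw [h0] at this
        linarith)
    · rw [hmem]
      constructor
      · rintro ⟨hφ, h⟩
        obtain ⟨d, σ, hσ, rfl⟩ := hφ.exists_isCont
        obtain ⟨k, rfl, hk⟩ := E.character_of_ext_empty hτ hirr (hinv c) hX hσ h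
        refine ⟨k, rfl, funext fun x => ?_⟩
        by_cases hx : ∃ n, x = E.ι n
        · obtain ⟨n, rfl⟩ := hx
          rw [h, Pi.smul_apply, E.character_ind_ι τ (hinv c)]
          simp
          ring
        · rw [hk x hx, Pi.smul_apply, E.character_ind_of_notMem τ hx, smul_zero]
      · rintro ⟨k, rfl, rfl⟩
        refine ⟨?_, fun n => ?_⟩
        · have := ((E.isCont_ind τ hτ).power (Fin k)).isRealCharacter
          convert! this using 1
          funext x
          rw [Representation.character_power]
          simp
        · rw [Pi.smul_apply, E.character_ind_ι τ (hinv c)]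
          simp
          ring
  · right
    obtain ⟨ψ, hψ⟩ := Set.nonempty_iff_ne_empty.2 hX
    have hpair := E.ext_eq_pair hτ hirr hψ
    have hψ' := hψ
    obtain ⟨hψr, hψι⟩ := hψ'
    obtain ⟨d, X, hXc, rfl⟩ := hψr.exists_isCont
    have hreal : ∀ a b : ℕ, IsRealCharacter
        (a • X.character + b • (fun k => E.sign k * X.character k)) := by
      intro a b
      classical
      have := (E.isCont_signedPower hXc (ι := Fin a ⊕ Fin b)
        (fun i => i.isRight = true)).isRealCharacter
      convert! this using 1
      funext k
      rw [IndexTwo.character_signedPower, Fintype.sum_sum_type]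
      simp
    have hiff : ∀ m φ, φ ∈ multChars τ.character K m ↔ ∃ a b : ℕ, a + b = m ∧
        φ = a • X.character + b • (fun k => E.sign k * X.character k) := by
      intro m φ
      rw [hmem]
      constructor
      · rintro ⟨hφ, h⟩
        obtain ⟨d', σ, hσ, rfl⟩ := hφ.exists_isCont
        obtain ⟨a, b, hab, h⟩ := E.character_of_mem_ext hτ hirr hψ hσ h
        refine ⟨a, b, hab, funext fun x => ?_⟩
        rw [h x]
        simp
      · rintro ⟨a, b, rfl, rfl⟩
        refine ⟨hreal a b, fun n => ?_⟩
        change a • X.character (E.ι n) + b • (E.sign (E.ι n) * X.character (E.ι n)) = _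
        rw [E.sign_ι, hψι, nsmul_eq_mul, nsmul_eq_mul]
        push_cast
        ring
    have hX1 : X.character 1 ≠ 0 := by
      have := hψι 1
      rw [map_one] at this
      rw [this]
      exact character_one_ne_zero
    -- An extension equal to its twist vanishes off `H` and is the only one.
    by_cases htw : X.character = fun k => E.sign k * X.character k
    · left
      refine ⟨?_, X.character, fun h => hX1 (congrFun h 1), fun m φ => ?_⟩
      · rw [hpair, ← htw, Set.pair_eq_singleton, Set.encard_singleton]
      · rw [hiff]
        constructor
        · rintro ⟨a, b, rfl, rfl⟩
          rw [← htw, add_smul]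
        · rintro rfl
          exact ⟨m, 0, add_zero m, by rw [zero_smul, add_zero]⟩
    · right
      -- Evaluation at `1` and at such an element determines `a + b` and `a - b`, which gives
      -- independence of the extension and its twist.
      have hne : ∃ k, E.sign k = -1 ∧ X.character k ≠ 0 := by
        by_contra! hc
        refine htw (funext fun k => ?_)
        rcases mul_self_eq_one_iff.1 (E.sign_sq k) with h | h
        · rw [h, one_mul]
        · rw [hc k h, mul_zero]
      obtain ⟨k₀, hk₀, hk₀'⟩ := hne
      refine ⟨?_, X.character,
        { toFun := E.sign, map_one' := by rw [← map_one E.ι, E.sign_ι], map_mul' := E.sign_mul },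
        E.continuous_sign, fun k hk => E.sign_ι ⟨k, hk⟩, E.sign_sq, ?_, hiff⟩
      · rw [hpair, Set.encard_pair htw]
      · intro a b a' b' h
        have h₁ := congrFun h 1
        have h₂ := congrFun h k₀
        have hs1 : E.sign 1 = 1 := by rw [← map_one E.ι, E.sign_ι]
        change a • X.character 1 + b • (E.sign 1 * X.character 1) =
          a' • X.character 1 + b' • (E.sign 1 * X.character 1) at h₁
        change a • X.character k₀ + b • (E.sign k₀ * X.character k₀) =
          a' • X.character k₀ + b' • (E.sign k₀ * X.character k₀) at h₂
        rw [hs1] at h₁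
        rw [hk₀] at h₂
        simp only [nsmul_eq_mul] at h₁ h₂
        have e₁ : (a : ℝ) + b = a' + b' := mul_right_cancel₀ hX1 (by linarith)
        have e₂ : (a : ℝ) - b = a' - b' := mul_right_cancel₀ hk₀' (by linarith)
        exact ⟨by exact_mod_cast (by linarith : (a : ℝ) = a'),
          by exact_mod_cast (by linarith : (b : ℝ) = b')⟩

theorem extensions_eq_ext {ρ : OrthRep G} {K : Subgroup G} (hHK : ρ.H ≤ K) {c : G} (hcK : c ∈ K)
    (hcH : c ∉ ρ.H) (hc : ∀ k ∈ K, k ∈ ρ.H ∨ c⁻¹ * k ∈ ρ.H) (χ : ρ.H → ℝ) :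
    ρ.extensions χ K = (IndexTwo.ofSubgroup hHK c hcK hcH hc).Ext χ := by
  ext ψ
  exact ⟨fun h => ⟨h.1, fun n => h.2 n n.2 _⟩, fun h => ⟨h.1, fun x hH hK => h.2 ⟨x, hH⟩⟩⟩

end Ends

end MultipleCharacters

/-! ### Bundles and the characters of their end fibers -/

section EndCharacters

set_option linter.unusedSectionVars false

open Module Representation

/-- The product of a representation with a one-dimensional character. -/
def Representation.smulHom {K W : Type*} [Group K] [AddCommGroup W] [Module ℝ W] (η : K →* ℝ)
    (σ : Representation ℝ K W) : Representation ℝ K W where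
  toFun k := η k • σ k
  map_one' := by rw [map_one, map_one, one_smul]
  map_mul' k l := by rw [map_mul, map_mul, smul_mul_smul_comm]

theorem Representation.smulHom_apply {K W : Type*} [Group K] [AddCommGroup W] [Module ℝ W]
    (η : K →* ℝ) (σ : Representation ℝ K W) (k : K) (w : W) : σ.smulHom η k w = η k • σ k w := rfl

theorem Representation.character_smulHom {K W : Type*} [Group K] [AddCommGroup W] [Module ℝ W]
    (η : K →* ℝ) (σ : Representation ℝ K W) : (σ.smulHom η).character = ⇑η * σ.character := by
  funext k
  exact (map_smul (LinearMap.trace ℝ W) (η k) (σ k)).trans rfl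

theorem Representation.IsCont.continuous {K W : Type*} [Group K] [TopologicalSpace K]
    [NormedAddCommGroup W] [NormedSpace ℝ W] [FiniteDimensional ℝ W] {σ : Representation ℝ K W}
    (hσ : σ.IsCont) (w : W) : Continuous fun k => σ k w := (hσ w).continuous

theorem Joined.exists_family {K W W' : Type*} [Group K] [TopologicalSpace K]
    [NormedAddCommGroup W] [NormedSpace ℝ W]
    [FiniteDimensional ℝ W] [NormedAddCommGroup W'] [NormedSpace ℝ W'] [FiniteDimensional ℝ W']
    {σ : Representation ℝ K W} {σ' : Representation ℝ K W'} {f g : σ.Equiv σ'} (h : Joined f g) :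
    ∃ a : unitInterval → (W ≃ₗ[ℝ] W'), (∀ w, Continuous fun t => a t w) ∧
      (∀ t k w, a t (σ k w) = σ' k (a t w)) ∧ (∀ w, a 0 w = f w) ∧ ∀ w, a 1 w = g w := by
  obtain ⟨γ⟩ := h
  refine ⟨fun t => (γ t).toLinearEquiv, fun w => (continuous_equiv_iff.1 γ.continuous w).continuous,
    fun t k w => IntertwiningMap.isIntertwining _ _ (γ t).toIntertwiningMap k w,
    fun w => ?_, fun w => ?_⟩
  · change γ 0 w = f w
    rw [γ.source]
  · change γ 1 w = g w
    rw [γ.target]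

namespace VectG

variable {G : Type*} [Group G] [TopologicalSpace G]
  {B : Type*} [TopologicalSpace B] [MulAction G B] [ContinuousSMul G B]

/-- The character of the fiber over `z` on classes of bundles. -/
noncomputable def charHom (z : B) (K : Subgroup G) (hK : ∀ k : K, (k : G) • z = z) :
    VectG G B →+ (K → ℝ) where
  toFun := Quotient.lift (fun A => A.charOn z K hK) fun _ _ ⟨f⟩ =>
    GVectorBundle.charOn_congr f z K hK
  map_zero' := funext fun k => map_zero (LinearMap.trace ℝ PUnit)
  map_add' := by
    rintro ⟨A⟩ ⟨A'⟩
    exact GVectorBundle.charOn_sum A A' z K hK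

end VectG

namespace GVectorBundle

variable {G : Type*} [Group G] [TopologicalSpace G] [IsTopologicalGroup G]

section

variable {B : Type*} [TopologicalSpace B] [MulAction G B] (A : GVectorBundle G B)

theorem exists_frame_const (z : B) : Nonempty (A.Frame (fun _ : PUnit.{1} => z) A.F) := by
  obtain ⟨φ⟩ := A.exists_frame_unitInterval (c := fun _ => z) continuous_const
  refine ⟨⟨fun _ => φ.map 0, ?_⟩⟩
  exact φ.continuous_map.comp
    ((continuous_const.prodMk continuous_snd) :
      Continuous fun p : PUnit.{1} × A.F => ((0 : unitInterval), p.2))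

theorem isRealCharacter_charOn (z : B) (K : Subgroup G) [CompactSpace K]
    (hK : ∀ k : K, (k : G) • z = z) : IsRealCharacter (A.charOn z K hK) := by
  obtain ⟨φ⟩ := A.exists_frame_const z
  rw [← φ.character_rep (T := PUnit.{1}) PUnit.unit K hK]
  exact (φ.isCont_rep PUnit.unit K hK).isRealCharacter

theorem Frame.isLineBundle {L : GVectorBundle G B} {T : Type*} [TopologicalSpace T] {c : T → B}
    (hcov : ∀ z, ∃ (g : G) (t : T), g • c t = z) (l : L.Frame c ℝ) : L.IsLineBundle := fun z => by
  obtain ⟨g, t, h⟩ := hcov z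
  rw [← ((l.map t).trans (L.actEquiv g h)).finrank_eq, finrank_self]

end

variable {ρ : OrthRep G} {A L C : GVectorBundle G ρ.S} {T : Type*} [TopologicalSpace T] {c : T → ρ.S}
  (hcov : ∀ z, ∃ (g : G) (t : T), g • c t = z)
  {W : Type*} [NormedAddCommGroup W] [NormedSpace ℝ W]

include hcov in
-- The action of `n` on the fiber over `g • c t` is the translate of the action of `g⁻¹ * n * g`,
-- which lies in the normal subgroup `H`.
theorem Frame.hasTrivialFiber (φ : L.Frame c W)
    (h : ∀ n ∈ ρ.H, ∀ t (hn : n • c t = c t) w, φ.trans n hn w = w) : ρ.HasTrivialFiber L := by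
  intro z n hn v
  obtain ⟨g, t, rfl⟩ := hcov z
  obtain ⟨v, rfl⟩ := (L.actEquiv g rfl).surjective v
  obtain ⟨w, rfl⟩ := (φ.map t).surjective v
  have hm : g⁻¹ * n * g ∈ ρ.H := by simpa using (inferInstance : ρ.H.Normal).conj_mem n n.2 g⁻¹
  have hm' := ρ.smul_eq_of_mem_H hm (c t)
  have e : (n : G) * g = g * (g⁻¹ * n * g) := by group
  simp only [actEquiv_apply]
  have e₁ : ((n : G) * g) • c t = g • c t := by rw [mul_smul, hn]
  rw [← L.act_mul n g rfl hn e₁]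
  have : ∀ x (hx : x • c t = g • c t), x = g * (g⁻¹ * n * g) → L.act x hx (φ.map t w) =
      L.act g rfl (φ.map t w) := by
    rintro x hx rfl
    rw [L.act_mul _ _ hm' rfl, ← φ.map_trans _ hm', h _ hm]
  exact this _ e₁ e

include hcov in
-- Translation by `g` conjugates the fiber `H`-module, which does not change its character because
-- `χ` is invariant; so the fibers over `c` suffice.
theorem Frame.hasFiberMultiple {χ : ρ.H → ℝ} (hinv : ρ.IsInvariant χ) (φ : A.Frame c W) (m : ℕ)
    (h : ∀ t k, (φ.rep t ρ.H fun k => ρ.smul_eq_of_mem_H k.2 _).character k = m * χ k) :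
    ρ.HasFiberMultiple χ A := by
  refine ⟨m, fun z n hn => ?_⟩
  obtain ⟨g, t, rfl⟩ := hcov z
  rw [← hinv g n, ← h t, φ.character_rep]
  unfold charOn
  rw [← LinearMap.trace_conj' _ (A.actEquiv g (rfl : g • c t = g • c t))]
  congr 1
  ext v
  obtain ⟨v, rfl⟩ := (A.actEquiv g (rfl : g • c t = g • c t)).surjective v
  rw [LinearEquiv.conj_apply_apply, LinearEquiv.symm_apply_apply]
  simp only [actEquiv_apply]
  have hm' : ((MulAut.conjNormal g⁻¹ n : ρ.H) : G) • c t = c t :=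
    ρ.smul_eq_of_mem_H (MulAut.conjNormal g⁻¹ n : ρ.H).2 _
  have e₁ : ((n : G) * g) • c t = g • c t := by rw [mul_smul, hn]
  rw [← A.act_mul n g rfl hn e₁, ← A.act_mul g _ hm' rfl (by rw [mul_smul, hm'])]
  congr 2
  simp [mul_assoc]

end GVectorBundle

variable {G : Type*} [Group G] [TopologicalSpace G]

/-- Classification of the bundles in `Vect` by the characters of the fibers on two subgroups. -/
structure EndCharacters (ρ : OrthRep G) (χ : ρ.H → ℝ) (K₁ K₂ : Subgroup G) where
  fst : ρ.Vect χ →+ (K₁ → ℝ)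
  snd : ρ.Vect χ →+ (K₂ → ℝ)
  mem : ∀ x, ∃ m, fst x ∈ multChars χ K₁ m ∧ snd x ∈ multChars χ K₂ m
  inj : ∀ x y, fst x = fst y → snd x = snd y → x = y
  -- For trivial `η₁` and `η₂` this says that all compatible pairs of characters occur; in general
  -- it produces the line bundles that relate generators.
  twist : ∀ (η₁ : K₁ →* ℝ) (η₂ : K₂ →* ℝ), Continuous η₁ → Continuous η₂ →
    (∀ k : K₁, (k : G) ∈ ρ.H → η₁ k = 1) → (∀ k : K₂, (k : G) ∈ ρ.H → η₂ k = 1) →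
    ∀ m, ∀ ψ₁ ∈ multChars χ K₁ m, ∀ ψ₂ ∈ multChars χ K₂ m, ∃ x y, fst x = ψ₁ ∧ snd x = ψ₂ ∧
      fst y = η₁ * ψ₁ ∧ snd y = η₂ * ψ₂ ∧ ρ.RelatedByLine x y

/-- Interchange of the two subgroups. -/
def EndCharacters.swap {ρ : OrthRep G} {χ : ρ.H → ℝ} {K₁ K₂ : Subgroup G}
    (E : EndCharacters ρ χ K₁ K₂) : EndCharacters ρ χ K₂ K₁ where
  fst := E.snd
  snd := E.fst
  mem x := (E.mem x).imp fun _ h => h.symm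
  inj x y h h' := E.inj x y h' h
  twist η₁ η₂ h₁ h₂ h₁' h₂' m ψ₁ hψ₁ ψ₂ hψ₂ := by
    obtain ⟨x, y, a, b, c, d, e⟩ := E.twist η₂ η₁ h₂ h₁ h₂' h₁' m ψ₂ hψ₂ ψ₁ hψ₁
    exact ⟨x, y, b, a, d, c, e⟩

/-- Construction of `EndCharacters` from statements about bundles. -/
theorem EndCharacters.nonempty_of [IsTopologicalGroup G] {ρ : OrthRep G} {χ : ρ.H → ℝ}
    {K₁ K₂ : Subgroup G} [CompactSpace K₁] [CompactSpace K₂] (z₁ z₂ : ρ.S)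
    (h₁ : ∀ k : K₁, (k : G) • z₁ = z₁) (h₂ : ∀ k : K₂, (k : G) • z₂ = z₂)
    (hinj : ∀ A A' : GVectorBundle G ρ.S, ρ.HasFiberMultiple χ A → ρ.HasFiberMultiple χ A' →
      A.charOn z₁ K₁ h₁ = A'.charOn z₁ K₁ h₁ → A.charOn z₂ K₂ h₂ = A'.charOn z₂ K₂ h₂ →
      Nonempty (GVectorBundle.Iso A A'))
    (htw : ∀ (η₁ : K₁ →* ℝ) (η₂ : K₂ →* ℝ), Continuous η₁ → Continuous η₂ →
      (∀ k : K₁, (k : G) ∈ ρ.H → η₁ k = 1) → (∀ k : K₂, (k : G) ∈ ρ.H → η₂ k = 1) →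
      ∀ m, ∀ ψ₁ ∈ multChars χ K₁ m, ∀ ψ₂ ∈ multChars χ K₂ m, ∃ A L C : GVectorBundle G ρ.S,
        ρ.HasFiberMultiple χ A ∧ ρ.HasFiberMultiple χ C ∧
        A.charOn z₁ K₁ h₁ = ψ₁ ∧ A.charOn z₂ K₂ h₂ = ψ₂ ∧
        C.charOn z₁ K₁ h₁ = η₁ * ψ₁ ∧ C.charOn z₂ K₂ h₂ = η₂ * ψ₂ ∧
        L.IsLineBundle ∧ ρ.HasTrivialFiber L ∧ A.IsTensor L C) :
    Nonempty (EndCharacters ρ χ K₁ K₂) := by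
  refine ⟨⟨(VectG.charHom z₁ K₁ h₁).comp (ρ.Vect χ).subtype,
    (VectG.charHom z₂ K₂ h₂).comp (ρ.Vect χ).subtype, ?_, ?_, ?_⟩⟩
  · rintro ⟨_, A, ⟨m, hm⟩, rfl⟩
    exact ⟨m, ⟨A.isRealCharacter_charOn z₁ K₁ h₁, fun n hn hK => hm z₁ ⟨n, hn⟩ _⟩,
      A.isRealCharacter_charOn z₂ K₂ h₂, fun n hn hK => hm z₂ ⟨n, hn⟩ _⟩
  · rintro ⟨_, A, hA, rfl⟩ ⟨_, A', hA', rfl⟩ e₁ e₂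
    obtain ⟨f⟩ := hinj A A' hA hA' e₁ e₂
    exact Subtype.ext (Quotient.sound ⟨f⟩)
  · intro η₁ η₂ c₁ c₂ t₁ t₂ m ψ₁ hψ₁ ψ₂ hψ₂
    obtain ⟨A, L, C, hA, hC, a₁, a₂, b₁, b₂, hL, hL', hT⟩ :=
      htw η₁ η₂ c₁ c₂ t₁ t₂ m ψ₁ hψ₁ ψ₂ hψ₂
    exact ⟨⟨_, A, hA, rfl⟩, ⟨_, C, hC, rfl⟩, a₁, a₂, b₁, b₂, A, L, C, hL, hL', hT, rfl, rfl⟩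

end EndCharacters

/-! ### Classification by end characters for each type of orbit space -/

section Geometries

set_option linter.unusedSectionVars false

open Module Representation GVectorBundle

/-- Two `H`-isomorphisms may lie in different components, but an automorphism over the end group
moves one into the component of the other; this is `exists_joined_automorphism` applied to their
quotient. -/
theorem IndexTwo.exists_joined_trans {N K : Type*} [Group N] [Group K] [TopologicalSpace N]
    [TopologicalSpace K] [IsTopologicalGroup N] [IsTopologicalGroup K] [CompactSpace N]
    [CompactSpace K] [T2Space K] (E : IndexTwo N K) {U V V' : Type*} [AddCommGroup U] [Module ℝ U]
    [FiniteDimensional ℝ U] [AddCommGroup V] [Module ℝ V] [FiniteDimensional ℝ V]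
    [AddCommGroup V'] [Module ℝ V'] [FiniteDimensional ℝ V'] {τ : Representation ℝ N U}
    (hτ : τ.IsCont) (hirr : τ.IsIrreducible)
    (hR : ∀ f : IntertwiningMap τ τ, ∃ r : ℝ, ∀ u, f u = r • u)
    (hX : (E.Ext τ.character).Nonempty) {S : Representation ℝ K V} (hS : S.IsCont) {m : ℕ}
    {σ : Representation ℝ N V} (hSσ : ∀ n w, S (E.ι n) w = σ n w)
    (h : ∀ n, σ.character n = m * τ.character n) {σ' : Representation ℝ N V'} (f g : σ.Equiv σ') :
    ∃ (r : S.Equiv S) (r' : σ.Equiv σ), (∀ v, r' v = r v) ∧ Joined (r'.trans f) g := by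
  obtain rfl : E.res S = σ := MonoidHom.ext fun n => LinearMap.ext (hSσ n)
  obtain ⟨r, r', hr, hj⟩ := E.exists_joined_automorphism hτ hirr hR hX hS h (g.trans f.symm)
  refine ⟨r, r', hr, ?_⟩
  have := hj.map (continuous_trans_right f)
  have e : (g.trans f.symm).trans f = g :=
    Representation.Equiv.ext (funext fun v => f.apply_symm_apply (g v))
  rwa [e] at this

variable {G : Type*} [Group G] [TopologicalSpace G] [IsTopologicalGroup G] [CompactSpace G]
  [T2Space G] {ρ : OrthRep G} {U : Type*} [AddCommGroup U] [Module ℝ U] [FiniteDimensional ℝ U]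
  {τ : Representation ℝ ρ.H U}

theorem compactSpace_stabilizer {B : Type*} [TopologicalSpace B] [T2Space B] [MulAction G B]
    [ContinuousSMul G B] (z : B) : CompactSpace (MulAction.stabilizer G z) := by
  have hK : IsClosed (MulAction.stabilizer G z : Set G) :=
    isClosed_eq (f := fun g : G => g • z) (by fun_prop) continuous_const
  exact isCompact_iff_compactSpace.1 hK.isCompact

theorem compactSpace_H : CompactSpace ρ.H := isCompact_iff_compactSpace.1 ρ.isClosed_H.isCompact

/-- Multiplying both end representations by characters trivial on `H` preserves their agreement on
`H`. The same characters glue to a line bundle, and transition maps multiply. -/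
theorem IntervalDomain.exists_tensor {c : unitInterval → ρ.S} (D : IntervalDomain ρ.H c)
    (hH : IsOpen (ρ.H : Set G)) {W : Type} [NormedAddCommGroup W] [NormedSpace ℝ W]
    [FiniteDimensional ℝ W] (σ₁ : Representation ℝ (MulAction.stabilizer G (c 0)) W)
    (σ₂ : Representation ℝ (MulAction.stabilizer G (c 1)) W)
    (hσ₁ : ∀ w, Continuous fun k => σ₁ k w) (hσ₂ : ∀ w, Continuous fun k => σ₂ k w)
    (hag : ∀ k (hk : k ∈ ρ.H) w, σ₁ ⟨k, D.smul_eq hk 0⟩ w = σ₂ ⟨k, D.smul_eq hk 1⟩ w)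
    {η₁ : MulAction.stabilizer G (c 0) →* ℝ} {η₂ : MulAction.stabilizer G (c 1) →* ℝ}
    (c₁ : Continuous η₁) (c₂ : Continuous η₂)
    (t₁ : ∀ k : MulAction.stabilizer G (c 0), (k : G) ∈ ρ.H → η₁ k = 1)
    (t₂ : ∀ k : MulAction.stabilizer G (c 1), (k : G) ∈ ρ.H → η₂ k = 1) :
    ∃ (A L C : GVectorBundle G ρ.S) (φ : A.Frame c W) (ψ : C.Frame c W),
      (∀ k (h : k • c 0 = c 0) w, φ.trans k h w = σ₁ ⟨k, h⟩ w) ∧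
      (∀ k (h : k • c 1 = c 1) w, φ.trans k h w = σ₂ ⟨k, h⟩ w) ∧
      (∀ k (hk : k ∈ ρ.H) t (h : k • c t = c t) w, φ.trans k h w = σ₁ ⟨k, D.smul_eq hk 0⟩ w) ∧
      (∀ k (h : k • c 0 = c 0) w, ψ.trans k h w = σ₁.smulHom η₁ ⟨k, h⟩ w) ∧
      (∀ k (h : k • c 1 = c 1) w, ψ.trans k h w = σ₂.smulHom η₂ ⟨k, h⟩ w) ∧
      (∀ k (hk : k ∈ ρ.H) t (h : k • c t = c t) w, ψ.trans k h w = σ₁ ⟨k, D.smul_eq hk 0⟩ w) ∧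
      L.IsLineBundle ∧ ρ.HasTrivialFiber L ∧ A.IsTensor L C := by
  obtain ⟨A, φ, a₁, a₂, a₃⟩ := D.exists_frame hH σ₁ σ₂ hσ₁ hσ₂ hag
  obtain ⟨C, ψ, b₁, b₂, b₃⟩ := D.exists_frame hH (σ₁.smulHom η₁) (σ₂.smulHom η₂)
    (fun w => c₁.smul (hσ₁ w)) (fun w => c₂.smul (hσ₂ w)) fun k hk w => by
      rw [smulHom_apply, smulHom_apply, t₁ _ hk, t₂ _ hk, hag k hk]
  obtain ⟨L, l, l₁, l₂, l₃⟩ := D.exists_frame hH (W := ℝ)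
    ((1 : Representation ℝ _ ℝ).smulHom η₁) ((1 : Representation ℝ _ ℝ).smulHom η₂)
    (fun w => c₁.smul continuous_const) (fun w => c₂.smul continuous_const) fun k hk w => by
      rw [smulHom_apply, smulHom_apply, t₁ _ hk, t₂ _ hk]
      rfl
  refine ⟨A, L, C, φ, ψ, a₁, a₂, a₃, b₁, b₂, fun k hk t h w => ?_, l.isLineBundle D.cover,
    l.hasTrivialFiber D.cover fun n hn t e w => ?_,
    Frame.isTensor D.continuous D.cover φ l ψ (D.induct (fun k h w => ?_) (fun k h w => ?_)
      fun k hk t h w => ?_)⟩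
  · rw [b₃ k hk, smulHom_apply, t₁ _ hk, one_smul]
  · rw [l₃ n hn, smulHom_apply, t₁ _ hn, one_smul]
    rfl
  · rw [b₁, l₁, a₁, smulHom_apply, smulHom_apply]
    congr 1
    exact (mul_one _).symm
  · rw [b₂, l₂, a₂, smulHom_apply, smulHom_apply]
    congr 1
    exact (mul_one _).symm
  · rw [b₃ k hk, l₃ k hk, a₃ k hk, smulHom_apply, smulHom_apply]
    congr 1
    exact (mul_one _).symm

/-- Equal end characters give isomorphisms over the end groups at both ends; a path of
`H`-isomorphisms between them is a gauge transformation. Its existence is the purpose of `hjoin`. -/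
theorem IntervalDomain.nonempty_endCharacters {c : unitInterval → ρ.S}
    (D : IntervalDomain ρ.H c) (hH : IsOpen (ρ.H : Set G)) (hτ : τ.IsCont) (hirr : τ.IsIrreducible)
    (hinv : ρ.IsInvariant τ.character)
    (E₁ : IndexTwo ρ.H (MulAction.stabilizer G (c 0))) (hE₁ : ∀ n, (E₁.ι n : G) = n)
    (E₂ : IndexTwo ρ.H (MulAction.stabilizer G (c 1))) (hE₂ : ∀ n, (E₂.ι n : G) = n)
    (hjoin : (∃ J : IntertwiningMap τ τ, ∀ w, J (J w) = -w) ∨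
      ((∀ f : IntertwiningMap τ τ, ∃ r : ℝ, ∀ u, f u = r • u) ∧
        ((E₁.Ext τ.character).Nonempty ∨ (E₂.Ext τ.character).Nonempty))) :
    Nonempty (EndCharacters ρ τ.character (MulAction.stabilizer G (c 0))
      (MulAction.stabilizer G (c 1))) := by
  have := compactSpace_stabilizer (G := G) (c 0)
  have := compactSpace_stabilizer (G := G) (c 1)
  have : CompactSpace ρ.H := compactSpace_H
  refine EndCharacters.nonempty_of (c 0) (c 1) (fun k => k.2) (fun k => k.2) ?_ ?_
  · rintro A A' ⟨m, hA⟩ ⟨m', hA'⟩ e₀ e₁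
    obtain ⟨φ, hφ⟩ := A.exists_equivariant_frame D.continuous ρ.H ρ.isClosed_H
      fun h t => D.smul_eq h.2 t
    obtain ⟨φ', hφ'⟩ := A'.exists_equivariant_frame D.continuous ρ.H ρ.isClosed_H
      fun h t => D.smul_eq h.2 t
    let σ := φ.rep 0 ρ.H fun k => D.smul_eq k.2 0
    let σ' := φ'.rep 0 ρ.H fun k => D.smul_eq k.2 0
    have hσ : σ.IsCont := φ.isCont_rep 0 ρ.H _
    have hσm : ∀ n, σ.character n = m * τ.character n := fun n =>
      (congrFun (φ.character_rep 0 ρ.H _) n).trans (hA _ n _)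
    let S₀ := φ.rep 0 (MulAction.stabilizer G (c 0)) fun k => k.2
    let S₀' := φ'.rep 0 (MulAction.stabilizer G (c 0)) fun k => k.2
    let S₁ := φ.rep 1 (MulAction.stabilizer G (c 1)) fun k => k.2
    let S₁' := φ'.rep 1 (MulAction.stabilizer G (c 1)) fun k => k.2
    obtain ⟨f₀⟩ : Nonempty (S₀.Equiv S₀') := exists_equiv_of_character_eq
      (φ.isCont_rep _ _ _) (φ'.isCont_rep _ _ _) (congrFun
        (((φ.character_rep 0 _ _).trans e₀).trans (φ'.character_rep 0 _ _).symm))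
    obtain ⟨f₁⟩ : Nonempty (S₁.Equiv S₁') := exists_equiv_of_character_eq
      (φ.isCont_rep _ _ _) (φ'.isCont_rep _ _ _) (congrFun
        (((φ.character_rep 1 _ _).trans e₁).trans (φ'.character_rep 1 _ _).symm))
    let f : σ.Equiv σ' := Representation.Equiv.mk f₀.toLinearEquiv fun n => LinearMap.ext fun v =>
      IntertwiningMap.isIntertwining S₀ S₀' f₀.toIntertwiningMap ⟨n, D.smul_eq n.2 0⟩ v
    let g : σ.Equiv σ' := Representation.Equiv.mk f₁.toLinearEquiv fun n => LinearMap.ext fun v => by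
      have := IntertwiningMap.isIntertwining S₁ S₁' f₁.toIntertwiningMap ⟨n, D.smul_eq n.2 1⟩ v
      change f₁ (φ.trans (n : G) _ v) = φ'.trans (n : G) _ (f₁ v) at this
      rw [hφ n 1, hφ' n 1] at this
      exact this
    -- With a complex structure any two isomorphisms are joined. In real type the isomorphism at an
    -- end where `χ` extends is first corrected by an automorphism over that end group.
    have key : ∃ (f₀ : S₀.Equiv S₀') (f₁ : S₁.Equiv S₁') (f g : σ.Equiv σ'),
        (∀ v, f v = f₀ v) ∧ (∀ v, g v = f₁ v) ∧ Joined f g := by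
      rcases hjoin with ⟨J, hJ⟩ | ⟨hR, hX | hX⟩
      · exact ⟨f₀, f₁, f, g, fun _ => rfl, fun _ => rfl, joined_of_isotypic hσ hτ hirr J hJ hσm f g⟩
      · obtain ⟨r, r', hr, hj⟩ := E₁.exists_joined_trans hτ hirr hR hX
          (φ.isCont_rep 0 (MulAction.stabilizer G (c 0)) fun k => k.2) (σ := σ)
          (fun n w => by
            change φ.trans (E₁.ι n : G) _ w = φ.trans (n : G) _ w
            congr 2
            exact hE₁ n) hσm f g
        exact ⟨r.trans f₀, f₁, r'.trans f, g, fun v => congrArg f₀ (hr v), fun _ => rfl, hj⟩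
      · obtain ⟨r, r', hr, hj⟩ := E₂.exists_joined_trans hτ hirr hR hX
          (φ.isCont_rep 1 (MulAction.stabilizer G (c 1)) fun k => k.2) (σ := σ)
          (fun n w => by
            change φ.trans (E₂.ι n : G) _ w = φ.trans (n : G) _ w
            rw [← hφ n 1]
            congr 2
            exact hE₂ n) hσm g f
        exact ⟨f₀, r.trans f₁, f, r'.trans g, fun _ => rfl, fun v => congrArg f₁ (hr v), hj.symm⟩
    obtain ⟨f₀, f₁, f, g, hf, hg, hj⟩ := key
    obtain ⟨a, ha, haN, ha₀, ha₁⟩ := hj.exists_family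
    refine D.nonempty_iso φ φ' a ha (fun k h w => ?_) (fun k h w => ?_) fun k hk t h w => ?_
    · rw [ha₀, ha₀, hf, hf]
      exact IntertwiningMap.isIntertwining S₀ S₀' f₀.toIntertwiningMap ⟨k, h⟩ w
    · rw [ha₁, ha₁, hg, hg]
      exact IntertwiningMap.isIntertwining S₁ S₁' f₁.toIntertwiningMap ⟨k, h⟩ w
    · have h₁ := hφ ⟨k, hk⟩ t w
      have h₂ := hφ' ⟨k, hk⟩ t (a t w)
      rw [h₁, h₂]
      exact haN t ⟨k, hk⟩ w
  · rintro η₁ η₂ c₁ c₂ t₁ t₂ m ψ₁ ⟨⟨d₁, σ₁, hσ₁, rfl⟩, h₁⟩ ψ₂ ⟨⟨d₂, σ₂, hσ₂, rfl⟩, h₂⟩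
    let i₀ : ρ.H →* MulAction.stabilizer G (c 0) := Subgroup.inclusion fun k hk => D.smul_eq hk 0
    let i₁ : ρ.H →* MulAction.stabilizer G (c 1) := Subgroup.inclusion fun k hk => D.smul_eq hk 1
    have hi₀ : Continuous i₀ := Continuous.subtype_mk continuous_subtype_val _
    have hi₁ : Continuous i₁ := Continuous.subtype_mk continuous_subtype_val _
    obtain ⟨f⟩ := exists_equiv_of_character_eq (σ := σ₁.comp i₀) (τ := σ₂.comp i₁)
      (fun w => ((hσ₁ w).comp hi₀).weaklyContinuous) (fun w => ((hσ₂ w).comp hi₁).weaklyContinuous)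
      fun n => (h₁ n n.2 (i₀ n).2).trans (h₂ n n.2 (i₁ n).2).symm
    -- The restrictions to `H` have the same character but are only isomorphic; transporting `σ₂`
    -- makes them equal on one space, as clutching requires.
    let σ₂' : Representation ℝ (MulAction.stabilizer G (c 1)) (Fin d₁ → ℝ) :=
      { toFun := fun k => f.toLinearEquiv.symm.conj (σ₂ k)
        map_one' := by rw [map_one]; exact LinearEquiv.conj_id _
        map_mul' := fun k l => by rw [map_mul]; exact LinearEquiv.conj_comp _ _ _ }
    have hσ₂' : ∀ w, Continuous fun k => σ₂' k w := fun w =>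
      (LinearMap.continuous_of_finiteDimensional f.toLinearEquiv.symm.toLinearMap).comp
        (hσ₂ (f w))
    have hχ₂ : σ₂'.character = σ₂.character := funext fun k => LinearMap.trace_conj' _ _
    have hag : ∀ k (hk : k ∈ ρ.H) w,
        σ₁ ⟨k, D.smul_eq hk 0⟩ w = σ₂' ⟨k, D.smul_eq hk 1⟩ w := fun k hk w => by
      have := IntertwiningMap.isIntertwining _ _ f.toIntertwiningMap ⟨k, hk⟩ w
      exact (f.toLinearEquiv.symm_apply_eq.2 this.symm).symm
    obtain ⟨A, L, C, φ, ψ, a₁, a₂, a₃, b₁, b₂, b₃, hL, hL', hT⟩ :=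
      D.exists_tensor hH σ₁ σ₂' hσ₁ hσ₂' hag c₁ c₂ t₁ t₂
    refine ⟨A, L, C, φ.hasFiberMultiple D.cover hinv m fun t k => ?_,
      ψ.hasFiberMultiple D.cover hinv m fun t k => ?_, ?_, ?_, ?_, ?_, hL, hL', hT⟩
    · rw [← h₁ k k.2 (i₀ k).2]
      exact congrArg (LinearMap.trace ℝ _) (LinearMap.ext fun w => a₃ k k.2 t _ w)
    · rw [← h₁ k k.2 (i₀ k).2]
      exact congrArg (LinearMap.trace ℝ _) (LinearMap.ext fun w => b₃ k k.2 t _ w)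
    · refine (φ.character_rep 0 _ _).symm.trans ?_
      exact congrArg character (MonoidHom.ext fun k => LinearMap.ext fun w => a₁ k k.2 w)
    · refine (φ.character_rep 1 _ _).symm.trans ?_
      rw [← hχ₂]
      exact congrArg character (MonoidHom.ext fun k => LinearMap.ext fun w => a₂ k k.2 w)
    · refine (ψ.character_rep 0 _ _).symm.trans ?_
      rw [← character_smulHom]
      exact congrArg character (MonoidHom.ext fun k => LinearMap.ext fun w => b₁ k k.2 w)
    · refine (ψ.character_rep 1 _ _).symm.trans ?_
      rw [← hχ₂, ← character_smulHom]
      exact congrArg character (MonoidHom.ext fun k => LinearMap.ext fun w => b₂ k k.2 w)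

theorem CyclicDomain.trans_conj {N : Subgroup G} [hN : N.Normal] {B : Type*} [TopologicalSpace B]
    [MulAction G B] {c : unitInterval → B} {g₀ : G} (D : CyclicDomain N c g₀)
    {A : GVectorBundle G B} {W : Type*} [NormedAddCommGroup W] [NormedSpace ℝ W]
    (φ : A.Frame c W) (k : N) (w : W) :
    φ.trans g₀ D.smul_zero (φ.trans (k : G) (D.smul_eq k.2 0) w) =
      φ.trans (MulAut.conjNormal g₀ k : N) (D.smul_eq (MulAut.conjNormal g₀ k : N).2 1)
        (φ.trans g₀ D.smul_zero w) := by
  have e : (MulAut.conjNormal g₀ k : N) * g₀ = g₀ * (k : G) := by simp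
  rw [← φ.trans_mul (D.smul_eq k.2 0) D.smul_zero (by
    rw [mul_smul, D.smul_eq k.2, D.smul_zero]),
    ← φ.trans_mul D.smul_zero (D.smul_eq (MulAut.conjNormal g₀ k : N).2 1) (by
    rw [mul_smul, D.smul_zero, D.smul_eq (MulAut.conjNormal g₀ k : N).2])]
  congr 2
  exact e.symm

theorem CyclicDomain.exists_tensor {c : unitInterval → ρ.S} {g₀ : G} (D : CyclicDomain ρ.H c g₀)
    (hH : IsOpen (ρ.H : Set G)) {W : Type} [NormedAddCommGroup W] [NormedSpace ℝ W]
    [FiniteDimensional ℝ W] (σ : Representation ℝ ρ.H W) (hσ : ∀ w, Continuous fun k => σ k w)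
    (γ : W ≃ₗ[ℝ] W) (hγ : ∀ k w, γ (σ k w) = σ (MulAut.conjNormal g₀ k) (γ w)) (u : ℝˣ) :
    ∃ (A L C : GVectorBundle G ρ.S) (φ : A.Frame c W) (ψ : C.Frame c W),
      (∀ w, φ.trans g₀ D.smul_zero w = γ w) ∧
      (∀ k (hk : k ∈ ρ.H) t (h : k • c t = c t) w, φ.trans k h w = σ ⟨k, hk⟩ w) ∧
      (∀ w, ψ.trans g₀ D.smul_zero w = (u : ℝ) • γ w) ∧
      (∀ k (hk : k ∈ ρ.H) t (h : k • c t = c t) w, ψ.trans k h w = σ ⟨k, hk⟩ w) ∧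
      L.IsLineBundle ∧ ρ.HasTrivialFiber L ∧ A.IsTensor L C := by
  obtain ⟨A, φ, a₁, a₂⟩ := D.exists_frame hH σ hσ γ hγ
  obtain ⟨C, ψ, b₁, b₂⟩ := D.exists_frame hH σ hσ (γ.trans (LinearEquiv.smulOfUnit u))
    fun k w => by
      rw [LinearEquiv.trans_apply, hγ]
      exact (map_smul (σ _) (u : ℝ) _).symm
  obtain ⟨L, l, l₁, l₂⟩ := D.exists_frame hH (1 : Representation ℝ ρ.H ℝ)
    (fun w => continuous_const) (LinearEquiv.smulOfUnit u) fun k w => rfl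
  refine ⟨A, L, C, φ, ψ, a₁, a₂, b₁, b₂, l.isLineBundle D.cover,
    l.hasTrivialFiber D.cover fun n hn t e w => l₂ n hn t e w,
    Frame.isTensor D.continuous D.cover φ l ψ fun k s t h w => ?_⟩
  have hu : l.trans g₀ D.smul_zero 1 = (u : ℝ) := (l₁ 1).trans (mul_one _)
  rcases D.cases h with ⟨rfl, hk⟩ | ⟨rfl, rfl, hk⟩ | ⟨rfl, rfl, hk⟩
  · rw [b₂ k hk, a₂ k hk, l₂ k hk]
    exact (one_smul _ _).symm
  · rw [D.trans_zero_one φ h hk, D.trans_zero_one ψ h hk, D.trans_zero_one l h hk, l₂ _ hk]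
    change _ = l.trans g₀ _ 1 • _
    rw [hu, b₁, a₁, a₂ _ hk, b₂ _ hk]
    rfl
  · rw [D.trans_one_zero φ h hk, D.trans_one_zero ψ h hk, D.trans_one_zero l h hk,
      LinearEquiv.symm_apply_eq, map_smul, b₁, b₂ _ hk, LinearEquiv.trans_apply, ← a₁,
      LinearEquiv.apply_symm_apply, l₂ _ hk]
    change _ = (l.trans g₀ _).symm 1 • (u : ℝ) • φ.trans (g₀ * k) _ w
    rw [smul_smul, a₂ _ hk]
    have : (l.trans g₀ D.smul_zero).symm 1 * (u : ℝ) = 1 := by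
      rw [mul_comm, ← smul_eq_mul, ← map_smul, LinearEquiv.symm_apply_eq, hu]
      exact mul_one _
    rw [this, one_smul]

/-- Invariance of the character means that the representation and its conjugate by `g₀` are
isomorphic; the isomorphism is a possible monodromy. -/
theorem exists_equiv_conj [CompactSpace ρ.H] {W : Type*} [AddCommGroup W] [Module ℝ W]
    [FiniteDimensional ℝ W] {σ : Representation ℝ ρ.H W} (hσ : σ.IsCont) (g₀ : G)
    (h : ∀ k, σ.character (MulAut.conjNormal g₀ k) = σ.character k) :
    ∃ γ : W ≃ₗ[ℝ] W, ∀ k w, γ (σ k w) = σ (MulAut.conjNormal g₀ k) (γ w) := by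
  have hc : Continuous fun k : ρ.H => (MulAut.conjNormal g₀ k : ρ.H) := by
    refine Continuous.subtype_mk (f := fun k : ρ.H => g₀ * (k : G) * g₀⁻¹) (by fun_prop) _
  obtain ⟨f⟩ := exists_equiv_of_character_eq (σ := σ)
    (τ := σ.comp (MulAut.conjNormal g₀ : MulAut ρ.H).toMonoidHom) hσ
    (fun w l => (hσ w l).comp hc) fun k => (h k).symm
  exact ⟨f.toLinearEquiv, fun k w => IntertwiningMap.isIntertwining _ _ f.toIntertwiningMap k w⟩

/-- With a complex structure the monodromy carries no information, because the isomorphisms of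
isotypic modules form a connected set. The bundle is determined by its fiber `H`-module, so both
groups are taken to be `H`. -/
theorem CyclicDomain.nonempty_endCharacters {c : unitInterval → ρ.S} {g₀ : G}
    (D : CyclicDomain ρ.H c g₀) (hH : IsOpen (ρ.H : Set G)) (hτ : τ.IsCont)
    (hirr : τ.IsIrreducible) (hinv : ρ.IsInvariant τ.character) (J : IntertwiningMap τ τ)
    (hJ : ∀ w, J (J w) = -w) : Nonempty (EndCharacters ρ τ.character ρ.H ρ.H) := by
  have : CompactSpace ρ.H := compactSpace_H
  refine EndCharacters.nonempty_of (c 0) (c 0) (fun k => D.smul_eq k.2 0)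
    (fun k => D.smul_eq k.2 0) ?_ ?_
  · rintro A A' ⟨m, hA⟩ ⟨m', hA'⟩ e₀ -
    obtain ⟨φ, hφ⟩ := A.exists_equivariant_frame D.continuous ρ.H ρ.isClosed_H
      fun h t => D.smul_eq h.2 t
    obtain ⟨φ', hφ'⟩ := A'.exists_equivariant_frame D.continuous ρ.H ρ.isClosed_H
      fun h t => D.smul_eq h.2 t
    let σ := φ.rep 0 ρ.H fun k => D.smul_eq k.2 0
    let σ' := φ'.rep 0 ρ.H fun k => D.smul_eq k.2 0
    have hσ : σ.IsCont := φ.isCont_rep 0 ρ.H _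
    have hσm : ∀ n, σ.character n = m * τ.character n := fun n =>
      (congrFun (φ.character_rep 0 ρ.H _) n).trans (hA _ n _)
    obtain ⟨f⟩ : Nonempty (σ.Equiv σ') := exists_equiv_of_character_eq
      (φ.isCont_rep _ _ _) (φ'.isCont_rep _ _ _) (congrFun
        (((φ.character_rep 0 _ _).trans e₀).trans (φ'.character_rep 0 _ _).symm))
    have hc : ∀ k w, φ.trans g₀ D.smul_zero (σ k w) =
        σ (MulAut.conjNormal g₀ k) (φ.trans g₀ D.smul_zero w) := fun k w =>
      (D.trans_conj φ k w).trans (hφ _ 1 _)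
    have hc' : ∀ k w, φ'.trans g₀ D.smul_zero (σ' k w) =
        σ' (MulAut.conjNormal g₀ k) (φ'.trans g₀ D.smul_zero w) := fun k w =>
      (D.trans_conj φ' k w).trans (hφ' _ 1 _)
    -- An isomorphism at `c 0` dictates one at `c 1` through `g₀`. It is compatible with `H` because
    -- `g₀` normalizes `H`, and a path from one to the other is the gauge transformation sought.
    let g : σ.Equiv σ' := Representation.Equiv.mk
      (((φ.trans g₀ D.smul_zero).symm.trans f.toLinearEquiv).trans (φ'.trans g₀ D.smul_zero))
      fun n => LinearMap.ext fun v => by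
        obtain ⟨w, rfl⟩ := (φ.trans g₀ D.smul_zero).surjective v
        obtain ⟨k, rfl⟩ := (MulAut.conjNormal g₀ : MulAut ρ.H).surjective n
        change φ'.trans g₀ D.smul_zero (f ((φ.trans g₀ D.smul_zero).symm
            (σ (MulAut.conjNormal g₀ k) (φ.trans g₀ D.smul_zero w)))) =
          σ' (MulAut.conjNormal g₀ k) (φ'.trans g₀ D.smul_zero (f
            ((φ.trans g₀ D.smul_zero).symm (φ.trans g₀ D.smul_zero w))))
        rw [← hc, LinearEquiv.symm_apply_apply, LinearEquiv.symm_apply_apply, ← hc']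
        exact congrArg _ (IntertwiningMap.isIntertwining σ σ' f.toIntertwiningMap k w)
    obtain ⟨a, ha, haN, ha₀, ha₁⟩ := (joined_of_isotypic hσ hτ hirr J hJ hσm f g).exists_family
    refine D.nonempty_iso φ φ' a ha (fun w => ?_) fun k hk t h w => ?_
    · rw [ha₀, ha₁]
      change φ'.trans g₀ D.smul_zero (f ((φ.trans g₀ D.smul_zero).symm
        (φ.trans g₀ D.smul_zero w))) = _
      rw [LinearEquiv.symm_apply_apply]
    · have h₁ := hφ ⟨k, hk⟩ t w
      have h₂ := hφ' ⟨k, hk⟩ t (a t w)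
      rw [h₁, h₂]
      exact haN t ⟨k, hk⟩ w
  -- Both groups being `H`, the two characters coincide and the twists are trivial, so the line
  -- bundle of monodromy `1` suffices.
  · rintro η₁ η₂ - - t₁ t₂ m ψ₁ ⟨⟨d₁, σ₁, hσ₁, rfl⟩, h₁⟩ ψ₂ ⟨-, h₂⟩
    have hψ : σ₁.character = ψ₂ := funext fun k => (h₁ k k.2 k.2).trans (h₂ k k.2 k.2).symm
    have ht : ∀ (η : ρ.H →* ℝ), (∀ k : ρ.H, (k : G) ∈ ρ.H → η k = 1) → ∀ ψ : ρ.H → ℝ,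
        ⇑η * ψ = ψ := fun η h ψ => funext fun k => by simp [h k k.2]
    obtain ⟨γ, hγ⟩ := exists_equiv_conj (σ := σ₁) (fun w => (hσ₁ w).weaklyContinuous) g₀
      fun k => by
        rw [h₁ _ (MulAut.conjNormal g₀ k : ρ.H).2 (MulAut.conjNormal g₀ k : ρ.H).2, h₁ k k.2 k.2]
        have := hinv g₀⁻¹ k
        rw [inv_inv] at this
        exact congrArg _ this
    obtain ⟨A, L, C, φ, ψ, -, a, -, b, hL, hL', hT⟩ := D.exists_tensor hH σ₁ hσ₁ γ hγ 1
    have hA : A.charOn (c 0) ρ.H (fun k => D.smul_eq k.2 0) = σ₁.character := by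
      rw [← φ.character_rep 0]
      exact congrArg character (MonoidHom.ext fun k => LinearMap.ext fun w => a k k.2 0 _ w)
    have hC : C.charOn (c 0) ρ.H (fun k => D.smul_eq k.2 0) = σ₁.character := by
      rw [← ψ.character_rep 0]
      exact congrArg character (MonoidHom.ext fun k => LinearMap.ext fun w => b k k.2 0 _ w)
    rw [ht _ t₁, ht _ t₂, ← hψ]
    refine ⟨A, L, C, φ.hasFiberMultiple D.cover hinv m fun t k => ?_,
      ψ.hasFiberMultiple D.cover hinv m fun t k => ?_, hA, hA, hC, hC, hL, hL', hT⟩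
    · rw [← h₁ k k.2 k.2]
      exact congrArg (LinearMap.trace ℝ _) (LinearMap.ext fun w => a k k.2 t _ w)
    · rw [← h₁ k k.2 k.2]
      exact congrArg (LinearMap.trace ℝ _) (LinearMap.ext fun w => b k k.2 t _ w)

/-- The isotropy module of one fiber determines the bundle and is arbitrary. Over `H` the second
character is just the multiple of `χ` already prescribed by the first. -/
theorem nonempty_endCharacters_of_transitive {z : ρ.S} (hz : ∀ w, ∃ g : G, g • z = w)
    {χ : ρ.H → ℝ} (hinv : ρ.IsInvariant χ) :
    Nonempty (EndCharacters ρ χ (MulAction.stabilizer G z) ρ.H) := by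
  have := compactSpace_stabilizer (G := G) z
  have : CompactSpace ρ.H := compactSpace_H
  have hcov : ∀ w, ∃ (g : G) (_ : PUnit.{1}), g • z = w := fun w => by
    obtain ⟨g, hg⟩ := hz w
    exact ⟨g, PUnit.unit, hg⟩
  refine EndCharacters.nonempty_of z z (fun k => k.2) (fun k => ρ.smul_eq_of_mem_H k.2 z) ?_ ?_
  · rintro A A' - - e₀ -
    obtain ⟨φ⟩ := A.exists_frame_const z
    obtain ⟨φ'⟩ := A'.exists_frame_const z
    obtain ⟨f⟩ := exists_equiv_of_character_eq
      (φ.isCont_rep PUnit.unit (MulAction.stabilizer G z) fun k => k.2)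
      (φ'.isCont_rep PUnit.unit (MulAction.stabilizer G z) fun k => k.2) (congrFun
        (((φ.character_rep _ _ _).trans e₀).trans (φ'.character_rep _ _ _).symm))
    exact nonempty_iso_of_transitive hz φ φ' f.toLinearEquiv fun k h w =>
      IntertwiningMap.isIntertwining _ _ f.toIntertwiningMap ⟨k, h⟩ w
  · rintro η₁ η₂ c₁ - t₁ t₂ m ψ₁ ⟨⟨d₁, σ₁, hσ₁, rfl⟩, h₁⟩ ψ₂ ⟨-, h₂⟩
    have ht : ⇑η₂ * ψ₂ = ψ₂ := funext fun k => by simp [t₂ k k.2]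
    obtain ⟨A, φ, a⟩ := exists_frame_of_transitive hz σ₁ hσ₁
    obtain ⟨C, ψ, b⟩ := exists_frame_of_transitive hz (σ₁.smulHom η₁)
      fun w => c₁.smul (hσ₁ w)
    obtain ⟨L, l, l₁⟩ := exists_frame_of_transitive hz (W := ℝ)
      ((1 : Representation ℝ _ ℝ).smulHom η₁) (fun w => c₁.smul continuous_const)
    have hb : ∀ k (hk : k ∈ ρ.H) w, (σ₁.smulHom η₁) ⟨k, ρ.H_le_stabilizer z hk⟩ w =
        σ₁ ⟨k, ρ.H_le_stabilizer z hk⟩ w := fun k hk w => by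
      rw [smulHom_apply, t₁ _ hk, one_smul]
    have hA : ∀ t k, (φ.rep t ρ.H fun k => ρ.smul_eq_of_mem_H k.2 z).character k =
        m * χ k := fun t k => by
      rw [← h₁ k k.2 (ρ.H_le_stabilizer z k.2)]
      exact congrArg (LinearMap.trace ℝ _) (LinearMap.ext fun w => a k _ w)
    have hC : ∀ t k, (ψ.rep t ρ.H fun k => ρ.smul_eq_of_mem_H k.2 z).character k =
        m * χ k := fun t k => by
      rw [← h₁ k k.2 (ρ.H_le_stabilizer z k.2)]
      exact congrArg (LinearMap.trace ℝ _) (LinearMap.ext fun w => (b k _ w).trans (hb k k.2 w))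
    refine ⟨A, L, C, φ.hasFiberMultiple hcov hinv m hA, ψ.hasFiberMultiple hcov hinv m hC,
      ?_, ?_, ?_, ?_, l.isLineBundle hcov, l.hasTrivialFiber hcov fun n hn t e w => ?_,
      Frame.isTensor continuous_const hcov φ l ψ fun k _ _ h w => ?_⟩
    · refine (φ.character_rep PUnit.unit _ _).symm.trans ?_
      exact congrArg character (MonoidHom.ext fun k => LinearMap.ext fun w => a k k.2 w)
    · rw [← φ.character_rep PUnit.unit]
      exact funext fun k => (hA _ k).trans (h₂ k k.2 k.2).symm
    · refine (ψ.character_rep PUnit.unit _ _).symm.trans ?_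
      rw [← character_smulHom]
      exact congrArg character (MonoidHom.ext fun k => LinearMap.ext fun w => b k k.2 w)
    · rw [← ψ.character_rep PUnit.unit, ht]
      exact funext fun k => (hC _ k).trans (h₂ k k.2 k.2).symm
    · refine (l₁ n e w).trans ?_
      rw [smulHom_apply, t₁ _ hn, one_smul]
      rfl
    · refine (b k h w).trans ?_
      have e₁ : φ.trans k h w = σ₁ ⟨k, h⟩ w := a k h w
      have e₂ : l.trans k h 1 = η₁ ⟨k, h⟩ • (1 : ℝ) := l₁ k h 1
      rw [e₁, e₂, smulHom_apply]
      congr 1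
      exact (mul_one _).symm

end Geometries

/-! ### Presentations of the semigroups of compatible end characters -/

section Presentations

set_option linter.unusedSectionVars false

open Module Representation

section Abstract

variable {ι M : Type*} [AddCommMonoid M] {L : ι → M} {r : (ι →₀ ℕ) → (ι →₀ ℕ) → Prop}

theorem isPresentedBy_of [Fintype ι]
    (hr : ∀ a b, r a b → ∑ i, a i • L i = ∑ i, b i • L i)
    (hgen : ∀ x : M, ∃ a : ι → ℕ, ∑ i, a i • L i = x)
    (hrel : ∀ a b : ι →₀ ℕ, ∑ i, a i • L i = ∑ i, b i • L i → addConGen r a b) :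
    IsPresentedBy L r := by
  have hs : ∀ a : ι →₀ ℕ, a.sum (fun i k => k • L i) = ∑ i, a i • L i := fun a =>
    Finsupp.sum_fintype _ _ fun i => zero_smul ℕ (L i)
  refine ⟨fun x => ?_, fun a b => ⟨fun h => hrel a b (by rwa [← hs, ← hs]), fun h => ?_⟩⟩
  · obtain ⟨a, ha⟩ := hgen x
    exact ⟨Finsupp.equivFunOnFinite.symm a, (hs _).trans ha⟩
  · let f : (ι →₀ ℕ) →+ M := Finsupp.liftAddHom fun i => (multiplesHom M) (L i)
    have hf : ∀ a : ι →₀ ℕ, f a = ∑ i, a i • L i := fun a => hs a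
    have : addConGen r ≤ AddCon.ker f := AddCon.addConGen_le.2 fun a b h => by
      change f a = f b
      rw [hf, hf, hr a b h]
    exact (hs a).trans (((hf a).symm.trans (this h)).trans ((hf b).trans (hs b).symm))

theorem isPresentedBy_free [Fintype ι] (hgen : ∀ x : M, ∃ a : ι → ℕ, ∑ i, a i • L i = x)
    (hrel : ∀ a b : ι → ℕ, ∑ i, a i • L i = ∑ i, b i • L i → a = b) :
    IsPresentedBy L fun _ _ => False :=
  isPresentedBy_of (fun _ _ h => h.elim) hgen fun a b h => by
    rw [DFunLike.coe_injective (hrel a b h)]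
    exact (addConGen _).refl b

/-- A defining relation applied `t` times in the presence of `c`; the presentations below need
nothing more of the congruence than this and symmetry. -/
theorem addConGen_add_nsmul {u v a b c : ι →₀ ℕ} {t : ℕ} (h : r u v) (ha : a = c + t • u)
    (hb : b = c + t • v) : addConGen r a b := by
  subst ha hb
  exact (addConGen r).add ((addConGen r).refl c)
    ((addConGen r).nsmul t (AddConGen.Rel.of _ _ h))

end Abstract

variable {G : Type*} [Group G] [TopologicalSpace G] {ρ : OrthRep G} {χ : ρ.H → ℝ}
  {K₁ K₂ : Subgroup G}

theorem nsmul_right_injective_of_ne_zero {X : Type*} {ψ : X → ℝ} (hψ : ψ ≠ 0) {a b : ℕ}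
    (h : a • ψ = b • ψ) : a = b := by
  obtain ⟨x, hx⟩ := Function.ne_iff.1 hψ
  have := congrFun h x
  simp only [Pi.smul_apply, nsmul_eq_mul] at this
  exact_mod_cast mul_right_cancel₀ hx this

/-- The characters over multiples of `χ` are the multiples of one over `s • χ`. -/
def SimpleEnd {H : Subgroup G} (χ : H → ℝ) (K : Subgroup G) (s : ℕ) : Prop :=
  ∃ ψ : K → ℝ, ψ ≠ 0 ∧ ∀ m φ, φ ∈ multChars χ K m ↔ ∃ k : ℕ, m = s * k ∧ φ = k • ψ

/-- The characters over multiples of `χ` are freely generated by two extensions of `χ` which differ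
by a one-dimensional character. -/
def DoubleEnd {H : Subgroup G} (χ : H → ℝ) (K : Subgroup G) : Prop :=
  ∃ (ψ : K → ℝ) (η : K →* ℝ), Continuous η ∧ (∀ k : K, (k : G) ∈ H → η k = 1) ∧
    (∀ k, η k * η k = 1) ∧
    (∀ a b a' b' : ℕ, a • ψ + b • (η * ψ) = a' • ψ + b' • (η * ψ) → a = a' ∧ b = b') ∧
    ∀ m φ, φ ∈ multChars χ K m ↔ ∃ a b : ℕ, a + b = m ∧ φ = a • ψ + b • (η * ψ)

/-- No extension and exactly one extension are treated alike: there is one generating character,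
over `2χ` or over `χ`. -/
theorem EndType.cases {H K : Subgroup G} {χ : H → ℝ} {e : ℕ∞} (h : EndType χ K e) :
    (e = 0 ∧ SimpleEnd χ K 2) ∨ (e = 1 ∧ SimpleEnd χ K 1) ∨ (e = 2 ∧ DoubleEnd χ K) := by
  rcases h with ⟨he, h⟩ | ⟨he, ψ, h₀, h⟩ | ⟨he, h⟩
  · exact Or.inl ⟨he, h⟩
  · refine Or.inr (Or.inl ⟨he, ψ, h₀, fun m φ => (h m φ).trans ⟨fun h => ⟨m, (one_mul m).symm, h⟩, ?_⟩⟩)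
    rintro ⟨k, rfl, rfl⟩
    rw [one_mul]
  · exact Or.inr (Or.inr ⟨he, h⟩)

namespace EndCharacters

theorem exists_eq (E : EndCharacters ρ χ K₁ K₂) {m : ℕ} {ψ₁ : K₁ → ℝ} {ψ₂ : K₂ → ℝ} (h₁ : ψ₁ ∈ multChars χ K₁ m)
    (h₂ : ψ₂ ∈ multChars χ K₂ m) : ∃ x, E.fst x = ψ₁ ∧ E.snd x = ψ₂ := by
  obtain ⟨x, -, a, b, -⟩ := E.twist 1 1 continuous_const continuous_const (fun _ _ => rfl)
    (fun _ _ => rfl) m ψ₁ h₁ ψ₂ h₂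
  exact ⟨x, a, b⟩

theorem related (E : EndCharacters ρ χ K₁ K₂) {x y : ρ.Vect χ} (η₁ : K₁ →* ℝ) (η₂ : K₂ →* ℝ) (c₁ : Continuous η₁)
    (c₂ : Continuous η₂) (h₁ : ∀ k : K₁, (k : G) ∈ ρ.H → η₁ k = 1)
    (h₂ : ∀ k : K₂, (k : G) ∈ ρ.H → η₂ k = 1) (e₁ : E.fst y = η₁ * E.fst x)
    (e₂ : E.snd y = η₂ * E.snd x) : ρ.RelatedByLine x y := by
  obtain ⟨m, hm₁, hm₂⟩ := E.mem x
  obtain ⟨x', y', a, b, c, d, h⟩ := E.twist η₁ η₂ c₁ c₂ h₁ h₂ m _ hm₁ _ hm₂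
  rw [E.inj x x' a.symm b.symm, E.inj y y' (e₁.trans c.symm) (e₂.trans d.symm)]
  exact h

/-- A multiplicity is allowed at both ends exactly when it is divisible by `s₁` and `s₂`, so the
generator lies over their least common multiple. -/
theorem presentation_one (E : EndCharacters ρ χ K₁ K₂) {s₁ s₂ : ℕ} (hs₁ : 0 < s₁) (hs₂ : 0 < s₂) (h₁ : SimpleEnd χ K₁ s₁)
    (h₂ : SimpleEnd χ K₂ s₂) :
    ∃ L : ρ.Vect χ, IsPresentedBy (fun _ : Unit => L) (fun _ _ => False) := by
  obtain ⟨ψ₁, hψ₁, h₁⟩ := h₁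
  obtain ⟨ψ₂, hψ₂, h₂⟩ := h₂
  obtain ⟨p₁, hp₁⟩ := Nat.dvd_lcm_left s₁ s₂
  obtain ⟨p₂, hp₂⟩ := Nat.dvd_lcm_right s₁ s₂
  have hlcm : 0 < Nat.lcm s₁ s₂ := Nat.lcm_pos hs₁ hs₂
  obtain ⟨L, hL₁, hL₂⟩ := E.exists_eq ((h₁ _ _).2 ⟨p₁, hp₁, rfl⟩) ((h₂ _ _).2 ⟨p₂, hp₂, rfl⟩)
  refine ⟨L, isPresentedBy_free (fun x => ?_) fun a b h => ?_⟩
  · obtain ⟨m, hm₁, hm₂⟩ := E.mem x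
    obtain ⟨k₁, hk₁, e₁⟩ := (h₁ _ _).1 hm₁
    obtain ⟨k₂, hk₂, e₂⟩ := (h₂ _ _).1 hm₂
    obtain ⟨k, hk⟩ := Nat.lcm_dvd (m := s₁) (n := s₂) (k := m) ⟨k₁, hk₁⟩ ⟨k₂, hk₂⟩
    refine ⟨fun _ => k, ?_⟩
    rw [Fintype.sum_unique]
    refine E.inj _ _ ?_ ?_
    · rw [map_nsmul, hL₁, e₁, smul_smul]
      congr 1
      refine Nat.eq_of_mul_eq_mul_left hs₁ ?_
      rw [← hk₁, hk, hp₁]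
      ring
    · rw [map_nsmul, hL₂, e₂, smul_smul]
      congr 1
      refine Nat.eq_of_mul_eq_mul_left hs₂ ?_
      rw [← hk₂, hk, hp₂]
      ring
  · rw [Fintype.sum_unique, Fintype.sum_unique] at h
    have := congrArg E.fst h
    rw [map_nsmul, map_nsmul, hL₁, smul_smul, smul_smul] at this
    have hp : 0 < p₁ := Nat.pos_of_ne_zero fun h0 => by
      rw [hp₁, h0, mul_zero] at hlcm
      exact hlcm.ne rfl
    have := Nat.eq_of_mul_eq_mul_right hp (nsmul_right_injective_of_ne_zero hψ₁ this)
    funext i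
    exact this

/-- The second end only records the multiplicity, which the first already determines; so the
semigroup is the free one of the first end. -/
theorem presentation_two (E : EndCharacters ρ χ K₁ K₂) (h₁ : DoubleEnd χ K₁) (h₂ : SimpleEnd χ K₂ 1) :
    ∃ Lp Lm : ρ.Vect χ, IsPresentedBy ![Lp, Lm] (fun _ _ => False) ∧ ρ.RelatedByLine Lp Lm := by
  obtain ⟨ψ, η, hη, hη', -, hind, h₁⟩ := h₁
  obtain ⟨ψ₂, hψ₂, h₂⟩ := h₂
  have m₂ : ψ₂ ∈ multChars χ K₂ 1 := (h₂ _ _).2 ⟨1, rfl, (one_smul _ _).symm⟩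
  obtain ⟨Lp, p₁, p₂⟩ := E.exists_eq ((h₁ 1 ψ).2 ⟨1, 0, rfl, by simp⟩) m₂
  obtain ⟨Lm, n₁, n₂⟩ := E.exists_eq ((h₁ 1 (η * ψ)).2 ⟨0, 1, rfl, by simp⟩) m₂
  refine ⟨Lp, Lm, isPresentedBy_free (fun x => ?_) fun a b h => ?_,
    E.related η 1 hη continuous_const hη' (fun _ _ => rfl) (by rw [p₁, n₁]) (by
      rw [p₂, n₂]
      exact (one_mul ψ₂).symm)⟩
  · obtain ⟨m, hm₁, hm₂⟩ := E.mem x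
    obtain ⟨a, b, rfl, e₁⟩ := (h₁ _ _).1 hm₁
    obtain ⟨k, hk, e₂⟩ := (h₂ _ _).1 hm₂
    refine ⟨![a, b], E.inj _ _ ?_ ?_⟩
    · simp [Fin.sum_univ_two, p₁, n₁, e₁]
    · rw [one_mul] at hk
      subst hk
      simp [Fin.sum_univ_two, p₂, n₂, e₂, add_mul]
  · have := congrArg E.fst h
    simp only [Fin.sum_univ_two, Matrix.cons_val_zero, Matrix.cons_val_one, map_add, map_nsmul, p₁,
      n₁] at this
    obtain ⟨e₀, e₁⟩ := hind _ _ _ _ this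
    funext i
    fin_cases i
    · exact e₀
    · exact e₁

/-- The second end forces an even multiplicity, so the semigroup consists of the pairs of
coefficients with even sum, generated by `(1, 1)`, `(2, 0)` and `(0, 2)` with `2 (1, 1) = (2, 0) +
(0, 2)`. -/
theorem presentation_three (E : EndCharacters ρ χ K₁ K₂) (h₁ : DoubleEnd χ K₁) (h₂ : SimpleEnd χ K₂ 2) :
    ∃ L0 Lp Lm : ρ.Vect χ, IsPresentedBy ![L0, Lp, Lm] (fun a b => a = Finsupp.single 0 2 ∧
      b = Finsupp.single 1 1 + Finsupp.single 2 1) ∧ ρ.RelatedByLine Lp Lm := by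
  obtain ⟨ψ, η, hη, hη', -, hind, h₁⟩ := h₁
  obtain ⟨ψ₂, hψ₂, h₂⟩ := h₂
  have m₂ : ψ₂ ∈ multChars χ K₂ 2 := (h₂ _ _).2 ⟨1, rfl, (one_smul _ _).symm⟩
  obtain ⟨L0, o₁, o₂⟩ := E.exists_eq
    ((h₁ 2 (1 • ψ + 1 • (η * ψ))).2 ⟨1, 1, rfl, rfl⟩) m₂
  obtain ⟨Lp, p₁, p₂⟩ := E.exists_eq ((h₁ 2 (2 • ψ + 0 • (η * ψ))).2 ⟨2, 0, rfl, rfl⟩) m₂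
  obtain ⟨Lm, n₁, n₂⟩ := E.exists_eq ((h₁ 2 (0 • ψ + 2 • (η * ψ))).2 ⟨0, 2, rfl, rfl⟩) m₂
  have hf : ∀ a : Fin 3 → ℕ, E.fst (∑ i, a i • (![L0, Lp, Lm] : Fin 3 → ρ.Vect χ) i) =
      (a 0 + 2 * a 1) • ψ + (a 0 + 2 * a 2) • (η * ψ) := by
    intro a
    simp only [Fin.sum_univ_three, Matrix.cons_val_zero, Matrix.cons_val_one, Matrix.cons_val,
      map_add, map_nsmul, o₁, p₁, n₁]
    module
  have hs : ∀ a : Fin 3 → ℕ, E.snd (∑ i, a i • (![L0, Lp, Lm] : Fin 3 → ρ.Vect χ) i) =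
      (a 0 + a 1 + a 2) • ψ₂ := by
    intro a
    simp only [Fin.sum_univ_three, Matrix.cons_val_zero, Matrix.cons_val_one, Matrix.cons_val,
      map_add, map_nsmul, o₂, p₂, n₂]
    module
  refine ⟨L0, Lp, Lm, isPresentedBy_of ?_ (fun x => ?_) fun a b h => ?_,
    E.related η 1 hη continuous_const hη' (fun _ _ => rfl) (by
      rw [p₁, n₁, zero_smul, zero_smul, zero_add, add_zero, mul_smul_comm]) (by
      rw [p₂, n₂]
      exact (one_mul ψ₂).symm)⟩
  · rintro a b ⟨rfl, rfl⟩
    refine E.inj _ _ ?_ ?_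
    · rw [hf, hf]
      simp
    · rw [hs, hs]
      simp
  · obtain ⟨m, hm₁, hm₂⟩ := E.mem x
    obtain ⟨a, b, hab, e₁⟩ := (h₁ _ _).1 hm₁
    obtain ⟨k, hk, e₂⟩ := (h₂ _ _).1 hm₂
    -- Both coefficients have the same parity, so at most one copy of `L0` is needed.
    refine ⟨![a % 2, a / 2, b / 2], E.inj _ _ ?_ ?_⟩
    · rw [hf, e₁]
      change (a % 2 + 2 * (a / 2)) • ψ + (a % 2 + 2 * (b / 2)) • (η * ψ) = _
      congr 2 <;> omega
    · rw [hs, e₂]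
      change (a % 2 + a / 2 + b / 2) • ψ₂ = _
      congr 1
      omega
  · have := congrArg E.fst h
    rw [hf, hf] at this
    obtain ⟨e₀, e₁⟩ := hind _ _ _ _ this
    -- Equal coefficients force the exponents of `L0` to have the same parity, and half their
    -- difference counts the applications of the relation.
    rcases le_total (a 0) (b 0) with hle | hle
    · refine (addConGen _).symm (addConGen_add_nsmul (t := (b 0 - a 0) / 2)
        (c := Finsupp.equivFunOnFinite.symm ![a 0, b 1, b 2]) ⟨rfl, rfl⟩ ?_ ?_) <;>
      · ext i
        fin_cases i <;> simp <;> omega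
    · refine addConGen_add_nsmul (t := (a 0 - b 0) / 2)
        (c := Finsupp.equivFunOnFinite.symm ![b 0, a 1, a 2]) ⟨rfl, rfl⟩ ?_ ?_ <;>
      · ext i
        fin_cases i <;> simp <;> omega

/-- An element is a pair of decompositions `a + b = c + d`. Writing it in the generators is filling
a two by two table of natural numbers with these margins, and two fillings differ by moves along the
diagonal relation. -/
theorem presentation_four (E : EndCharacters ρ χ K₁ K₂) (h₁ : DoubleEnd χ K₁) (h₂ : DoubleEnd χ K₂) :
    ∃ Lpp Lpm Lmp Lmm : ρ.Vect χ, IsPresentedBy ![Lpp, Lpm, Lmp, Lmm] (fun a b =>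
        a = Finsupp.single 0 1 + Finsupp.single 3 1 ∧
        b = Finsupp.single 1 1 + Finsupp.single 2 1) ∧
      ∀ x ∈ ({Lpp, Lpm, Lmp, Lmm} : Set (ρ.Vect χ)),
        ∀ y ∈ ({Lpp, Lpm, Lmp, Lmm} : Set (ρ.Vect χ)), ρ.RelatedByLine x y := by
  obtain ⟨ψ, η, hη, hη', hη2, hind, h₁⟩ := h₁
  obtain ⟨ψ', η', hη₂, hη₂', hη2', hind', h₂⟩ := h₂
  have m₁ : ψ ∈ multChars χ K₁ 1 := (h₁ 1 ψ).2 ⟨1, 0, rfl, by simp⟩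
  have m₁' : ⇑η * ψ ∈ multChars χ K₁ 1 := (h₁ 1 _).2 ⟨0, 1, rfl, by simp⟩
  have m₂ : ψ' ∈ multChars χ K₂ 1 := (h₂ 1 ψ').2 ⟨1, 0, rfl, by simp⟩
  have m₂' : ⇑η' * ψ' ∈ multChars χ K₂ 1 := (h₂ 1 _).2 ⟨0, 1, rfl, by simp⟩
  obtain ⟨Lpp, a₁, a₂⟩ := E.exists_eq m₁ m₂
  obtain ⟨Lpm, b₁, b₂⟩ := E.exists_eq m₁ m₂'
  obtain ⟨Lmp, c₁, c₂⟩ := E.exists_eq m₁' m₂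
  obtain ⟨Lmm, d₁, d₂⟩ := E.exists_eq m₁' m₂'
  have hf : ∀ a : Fin 4 → ℕ, E.fst (∑ i, a i • (![Lpp, Lpm, Lmp, Lmm] : Fin 4 → ρ.Vect χ) i) =
      (a 0 + a 1) • ψ + (a 2 + a 3) • (η * ψ) := by
    intro a
    simp only [Fin.sum_univ_four, Matrix.cons_val_zero, Matrix.cons_val_one, Matrix.cons_val,
      map_add, map_nsmul, a₁, b₁, c₁, d₁]
    module
  have hs : ∀ a : Fin 4 → ℕ, E.snd (∑ i, a i • (![Lpp, Lpm, Lmp, Lmm] : Fin 4 → ρ.Vect χ) i) =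
      (a 0 + a 2) • ψ' + (a 1 + a 3) • (η' * ψ') := by
    intro a
    simp only [Fin.sum_univ_four, Matrix.cons_val_zero, Matrix.cons_val_one, Matrix.cons_val,
      map_add, map_nsmul, a₂, b₂, c₂, d₂]
    module
  refine ⟨Lpp, Lpm, Lmp, Lmm, isPresentedBy_of ?_ (fun x => ?_) fun a b h => ?_, ?_⟩
  · rintro a b ⟨rfl, rfl⟩
    refine E.inj _ _ ?_ ?_
    · rw [hf, hf]
      simp
    · rw [hs, hs]
      simp
  · obtain ⟨m, hm₁, hm₂⟩ := E.mem x
    obtain ⟨a, b, hab, e₁⟩ := (h₁ _ _).1 hm₁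
    obtain ⟨c, d, hcd, e₂⟩ := (h₂ _ _).1 hm₂
    -- The filling with the largest possible upper left entry.
    refine ⟨![min a c, a - min a c, c - min a c, b - (c - min a c)], E.inj _ _ ?_ ?_⟩
    · rw [hf, e₁]
      change (min a c + (a - min a c)) • ψ +
        (c - min a c + (b - (c - min a c))) • (η * ψ) = _
      congr 2 <;> omega
    · rw [hs, e₂]
      change (min a c + (c - min a c)) • ψ' +
        (a - min a c + (b - (c - min a c))) • (η' * ψ') = _
      congr 2 <;> omega
  · have h₁ := congrArg E.fst h
    have h₂ := congrArg E.snd h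
    rw [hf, hf] at h₁
    rw [hs, hs] at h₂
    obtain ⟨e₀, e₁⟩ := hind _ _ _ _ h₁
    obtain ⟨e₂, e₃⟩ := hind' _ _ _ _ h₂
    -- With the margins fixed, the upper left entry determines the table; the difference of these
    -- entries counts the applications of the relation.
    rcases le_total (a 0) (b 0) with hle | hle
    · refine (addConGen _).symm (addConGen_add_nsmul (t := b 0 - a 0)
        (c := Finsupp.equivFunOnFinite.symm ![a 0, b 1, b 2, a 3]) ⟨rfl, rfl⟩ ?_ ?_) <;>
      · ext i
        fin_cases i <;> simp <;> omega
    · refine addConGen_add_nsmul (t := a 0 - b 0)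
        (c := Finsupp.equivFunOnFinite.symm ![b 0, a 1, a 2, b 3]) ⟨rfl, rfl⟩ ?_ ?_ <;>
      · ext i
        fin_cases i <;> simp <;> omega
  -- As `η` has square one, it also leads back from the twist to `ψ`; so any two generators differ
  -- at each end by `1` or by the twisting character.
  · have key : ∀ {K : Subgroup G} {ψ : K → ℝ} {η : K →* ℝ}, Continuous η →
        (∀ k : K, (k : G) ∈ ρ.H → η k = 1) → (∀ k, η k * η k = 1) → ∀ φ φ' : K → ℝ,
        (φ = ψ ∨ φ = η * ψ) → (φ' = ψ ∨ φ' = η * ψ) → ∃ η₀ : K →* ℝ, Continuous η₀ ∧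
          (∀ k : K, (k : G) ∈ ρ.H → η₀ k = 1) ∧ φ' = η₀ * φ := by
      intro K ψ η hη hη' hη2 φ φ' h h'
      have hsq : ⇑η * (⇑η * ψ) = ψ := by
        rw [← mul_assoc]
        funext k
        simp [hη2 k]
      have h1 : ∀ ψ : K → ℝ, ψ = ⇑(1 : K →* ℝ) * ψ := fun ψ => (one_mul ψ).symm
      rcases h with rfl | rfl <;> rcases h' with rfl | rfl
      · exact ⟨1, continuous_const, fun _ _ => rfl, h1 _⟩
      · exact ⟨η, hη, hη', rfl⟩
      · exact ⟨η, hη, hη', hsq.symm⟩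
      · exact ⟨1, continuous_const, fun _ _ => rfl, h1 _⟩
    have hmem : ∀ x ∈ ({Lpp, Lpm, Lmp, Lmm} : Set (ρ.Vect χ)),
        (E.fst x = ψ ∨ E.fst x = η * ψ) ∧ (E.snd x = ψ' ∨ E.snd x = η' * ψ') := by
      rintro x (rfl | rfl | rfl | rfl)
      · exact ⟨Or.inl a₁, Or.inl a₂⟩
      · exact ⟨Or.inl b₁, Or.inr b₂⟩
      · exact ⟨Or.inr c₁, Or.inl c₂⟩
      · exact ⟨Or.inr d₁, Or.inr d₂⟩
    intro x hx y hy
    obtain ⟨ζ₁, i₁, j₁, k₁⟩ := key hη hη' hη2 _ _ (hmem x hx).1 (hmem y hy).1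
    obtain ⟨ζ₂, i₂, j₂, k₂⟩ := key hη₂ hη₂' hη2' _ _ (hmem x hx).2 (hmem y hy).2
    exact E.related ζ₁ ζ₂ i₁ i₂ j₁ j₂ k₁ k₂

/-- The presentations in the case of fibers classified by their characters. -/
theorem presentations (E : EndCharacters ρ χ K₁ K₂) {e₁ e₂ : ℕ∞} (h₁ : EndType χ K₁ e₁) (h₂ : EndType χ K₂ e₂) :
    ((e₁, e₂) ∈ ({(0, 0), (1, 0), (0, 1), (1, 1)} : Set (ℕ∞ × ℕ∞)) →
        ∃ L : ρ.Vect χ, IsPresentedBy (fun _ : Unit => L) (fun _ _ => False)) ∧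
      ((e₁, e₂) ∈ ({(2, 1), (1, 2)} : Set (ℕ∞ × ℕ∞)) →
        ∃ Lp Lm : ρ.Vect χ, IsPresentedBy ![Lp, Lm] (fun _ _ => False) ∧
          ρ.RelatedByLine Lp Lm) ∧
      ((e₁, e₂) ∈ ({(2, 0), (0, 2)} : Set (ℕ∞ × ℕ∞)) →
        ∃ L0 Lp Lm : ρ.Vect χ,
          IsPresentedBy ![L0, Lp, Lm] (fun a b => a = Finsupp.single 0 2 ∧
            b = Finsupp.single 1 1 + Finsupp.single 2 1) ∧
          ρ.RelatedByLine Lp Lm) ∧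
      ((e₁, e₂) ∈ ({(2, 2)} : Set (ℕ∞ × ℕ∞)) →
        ∃ Lpp Lpm Lmp Lmm : ρ.Vect χ,
          IsPresentedBy ![Lpp, Lpm, Lmp, Lmm] (fun a b =>
            a = Finsupp.single 0 1 + Finsupp.single 3 1 ∧
            b = Finsupp.single 1 1 + Finsupp.single 2 1) ∧
          ∀ x ∈ ({Lpp, Lpm, Lmp, Lmm} : Set (ρ.Vect χ)),
            ∀ y ∈ ({Lpp, Lpm, Lmp, Lmm} : Set (ρ.Vect χ)), ρ.RelatedByLine x y) := by
  have h01 : (0 : ℕ∞) ≠ 1 := by decide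
  have h02 : (0 : ℕ∞) ≠ 2 := by decide
  have h12 : (1 : ℕ∞) ≠ 2 := by decide
  rcases h₁.cases with ⟨rfl, d₁⟩ | ⟨rfl, d₁⟩ | ⟨rfl, d₁⟩ <;>
  rcases h₂.cases with ⟨rfl, d₂⟩ | ⟨rfl, d₂⟩ | ⟨rfl, d₂⟩ <;>
  simp only [Set.mem_insert_iff, Set.mem_singleton_iff, Prod.mk.injEq, h01, h02, h12, h01.symm,
    h02.symm, h12.symm, true_and, and_true, and_false, or_false, or_true, and_self, IsEmpty.forall_iff, forall_true_left]
  · exact E.presentation_one two_pos two_pos d₁ d₂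
  · exact E.presentation_one two_pos one_pos d₁ d₂
  · exact E.swap.presentation_three d₂ d₁
  · exact E.presentation_one one_pos two_pos d₁ d₂
  · exact E.presentation_one one_pos one_pos d₁ d₂
  · exact E.swap.presentation_two d₂ d₁
  · exact E.presentation_three d₁ d₂
  · exact E.presentation_two d₁ d₂
  · exact E.presentation_four d₁ d₂

end EndCharacters

end Presentations

/-! ### Real type, complex structures and the presentation from a sign -/

section RealTypes

set_option linter.unusedSectionVars false

open Module Representation

section Endomorphisms

variable {K U : Type*} [Group K] [AddCommGroup U] [Module ℝ U] [FiniteDimensional ℝ U]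
  {τ : Representation ℝ K U}

theorem IntertwiningMap.injective_of_ne_zero (hirr : τ.IsIrreducible) {f : IntertwiningMap τ τ}
    (hf : f ≠ 0) : Function.Injective f := by
  rcases hirr.eq_bot_or_eq_top f.ker with h | h
  · refine (injective_iff_map_eq_zero f.toLinearMap).2 fun v hv => ?_
    have : v ∈ f.ker.toSubmodule := hv
    rw [h] at this
    exact this
  · refine absurd ?_ hf
    ext v
    have : v ∈ (⊤ : Subrepresentation τ).toSubmodule := Submodule.mem_top
    rw [← h] at this
    exact this

/-- An irreducible real module is of real type or has a complex structure. -/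
theorem scalar_or_exists_complexStructure [TopologicalSpace K] [IsTopologicalGroup K]
    [CompactSpace K] (hirr : τ.IsIrreducible) :
    (∀ f : IntertwiningMap τ τ, ∃ r : ℝ, ∀ u, f u = r • u) ∨
      ∃ J : IntertwiningMap τ τ, ∀ w, J (J w) = -w := by
  rw [or_iff_not_imp_left]
  intro hR
  push Not at hR
  obtain ⟨f, hf⟩ := hR
  have hnt := hirr.nontrivial
  have : Nontrivial (IntertwiningMap τ τ) := ⟨0, 1, fun h => by
    obtain ⟨x, hx⟩ := exists_ne (0 : U)
    exact hx (congrArg (fun f : IntertwiningMap τ τ => f x) h).symm⟩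
  let _ : Ring (IntertwiningMap τ τ) := Algebra.semiringToRing ℝ
  have : NoZeroDivisors (IntertwiningMap τ τ) := ⟨fun {a b} h => by
    by_contra! hc
    refine hc.2 ?_
    ext v
    apply IntertwiningMap.injective_of_ne_zero hirr hc.1
    exact (congrArg (fun f : IntertwiningMap τ τ => f v) h).trans (map_zero a).symm⟩
  have : IsDomain (IntertwiningMap τ τ) := NoZeroDivisors.to_isDomain (IntertwiningMap τ τ)
  have : Module.Finite ℝ (IntertwiningMap τ τ) := Module.Finite.of_injective
    ({ toFun := fun f => f.toLinearMap
       map_add' := fun _ _ => rfl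
       map_smul' := fun _ _ => rfl } : IntertwiningMap τ τ →ₗ[ℝ] (U →ₗ[ℝ] U))
    (IntertwiningMap.toLinearMap_injective τ τ)
  have hint : IsIntegral ℝ f := IsIntegral.of_finite ℝ f
  -- Endomorphisms of an irreducible module have no zero divisors, so the minimal polynomial of a
  -- nonscalar `f` is an irreducible real polynomial, of degree at most two.
  have hdeg := (minpoly.irreducible hint).degree_le_two
  obtain ⟨a, b, c, habc⟩ : ∃ a b c : ℝ, minpoly ℝ f =
      Polynomial.C a * Polynomial.X ^ 2 + Polynomial.C b * Polynomial.X + Polynomial.C c :=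
    ⟨_, _, _, Polynomial.eq_quadratic_of_degree_le_two hdeg⟩
  have haev := minpoly.aeval ℝ f
  rw [habc] at haev
  have hv : ∀ u, a • f (f u) + b • f u + c • u = 0 := by
    intro u
    have := congrArg (fun f : IntertwiningMap τ τ => f u) haev
    simpa [pow_two, Algebra.algebraMap_eq_smul_one] using this
  have ha : a ≠ 0 := by
    rintro rfl
    have hb : b ≠ 0 := by
      rintro rfl
      obtain ⟨x, hx⟩ := exists_ne (0 : U)
      have := hv x
      rw [zero_smul, zero_smul, zero_add, zero_add] at this
      rw [(smul_eq_zero.1 this).resolve_right hx] at habc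
      exact minpoly.ne_zero hint (by rw [habc]; simp)
    obtain ⟨u, hu⟩ := hf (-c / b)
    refine hu ?_
    have := hv u
    rw [zero_smul, zero_add, add_eq_zero_iff_eq_neg] at this
    rw [div_eq_inv_mul, mul_smul, neg_smul, ← this, smul_smul, inv_mul_cancel₀ hb, one_smul]
  -- Completing the square: `g = f + p` has a scalar square. If that scalar is negative, a real
  -- multiple of `g` is a complex structure.
  let p := b / (2 * a)
  let g : IntertwiningMap τ τ := f + p • 1
  have hg : ∀ u, g u = f u + p • u := fun u => rfl
  have hg2 : ∀ u, g (g u) = (p ^ 2 - c / a) • u := by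
    intro u
    have h₁ : f (f u) = -((b / a) • f u) - (c / a) • u := by
      have := congrArg (fun v => a⁻¹ • v) (hv u)
      simp only [smul_add, smul_smul, inv_mul_cancel₀ ha, one_smul, smul_zero] at this
      rw [← sub_eq_zero, ← this]
      module
    rw [hg, hg, map_add, map_smul, h₁]
    have h₂ : b / a = 2 * p := by
      simp only [p]
      field_simp
    rw [h₂]
    module
  by_cases hD : p ^ 2 - c / a < 0
  · let s := Real.sqrt (-(p ^ 2 - c / a))
    have hs : s ^ 2 = -(p ^ 2 - c / a) := Real.sq_sqrt (by linarith)
    have hs0 : s ≠ 0 := fun h => by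
      rw [h] at hs
      simp only [ne_eq, OfNat.ofNat_ne_zero, not_false_eq_true, zero_pow] at hs
      linarith
    refine ⟨s⁻¹ • g, fun w => ?_⟩
    change s⁻¹ • g (s⁻¹ • g w) = _
    rw [map_smul, hg2, smul_smul, smul_smul]
    have : s⁻¹ * s⁻¹ * (p ^ 2 - c / a) = -1 := by
      have h₃ : p ^ 2 - c / a = -s ^ 2 := by linarith
      rw [h₃]
      field_simp
    rw [this, neg_one_smul]
  · exfalso
    let s := Real.sqrt (p ^ 2 - c / a)
    have hs : s ^ 2 = p ^ 2 - c / a := Real.sq_sqrt (not_lt.1 hD)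
    -- A nonnegative square would factor, and absence of zero divisors would make `f` a scalar.
    have hz : (g + (-s) • 1) * (g + s • 1) = 0 := by
      ext u
      change g (g u + s • u) + (-s) • (g u + s • u) = 0
      rw [map_add, map_smul, hg2, ← hs]
      module
    rcases mul_eq_zero.1 hz with h | h
    · obtain ⟨u, hu⟩ := hf (s - p)
      refine hu ?_
      have : f u + p • u + (-s) • u = 0 := congrArg (fun f : IntertwiningMap τ τ => f u) h
      rw [← sub_eq_zero, ← this]
      module
    · obtain ⟨u, hu⟩ := hf (-s - p)
      refine hu ?_
      have : f u + p • u + s • u = 0 := congrArg (fun f : IntertwiningMap τ τ => f u) h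
      rw [← sub_eq_zero, ← this]
      module

/-- The definition of real type concerns some module with the given character; equality of
characters transfers the condition on endomorphisms to `τ`. -/
theorem isOfRealType_iff [TopologicalSpace K] [IsTopologicalGroup K] [CompactSpace K] {d : ℕ}
    {τ : Representation ℝ K (Fin d → ℝ)} (hτ : ∀ v, Continuous fun k => τ k v)
    (hirr : τ.IsIrreducible) : IsOfRealType τ.character ↔
      ∀ f : IntertwiningMap τ τ, ∃ r : ℝ, ∀ u, f u = r • u := by
  constructor
  · rintro ⟨d', σ, hσ, -, hστ, ⟨A⟩⟩
    obtain ⟨e⟩ := exists_equiv_of_character_eq (σ := σ) (τ := τ)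
      (fun v => (hσ v).weaklyContinuous) (fun v => (hτ v).weaklyContinuous) (congrFun hστ)
    refine IntertwiningMap.scalar_of_equiv e fun f => ⟨A f, fun u => ?_⟩
    have : f = A f • 1 := A.injective (by simp)
    exact congrArg (fun f : IntertwiningMap σ σ => f u) this
  · intro hR
    have hnt := hirr.nontrivial
    have : Nontrivial (IntertwiningMap τ τ) := ⟨0, 1, fun h => by
      obtain ⟨x, hx⟩ := exists_ne (0 : Fin d → ℝ)
      exact hx (congrArg (fun f : IntertwiningMap τ τ => f x) h).symm⟩
    refine ⟨d, τ, hτ, hirr, rfl, ⟨(AlgEquiv.ofBijective (Algebra.ofId ℝ _)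
      ⟨(Algebra.ofId ℝ _).toRingHom.injective, fun f => ?_⟩).symm⟩⟩
    obtain ⟨r, hr⟩ := hR f
    refine ⟨r, ?_⟩
    rw [Algebra.ofId_apply, Algebra.algebraMap_eq_smul_one]
    exact IntertwiningMap.ext (LinearMap.ext fun u => (hr u).symm)

end Endomorphisms

section ComplexStructures

/-- Two complex structures on a real vector space are conjugate. -/
theorem exists_conj_complexStructure {V V' : Type*} [AddCommGroup V] [Module ℝ V]
    [FiniteDimensional ℝ V] [AddCommGroup V'] [Module ℝ V'] [FiniteDimensional ℝ V']
    (h : finrank ℝ V = finrank ℝ V') {J : Module.End ℝ V} {J' : Module.End ℝ V'} (hJ : J * J = -1)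
    (hJ' : J' * J' = -1) : ∃ e : V ≃ₗ[ℝ] V', ∀ v, e (J v) = J' (e v) := by
  -- Complex structures turn both spaces into complex vector spaces of equal dimension, and a
  -- complex-linear isomorphism conjugates one structure to the other.
  let m : Module ℂ V := Module.compHom V (Complex.liftAux J hJ).toRingHom
  let m' : Module ℂ V' := Module.compHom V' (Complex.liftAux J' hJ').toRingHom
  have hs : ∀ (z : ℂ) (v : V), z • v = Complex.liftAux J hJ z v := fun _ _ => rfl
  have hs' : ∀ (z : ℂ) (v : V'), z • v = Complex.liftAux J' hJ' z v := fun _ _ => rfl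
  have : IsScalarTower ℝ ℂ V := ⟨fun r z v => by
    rw [hs, hs, map_smul]
    rfl⟩
  have : IsScalarTower ℝ ℂ V' := ⟨fun r z v => by
    rw [hs', hs', map_smul]
    rfl⟩
  have : Module.Finite ℂ V := Module.Finite.of_restrictScalars_finite ℝ ℂ V
  have : Module.Finite ℂ V' := Module.Finite.of_restrictScalars_finite ℝ ℂ V'
  have hf : finrank ℂ V = finrank ℂ V' := by
    have h₁ := finrank_mul_finrank ℝ ℂ V
    have h₂ := finrank_mul_finrank ℝ ℂ V'
    rw [Complex.finrank_real_complex] at h₁ h₂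
    omega
  let e : V ≃ₗ[ℂ] V' := LinearEquiv.ofFinrankEq V V' hf
  refine ⟨e.restrictScalars ℝ, fun v => ?_⟩
  have h₁ : Complex.I • v = J v := by rw [hs, Complex.liftAux_apply_I]
  have h₂ : Complex.I • e v = J' (e v) := by rw [hs', Complex.liftAux_apply_I]
  rw [← h₁]
  exact (map_smul e _ _).trans h₂

/-- A complex structure lives on an even-dimensional space. -/
theorem even_finrank_of_complexStructure {V : Type*} [AddCommGroup V] [Module ℝ V]
    [FiniteDimensional ℝ V] {J : Module.End ℝ V} (hJ : J * J = -1) : Even (finrank ℝ V) := by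
  have h := congrArg LinearMap.det hJ
  rw [map_mul, ← neg_one_smul ℝ (1 : Module.End ℝ V), LinearMap.det_smul, map_one, mul_one] at h
  by_contra hodd
  rw [Nat.not_even_iff_odd] at hodd
  rw [hodd.neg_one_pow] at h
  nlinarith [mul_self_nonneg (LinearMap.det J)]

variable {ι : Type*} [Fintype ι] [DecidableEq ι]

theorem Matrix.toLin'_mul_toLin'_eq_neg_one {J : Matrix ι ι ℝ} (hJ : J * J = -1) :
    (Matrix.toLin' J : Module.End ℝ (ι → ℝ)) * Matrix.toLin' J = -1 := by
  rw [Module.End.mul_eq_comp, ← Matrix.toLin'_mul, hJ, map_neg, Matrix.toLin'_one]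
  rfl

theorem Matrix.exists_conj_complexStructure {J J' : Matrix ι ι ℝ} (hJ : J * J = -1)
    (hJ' : J' * J' = -1) : ∃ P : Matrix ι ι ℝ, P.det ≠ 0 ∧ P * J = J' * P := by
  obtain ⟨e, he⟩ := _root_.exists_conj_complexStructure rfl
    (Matrix.toLin'_mul_toLin'_eq_neg_one hJ) (Matrix.toLin'_mul_toLin'_eq_neg_one hJ')
  refine ⟨LinearMap.toMatrix' e.toLinearMap, ?_, ?_⟩
  · rw [LinearMap.det_toMatrix']
    exact (LinearEquiv.isUnit_det' e).ne_zero
  · apply Matrix.toLin'.injective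
    rw [Matrix.toLin'_mul, Matrix.toLin'_mul, Matrix.toLin'_toMatrix']
    exact LinearMap.ext he

theorem Matrix.even_card_of_mul_self {J : Matrix ι ι ℝ} (hJ : J * J = -1) :
    Even (Fintype.card ι) := by
  have := even_finrank_of_complexStructure (Matrix.toLin'_mul_toLin'_eq_neg_one hJ)
  rwa [finrank_fintype_fun_eq_card] at this

theorem Matrix.det_pos_of_commute {J P : Matrix ι ι ℝ} (hJ : J * J = -1) (hP : P.det ≠ 0)
    (h : J * P = P * J) : 0 < P.det := by
  rw [← LinearMap.det_toLin']
  refine _root_.det_pos_of_commute (J := Matrix.toLin' J)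
    (Function.LeftInverse.injective (g := Matrix.toLin' P⁻¹) fun v => ?_)
    (Matrix.toLin'_mul_toLin'_eq_neg_one hJ) ?_
  · rw [← Matrix.toLin'_mul_apply, Matrix.nonsing_inv_mul _ (isUnit_iff_ne_zero.2 hP),
      Matrix.toLin'_one, LinearMap.id_apply]
  · rw [Module.End.mul_eq_comp, Module.End.mul_eq_comp, ← Matrix.toLin'_mul, ← Matrix.toLin'_mul, h]

end ComplexStructures

/-- The presentation by two generators with `2 L⁺ = 2 L⁻`, from a rank and a sign. -/
theorem isPresentedBy_of_sign {M : Type*} [AddCommMonoid M] {T : M → ℕ → ℤˣ → Prop}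
    (hex : ∀ x, ∃ n s, T x n s) (hinj : ∀ {x y n s}, T x n s → T y n s → x = y)
    (hfun : ∀ {x n s n' s'}, T x n s → T x n' s' → n = n' ∧ s = s')
    (hadd : ∀ {x y n s n' s'}, T x n s → T y n' s' → T (x + y) (n + n') (s * s'))
    (hzero : ∀ {x s}, T x 0 s → s = 1) {Lp Lm : M} (hp : T Lp 1 1) (hm : T Lm 1 (-1)) :
    IsPresentedBy ![Lp, Lm] (fun a b => a = Finsupp.single 0 2 ∧ b = Finsupp.single 1 2) := by
  have h0 : T 0 0 1 := by
    -- From `0 + 0 = 0` the rank of zero satisfies `n = n + n`.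
    obtain ⟨n, s, h⟩ := hex 0
    have h' := hadd h h
    rw [add_zero] at h'
    obtain ⟨e, -⟩ := hfun h h'
    obtain rfl : n = 0 := by omega
    rwa [hzero h] at h
  have hP : ∀ k : ℕ, T (k • Lp) k 1 := fun k => by
    induction k with
    | zero => rwa [zero_smul]
    | succ k ih =>
      have := hadd ih hp
      rwa [one_mul, ← succ_nsmul] at this
  have hM : ∀ k : ℕ, T (k • Lm) k ((-1) ^ k) := fun k => by
    induction k with
    | zero => rwa [zero_smul, pow_zero]
    | succ k ih =>
      have := hadd ih hm
      rwa [← pow_succ, ← succ_nsmul] at this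
  have hsum : ∀ a : Fin 2 → ℕ, T (∑ i, a i • (![Lp, Lm] : Fin 2 → M) i) (a 0 + a 1)
      ((-1) ^ a 1) := fun a => by
    have := hadd (hP (a 0)) (hM (a 1))
    rw [one_mul] at this
    rwa [Fin.sum_univ_two]
  have hpar : ∀ a b : ℕ, ((-1 : ℤˣ)) ^ a = (-1) ^ b → a % 2 = b % 2 := fun a b h => by
    have hn : (1 : ℤˣ) ≠ -1 := by decide
    rcases Nat.even_or_odd a with ha | ha <;> rcases Nat.even_or_odd b with hb | hb
    · rw [Nat.even_iff.1 ha, Nat.even_iff.1 hb]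
    · rw [ha.neg_one_pow, hb.neg_one_pow] at h
      exact absurd h hn
    · rw [ha.neg_one_pow, hb.neg_one_pow] at h
      exact absurd h.symm hn
    · rw [Nat.odd_iff.1 ha, Nat.odd_iff.1 hb]
  refine isPresentedBy_of ?_ (fun x => ?_) fun a b h => ?_
  · rintro a b ⟨rfl, rfl⟩
    exact hinj (hsum _) (by simpa using hsum (Finsupp.single 1 2 : Fin 2 →₀ ℕ))
  · obtain ⟨n, s, h⟩ := hex x
    rcases Int.units_eq_one_or s with rfl | rfl
    · exact ⟨![n, 0], hinj (hsum _) (by simpa using h)⟩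
    · obtain ⟨n, rfl⟩ : ∃ k, n = k + 1 := Nat.exists_eq_succ_of_ne_zero (by
        rintro rfl
        exact absurd (hzero h) (by decide))
      exact ⟨![n, 1], hinj (hsum _) (by simpa using h)⟩
  · have ha := hsum a
    rw [h] at ha
    obtain ⟨e, hs⟩ := hfun ha (hsum b)
    have hs' := hpar _ _ hs
    rcases le_total (a 0) (b 0) with hle | hle
    · refine (addConGen _).symm (addConGen_add_nsmul (t := (b 0 - a 0) / 2)
        (c := Finsupp.equivFunOnFinite.symm ![a 0, b 1]) ⟨rfl, rfl⟩ ?_ ?_) <;>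
      · ext i
        fin_cases i <;> simp <;> omega
    · refine addConGen_add_nsmul (t := (a 0 - b 0) / 2)
        (c := Finsupp.equivFunOnFinite.symm ![b 0, a 1]) ⟨rfl, rfl⟩ ?_ ?_ <;>
      · ext i
        fin_cases i <;> simp <;> omega

end RealTypes

/-! ### Frames modelled on powers of an irreducible module -/

section PowerFrames

set_option linter.unusedSectionVars false

open Module Representation GVectorBundle

theorem det_ne_zero_of_matAct_injective {U : Type*} [AddCommGroup U] [Module ℝ U] [Nontrivial U]
    {ι : Type*} [Fintype ι] [DecidableEq ι] {M : Matrix ι ι ℝ} {γ : U →ₗ[ℝ] U}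
    (h : Function.Injective (matAct M γ)) : M.det ≠ 0 := by
  intro h0
  obtain ⟨v, hv, hMv⟩ := Matrix.exists_mulVec_eq_zero_iff.2 h0
  obtain ⟨u, hu⟩ := exists_ne (0 : U)
  obtain ⟨i, hi⟩ := Function.ne_iff.1 hv
  have : (fun i => v i • u) = (0 : ι → U) := h (funext fun i => by
    rw [matAct_apply, map_zero]
    have : ∑ j, M i j • γ (v j • u) = (∑ j, M i j * v j) • γ u := by
      rw [Finset.sum_smul]
      exact Finset.sum_congr rfl fun j _ => by rw [map_smul, smul_smul]
    rw [this]
    have h' : ∑ j, M i j * v j = 0 := congrFun hMv i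
    rw [h', zero_smul]
    rfl)
  exact hu ((smul_eq_zero.1 (congrFun this i)).resolve_left hi)

theorem matAct_smul {U : Type*} [AddCommGroup U] [Module ℝ U] {ι κ : Type*} [Fintype ι]
    (r : ℝ) (M : Matrix κ ι ℝ) (γ : U →ₗ[ℝ] U) (w : ι → U) :
    matAct (r • M) γ w = r • matAct M γ w := by
  funext i
  rw [Pi.smul_apply, matAct_apply, matAct_apply, Finset.smul_sum]
  exact Finset.sum_congr rfl fun j _ => by rw [Matrix.smul_apply, smul_eq_mul, mul_smul]

/-- The quotient `P₁ * P₀⁻¹` has positive determinant and is joined to the identity; composing with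
`P₀` gives a path of `H`-automorphisms with the prescribed ends. -/
theorem exists_gauge_of_det {K : Type*} [Group K] [TopologicalSpace K] {U : Type*}
    [NormedAddCommGroup U] [NormedSpace ℝ U] [FiniteDimensional ℝ U] (τ : Representation ℝ K U)
    {ι : Type*} [Fintype ι] [DecidableEq ι] {P₀ P₁ : Matrix ι ι ℝ} (h : 0 < P₀.det * P₁.det) :
    ∃ a : unitInterval → ((ι → U) ≃ₗ[ℝ] (ι → U)), (∀ w, Continuous fun t => a t w) ∧
      (∀ t k w, a t (τ.power ι k w) = τ.power ι k (a t w)) ∧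
      (∀ w, a 0 w = matAct P₀ LinearMap.id w) ∧ ∀ w, a 1 w = matAct P₁ LinearMap.id w := by
  have h₀ : IsUnit P₀.det := isUnit_iff_ne_zero.2 fun h0 => by
    rw [h0, zero_mul] at h
    exact h.ne rfl
  have h₁ : IsUnit P₁.det := isUnit_iff_ne_zero.2 fun h0 => by
    rw [h0, mul_zero] at h
    exact h.ne rfl
  have hpos : 0 < (P₁ * P₀⁻¹).det := by
    rw [Matrix.det_mul, Matrix.det_nonsing_inv, Ring.inverse_eq_inv']
    rcases mul_pos_iff.1 h with ⟨a, b⟩ | ⟨a, b⟩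
    · exact mul_pos b (inv_pos.2 a)
    · exact mul_pos_of_neg_of_neg b (inv_lt_zero.2 a)
  have hj := (joined_matEquiv (τ := τ) (P₁ * P₀⁻¹) hpos
    (matEquiv τ (P₁ * P₀⁻¹) (isUnit_iff_ne_zero.2 hpos.ne')) fun _ => rfl).map
    (continuous_trans_left (matEquiv τ P₀ h₀))
  obtain ⟨a, ha, hac, a₀, a₁⟩ := hj.symm.exists_family
  refine ⟨a, ha, hac, a₀, fun w => (a₁ w).trans ?_⟩
  change matAct (P₁ * P₀⁻¹) LinearMap.id (matAct P₀ LinearMap.id w) = _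
  rw [matAct_matAct, LinearMap.comp_id, mul_assoc, Matrix.nonsing_inv_mul _ h₀, mul_one]

variable {G : Type*} [Group G] [TopologicalSpace G] [IsTopologicalGroup G] [CompactSpace G]
  [T2Space G] {ρ : OrthRep G} {U : Type*} [NormedAddCommGroup U] [NormedSpace ℝ U]
  [FiniteDimensional ℝ U] {τ : Representation ℝ ρ.H U} {A A' : GVectorBundle G ρ.S}
  {c : unitInterval → ρ.S} {ι κ : Type*} [Fintype ι] [Fintype κ]

namespace GVectorBundle.Frame

/-- The kernel `H` acts on the frame through a power of `τ`. -/
def IsPower (τ : Representation ℝ ρ.H U) (φ : A.Frame c (ι → U)) : Prop :=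
  ∀ k (hk : k ∈ ρ.H) t (h : k • c t = c t) w, φ.trans k h w = τ.power ι ⟨k, hk⟩ w

theorem exists_isPower (hτ : τ.IsCont) (hc : Continuous c) {m : ℕ}
    (hA : ∀ (z : ρ.S) (h : ρ.H) (hz : (h : G) • z = z),
      LinearMap.trace ℝ (A.E z) (A.act h hz) = m * τ.character h) :
    ∃ φ : A.Frame c (Fin m → U), φ.IsPower τ := by
  have : CompactSpace ρ.H := compactSpace_H
  obtain ⟨φ, hφ⟩ := A.exists_equivariant_frame hc ρ.H ρ.isClosed_H
    fun h t => ρ.smul_eq_of_mem_H h.2 _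
  obtain ⟨e⟩ := exists_equiv_of_character_eq (τ := τ.power (Fin m))
    (φ.isCont_rep 0 ρ.H fun k => ρ.smul_eq_of_mem_H k.2 _) (hτ.power _) fun k => by
      rw [φ.character_rep, Representation.character_power, Fintype.card_fin]
      exact hA _ k _
  refine ⟨φ.change (fun _ => e.toLinearEquiv.symm)
    ((LinearMap.continuous_of_finiteDimensional e.toLinearEquiv.symm.toLinearMap).comp
      continuous_snd), fun k hk t h w => ?_⟩
  rw [change_trans]
  have h₁ := hφ ⟨k, hk⟩ t (e.symm w)
  have h₂ := IntertwiningMap.isIntertwining _ _ e.toIntertwiningMap ⟨k, hk⟩ (e.symm w)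
  change e (φ.trans k h (e.symm w)) = _
  rw [h₁]
  exact h₂.trans (congrArg _ (e.apply_symm_apply w))

theorem IsPower.trans_conj {φ : A.Frame c (ι → U)} (hφ : φ.IsPower τ) {g : G} {s t : unitInterval}
    (h : g • c t = c s) (k : ρ.H) (w : ι → U) : φ.trans g h (τ.power ι k w) =
      τ.power ι (MulAut.conjNormal g k) (φ.trans g h w) := by
  have h₁ := ρ.smul_eq_of_mem_H k.2 (c t)
  have h₂ := ρ.smul_eq_of_mem_H (MulAut.conjNormal g k : ρ.H).2 (c s)
  have e : (MulAut.conjNormal g k : ρ.H) * g = g * (k : G) := by simp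
  have e₁ := hφ k k.2 t h₁ w
  have e₂ := hφ _ (MulAut.conjNormal g k : ρ.H).2 s h₂ (φ.trans g h w)
  refine (congrArg _ e₁.symm).trans (Eq.trans ?_ e₂)
  rw [← φ.trans_mul h₁ h (by rw [mul_smul, h₁, h]), ← φ.trans_mul h h₂ (by rw [mul_smul, h, h₂])]
  congr 2
  exact e.symm

/-- A transition map along `g` is semilinear for conjugation by `g`. In real type it is therefore a
fixed semilinear `γ` on `U` tensored with a real matrix, and this matrix carries all the
information. -/
theorem IsPower.exists_matrix [DecidableEq ι] [Nontrivial U] {φ : A.Frame c (ι → U)}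
    (hφ : φ.IsPower τ)
    (hR : ∀ f : IntertwiningMap τ τ, ∃ r : ℝ, ∀ u, f u = r • u) {g : G} {γ : U ≃ₗ[ℝ] U}
    (hγ : ∀ k u, γ (τ k u) = τ (MulAut.conjNormal g k) (γ u)) {s t : unitInterval}
    (h : g • c t = c s) : ∃ M : Matrix ι ι ℝ, M.det ≠ 0 ∧ ∀ w, φ.trans g h w = matAct M γ w := by
  obtain ⟨M, hM⟩ := _root_.exists_matrix hR γ hγ (φ.trans g h).toLinearMap (hφ.trans_conj h)
  refine ⟨M, det_ne_zero_of_matAct_injective (γ := γ.toLinearMap) fun w w' e => ?_, hM⟩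
  rw [← hM, ← hM] at e
  exact (φ.trans g h).injective e

theorem IsPower.card_eq {φ : A.Frame c (ι → U)} {φ' : A'.Frame c (κ → U)} [Nontrivial U]
    (f : Iso A A') : Fintype.card ι = Fintype.card κ := by
  have := (((φ.map 0).trans (f.map (c 0))).trans (φ'.map 0).symm).finrank_eq
  rw [finrank_pi_fintype, finrank_pi_fintype] at this
  simp only [Finset.sum_const, Finset.card_univ, smul_eq_mul] at this
  exact Nat.eq_of_mul_eq_mul_right (finrank_pos (R := ℝ) (M := U)) this

/-- The matrices comparing two frames of isomorphic bundles. -/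
theorem IsPower.exists_matrices [DecidableEq ι] [Nontrivial U] {φ : A.Frame c (ι → U)}
    {φ' : A'.Frame c (ι → U)} (hφ : φ.IsPower τ) (hφ' : φ'.IsPower τ)
    (hR : ∀ f : IntertwiningMap τ τ, ∃ r : ℝ, ∀ u, f u = r • u) (f : Iso A A') :
    ∃ P : unitInterval → Matrix ι ι ℝ, 0 < (P 0).det * (P 1).det ∧
      ∀ (k : G) {s t} (h : k • c t = c s) (γ : U ≃ₗ[ℝ] U) (M M' : Matrix ι ι ℝ),
        (∀ w, φ.trans k h w = matAct M γ w) → (∀ w, φ'.trans k h w = matAct M' γ w) →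
        P s * M = M' * P t := by
  let E : unitInterval → ((ι → U) ≃ₗ[ℝ] (ι → U)) := fun t =>
    ((φ.map t).trans (f.map (c t))).trans (φ'.map t).symm
  have hE : ∀ (k : G) {s t} (h : k • c t = c s) w, E s (φ.trans k h w) = φ'.trans k h (E t w) := by
    intro k s t h w
    change (φ'.map s).symm (f.map (c s) (φ.map s (φ.trans k h w))) = _
    rw [φ.map_trans, f.map_act, LinearEquiv.symm_apply_eq, φ'.map_trans]
    congr 1
    exact ((φ'.map t).apply_symm_apply _).symm
  let e : unitInterval → (τ.power ι).Equiv (τ.power ι) := fun t =>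
    Representation.Equiv.mk (E t) fun k => LinearMap.ext fun w => by
      have h := ρ.smul_eq_of_mem_H k.2 (c t)
      change E t (τ.power ι k w) = τ.power ι k (E t w)
      exact (congrArg _ (hφ k k.2 t h w).symm).trans
        ((hE k h w).trans (hφ' k k.2 t h (E t w)))
  have he : Continuous e := continuous_equiv_iff.2 fun w => Continuous.weaklyContinuous <|
    φ'.continuous_symm continuous_id ((φ.ofIso f).continuous_map.comp
      (continuous_id.prodMk continuous_const : Continuous fun t : unitInterval => (t, w)))
  have hm : ∀ t, ∃ M : Matrix ι ι ℝ, ∀ w, e t w = matAct M LinearMap.id w := fun t =>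
    _root_.exists_matrix hR (LinearEquiv.refl ℝ U) (α := fun k => k) (fun _ _ => rfl)
      (e t).toLinearMap fun k u => IntertwiningMap.isIntertwining _ _ (e t).toIntertwiningMap k u
  choose P hP using hm
  -- The isomorphism read along the arc is itself a path of `H`-automorphisms, so its matrices at
  -- the two ends have determinants of the same sign.
  refine ⟨P, det_mul_det_pos_of_joined_matAct hR (hP 0) (hP 1)
    ⟨⟨⟨e, he⟩, rfl, rfl⟩⟩, fun k s t h γ M M' hM hM' => ?_⟩
  refine matAct_injective (γ := γ.toLinearMap) γ.injective fun w => ?_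
  have h₁ : matAct (P s) LinearMap.id (matAct M γ.toLinearMap w) = E s (φ.trans k h w) := by
    rw [hM]
    exact (hP s _).symm
  have h₂ : matAct M' γ.toLinearMap (matAct (P t) LinearMap.id w) = φ'.trans k h (E t w) := by
    rw [hM']
    exact congrArg _ (hP t w).symm
  rw [matAct_matAct, LinearMap.id_comp] at h₁
  rw [matAct_matAct, LinearMap.comp_id] at h₂
  rw [h₁, h₂, hE]

/-- Change of the index set of a frame. -/
noncomputable def reindex (φ : A.Frame c (κ → U)) (e : ι ≃ κ) : A.Frame c (ι → U) :=
  φ.change (fun _ => LinearEquiv.funCongrLeft ℝ U e.symm)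
    ((LinearMap.continuous_of_finiteDimensional
      (LinearEquiv.funCongrLeft ℝ U e.symm).toLinearMap).comp continuous_snd)

theorem reindex_trans (φ : A.Frame c (κ → U)) (e : ι ≃ κ) (k : G) {s t : unitInterval}
    (h : k • c t = c s) (w : ι → U) :
    (φ.reindex e).trans k h w = φ.trans k h (w ∘ e.symm) ∘ e := rfl

theorem IsPower.reindex {φ : A.Frame c (κ → U)} (hφ : φ.IsPower τ) (e : ι ≃ κ) :
    (φ.reindex e).IsPower τ := fun k hk t h w => by
  rw [reindex_trans, hφ k hk]
  funext i
  simp [Representation.power_apply]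

theorem reindex_trans_matAct {φ : A.Frame c (κ → U)} (e : ι ≃ κ) {k : G} {s t : unitInterval}
    {h : k • c t = c s} {M : Matrix κ κ ℝ} {γ : U →ₗ[ℝ] U}
    (hM : ∀ w, φ.trans k h w = matAct M γ w) (w : ι → U) :
    (φ.reindex e).trans k h w = matAct (M.submatrix e e) γ w := by
  rw [reindex_trans, hM]
  funext i
  simp only [Function.comp_apply, matAct_apply, Matrix.submatrix_apply]
  exact (Equiv.sum_comp e _).symm.trans (by simp)

/-- The frame of a Whitney sum modelled on the sum of the index sets. -/
noncomputable def sumPower (φ : A.Frame c (ι → U)) (φ' : A'.Frame c (κ → U)) :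
    (A.sum A').Frame c (ι ⊕ κ → U) :=
  (φ.sum φ').change (fun _ => LinearEquiv.sumArrowLequivProdArrow ι κ ℝ U)
    ((LinearMap.continuous_of_finiteDimensional
      (LinearEquiv.sumArrowLequivProdArrow ι κ ℝ U).toLinearMap).comp continuous_snd)

theorem sumPower_trans (φ : A.Frame c (ι → U)) (φ' : A'.Frame c (κ → U)) (k : G)
    {s t : unitInterval} (h : k • c t = c s) (w : ι ⊕ κ → U) :
    (φ.sumPower φ').trans k h w = Sum.elim (φ.trans k h (w ∘ Sum.inl))
      (φ'.trans k h (w ∘ Sum.inr)) := rfl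

theorem IsPower.sumPower {φ : A.Frame c (ι → U)} {φ' : A'.Frame c (κ → U)} (hφ : φ.IsPower τ)
    (hφ' : φ'.IsPower τ) : (φ.sumPower φ').IsPower τ := fun k hk t h w => by
  rw [sumPower_trans, hφ k hk, hφ' k hk]
  funext i
  rcases i with i | i <;> simp [Representation.power_apply]

theorem sumPower_trans_matAct {φ : A.Frame c (ι → U)} {φ' : A'.Frame c (κ → U)} {k : G}
    {s t : unitInterval} {h : k • c t = c s} {M : Matrix ι ι ℝ} {M' : Matrix κ κ ℝ}
    {γ : U →ₗ[ℝ] U} (hM : ∀ w, φ.trans k h w = matAct M γ w)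
    (hM' : ∀ w, φ'.trans k h w = matAct M' γ w) (w : ι ⊕ κ → U) :
    (φ.sumPower φ').trans k h w = matAct (Matrix.fromBlocks M 0 0 M') γ w := by
  rw [sumPower_trans, hM, hM']
  funext i
  rcases i with i | i <;> simp [matAct_apply]

end GVectorBundle.Frame

theorem sign_eq_of_mul_pos {a b : ℝ} {s s' : ℤˣ} (h : 0 < ((s : ℤ) : ℝ) * a)
    (h' : 0 < ((s' : ℤ) : ℝ) * b) (hab : 0 < a * b) : s = s' := by
  rcases Int.units_eq_one_or s with rfl | rfl <;> rcases Int.units_eq_one_or s' with rfl | rfl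
  · rfl
  · simp at h h'
    nlinarith
  · simp at h h'
    nlinarith
  · rfl

theorem mul_pos_of_sign {a b : ℝ} {s : ℤˣ} (h : 0 < ((s : ℤ) : ℝ) * a)
    (h' : 0 < ((s : ℤ) : ℝ) * b) : 0 < a * b := by
  rcases Int.units_eq_one_or s with rfl | rfl <;> simp at h h' <;> nlinarith

theorem exists_sign_mul_pos {a : ℝ} (h : a ≠ 0) : ∃ s : ℤˣ, 0 < ((s : ℤ) : ℝ) * a := by
  rcases lt_or_gt_of_ne h with h | h
  · exact ⟨-1, by simpa using h⟩
  · exact ⟨1, by simpa using h⟩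

theorem sign_mul_pos {a b : ℝ} {s s' : ℤˣ} (h : 0 < ((s : ℤ) : ℝ) * a)
    (h' : 0 < ((s' : ℤ) : ℝ) * b) : 0 < (((s * s' : ℤˣ) : ℤ) : ℝ) * (a * b) := by
  have := mul_pos h h'
  push_cast
  nlinarith

end PowerFrames

/-! ### Finite rotation groups in real type: the sign of the monodromy -/

section CyclicRealType

set_option linter.unusedSectionVars false

open Module Representation GVectorBundle

variable {G : Type*} [Group G] [TopologicalSpace G] [IsTopologicalGroup G] [CompactSpace G]
  [T2Space G] {ρ : OrthRep G} {U : Type} [NormedAddCommGroup U] [NormedSpace ℝ U]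
  [FiniteDimensional ℝ U] {τ : Representation ℝ ρ.H U}

/-- Membership in `Vect` by means of a frame. -/
theorem GVectorBundle.Frame.IsPower.hasFiberMultiple {A : GVectorBundle G ρ.S}
    {c : unitInterval → ρ.S} {ι : Type*} [Fintype ι] {φ : A.Frame c (ι → U)} (hφ : φ.IsPower τ)
    (hcov : ∀ z, ∃ (g : G) (t : unitInterval), g • c t = z) (hinv : ρ.IsInvariant τ.character) :
    ρ.HasFiberMultiple τ.character A := by
  refine Frame.hasFiberMultiple hcov hinv φ (Fintype.card ι) fun t k => ?_
  rw [← Representation.character_power]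
  exact congrArg (LinearMap.trace ℝ _) (LinearMap.ext fun w => hφ k k.2 t _ w)

namespace CyclicDomain

variable {c : unitInterval → ρ.S} {g₀ : G} (D : CyclicDomain ρ.H c g₀)

/-- The class `x` has rank `n`, and the determinant of its monodromy has sign `s`. -/
def HasSign (τ : Representation ℝ ρ.H U) (γ : U ≃ₗ[ℝ] U) (x : VectG G ρ.S) (n : ℕ) (s : ℤˣ) :
    Prop :=
  ∃ (A : GVectorBundle G ρ.S) (ι : Type) (_ : Fintype ι) (_ : DecidableEq ι)
    (φ : A.Frame c (ι → U)) (M : Matrix ι ι ℝ), VectG.mk A = x ∧ φ.IsPower τ ∧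
    Fintype.card ι = n ∧ (∀ w, φ.trans g₀ D.smul_zero w = matAct M γ w) ∧
    0 < ((s : ℤ) : ℝ) * M.det

variable {D} {γ : U ≃ₗ[ℝ] U}

/-- If the monodromy matrices have determinants of the same sign, a path from the identity to the
quotient of one by the other is a gauge transformation between the bundles. -/
theorem HasSign.eq {x y : VectG G ρ.S} {n : ℕ} {s : ℤˣ} (hx : D.HasSign τ γ x n s)
    (hy : D.HasSign τ γ y n s) : x = y := by
  obtain ⟨A, ι, _, _, φ, M, rfl, hφ, hι, hM, hs⟩ := hx
  obtain ⟨A', κ, _, _, φ', M', rfl, hφ', hκ, hM', hs'⟩ := hy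
  obtain ⟨e⟩ := Fintype.card_eq.1 (hι.trans hκ.symm)
  have hM₂ := Frame.reindex_trans_matAct e hM'
  have hdet : 0 < M.det * (M'.submatrix e e).det := by
    rw [Matrix.det_submatrix_equiv_self]
    exact mul_pos_of_sign hs hs'
  have hu : IsUnit M.det := isUnit_iff_ne_zero.2 fun h0 => by
    rw [h0, zero_mul] at hdet
    exact hdet.ne rfl
  obtain ⟨a, ha, hac, a₀, a₁⟩ := exists_gauge_of_det τ (P₀ := 1) (P₁ := M'.submatrix e e * M⁻¹) (by
    rw [Matrix.det_one, one_mul, Matrix.det_mul, Matrix.det_nonsing_inv, Ring.inverse_eq_inv']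
    rcases mul_pos_iff.1 hdet with ⟨a, b⟩ | ⟨a, b⟩
    · exact mul_pos b (inv_pos.2 a)
    · exact mul_pos_of_neg_of_neg b (inv_lt_zero.2 a))
  refine Quotient.sound (D.nonempty_iso φ (φ'.reindex e) a ha (fun w => ?_) fun k hk t h w => ?_)
  · rw [a₁, a₀, hM, hM₂, matAct_matAct, matAct_one_id, mul_assoc, Matrix.nonsing_inv_mul _ hu,
      mul_one, LinearMap.id_comp]
  · rw [hφ k hk, (hφ'.reindex e) k hk, hac]

/-- An isomorphism gives matrices with `P 1 * M = M' * P 0`, where `P 0` and `P 1` have determinants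
of the same sign; hence so do `M` and `M'`. -/
theorem HasSign.unique [Nontrivial U] (hR : ∀ f : IntertwiningMap τ τ, ∃ r : ℝ, ∀ u, f u = r • u)
    {x : VectG G ρ.S} {n n' : ℕ} {s s' : ℤˣ} (hx : D.HasSign τ γ x n s)
    (hy : D.HasSign τ γ x n' s') : n = n' ∧ s = s' := by
  obtain ⟨A, ι, _, _, φ, M, rfl, hφ, hι, hM, hs⟩ := hx
  obtain ⟨A', κ, _, _, φ', M', h, hφ', hκ, hM', hs'⟩ := hy
  obtain ⟨f⟩ := Quotient.exact h.symm
  have hcard := Frame.IsPower.card_eq (φ := φ) (φ' := φ') f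
  refine ⟨hι.symm.trans (hcard.trans hκ), ?_⟩
  obtain ⟨e⟩ := Fintype.card_eq.1 hcard
  have hM₂ := Frame.reindex_trans_matAct e hM'
  obtain ⟨P, hP, hPM⟩ := hφ.exists_matrices (hφ'.reindex e) hR f
  have := congrArg Matrix.det (hPM g₀ D.smul_zero γ M _ hM hM₂)
  rw [Matrix.det_mul, Matrix.det_mul, Matrix.det_submatrix_equiv_self] at this
  refine sign_eq_of_mul_pos hs hs' ?_
  have h₁ : M'.det ≠ 0 := fun h0 => by
    rw [h0, mul_zero] at hs'
    exact hs'.ne rfl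
  have h₂ : (P 0).det ≠ 0 := fun h0 => by
    rw [h0, zero_mul] at hP
    exact hP.ne rfl
  have h₃ : ((P 0).det * (P 1).det) * (M.det * M'.det) = ((P 0).det * M'.det) ^ 2 := by
    calc _ = (P 0).det * M'.det * ((P 1).det * M.det) := by ring
      _ = _ := by rw [this]; ring
  have h₄ : 0 < ((P 0).det * M'.det) ^ 2 := by positivity
  rw [← h₃] at h₄
  exact (mul_pos_iff_of_pos_left hP).1 h₄

theorem HasSign.add {x y : VectG G ρ.S} {n n' : ℕ} {s s' : ℤˣ} (hx : D.HasSign τ γ x n s)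
    (hy : D.HasSign τ γ y n' s') : D.HasSign τ γ (x + y) (n + n') (s * s') := by
  obtain ⟨A, ι, _, _, φ, M, rfl, hφ, rfl, hM, hs⟩ := hx
  obtain ⟨A', κ, _, _, φ', M', rfl, hφ', rfl, hM', hs'⟩ := hy
  refine ⟨A.sum A', ι ⊕ κ, inferInstance, inferInstance, φ.sumPower φ', _, rfl,
    hφ.sumPower hφ', Fintype.card_sum, Frame.sumPower_trans_matAct hM hM', ?_⟩
  rw [Matrix.det_fromBlocks_zero₂₁]
  exact sign_mul_pos hs hs'

/-- The presentation over a circle with a cyclic action, for a character of real type. -/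
theorem isPresentedBy (D : CyclicDomain ρ.H c g₀) (hH : IsOpen (ρ.H : Set G)) (hτ : τ.IsCont)
    (hirr : τ.IsIrreducible) (hR : ∀ f : IntertwiningMap τ τ, ∃ r : ℝ, ∀ u, f u = r • u)
    (hinv : ρ.IsInvariant τ.character) : ∃ Lp Lm : ρ.Vect τ.character,
      IsPresentedBy ![Lp, Lm] (fun a b => a = Finsupp.single 0 2 ∧ b = Finsupp.single 1 2) ∧
      ρ.RelatedByLine Lp Lm := by
  have : CompactSpace ρ.H := compactSpace_H
  have hnt := hirr.nontrivial
  obtain ⟨γ, hγ⟩ := exists_equiv_conj hτ g₀ fun k => by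
    have := hinv g₀⁻¹ k
    rwa [inv_inv] at this
  let γ₁ : (Unit → U) ≃ₗ[ℝ] (Unit → U) := LinearEquiv.piCongrRight fun _ => γ
  have hγ₁ : ∀ w, γ₁ w = matAct (1 : Matrix Unit Unit ℝ) γ.toLinearMap w := fun w =>
    funext fun i => (matAct_one γ.toLinearMap w i).symm
  -- Both generators have a single copy of `U` as fiber. The monodromy of `A` is `γ`, and the line
  -- bundle of monodromy `-1` changes it to `-γ`.
  obtain ⟨A, L, C, φ, ψ, a₁, a₂, b₁, b₂, hL, hL', hT⟩ := D.exists_tensor hH (τ.power Unit)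
    (hτ.power Unit).continuous γ₁ (fun k w => funext fun i => hγ k (w i)) (-1)
  have hφ : φ.IsPower τ := a₂
  have hψ : ψ.IsPower τ := b₂
  refine ⟨⟨_, A, hφ.hasFiberMultiple D.cover hinv, rfl⟩,
    ⟨_, C, hψ.hasFiberMultiple D.cover hinv, rfl⟩,
    isPresentedBy_of_sign (T := fun (x : ρ.Vect τ.character) n s => D.HasSign τ γ (x : VectG G ρ.S) n s) ?_
      (fun h h' => Subtype.ext (h.eq h')) (fun h h' => h.unique hR h') (fun h h' => h.add h') ?_
      ⟨A, Unit, inferInstance, inferInstance, φ, 1, rfl, hφ, rfl, fun w => ?_, by simp⟩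
      ⟨C, Unit, inferInstance, inferInstance, ψ, (-1 : ℝ) • 1, rfl, hψ, rfl, fun w => ?_, by simp⟩,
    A, L, C, hL, hL', hT, rfl, rfl⟩
  · rintro ⟨_, B, ⟨m, hB⟩, rfl⟩
    obtain ⟨θ, hθ⟩ := Frame.exists_isPower hτ D.continuous hB
    obtain ⟨M, hM, hM'⟩ := hθ.exists_matrix hR hγ D.smul_zero
    obtain ⟨s, hs⟩ := exists_sign_mul_pos hM
    exact ⟨m, s, B, Fin m, inferInstance, inferInstance, θ, M, rfl, hθ, Fintype.card_fin m, hM', hs⟩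
  · rintro x s ⟨B, ι, _, _, θ, M, -, -, hι, -, hs⟩
    have := Fintype.card_eq_zero_iff.1 hι
    rw [Matrix.det_isEmpty, mul_one] at hs
    rcases Int.units_eq_one_or s with rfl | rfl
    · rfl
    · norm_num at hs
  · rw [a₁, hγ₁]
  · rw [b₁, hγ₁, matAct_smul]
    simp

end CyclicDomain

end CyclicRealType

/-! ### Dihedral groups in real type without extensions -/

section DihedralRealType

set_option linter.unusedSectionVars false

open Module Representation GVectorBundle

namespace IndexTwo

variable {N K : Type*} [Group N] [Group K] [TopologicalSpace N] [TopologicalSpace K]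
  (E : IndexTwo N K) {U : Type*} [AddCommGroup U] [Module ℝ U] {τ : Representation ℝ N U}

theorem conj_conjInv (n : N) : E.conj (E.conjInv n) = n := E.injective (by
  rw [← E.conj_spec, ← E.conjInv_spec]
  group)

theorem ι_mul_c (n : N) : E.ι n * E.c = E.c * E.ι (E.conjInv n) := by
  rw [← E.conjInv_spec]
  group

/-- The extension of a representation by an endomorphism representing `c`. -/
theorem exists_extension {γ : Module.End ℝ U} (hγ : ∀ n u, γ (τ n u) = τ (E.conj n) (γ u))
    (hsq : ∀ s, E.c * E.c = E.ι s → ∀ u, γ (γ u) = τ s u) :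
    ∃ σ : Representation ℝ K U, (∀ n, σ (E.ι n) = τ n) ∧ σ E.c = γ := by
  classical
  let f : K → Module.End ℝ U := fun k => if h : ∃ n, k = E.ι n then τ h.choose else
    if h : ∃ n, k = E.c * E.ι n then γ * τ h.choose else 0
  have f₁ : ∀ n, f (E.ι n) = τ n := fun n => by
    have h : ∃ n', E.ι n = E.ι n' := ⟨n, rfl⟩
    have hn : h.choose = n := (E.injective h.choose_spec).symm
    simp only [f]
    rw [dif_pos h, hn]
  have f₂ : ∀ n, f (E.c * E.ι n) = γ * τ n := fun n => by
    have h : ∃ n', E.c * E.ι n = E.c * E.ι n' := ⟨n, rfl⟩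
    have hn : h.choose = n := (E.injective (mul_left_cancel h.choose_spec)).symm
    simp only [f]
    rw [dif_neg (E.not_both rfl), dif_pos h, hn]
  have hτγ : ∀ n, τ n * γ = γ * τ (E.conjInv n) := fun n => LinearMap.ext fun u => by
    have := hγ (E.conjInv n) u
    rw [E.conj_conjInv] at this
    exact this.symm
  obtain ⟨s, hs⟩ := E.sq_mem
  have hγγ : γ * γ = τ s := LinearMap.ext (hsq s hs)
  refine ⟨{ toFun := f, map_one' := ?_, map_mul' := fun k l => ?_ }, f₁, ?_⟩
  · rw [← map_one E.ι, f₁, map_one]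
  · rcases E.cover k with ⟨n, rfl⟩ | ⟨n, rfl⟩ <;> rcases E.cover l with ⟨n', rfl⟩ | ⟨n', rfl⟩
    · rw [← map_mul, f₁, f₁, f₁, map_mul]
    · rw [← mul_assoc, E.ι_mul_c, mul_assoc, ← map_mul, f₂, f₁, f₂, ← mul_assoc, hτγ, map_mul,
        mul_assoc]
    · rw [mul_assoc, ← map_mul, f₂, f₂, f₁, map_mul, mul_assoc]
    · rw [mul_assoc, ← mul_assoc (E.ι n), E.ι_mul_c, mul_assoc, ← mul_assoc, hs, ← map_mul,
        ← map_mul, f₁, f₂, f₂, map_mul, map_mul, ← hγγ, mul_assoc γ (τ n), ← mul_assoc (τ n), hτγ]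
      simp only [mul_assoc]
  · have := f₂ 1
    rw [map_one, map_one, mul_one, mul_one] at this
    exact this

/-- For a representation of real type without extension, the element of the other coset can be
represented by a semilinear automorphism whose square has the wrong sign. -/
theorem exists_equiv_sq_eq_neg [FiniteDimensional ℝ U] [IsTopologicalGroup N]
    [IsTopologicalGroup K] [CompactSpace N] [T2Space K] [Nontrivial U] (hτ : τ.IsCont)
    (hR : ∀ f : IntertwiningMap τ τ, ∃ r : ℝ, ∀ u, f u = r • u) (hX : E.Ext τ.character = ∅)
    {γ : U ≃ₗ[ℝ] U} (hγ : ∀ n u, γ (τ n u) = τ (E.conj n) (γ u)) :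
    ∃ γ' : U ≃ₗ[ℝ] U, (∀ n u, γ' (τ n u) = τ (E.conj n) (γ' u)) ∧
      ∀ s, E.c * E.c = E.ι s → ∀ u, γ' (γ' u) = -τ s u := by
  obtain ⟨s, hs⟩ := E.sq_mem
  have hconj : ∀ n, s⁻¹ * E.conj (E.conj n) = n * s⁻¹ := fun n => E.injective (by
    rw [map_mul, map_mul, ← E.conj_spec, ← E.conj_spec, map_inv, ← hs]
    group)
  -- Two applications of `γ` followed by `τ s⁻¹` commute with `τ`, so they amount to a scalar `r`.
  -- Division of `γ` by the square root of `|r|` makes it `1` or `-1`.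
  let F : IntertwiningMap τ τ := ⟨(τ s⁻¹).comp (γ.toLinearMap.comp γ.toLinearMap), fun n =>
    LinearMap.ext fun u => by
      change τ s⁻¹ (γ (γ (τ n u))) = τ n (τ s⁻¹ (γ (γ u)))
      rw [hγ, hγ, ← Module.End.mul_apply, ← map_mul, hconj, map_mul, Module.End.mul_apply]⟩
  obtain ⟨r, hr⟩ := hR F
  have hr' : ∀ u, γ (γ u) = r • τ s u := fun u => by
    have : τ s⁻¹ (γ (γ u)) = r • u := hr u
    rw [← map_smul, ← this, ← Module.End.mul_apply, ← map_mul, mul_inv_cancel, map_one,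
      Module.End.one_apply]
  have hr0 : r ≠ 0 := fun h0 => by
    obtain ⟨u, hu⟩ := exists_ne (0 : U)
    have := hr' u
    rw [h0, zero_smul] at this
    exact hu (γ.injective (γ.injective (by rw [this, map_zero, map_zero])))
  have ha : (Real.sqrt |r|)⁻¹ ≠ 0 := inv_ne_zero (Real.sqrt_ne_zero'.2 (abs_pos.2 hr0))
  have ha' : (Real.sqrt |r|)⁻¹ * (Real.sqrt |r|)⁻¹ = |r|⁻¹ := by
    rw [← mul_inv, Real.mul_self_sqrt (abs_nonneg r)]
  let γ' : U ≃ₗ[ℝ] U := γ.trans (LinearEquiv.smulOfNeZero ℝ U _ ha)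
  have happ : ∀ u, γ' u = (Real.sqrt |r|)⁻¹ • γ u := fun _ => rfl
  have hγ' : ∀ n u, γ' (τ n u) = τ (E.conj n) (γ' u) := fun n u => by
    rw [happ, happ, hγ, map_smul]
  have hsq : ∀ u, γ' (γ' u) = (|r|⁻¹ * r) • τ s u := fun u => by
    rw [happ, happ, map_smul, hr', smul_smul, smul_smul, ha']
  have huniq : ∀ s', E.c * E.c = E.ι s' → s' = s := fun s' h => E.injective (h.symm.trans hs)
  refine ⟨γ', hγ', fun s' h' u => ?_⟩
  rw [huniq s' h', hsq]
  rcases lt_or_gt_of_ne hr0 with h | h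
  · rw [abs_of_neg h, inv_neg, neg_mul, inv_mul_cancel₀ hr0, neg_one_smul]
  -- With the sign `+1` the map `γ'` could represent `c` and would extend the representation.
  · exfalso
    rw [abs_of_pos h, inv_mul_cancel₀ hr0] at hsq
    obtain ⟨σ, hσ, -⟩ := E.exists_extension (γ := γ'.toLinearMap) hγ' fun s' h' u => by
      rw [huniq s' h', ← one_smul ℝ (τ s u)]
      exact hsq u
    have hσc : σ.IsCont := fun u l => by
      refine E.continuous_of ?_ ?_
      · simp only [hσ]
        exact hτ u l
      · simp only [map_mul, Module.End.mul_apply, hσ]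
        exact hτ u (l.comp (σ E.c))
    have : σ.character ∈ E.Ext τ.character := ⟨hσc.isRealCharacter, fun n =>
      congrArg (LinearMap.trace ℝ U) (hσ n)⟩
    rw [hX] at this
    exact this

end IndexTwo

variable {G : Type*} [Group G] [TopologicalSpace G] [IsTopologicalGroup G] [CompactSpace G]
  [T2Space G] {ρ : OrthRep G} {U : Type} [NormedAddCommGroup U] [NormedSpace ℝ U]
  [FiniteDimensional ℝ U] {τ : Representation ℝ ρ.H U} {c : unitInterval → ρ.S}

namespace IndexTwo

/-- The isotropy group is generated by `H` and `E.c`, so a gauge transformation need only be checked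
on these. -/
theorem trans_induct {z : unitInterval} (E : IndexTwo ρ.H (MulAction.stabilizer G (c z)))
    (hE : ∀ n, (E.ι n : G) = n) {A A' : GVectorBundle G ρ.S} {W W' : Type*}
    [NormedAddCommGroup W] [NormedSpace ℝ W] [NormedAddCommGroup W'] [NormedSpace ℝ W']
    {φ : A.Frame c W} {φ' : A'.Frame c W'} {a : W → W'}
    (hN : ∀ k ∈ ρ.H, ∀ (h : k • c z = c z) w, a (φ.trans k h w) = φ'.trans k h (a w))
    (hc : ∀ w, a (φ.trans E.c E.c.2 w) = φ'.trans E.c E.c.2 (a w)) (k : G) (h : k • c z = c z)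
    (w : W) : a (φ.trans k h w) = φ'.trans k h (a w) := by
  rcases E.cover ⟨k, h⟩ with ⟨n, hn⟩ | ⟨n, hn⟩
  · refine hN k ?_ h w
    have : k = n := (congrArg Subtype.val hn).trans (hE n)
    rw [this]
    exact n.2
  · obtain rfl : k = E.c * n := (congrArg Subtype.val hn).trans (congrArg (_ * ·) (hE n))
    have h' := ρ.smul_eq_of_mem_H n.2 (c z)
    rw [φ.trans_mul h' E.c.2 h, φ'.trans_mul h' E.c.2 h, hc, hN n n.2]

theorem conj_eq {z : ρ.S} (E : IndexTwo ρ.H (MulAction.stabilizer G z))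
    (hE : ∀ n, (E.ι n : G) = n) (n : ρ.H) : E.conj n = MulAut.conjNormal (E.c : G) n := by
  refine Subtype.ext ?_
  rw [← hE, ← E.conj_spec, MulAut.conjNormal_apply, ← hE n]
  rfl

end IndexTwo

/-- The square of `c` acts by `1 ⊗ τ s` as an element of `H`, and by `M² ⊗ γ²` with `γ² = -τ s` as a
square. -/
theorem GVectorBundle.Frame.IsPower.mul_self_eq_neg_one {z : unitInterval}
    (E : IndexTwo ρ.H (MulAction.stabilizer G (c z))) (hE : ∀ n, (E.ι n : G) = n) [Nontrivial U]
    {A : GVectorBundle G ρ.S} {ι : Type*} [Fintype ι] [DecidableEq ι] {φ : A.Frame c (ι → U)}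
    (hφ : φ.IsPower τ) {γ : U ≃ₗ[ℝ] U} (hγ : ∀ s, E.c * E.c = E.ι s → ∀ u, γ (γ u) = -τ s u)
    {M : Matrix ι ι ℝ} (hM : ∀ w, φ.trans E.c E.c.2 w = matAct M γ w) : M * M = -1 := by
  obtain ⟨s, hs⟩ := E.sq_mem
  have hs' : (E.c : G) * E.c = s := (congrArg Subtype.val hs).trans (hE s)
  have hinj : Function.Injective (τ s) := Function.LeftInverse.injective (g := τ s⁻¹) fun u => by
    rw [← Module.End.mul_apply, ← map_mul, inv_mul_cancel, map_one, Module.End.one_apply]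
  rw [← neg_eq_iff_eq_neg]
  refine matAct_injective hinj fun w => ?_
  have hz : ((E.c : G) * E.c) • c z = c z := by
    rw [hs']
    exact ρ.smul_eq_of_mem_H s.2 _
  have h₁ : φ.trans ((E.c : G) * E.c) hz w = matAct 1 (τ s) w := by
    have := hφ s s.2 z (ρ.smul_eq_of_mem_H s.2 _) w
    refine Eq.trans ?_ (this.trans (funext fun i => (matAct_one (τ s) w i).symm))
    congr 2
  rw [φ.trans_mul E.c.2 E.c.2, hM, hM, matAct_matAct] at h₁
  rw [← h₁, ← neg_one_smul ℝ (M * M), matAct_smul]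
  funext i
  simp only [Pi.smul_apply, matAct_apply, Finset.smul_sum]
  refine Finset.sum_congr rfl fun j _ => ?_
  change _ = (M * M) i j • γ (γ (w j))
  rw [hγ s hs, smul_neg, neg_one_smul]

namespace IntervalDomain

/-- The class `x` is of rank `2 n`, and the complex structures given by the two generators of the
isotropy groups induce orientations whose comparison is `s`. -/
def HasSign (E₁ : IndexTwo ρ.H (MulAction.stabilizer G (c 0)))
    (E₂ : IndexTwo ρ.H (MulAction.stabilizer G (c 1))) (τ : Representation ℝ ρ.H U)
    (γ₁ γ₂ : U ≃ₗ[ℝ] U) (x : VectG G ρ.S) (n : ℕ) (s : ℤˣ) : Prop :=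
  ∃ (A : GVectorBundle G ρ.S) (φ : A.Frame c (Fin (2 * n) → U))
    (M₁ M₂ P : Matrix (Fin (2 * n)) (Fin (2 * n)) ℝ), VectG.mk A = x ∧ φ.IsPower τ ∧
    (∀ w, φ.trans E₁.c E₁.c.2 w = matAct M₁ γ₁ w) ∧
    (∀ w, φ.trans E₂.c E₂.c.2 w = matAct M₂ γ₂ w) ∧
    M₁ * M₁ = -1 ∧ P * M₁ = M₂ * P ∧ 0 < ((s : ℤ) : ℝ) * P.det

variable {E₁ : IndexTwo ρ.H (MulAction.stabilizer G (c 0))}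
  {E₂ : IndexTwo ρ.H (MulAction.stabilizer G (c 1))} {γ₁ γ₂ : U ≃ₗ[ℝ] U}

/-- A matrix `Q` conjugates the complex structures at the first end, and `P' * Q * P⁻¹` then
conjugates those at the second. Equal signs of `P` and `P'` make these two determinants agree in
sign, so a path of automorphisms joins them. -/
theorem HasSign.eq (D : IntervalDomain ρ.H c) (hE₁ : ∀ n, (E₁.ι n : G) = n)
    (hE₂ : ∀ n, (E₂.ι n : G) = n) {x y : VectG G ρ.S} {n : ℕ} {s : ℤˣ}
    (hx : HasSign E₁ E₂ τ γ₁ γ₂ x n s) (hy : HasSign E₁ E₂ τ γ₁ γ₂ y n s) : x = y := by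
  obtain ⟨A, φ, M₁, M₂, P, rfl, hφ, h₁, h₂, hsq, hP, hs⟩ := hx
  obtain ⟨A', φ', M₁', M₂', P', rfl, hφ', h₁', h₂', hsq', hP', hs'⟩ := hy
  obtain ⟨Q, hQ, hQM⟩ := Matrix.exists_conj_complexStructure hsq hsq'
  have hdet := mul_pos_of_sign hs hs'
  have hu : IsUnit P.det := isUnit_iff_ne_zero.2 fun h0 => by
    rw [h0, zero_mul] at hdet
    exact hdet.ne rfl
  have hPi : P⁻¹ * M₂ = M₁ * P⁻¹ := by
    calc P⁻¹ * M₂ = P⁻¹ * (M₂ * P) * P⁻¹ := by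
          rw [mul_assoc, mul_assoc, Matrix.mul_nonsing_inv _ hu, mul_one]
      _ = M₁ * P⁻¹ := by rw [← hP, ← mul_assoc, Matrix.nonsing_inv_mul _ hu, one_mul]
  have hR : P' * Q * P⁻¹ * M₂ = M₂' * (P' * Q * P⁻¹) := by
    rw [mul_assoc, hPi, ← mul_assoc, mul_assoc P' Q, hQM, ← mul_assoc, hP']
    simp only [mul_assoc]
  obtain ⟨a, ha, hac, a₀, a₁⟩ := exists_gauge_of_det τ (P₀ := Q) (P₁ := P' * Q * P⁻¹) (by
    rw [Matrix.det_mul, Matrix.det_mul, Matrix.det_nonsing_inv, Ring.inverse_eq_inv']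
    have : Q.det * (P'.det * Q.det * P.det⁻¹) = (P.det * P'.det) * (Q.det * P.det⁻¹) ^ 2 := by
      field_simp [hu.ne_zero]
    rw [this]
    have : Q.det * P.det⁻¹ ≠ 0 := mul_ne_zero hQ (inv_ne_zero hu.ne_zero)
    positivity)
  have hN : ∀ k ∈ ρ.H, ∀ t (h : k • c t = c t) w, a t (φ.trans k h w) = φ'.trans k h (a t w) :=
    fun k hk t h w => by rw [hφ k hk, hφ' k hk, hac]
  refine Quotient.sound (D.nonempty_iso φ φ' a ha
    (E₁.trans_induct hE₁ (fun k hk => hN k hk 0) fun w => ?_)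
    (E₂.trans_induct hE₂ (fun k hk => hN k hk 1) fun w => ?_) hN)
  · rw [a₀, a₀, h₁, h₁', matAct_matAct, matAct_matAct, hQM]
    rfl
  · rw [a₁, a₁, h₂, h₂', matAct_matAct, matAct_matAct, hR]
    rfl

/-- The comparison matrices of an isomorphism at the two ends have determinants of the same sign.
Going around the square formed by them, `P` and `P'` gives a matrix commuting with `M₁'`, whose
determinant is positive; this forces equal signs. -/
theorem HasSign.unique [Nontrivial U]
    (hR : ∀ f : IntertwiningMap τ τ, ∃ r : ℝ, ∀ u, f u = r • u) {x : VectG G ρ.S} {n n' : ℕ}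
    {s s' : ℤˣ} (hx : HasSign E₁ E₂ τ γ₁ γ₂ x n s) (hy : HasSign E₁ E₂ τ γ₁ γ₂ x n' s') :
    n = n' ∧ s = s' := by
  obtain ⟨A, φ, M₁, M₂, P, rfl, hφ, h₁, h₂, hsq, hP, hs⟩ := hx
  obtain ⟨A', φ', M₁', M₂', P', h, hφ', h₁', h₂', hsq', hP', hs'⟩ := hy
  obtain ⟨f⟩ := Quotient.exact h.symm
  have hcard := Frame.IsPower.card_eq (φ := φ) (φ' := φ') f
  rw [Fintype.card_fin, Fintype.card_fin] at hcard
  obtain rfl : n = n' := by omega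
  refine ⟨rfl, ?_⟩
  obtain ⟨Q, hQ, hQM⟩ := hφ.exists_matrices hφ' hR f
  have e₁ := hQM E₁.c E₁.c.2 γ₁ M₁ M₁' h₁ h₁'
  have e₂ := hQM E₂.c E₂.c.2 γ₂ M₂ M₂' h₂ h₂'
  have u₀ : (Q 0).det ≠ 0 := fun h0 => by
    rw [h0, zero_mul] at hQ
    exact hQ.ne rfl
  have u₁ : (Q 1).det ≠ 0 := fun h0 => by
    rw [h0, mul_zero] at hQ
    exact hQ.ne rfl
  have u : P.det ≠ 0 := fun h0 => by
    rw [h0, mul_zero] at hs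
    exact hs.ne rfl
  have u' : P'.det ≠ 0 := fun h0 => by
    rw [h0, mul_zero] at hs'
    exact hs'.ne rfl
  have hv' := isUnit_iff_ne_zero.2 u'
  have hv₀ := isUnit_iff_ne_zero.2 u₀
  have i' : P'⁻¹ * M₂' = M₁' * P'⁻¹ := by
    calc P'⁻¹ * M₂' = P'⁻¹ * (M₂' * P') * P'⁻¹ := by
          rw [mul_assoc, mul_assoc, Matrix.mul_nonsing_inv _ hv', mul_one]
      _ = M₁' * P'⁻¹ := by rw [← hP', ← mul_assoc, Matrix.nonsing_inv_mul _ hv', one_mul]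
  have i₀ : M₁ * (Q 0)⁻¹ = (Q 0)⁻¹ * M₁' := by
    calc M₁ * (Q 0)⁻¹ = (Q 0)⁻¹ * (Q 0 * M₁) * (Q 0)⁻¹ := by
          rw [← mul_assoc, Matrix.nonsing_inv_mul _ hv₀, one_mul]
      _ = (Q 0)⁻¹ * M₁' := by
          rw [e₁, mul_assoc, mul_assoc, Matrix.mul_nonsing_inv _ hv₀, mul_one]
  have hcomm : M₁' * (P'⁻¹ * (Q 1 * (P * (Q 0)⁻¹))) = P'⁻¹ * (Q 1 * (P * (Q 0)⁻¹)) * M₁' := by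
    have h₁ : Q 1 * (P * (Q 0)⁻¹) * M₁' = M₂' * (Q 1 * (P * (Q 0)⁻¹)) := by
      rw [mul_assoc, mul_assoc P, ← i₀, ← mul_assoc P, hP, mul_assoc, ← mul_assoc, e₂, mul_assoc]
    rw [mul_assoc, h₁, ← mul_assoc, ← mul_assoc P'⁻¹ M₂', i']
  have hdet : (P'⁻¹ * (Q 1 * (P * (Q 0)⁻¹))).det =
      P'.det⁻¹ * ((Q 1).det * (P.det * (Q 0).det⁻¹)) := by
    rw [Matrix.det_mul, Matrix.det_mul, Matrix.det_mul, Matrix.det_nonsing_inv,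
      Matrix.det_nonsing_inv, Ring.inverse_eq_inv']
  have hpos := Matrix.det_pos_of_commute hsq' (by rw [hdet]; positivity) hcomm
  rw [hdet] at hpos
  refine sign_eq_of_mul_pos hs hs' ?_
  have : P.det * P'.det = (P'.det⁻¹ * ((Q 1).det * (P.det * (Q 0).det⁻¹))) *
      ((Q 0).det * (Q 1).det) * (P'.det * (Q 1).det⁻¹) ^ 2 := by
    field_simp
  rw [this]
  positivity

theorem HasSign.add {x y : VectG G ρ.S} {n n' : ℕ} {s s' : ℤˣ}
    (hx : HasSign E₁ E₂ τ γ₁ γ₂ x n s) (hy : HasSign E₁ E₂ τ γ₁ γ₂ y n' s') :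
    HasSign E₁ E₂ τ γ₁ γ₂ (x + y) (n + n') (s * s') := by
  obtain ⟨A, φ, M₁, M₂, P, rfl, hφ, h₁, h₂, hsq, hP, hs⟩ := hx
  obtain ⟨A', φ', M₁', M₂', P', rfl, hφ', h₁', h₂', hsq', hP', hs'⟩ := hy
  obtain ⟨e⟩ : Nonempty (Fin (2 * (n + n')) ≃ Fin (2 * n) ⊕ Fin (2 * n')) :=
    Fintype.card_eq.1 (by simp [mul_add])
  refine ⟨A.sum A', (φ.sumPower φ').reindex e, _, _,
    (Matrix.fromBlocks P 0 0 P').submatrix e e, rfl, (hφ.sumPower hφ').reindex e,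
    Frame.reindex_trans_matAct e (Frame.sumPower_trans_matAct h₁ h₁'),
    Frame.reindex_trans_matAct e (Frame.sumPower_trans_matAct h₂ h₂'), ?_, ?_, ?_⟩
  · rw [Matrix.submatrix_mul_equiv, Matrix.fromBlocks_multiply, hsq, hsq']
    simp only [Matrix.mul_zero, Matrix.zero_mul, add_zero, zero_add]
    have : Matrix.fromBlocks (-1 : Matrix (Fin (2 * n)) (Fin (2 * n)) ℝ) 0 0
        (-1 : Matrix (Fin (2 * n')) (Fin (2 * n')) ℝ) = -1 := by
      rw [← Matrix.fromBlocks_one, Matrix.fromBlocks_neg, neg_zero, neg_zero]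
    rw [this, Matrix.submatrix_neg]
    simp
  · rw [Matrix.submatrix_mul_equiv, Matrix.submatrix_mul_equiv, Matrix.fromBlocks_multiply,
      Matrix.fromBlocks_multiply, hP, hP']
    simp
  · rw [Matrix.det_submatrix_equiv_self, Matrix.det_fromBlocks_zero₂₁]
    exact sign_mul_pos hs hs'

/-- The presentation over a circle with a dihedral action, for a character of real type which
extends to none of the isotropy groups. -/
theorem isPresentedBy (D : IntervalDomain ρ.H c) (hH : IsOpen (ρ.H : Set G)) (hτ : τ.IsCont)
    (hirr : τ.IsIrreducible) (hR : ∀ f : IntertwiningMap τ τ, ∃ r : ℝ, ∀ u, f u = r • u)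
    (hinv : ρ.IsInvariant τ.character)
    (E₁ : IndexTwo ρ.H (MulAction.stabilizer G (c 0))) (hE₁ : ∀ n, (E₁.ι n : G) = n)
    (E₂ : IndexTwo ρ.H (MulAction.stabilizer G (c 1))) (hE₂ : ∀ n, (E₂.ι n : G) = n)
    (hX₁ : E₁.Ext τ.character = ∅) (hX₂ : E₂.Ext τ.character = ∅) :
    ∃ Lp Lm : ρ.Vect τ.character,
      IsPresentedBy ![Lp, Lm] (fun a b => a = Finsupp.single 0 2 ∧ b = Finsupp.single 1 2) ∧
      ρ.RelatedByLine Lp Lm := by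
  have : CompactSpace ρ.H := compactSpace_H
  have hnt := hirr.nontrivial
  have hγ : ∀ {z : ρ.S} (E : IndexTwo ρ.H (MulAction.stabilizer G z)),
      (∀ n, (E.ι n : G) = n) → E.Ext τ.character = ∅ → ∃ γ : U ≃ₗ[ℝ] U,
      (∀ n u, γ (τ n u) = τ (MulAut.conjNormal (E.c : G) n) (γ u)) ∧
      ∀ s, E.c * E.c = E.ι s → ∀ u, γ (γ u) = -τ s u := fun {z} E hE hX => by
    have := compactSpace_stabilizer (G := G) z
    obtain ⟨γ, hγ⟩ := exists_equiv_conj hτ (E.c : G) fun k => by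
      have := hinv (E.c : G)⁻¹ k
      rwa [inv_inv] at this
    simp only [← E.conj_eq hE] at hγ ⊢
    exact E.exists_equiv_sq_eq_neg hτ hR hX hγ
  obtain ⟨γ₁, hγ₁, hs₁⟩ := hγ E₁ hE₁ hX₁
  obtain ⟨γ₂, hγ₂, hs₂⟩ := hγ E₂ hE₂ hX₂
  -- The smallest bundles have two copies of `U` as fiber, with the standard complex structure at
  -- both ends.
  let J : Matrix (Fin (2 * 1)) (Fin (2 * 1)) ℝ := !![0, -1; 1, 0]
  have hJ : J * J = -1 := by
    ext i j
    fin_cases i <;> fin_cases j <;> simp [J, Matrix.mul_apply, Fin.sum_univ_two]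
  have hσ : ∀ {z : ρ.S} (E : IndexTwo ρ.H (MulAction.stabilizer G z)),
      (∀ n, (E.ι n : G) = n) → ∀ γ : U ≃ₗ[ℝ] U,
      (∀ n u, γ (τ n u) = τ (MulAut.conjNormal (E.c : G) n) (γ u)) →
      (∀ s, E.c * E.c = E.ι s → ∀ u, γ (γ u) = -τ s u) →
      ∃ σ : Representation ℝ (MulAction.stabilizer G z) (Fin (2 * 1) → U),
        (∀ n, σ (E.ι n) = τ.power _ n) ∧ (∀ w, σ E.c w = matAct J γ w) ∧
        ∀ w, Continuous fun k => σ k w := fun {z} E hE γ hγ hs => by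
    have := compactSpace_stabilizer (G := G) z
    obtain ⟨σ, h, h'⟩ := E.exists_extension (τ := τ.power (Fin (2 * 1)))
      (γ := matAct J γ.toLinearMap) (fun n w => matAct_power J (fun u => by
        rw [E.conj_eq hE]
        exact hγ n u) w) fun s hs' w => by
        rw [matAct_matAct, hJ]
        funext i
        rw [matAct_apply, Finset.sum_eq_single i]
        · rw [Matrix.neg_apply, Matrix.one_apply_eq, neg_one_smul, power_apply]
          exact (congrArg Neg.neg (hs s hs' (w i))).trans (neg_neg _)
        · intro j _ hj
          rw [Matrix.neg_apply, Matrix.one_apply_ne hj.symm, neg_zero, zero_smul]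
        · simp
    refine ⟨σ, h, fun w => by rw [h'], fun w => E.continuous_of ?_ ?_⟩
    · simp only [h]
      exact (hτ.power _).continuous w
    · simp only [map_mul, Module.End.mul_apply, h]
      exact (LinearMap.continuous_of_finiteDimensional (σ E.c)).comp ((hτ.power _).continuous w)
  obtain ⟨σ₁, r₁, g₁, hσ₁⟩ := hσ E₁ hE₁ γ₁ hγ₁ hs₁
  obtain ⟨σ₂, r₂, g₂, hσ₂⟩ := hσ E₂ hE₂ γ₂ hγ₂ hs₂
  have hr₁ : ∀ k (hk : k ∈ ρ.H) (h : k • c 0 = c 0), σ₁ ⟨k, h⟩ = τ.power _ ⟨k, hk⟩ :=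
    fun k hk h => by
      rw [← r₁]
      exact congrArg σ₁ (Subtype.ext (hE₁ ⟨k, hk⟩).symm)
  have hr₂ : ∀ k (hk : k ∈ ρ.H) (h : k • c 1 = c 1), σ₂ ⟨k, h⟩ = τ.power _ ⟨k, hk⟩ :=
    fun k hk h => by
      rw [← r₂]
      exact congrArg σ₂ (Subtype.ext (hE₂ ⟨k, hk⟩).symm)
  have := compactSpace_stabilizer (G := G) (c 1)
  -- Twisting by the sign at the second end only replaces `J` there by `-J`. The matrix `diag(1,
  -- -1)` conjugates `J` to `-J` and has determinant `-1`, so the twisted bundle has the other sign.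
  let η₂ : MulAction.stabilizer G (c 1) →* ℝ :=
    { toFun := E₂.sign
      map_one' := by rw [← map_one E₂.ι, E₂.sign_ι]
      map_mul' := E₂.sign_mul }
  obtain ⟨A, L, C, φ, ψ, a₁, a₂, a₃, b₁, b₂, b₃, hL, hL', hT⟩ := D.exists_tensor hH σ₁ σ₂ hσ₁ hσ₂
    (fun k hk w => by rw [hr₁ k hk, hr₂ k hk]) (η₁ := 1) (η₂ := η₂) continuous_const
    E₂.continuous_sign (fun _ _ => rfl) fun k hk => by
      rw [← E₂.sign_ι ⟨k, hk⟩]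
      exact congrArg E₂.sign (Subtype.ext (hE₂ ⟨k, hk⟩).symm)
  have hφ : φ.IsPower τ := fun k hk t h w => by rw [a₃ k hk, hr₁ k hk]
  have hψ : ψ.IsPower τ := fun k hk t h w => by rw [b₃ k hk, hr₁ k hk]
  refine ⟨⟨_, A, hφ.hasFiberMultiple D.cover hinv, rfl⟩,
    ⟨_, C, hψ.hasFiberMultiple D.cover hinv, rfl⟩,
    isPresentedBy_of_sign
      (T := fun (x : ρ.Vect τ.character) n s => HasSign E₁ E₂ τ γ₁ γ₂ (x : VectG G ρ.S) n s) ?_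
      (fun h h' => Subtype.ext (HasSign.eq D hE₁ hE₂ h h')) (fun h h' => h.unique hR h')
      (fun h h' => h.add h') ?_
      ⟨A, φ, J, J, 1, rfl, hφ, fun w => (a₁ _ _ w).trans (g₁ w), fun w => (a₂ _ _ w).trans (g₂ w),
        hJ, (one_mul J).trans (mul_one J).symm, by simp⟩
      ⟨C, ψ, J, (-1 : ℝ) • J, !![1, 0; 0, -1], rfl, hψ, fun w => ?_, fun w => ?_, hJ, ?_, ?_⟩,
    A, L, C, hL, hL', hT, rfl, rfl⟩
  · rintro ⟨_, B, ⟨m, hB⟩, rfl⟩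
    obtain ⟨θ, hθ⟩ := Frame.exists_isPower hτ D.continuous hB
    obtain ⟨M₁, -, h₁⟩ := hθ.exists_matrix hR hγ₁ E₁.c.2
    obtain ⟨M₂, -, h₂⟩ := hθ.exists_matrix hR hγ₂ E₂.c.2
    have q₁ := hθ.mul_self_eq_neg_one E₁ hE₁ hs₁ h₁
    have q₂ := hθ.mul_self_eq_neg_one E₂ hE₂ hs₂ h₂
    obtain ⟨P, hP, hPM⟩ := Matrix.exists_conj_complexStructure q₁ q₂
    obtain ⟨s, hs⟩ := exists_sign_mul_pos hP
    have heven := Matrix.even_card_of_mul_self q₁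
    rw [Fintype.card_fin, even_iff_two_dvd] at heven
    obtain ⟨n, rfl⟩ := heven
    exact ⟨n, s, B, θ, M₁, M₂, P, rfl, hθ, h₁, h₂, q₁, hPM, hs⟩
  · rintro x s ⟨B, θ, M₁, M₂, P, -, -, -, -, -, -, hs⟩
    have : IsEmpty (Fin (2 * 0)) := inferInstanceAs (IsEmpty (Fin 0))
    rw [Matrix.det_isEmpty, mul_one] at hs
    rcases Int.units_eq_one_or s with rfl | rfl
    · rfl
    · norm_num at hs
  · refine (b₁ _ _ w).trans ?_
    rw [smulHom_apply, ← g₁]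
    exact one_smul _ _
  · refine (b₂ _ _ w).trans ?_
    rw [smulHom_apply, matAct_smul, ← g₂]
    exact congrArg (· • _) E₂.sign_c
  · ext i j
    fin_cases i <;> fin_cases j <;> simp [J, Matrix.mul_apply, Fin.sum_univ_two]
  · have : (!![1, 0; 0, -1] : Matrix (Fin (2 * 1)) (Fin (2 * 1)) ℝ).det = -1 := by
      exact (Matrix.det_fin_two_of (1 : ℝ) 0 0 (-1)).trans (by norm_num)
    rw [this]
    norm_num

end IntervalDomain

end DihedralRealType

/-! ### The three types of image and the theorem -/

section Presentations

set_option linter.unusedSectionVars false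

open Module Representation

namespace OrthRep

variable {G : Type*} [Group G] [TopologicalSpace G] {ρ : OrthRep G}

theorem not_image_le_SO2_of_isDihedral (hρ : ρ.IsDihedral) : ¬ ρ.image ≤ SO2 := fun h => by
  have hc : Complex.conjLIE ∈ ρ.image := by
    rw [(image_eq_dihedral hρ).2]
    exact conj_mem_dihedral _
  obtain ⟨ζ, hζ⟩ := h hc
  have h₁ : (ζ : ℂ) = 1 := by simpa using DFunLike.congr_fun hζ 1
  have h₂ := DFunLike.congr_fun hζ Complex.I
  rw [rotation_apply, h₁, one_mul, Complex.conjLIE_apply, Complex.conj_I] at h₂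
  have := congrArg Complex.im h₂
  norm_num at this

theorem e₁_eq_arc (a : ℝ) (χ : ρ.H → ℝ) :
    ρ.e₁ χ = (ρ.extensions χ (MulAction.stabilizer G (ρ.arc a 0))).encard := by
  rw [arc_zero]
  rfl

theorem eμ_eq_arc (hρ : ρ.IsDihedral) (χ : ρ.H → ℝ) : ρ.eμ χ =
    (ρ.extensions χ (MulAction.stabilizer G (ρ.arc (Real.pi / ρ.order) 1))).encard := by
  rw [arc_one, eμ, if_pos hρ]
  rfl

end OrthRep

end Presentations

theorem theorem5p1
    {V : Type*} [NormedAddCommGroup V] [NormedSpace ℝ V] [FiniteDimensional ℝ V]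
    {G : Type*} [TopologicalSpace G] [ChartedSpace V G] [Group G] [LieGroup 𝓘(ℝ, V) ∞ G]
    [CompactSpace G] [T2Space G]
    (ρ : OrthRep G)
    (hρ : ρ.image ≤ SO2 ∨ ρ.image = ⊤ ∨ ρ.IsDihedral)
    (χ : ρ.H → ℝ) (hχ : IsIrreducibleRealCharacter χ) (hinv : ρ.IsInvariant χ) :
    (¬ ρ.CaseA χ → ¬ ρ.CaseB χ →
      ((ρ.e₁ χ, ρ.eμ χ) ∈ ({(0, 0), (1, 0), (0, 1), (1, 1)} : Set (ℕ∞ × ℕ∞)) →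
        ∃ L : ρ.Vect χ, IsPresentedBy (fun _ : Unit => L) (fun _ _ => False)) ∧
      ((ρ.e₁ χ, ρ.eμ χ) ∈ ({(2, 1), (1, 2)} : Set (ℕ∞ × ℕ∞)) →
        ∃ Lp Lm : ρ.Vect χ, IsPresentedBy ![Lp, Lm] (fun _ _ => False) ∧
          ρ.RelatedByLine Lp Lm) ∧
      ((ρ.e₁ χ, ρ.eμ χ) ∈ ({(2, 0), (0, 2)} : Set (ℕ∞ × ℕ∞)) →
        ∃ L0 Lp Lm : ρ.Vect χ,
          IsPresentedBy ![L0, Lp, Lm] (fun a b => a = Finsupp.single 0 2 ∧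
            b = Finsupp.single 1 1 + Finsupp.single 2 1) ∧
          ρ.RelatedByLine Lp Lm) ∧
      ((ρ.e₁ χ, ρ.eμ χ) ∈ ({(2, 2)} : Set (ℕ∞ × ℕ∞)) →
        ∃ Lpp Lpm Lmp Lmm : ρ.Vect χ,
          IsPresentedBy ![Lpp, Lpm, Lmp, Lmm] (fun a b =>
            a = Finsupp.single 0 1 + Finsupp.single 3 1 ∧
            b = Finsupp.single 1 1 + Finsupp.single 2 1) ∧
          ∀ x ∈ ({Lpp, Lpm, Lmp, Lmm} : Set (ρ.Vect χ)),
            ∀ y ∈ ({Lpp, Lpm, Lmp, Lmm} : Set (ρ.Vect χ)), ρ.RelatedByLine x y)) ∧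
    (ρ.CaseA χ ∨ ρ.CaseB χ →
      ∃ Lp Lm : ρ.Vect χ,
        IsPresentedBy ![Lp, Lm] (fun a b => a = Finsupp.single 0 2 ∧ b = Finsupp.single 1 2) ∧
        ρ.RelatedByLine Lp Lm) := by
  have : IsTopologicalGroup G := topologicalGroup_of_lieGroup 𝓘(ℝ, V) ∞
  have : CompactSpace ρ.H := compactSpace_H
  obtain ⟨d, τ, hτ, hirr, rfl⟩ := hχ
  have hτ' : τ.IsCont := fun v => (hτ v).weaklyContinuous
  have hreal := isOfRealType_iff hτ hirr
  have hscal := scalar_or_exists_complexStructure hirr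
  have hcont := hτ'.isRealCharacter
  by_cases hD : ρ.IsDihedral
  · have hA : ¬ ρ.CaseA τ.character := fun h =>
      OrthRep.not_image_le_SO2_of_isDihedral hD h.1.le
    let D := OrthRep.intervalDomain hD
    have hH := OrthRep.isOpen_H_of_isDihedral hD
    obtain ⟨c₁, hcK₁, hcH₁, hc₁⟩ := OrthRep.exists_indexTwo_arc hD (t := 0) (Or.inl rfl)
    obtain ⟨c₂, hcK₂, hcH₂, hc₂⟩ := OrthRep.exists_indexTwo_arc hD (t := 1) (Or.inr rfl)
    have x₁ := extensions_eq_ext (OrthRep.H_le_stabilizer _) hcK₁ hcH₁ hc₁ τ.character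
    have x₂ := extensions_eq_ext (OrthRep.H_le_stabilizer _) hcK₂ hcH₂ hc₂ τ.character
    have := compactSpace_stabilizer (G := G) (ρ.arc (Real.pi / ρ.order) 0)
    have := compactSpace_stabilizer (G := G) (ρ.arc (Real.pi / ρ.order) 1)
    have hB : ρ.CaseB τ.character ↔ IsOfRealType τ.character ∧
        ¬ (ρ.extensions τ.character
          (MulAction.stabilizer G (ρ.arc (Real.pi / ρ.order) 0))).Nonempty ∧
        ¬ (ρ.extensions τ.character
          (MulAction.stabilizer G (ρ.arc (Real.pi / ρ.order) 1))).Nonempty := by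
      rw [ρ.arc_zero, ρ.arc_one]
      exact and_iff_right hD
    refine ⟨fun _ hB' => ?_, fun h => ?_⟩
    · rw [OrthRep.e₁_eq_arc (Real.pi / ρ.order), OrthRep.eμ_eq_arc hD, x₁, x₂]
      obtain ⟨E⟩ := D.nonempty_endCharacters hH hτ' hirr hinv
        (IndexTwo.ofSubgroup (OrthRep.H_le_stabilizer _) c₁ hcK₁ hcH₁ hc₁) (fun _ => rfl)
        (IndexTwo.ofSubgroup (OrthRep.H_le_stabilizer _) c₂ hcK₂ hcH₂ hc₂) (fun _ => rfl) (by
          -- Outside Case B a character of real type extends at one of the ends, which is what the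
          -- classification by end characters needs.
          rcases hscal with hR | hJ
          · refine Or.inr ⟨hR, ?_⟩
            rw [← x₁, ← x₂]
            by_contra hc
            rw [not_or] at hc
            exact hB' (hB.2 ⟨hreal.2 hR, hc⟩)
          · exact Or.inl hJ)
      exact E.presentations
        (endType_of_indexTwo (OrthRep.H_le_stabilizer _) hcK₁ hcH₁ hc₁ hτ' hirr hinv)
        (endType_of_indexTwo (OrthRep.H_le_stabilizer _) hcK₂ hcH₂ hc₂ hτ' hirr hinv)
    · obtain ⟨hR, h₁, h₂⟩ := hB.1 (h.resolve_left hA)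
      rw [x₁, Set.not_nonempty_iff_eq_empty] at h₁
      rw [x₂, Set.not_nonempty_iff_eq_empty] at h₂
      exact D.isPresentedBy hH hτ' hirr (hreal.1 hR) hinv _ (fun _ => rfl) _ (fun _ => rfl) h₁ h₂
  have hB : ¬ ρ.CaseB τ.character := fun h => hD h.1
  -- The default value `1` is the number of extensions of `χ` to `H` itself, which stands in for the
  -- missing second end group.
  have hμ : ρ.eμ τ.character = 1 := if_neg hD
  have hself := endType_self hτ' hirr
  have hone : ρ.image ≤ SO2 → ρ.isotropyOne = ρ.H :=
    fun h => OrthRep.stabilizer_eq_of_le_SO2 h _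
  by_cases hlt : ρ.image < SO2
  · obtain ⟨hH, a, g₀, D⟩ := OrthRep.exists_cyclicDomain hlt
    refine ⟨fun hA _ => ?_, fun h => ?_⟩
    -- For a proper group of rotations, not being in Case A leaves only modules with an equivariant
    -- complex structure.
    · obtain ⟨J, hJ⟩ := hscal.resolve_left fun hR => hA ⟨hlt, hreal.2 hR⟩
      obtain ⟨E⟩ := D.nonempty_endCharacters hH hτ' hirr hinv J hJ
      rw [hμ, OrthRep.e₁, hone hlt.le, encard_extensions_self hcont]
      exact E.presentations hself hself
    · exact D.isPresentedBy hH hτ' hirr (hreal.1 (h.resolve_right hB).2) hinv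
  have hA : ¬ ρ.CaseA τ.character := fun h => hlt h.1
  refine ⟨fun _ _ => ?_, fun h => (h.elim hA hB).elim⟩
  rw [hμ]
  rcases hρ with h | h | h
  -- The action is transitive with isotropy group `H`, so both end groups are `H` and `e₁ = 1`.
  · have heq : ρ.image = SO2 := h.eq_of_not_lt hlt
    obtain ⟨E⟩ := nonempty_endCharacters_of_transitive
      (OrthRep.transitive_of_SO2_le heq.ge) hinv
    rw [OrthRep.e₁, hone h, encard_extensions_self hcont]
    refine E.presentations ?_ hself
    rw [OrthRep.stabilizer_eq_of_le_SO2 h]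
    exact hself
  · obtain ⟨c, hcK, hcH, hc⟩ := OrthRep.exists_indexTwo_of_top h
    have := compactSpace_stabilizer (G := G) (ρ.pt 1)
    obtain ⟨E⟩ := nonempty_endCharacters_of_transitive
      (OrthRep.transitive_of_SO2_le (h ▸ le_top)) hinv
    rw [OrthRep.e₁, OrthRep.isotropyOne, extensions_eq_ext (OrthRep.H_le_stabilizer _) hcK hcH hc]
    exact E.presentations
      (endType_of_indexTwo (OrthRep.H_le_stabilizer _) hcK hcH hc hτ' hirr hinv) hself
  · exact (hD h).elim
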